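/- **Conventions.** Manifolds are smooth, Hausdorff and second countable; $n\ge 0$ is an integer. A *contact quadruple* $(M,N,\alpha,\pi)$ with symplectic form $\omega$ consists of a $2n$-dimensional symplectic manifold $(M,\omega)$, a $(2n+1)$-dimensional manifold $N$, a smooth $1$-form $\alpha$ on $N$ with $\alpha\wedge(d\alpha)^n$ nowhere zero, and a smooth submersion $\pi:N\to M$ with $d\alpha=\pi^*\omega$. A symplectic manifold of dimension $2n+2$ is *obtained by induction* from the quadruple if it is symplectically diffeomorphic to $\bigl(N\times\mathbb R,\ d(e^{2s}p_1^*\alpha)\bigr)$, where $s$ is the coordinate on $\mathbb R$ and $p_1:N\times\mathbb R\to N$ is the projection. A *symplectic connection* on $(P,\mu)$ is a smooth torsion-free linear connection $\nabla$ on $TP$ with $\nabla\mu=0$; it is *Ricci-flat* if its Ricci tensor $r(Y,Z)=\operatorname{Tr}[X\mapsto R(X,Y)Z]$ vanishes. **Theorem 5.3.** Let $(P,\mu)$ be a symplectic manifold of dimension $2n+2$, let $S$ be a complete smooth vector field on $P$ with $L_S\mu=2\mu$, and let $E$ be a smooth vector field on $P$ with $L_E\mu=0$ and $[S,E]=0$.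 Assume that $\mu_x(S,E)>0$ for every $x\in P$. Then $$\Sigma=\{x\in P\mid \mu_x(S,E)=1\}$$ is an embedded hypersurface of $P$. Suppose moreover that the quotient of $\Sigma$ by the flow of $E$ is a manifold, that is, that there are a $2n$-dimensional manifold $M$ and a smooth surjective submersion $\pi:\Sigma\to M$ such that $\pi(x)=\pi(y)$ if and only if $x$ and $y$ lie on the same integral curve of $E$. Let $\iota:\Sigma\to P$ be the inclusion and $\alpha=\iota^*\bigl(\tfrac12\, i(S)\mu\bigr)$. Then: 1. there is a symplectic form $\omega$ on $M$ with $\pi^*\omega=\iota^*\mu$ (the reduced symplectic form), $(M,\Sigma,\alpha,\pi)$ is a contact quadruple with symplectic form $\omega$, and $(P,\mu)$ is obtained by induction from it; 2. $(P,\mu)$ admits a Ricci-flat symplectic connection. -/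

import Mathlib

open scoped Manifold ContDiff

noncomputable section

namespace SymplecticInduction

section Forms

variable {E : Type*} [NormedAddCommGroup E] [NormedSpace ℝ E]
  {H : Type*} [TopologicalSpace H] {I : ModelWithCorners ℝ E H}
  {M : Type*} [TopologicalSpace M] [ChartedSpace H M]
  {E' : Type*} [NormedAddCommGroup E'] [NormedSpace ℝ E']
  {H' : Type*} [TopologicalSpace H'] {I' : ModelWithCorners ℝ E' H'}
  {M' : Type*} [TopologicalSpace M'] [ChartedSpace H' M']

variable (I M) in
/-- Vector fields on `M`, without any regularity. -/
abbrev VField : Type _ := (x : M) → TangentSpace I x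

variable (I M) in
/-- Real-valued differential `k`-forms on `M`, without any regularity. -/
abbrev DForm (k : ℕ) : Type _ := (x : M) → TangentSpace I x [⋀^Fin k]→L[ℝ] ℝ

/-- `X` is a `C^∞` section of the tangent bundle. -/
def IsSmoothField [IsManifold I ∞ M] (X : VField I M) : Prop :=
  ContMDiff I I.tangent ∞ (fun x ↦ (⟨x, X x⟩ : TangentBundle I M))

/-- The expression of the `k`-form `η` in the preferred chart at `x₀`: the pullback of `η` under
the inverse of that chart, a `k`-form on (the target of the chart in) the model space. -/
def localForm {k : ℕ} (η : DForm I M k) (x₀ : M) : E → E [⋀^Fin k]→L[ℝ] ℝ :=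
  fun y ↦ (η ((extChartAt I x₀).symm y)).compContinuousLinearMap
    (mfderivWithin 𝓘(ℝ, E) I (extChartAt I x₀).symm (Set.range I) y)

/-- The expression of the vector field `X` in the preferred chart at `x₀`. -/
def localField (X : VField I M) (x₀ : M) : E → E :=
  fun y ↦ VectorField.mpullbackWithin 𝓘(ℝ, E) I (extChartAt I x₀).symm X (Set.range I) y

/-- `η` is smooth: its coefficients are smooth in the charts. -/
def IsSmoothForm {k : ℕ} (η : DForm I M k) : Prop :=
  ∀ x₀ : M, ContDiffOn ℝ ∞ (localForm η x₀) (extChartAt I x₀).target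

/-- The pullback `f^*η`. -/
def pullback (f : M → M') {k : ℕ} (η : DForm I' M' k) : DForm I M k :=
  fun x ↦ (η (f x)).compContinuousLinearMap (mfderiv I I' f x)

/-- The exterior derivative: computed at `x` in the preferred chart at `x`. -/
def extD {k : ℕ} (η : DForm I M k) : DForm I M (k + 1) :=
  fun x ↦ (extDerivWithin (localForm η x) (Set.range I)
    (extChartAt I x x)).compContinuousLinearMap (mfderiv I 𝓘(ℝ, E) (extChartAt I x) x)

/-- The interior product `i(X)η = η(X, ·, …, ·)`. -/
def interior {k : ℕ} (X : VField I M) (η : DForm I M (k + 1)) : DForm I M k :=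
  fun x ↦ ContinuousAlternatingMap.curryLeft (E := E) (η x) (X x)

/-- The Lie derivative `L_X η`, computed at `x` in the preferred chart at `x` by the formula
`(L_X η)(v₁, …, v_k) = (D_X η)(v₁, …, v_k) + ∑ᵢ η(v₁, …, D_{vᵢ} X, …, v_k)`. -/
def lieDeriv {k : ℕ} (X : VField I M) (η : DForm I M k) (x : M)
    (v : Fin k → TangentSpace I x) : ℝ :=
  let y : E := extChartAt I x x
  let w : Fin k → E := fun i ↦ mfderiv I 𝓘(ℝ, E) (extChartAt I x) x (v i)
  fderivWithin ℝ (localForm η x) (Set.range I) y (localField X x y) w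
    + ∑ i, localForm η x y
        (Function.update w i (fderivWithin ℝ (localField X x) (Set.range I) y (w i)))

/-- A symplectic form: a smooth closed nondegenerate `2`-form. -/
structure IsSymplecticForm (η : DForm I M 2) : Prop where
  smooth : IsSmoothForm η
  closed : extD η = 0
  nondegenerate : ∀ (x : M) (v : TangentSpace I x),
    (∀ w : TangentSpace I x, η x ![v, w] = 0) → v = 0

/-- The value `(a ∧ b ∧ ⋯ ∧ b)(v₀, …, v_{2n})`, with `n` factors `b`, for a `1`-form `a` and a
`2`-form `b` on a vector space:
`1 / (1! (2!)^n) ∑_σ sgn(σ) a(v_{σ 0}) b(v_{σ 1}, v_{σ 2}) ⋯ b(v_{σ (2n-1)}, v_{σ (2n)})`. -/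
def wedgePow {V : Type*} [AddCommGroup V] [Module ℝ V] [TopologicalSpace V] (n : ℕ)
    (a : V [⋀^Fin 1]→L[ℝ] ℝ) (b : V [⋀^Fin 2]→L[ℝ] ℝ) (v : Fin (2 * n + 1) → V) : ℝ :=
  ((2 : ℝ) ^ n)⁻¹ * ∑ σ : Equiv.Perm (Fin (2 * n + 1)),
    ((Equiv.Perm.sign σ : ℤ) : ℝ) * (a ![v (σ 0)] *
      ∏ i : Fin n, b ![v (σ ⟨2 * i + 1, by omega⟩), v (σ ⟨2 * i + 2, by omega⟩)])

/-- `α` is a (cooriented) contact form on the `2n+1`-dimensional manifold `M`: a smooth `1`-form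
such that `α ∧ (dα)^n` vanishes nowhere. -/
structure IsContactForm (n : ℕ) (α : DForm I M 1) : Prop where
  smooth : IsSmoothForm α
  nonvanishing : ∀ x : M, ∃ v : Fin (2 * n + 1) → TangentSpace I x,
    wedgePow n (α x) (extD α x) v ≠ 0

/-- The form `d(e^{2s} p₁^*α)` on `M × ℝ`, where `s` is the coordinate on `ℝ`. -/
def inducedForm (α : DForm I M 1) : DForm (I.prod 𝓘(ℝ, ℝ)) (M × ℝ) 2 :=
  extD (fun p ↦ Real.exp (2 * p.2) • pullback (Prod.fst : M × ℝ → M) α p)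

/-- `X` is complete: through every point there is an integral curve defined on all of `ℝ`. -/
def IsCompleteField (X : VField I M) : Prop :=
  ∀ x : M, ∃ γ : ℝ → M, γ 0 = x ∧ IsMIntegralCurve γ X

/-- `y` is reached from `x` by following the (possibly only locally defined) flow of `X`. -/
def SameOrbit (X : VField I M) (x y : M) : Prop :=
  ∃ (γ : ℝ → M) (a b t : ℝ), 0 ∈ Set.Ioo a b ∧ t ∈ Set.Ioo a b ∧
    IsMIntegralCurveOn γ X (Set.Ioo a b) ∧ γ 0 = x ∧ γ t = y

/-- The set `{x | μ_x(S, T) = 1}`. -/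
def constraintSet (μ : DForm I M 2) (S T : VField I M) : Set M :=
  {x | μ x ![S x, T x] = 1}

end Forms

section Quadruples

variable {n : ℕ}
  {M : Type*} [TopologicalSpace M] [ChartedSpace (EuclideanSpace ℝ (Fin (2 * n))) M]
  {N : Type*} [TopologicalSpace N] [ChartedSpace (EuclideanSpace ℝ (Fin (2 * n + 1))) N]
  {P : Type*} [TopologicalSpace P] [ChartedSpace (EuclideanSpace ℝ (Fin (2 * n + 2))) P]

/-- `(M, N, α, π)` is a contact quadruple, with `η` the symplectic form on `M`. -/
structure IsContactQuadruple (η : DForm (𝓡 (2 * n)) M 2) (α : DForm (𝓡 (2 * n + 1)) N 1)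
    (π : N → M) : Prop where
  symplectic : IsSymplecticForm η
  contact : IsContactForm n α
  submersion : Manifold.IsSubmersion (𝓡 (2 * n + 1)) (𝓡 (2 * n)) ∞ π
  extD_eq : extD α = pullback π η

/-- `(P, μ)` is, up to a symplectic diffeomorphism, the symplectic manifold
`(N × ℝ, d(e^{2s} p₁^*α))`. -/
def IsInducedFrom (μ : DForm (𝓡 (2 * n + 2)) P 2) (α : DForm (𝓡 (2 * n + 1)) N 1) : Prop :=
  ∃ Φ : (N × ℝ) ≃ₘ^∞⟮(𝓡 (2 * n + 1)).prod 𝓘(ℝ, ℝ), 𝓡 (2 * n + 2)⟯ P,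
    pullback Φ μ = inducedForm α

end Quadruples

section Connections

variable {E : Type*} [NormedAddCommGroup E] [NormedSpace ℝ E] [FiniteDimensional ℝ E]
  {H : Type*} [TopologicalSpace H] {I : ModelWithCorners ℝ E H}
  {M : Type*} [TopologicalSpace M] [ChartedSpace H M] [IsManifold I ∞ M]

variable (I M) in
/-- Linear connections on `M`; `∇_X Y` at `x` is `D Y x (X x)`. -/
abbrev LinearConnection : Type _ :=
  CovariantDerivative I E (TangentSpace I : M → Type _)

/-- A symplectic connection: a smooth torsion-free linear connection for which `η` is parallel,
that is, `X(η(Y, Z)) = η(∇_X Y, Z) + η(Y, ∇_X Z)`. -/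
structure IsSymplecticConnection (η : DForm I M 2) (D : LinearConnection I M) : Prop where
  smooth : CovariantDerivative.ContMDiffCovariantDerivative D ∞
  torsionFree : D.torsion = 0
  parallel : ∀ (Y Z : VField I M), IsSmoothField Y → IsSmoothField Z →
    ∀ (x : M) (u : TangentSpace I x),
      (mfderiv I 𝓘(ℝ, ℝ) (fun y ↦ η y ![Y y, Z y]) x u : ℝ)
        = η x ![D Y x u, Z x] + η x ![Y x, D Z x u]

/-- `∇_X ∇_Y Z - ∇_Y ∇_X Z - ∇_{[X, Y]} Z`. -/
def curvature (D : LinearConnection I M) (X Y Z : VField I M) : VField I M :=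
  fun x ↦ D (fun y ↦ D Z y (Y y)) x (X x) - D (fun y ↦ D Z y (X y)) x (Y x)
    - D Z x (VectorField.mlieBracket I X Y x)

/-- `R` is the curvature tensor of the connection. -/
def IsCurvatureTensor (D : LinearConnection I M)
    (R : (x : M) → TangentSpace I x →ₗ[ℝ] TangentSpace I x →ₗ[ℝ]
      TangentSpace I x →ₗ[ℝ] TangentSpace I x) : Prop :=
  ∀ X Y Z : VField I M, IsSmoothField X → IsSmoothField Y → IsSmoothField Z →
    ∀ x : M, R x (X x) (Y x) (Z x) = curvature D X Y Z x

/-- The Ricci tensor `r(u, w) = Tr[v ↦ R(v, u)w]` vanishes. -/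
def IsRicciFlat (D : LinearConnection I M) : Prop :=
  ∃ R, IsCurvatureTensor D R ∧ ∀ (x : M) (u w : TangentSpace I x),
    LinearMap.trace ℝ (TangentSpace I x) (((R x).flip u).flip w) = 0

end Connections

end SymplecticInduction

end

/-! Put g = μ(S, E) and λ = ½ i(S)μ. Cartan's formula turns L_S μ = 2μ into dλ = μ (`extD_interior`)
and, with L_E μ = 0 and [S, E] = 0, gives dg = 2μ(·, E) (`mfderiv_pairing_eq`). Hence dg(S) = 2g and
dg(E) = 0. As g > 0, the level Σ = {g = 1} is regular, and the flow of S multiplies g by e^{2s}, so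
each orbit of S meets Σ exactly once and the flow is a diffeomorphism Σ × ℝ → P (`coneDiffeo`). It
pulls λ back to e^{2s} p₁^*α, because λ(S) = 0 and L_S λ = 2λ; applying d shows that P is obtained
by induction (`pullback_coneDiffeo`).

The tangent space of Σ is the kernel of μ(·, E), so E is tangent to Σ and spans the kernel of ι^*μ =
dα. As α(E) = ½, the form dα is nondegenerate on ker α, which makes α a contact form
(`exists_wedgePow_ne_zero`). A closed 2-form killed by the vertical vectors of a submersion is
locally a pullback from the base. The fibres of π are orbits, hence connected, so the local forms on
M agree and define ω (`exists_reduced_form`).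

The Ricci-flat connection is built on the cone. In coordinates V × ℝ the field S is the constant
vector e = (0, 1), and one considers torsion-free connections that preserve μ, are invariant along e
and satisfy ∇S = Id (`ConeConn`). They exist locally, and all these conditions are affine, so a
partition of unity pulled back from Σ glues them (`ConeAtlas.exists_isConnection`). For such a
connection the Ricci tensor is symmetric, invariant and annihilated by S. For a tensor τ of this
kind, with t defined by μ(tu, v) = τ(u, v), adding λ(u)tv + λ(v)tu + ½τ(u, v)S stays in the class
and changes the Ricci tensor by (d/2)τ + λ⊗δ + δ⊗λ − tr(t²) λ⊗λ, where δ = div t and d = dim P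
(`ric_add_corr`). Taking τ = a Ric three times, with constants a depending only on d, first kills
Ric on ker λ × ker λ, then whenever one argument is in ker λ, then entirely. In dimension 2 the
relation R(S, ·) = 0 already gives flatness. The correction is natural, so it commutes with the
changes of coordinates (`ConeChange.improve`). -/

open scoped Manifold ContDiff Topology

set_option linter.unusedSectionVars false

noncomputable section

namespace SymplecticInduction

/-! ### Calculus of differential forms in parametrisations -/

section FormCalculus

variable {F : Type*} [NormedAddCommGroup F] [NormedSpace ℝ F]
  {E : Type*} [NormedAddCommGroup E] [NormedSpace ℝ E]
  {H : Type*} [TopologicalSpace H] {I : ModelWithCorners ℝ E H}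
  {M : Type*} [TopologicalSpace M] [ChartedSpace H M]
  {E' : Type*} [NormedAddCommGroup E'] [NormedSpace ℝ E']
  {H' : Type*} [TopologicalSpace H'] {I' : ModelWithCorners ℝ E' H'}
  {M' : Type*} [TopologicalSpace M'] [ChartedSpace H' M']
  {E'' : Type*} [NormedAddCommGroup E''] [NormedSpace ℝ E'']
  {H'' : Type*} [TopologicalSpace H''] {I'' : ModelWithCorners ℝ E'' H''}
  {M'' : Type*} [TopologicalSpace M''] [ChartedSpace H'' M'']

/-- Evaluation of a smooth family of alternating forms on smooth families of vectors. -/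
theorem contDiffAt_alternating_apply {k : ℕ} {r : WithTop ℕ∞} {η : F → E [⋀^Fin k]→L[ℝ] ℝ}
    {u : F → Fin k → E} {w : F} (hη : ContDiffAt ℝ r η w) (hu : ContDiffAt ℝ r u w) :
    ContDiffAt ℝ r (fun y ↦ η y (u y)) w := by
  -- Evaluation is multilinear in the vectors with values in the dual of the space of forms, hence
  -- jointly analytic.
  let g : ContinuousMultilinearMap ℝ (fun _ : Fin k ↦ E) ((E [⋀^Fin k]→L[ℝ] ℝ) →L[ℝ] ℝ) :=
    (ContinuousAlternatingMap.toContinuousMultilinearMapCLM ℝ :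
      (E [⋀^Fin k]→L[ℝ] ℝ) →L[ℝ] _).flipMultilinear
  have h : AnalyticAt ℝ (fun p : (Fin k → E) × (E [⋀^Fin k]→L[ℝ] ℝ) ↦ g p.1 p.2) (u w, η w) :=
    g.analyticAt_uncurry_of_linear
  exact (h.contDiffAt (n := r)).comp w (hu.prodMk hη)

section FiniteDim
variable [FiniteDimensional ℝ E]

/-- On a finite-dimensional space, smoothness of a family of forms can be checked on vectors. -/
theorem contDiffAt_alternating_of_apply {k : ℕ} {r : WithTop ℕ∞} {η : F → E [⋀^Fin k]→L[ℝ] ℝ}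
    {w : F} (h : ∀ v, ContDiffAt ℝ r (fun y ↦ η y v) w) : ContDiffAt ℝ r η w := by
  let b := Module.finBasis ℝ E
  -- The values on tuples of basis vectors embed the space of forms linearly in a finite product of
  -- lines; a linear left inverse recovers `η` from finitely many smooth functions.
  let ev : (E [⋀^Fin k]→L[ℝ] ℝ) →ₗ[ℝ] ((Fin k → Fin (Module.finrank ℝ E)) → ℝ) :=
    LinearMap.pi fun s ↦ (ContinuousAlternatingMap.apply ℝ E ℝ (fun i ↦ b (s i))).toLinearMap
  have hinj : Function.Injective ev := by
    intro θ₁ θ₂ h12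
    refine ContinuousAlternatingMap.toAlternatingMap_injective ?_
    refine b.ext_alternating fun s _ ↦ ?_
    exact congrFun h12 s
  obtain ⟨L, hL⟩ := LinearMap.exists_leftInverse_of_injective ev (LinearMap.ker_eq_bot.2 hinj)
  have : η = fun y ↦ LinearMap.toContinuousLinearMap L (ev (η y)) := by
    funext y
    exact (congrArg (fun f ↦ f (η y)) hL).symm
  rw [this]
  refine (ContinuousLinearMap.contDiff _).contDiffAt.comp w ?_
  exact contDiffAt_pi.2 fun s ↦ h _

theorem contDiffAt_compContinuousLinearMap [FiniteDimensional ℝ E'] {k : ℕ} {r : WithTop ℕ∞}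
    {η : F → E [⋀^Fin k]→L[ℝ] ℝ} {A : F → E' →L[ℝ] E} {w : F} (hη : ContDiffAt ℝ r η w)
    (hA : ContDiffAt ℝ r A w) :
    ContDiffAt ℝ r (fun y ↦ (η y).compContinuousLinearMap (A y)) w := by
  refine contDiffAt_alternating_of_apply fun v ↦ ?_
  exact contDiffAt_alternating_apply (u := fun y i ↦ A y (v i)) hη
    (contDiffAt_pi.2 fun i ↦ hA.clm_apply contDiffAt_const)

end FiniteDim

theorem pullback_apply (f : M → M') {k : ℕ} (η : DForm I' M' k) (x : M)
    (v : Fin k → TangentSpace I x) :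
    pullback (I := I) f η x v = η (f x) (fun i ↦ mfderiv I I' f x (v i)) := rfl

theorem pullback_congr {f g : M → M'} {k : ℕ} (η : DForm I' M' k) {x : M} (h : f =ᶠ[𝓝 x] g) :
    pullback (I := I) f η x = pullback (I := I) g η x := by
  ext v
  rw [pullback_apply, pullback_apply, h.mfderiv_eq, h.self_of_nhds]

theorem pullback_comp {f : M → M'} {g : M' → M''} {k : ℕ} (η : DForm I'' M'' k) {x : M}
    (hg : MDifferentiableAt I' I'' g (f x)) (hf : MDifferentiableAt I I' f x) :
    pullback (I := I) (g ∘ f) η x = pullback (I := I) f (pullback (I := I') g η) x := by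
  ext v
  simp only [pullback_apply, mfderiv_comp x hg hf]
  rfl

/-- The pullback of a form under a map from a normed space, as a family of forms on that space. -/
def coordForm (ψ : F → M) {k : ℕ} (η : DForm I M k) : F → F [⋀^Fin k]→L[ℝ] ℝ :=
  fun w ↦ pullback (I := 𝓘(ℝ, F)) ψ η w

theorem coordForm_apply (ψ : F → M) {k : ℕ} (η : DForm I M k) (w : F) (v : Fin k → F) :
    coordForm ψ η w v = η (ψ w) (fun i ↦ mfderiv 𝓘(ℝ, F) I ψ w (v i)) := rfl

theorem coordForm_congr {f g : F → M} {k : ℕ} (η : DForm I M k) {x : F} (h : f =ᶠ[𝓝 x] g) :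
    coordForm f η x = coordForm g η x := by
  ext v
  rw [coordForm_apply, coordForm_apply, h.mfderiv_eq, h.self_of_nhds]

theorem coordForm_comp {f : F → M} {g : M → M'} {k : ℕ} (η : DForm I' M' k) {x : F}
    (hg : MDifferentiableAt I I' g (f x)) (hf : MDifferentiableAt 𝓘(ℝ, F) I f x) :
    coordForm (g ∘ f) η x = coordForm f (pullback (I := I) g η) x := by
  ext v
  simp only [coordForm_apply, pullback_apply, mfderiv_comp x hg hf]
  rfl

theorem coordForm_comp_right {f : F → E'} {g : E' → M} {k : ℕ} (η : DForm I M k) {x : F}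
    (hg : MDifferentiableAt 𝓘(ℝ, E') I g (f x)) (hf : DifferentiableAt ℝ f x) :
    coordForm (g ∘ f) η x = (coordForm g η (f x)).compContinuousLinearMap (fderiv ℝ f x) := by
  ext v
  rw [coordForm_apply, mfderiv_comp x hg hf.mdifferentiableAt, mfderiv_eq_fderiv]
  rfl

theorem localForm_eq_coordForm [I.Boundaryless] {k : ℕ} (η : DForm I M k) (x₀ : M) :
    localForm η x₀ = coordForm (extChartAt I x₀).symm η := by
  funext y
  ext v
  rw [coordForm_apply]
  change η _ (fun i ↦ mfderivWithin _ _ _ _ _ (v i)) = _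
  rw [I.range_eq_univ, mfderivWithin_univ]

variable [IsManifold I ∞ M] [IsManifold I' ∞ M']

/-- The preferred chart at `x` has the identity as its derivative at `x`, so the outer pullback in
`extD` disappears; without boundary the derivatives within the range are ordinary ones. -/
theorem extD_apply [I.Boundaryless] {k : ℕ} (η : DForm I M k) (x : M)
    (v : Fin (k + 1) → TangentSpace I x) :
    extD η x v = extDeriv (localForm η x) (extChartAt I x x) v := by
  unfold extD
  rw [I.range_eq_univ, extDerivWithin_univ]
  have : IsManifold I 1 M := IsManifold.of_le (n := ∞) (by simp)
  rw [mfderiv_extChartAt_self]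
  rfl

theorem contMDiffAt_extChartAt_of_mem_source {x₀ x : M} (hx : x ∈ (extChartAt I x₀).source) :
    ContMDiffAt I 𝓘(ℝ, E) ∞ (extChartAt I x₀) x :=
  contMDiffAt_extChartAt' (by simpa using hx)

theorem mdifferentiableAt_extChartAt_of_mem_source {x₀ x : M}
    (hx : x ∈ (extChartAt I x₀).source) :
    MDifferentiableAt I 𝓘(ℝ, E) (extChartAt I x₀) x :=
  (contMDiffAt_extChartAt_of_mem_source hx).mdifferentiableAt (by simp)

theorem ContMDiffAt.eventually_mdifferentiableAt {f : M → M'} {x : M}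
    (hf : ContMDiffAt I I' ∞ f x) : ∀ᶠ z in 𝓝 x, MDifferentiableAt I I' f z := by
  have : IsManifold I 1 M := IsManifold.of_le (n := ∞) (by simp)
  have : IsManifold I' 1 M' := IsManifold.of_le (n := ∞) (by simp)
  filter_upwards [(contMDiffAt_iff_contMDiffAt_nhds (n := 1) (by simp)).1 (hf.of_le (by simp))]
    with z hz using hz.mdifferentiableAt (by simp)

variable [I.Boundaryless] [I'.Boundaryless]

theorem contMDiffAt_extChartAt_symm {x₀ : M} {y : E} (hy : y ∈ (extChartAt I x₀).target) :
    ContMDiffAt 𝓘(ℝ, E) I ∞ (extChartAt I x₀).symm y :=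
  (contMDiffOn_extChartAt_symm x₀ (n := ∞)).contMDiffAt
    ((isOpen_extChartAt_target x₀).mem_nhds hy)

theorem mdifferentiableAt_extChartAt_symm {x₀ : M} {y : E} (hy : y ∈ (extChartAt I x₀).target) :
    MDifferentiableAt 𝓘(ℝ, E) I (extChartAt I x₀).symm y :=
  (contMDiffAt_extChartAt_symm hy).mdifferentiableAt (by simp)

/-- The pullback of a form through a parametrisation, expressed through a chart. -/
theorem coordForm_eq_localForm {k : ℕ} (η : DForm I M k) {ψ : F → M} {w : F} {x₀ : M}
    (hψ : MDifferentiableAt 𝓘(ℝ, F) I ψ w) (hx : ψ w ∈ (extChartAt I x₀).source) :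
    coordForm ψ η w =
      (localForm η x₀ ((extChartAt I x₀ ∘ ψ) w)).compContinuousLinearMap
        (fderiv ℝ (extChartAt I x₀ ∘ ψ) w) := by
  have hg : MDifferentiableAt 𝓘(ℝ, F) 𝓘(ℝ, E) (extChartAt I x₀ ∘ ψ) w :=
    (mdifferentiableAt_extChartAt_of_mem_source hx).comp w hψ
  have hev : ψ =ᶠ[𝓝 w] (extChartAt I x₀).symm ∘ (extChartAt I x₀ ∘ ψ) := by
    have : ∀ᶠ z in 𝓝 w, ψ z ∈ (extChartAt I x₀).source :=
      hψ.continuousAt.eventually_mem ((isOpen_extChartAt_source x₀).mem_nhds hx)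
    filter_upwards [this] with z hz
    exact ((extChartAt I x₀).left_inv hz).symm
  rw [coordForm_congr η hev, localForm_eq_coordForm, coordForm_comp_right (f := extChartAt I x₀ ∘ ψ) η
    (mdifferentiableAt_extChartAt_symm ((extChartAt I x₀).map_source hx)) hg.differentiableAt]

theorem contDiffAt_extChartAt_comp {ψ : F → M} {w : F} {x₀ : M} {r : WithTop ℕ∞} (hr : r ≤ ∞)
    (hψ : ContMDiffAt 𝓘(ℝ, F) I r ψ w) (hx : ψ w ∈ (extChartAt I x₀).source) :
    ContDiffAt ℝ r (extChartAt I x₀ ∘ ψ) w :=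
  (((contMDiffAt_extChartAt_of_mem_source hx).of_le hr).comp w hψ).contDiffAt

theorem coordForm_eventuallyEq_localForm {k : ℕ} (η : DForm I M k) {ψ : F → M} {w : F} {x₀ : M}
    (hψ : ContMDiffAt 𝓘(ℝ, F) I ∞ ψ w) (hx : ψ w ∈ (extChartAt I x₀).source) :
    coordForm ψ η =ᶠ[𝓝 w] fun z ↦
      (localForm η x₀ ((extChartAt I x₀ ∘ ψ) z)).compContinuousLinearMap
        (fderiv ℝ (extChartAt I x₀ ∘ ψ) z) := by
  have h1 : ∀ᶠ z in 𝓝 w, ψ z ∈ (extChartAt I x₀).source :=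
    hψ.continuousAt.eventually_mem ((isOpen_extChartAt_source x₀).mem_nhds hx)
  filter_upwards [h1, ContMDiffAt.eventually_mdifferentiableAt hψ] with z hz hz'
  exact coordForm_eq_localForm η hz' hz

/-- The pullback of a smooth form through a smooth parametrisation is smooth. -/
theorem IsSmoothForm.contDiffAt_coordForm [FiniteDimensional ℝ E] [FiniteDimensional ℝ F] {k : ℕ}
    {η : DForm I M k} (hη : IsSmoothForm η) {ψ : F → M} {w : F}
    (hψ : ContMDiffAt 𝓘(ℝ, F) I ∞ ψ w) :
    ContDiffAt ℝ ∞ (coordForm ψ η) w := by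
  have hx : ψ w ∈ (extChartAt I (ψ w)).source := mem_extChartAt_source _
  refine ContDiffAt.congr_of_eventuallyEq ?_ (coordForm_eventuallyEq_localForm η hψ hx)
  have hg := contDiffAt_extChartAt_comp le_rfl hψ hx
  refine contDiffAt_compContinuousLinearMap
    (η := fun z ↦ localForm η (ψ w) ((extChartAt I (ψ w) ∘ ψ) z)) ?_
    (hg.fderiv_right (m := ∞) (by simp))
  exact ((hη (ψ w)).contDiffAt ((isOpen_extChartAt_target _).mem_nhds
    (mem_extChartAt_target _))).comp w hg

/-- The exterior derivative can be computed in any smooth parametrisation. -/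
theorem IsSmoothForm.coordForm_extD {k : ℕ} {η : DForm I M k} (hη : IsSmoothForm η) {ψ : F → M}
    {w : F} (hψ : ContMDiffAt 𝓘(ℝ, F) I ∞ ψ w) :
    coordForm ψ (extD η) w = extDeriv (coordForm ψ η) w := by
  have hx : ψ w ∈ (extChartAt I (ψ w)).source := mem_extChartAt_source _
  have hg := contDiffAt_extChartAt_comp le_rfl hψ hx
  have hd : DifferentiableAt ℝ (localForm η (ψ w)) ((extChartAt I (ψ w) ∘ ψ) w) :=
    ((hη (ψ w)).contDiffAt ((isOpen_extChartAt_target _).mem_nhds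
      (mem_extChartAt_target _))).differentiableAt (by simp)
  -- Near `w` the family is the pullback of the chart expression of `η` under the coordinate
  -- expression of `ψ`, and the flat exterior derivative commutes with such pullbacks.
  rw [(coordForm_eventuallyEq_localForm η hψ hx).extDeriv_eq,
    extDeriv_pullback (r := 2) hd (hg.of_le (by norm_cast)) (by simp)]
  have : IsManifold I 1 M := IsManifold.of_le (n := ∞) (by simp)
  have hm : mfderiv 𝓘(ℝ, F) 𝓘(ℝ, E) (extChartAt I (ψ w) ∘ ψ) w = mfderiv 𝓘(ℝ, F) I ψ w := by
    rw [mfderiv_comp w (mdifferentiableAt_extChartAt_of_mem_source hx)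
      (hψ.mdifferentiableAt (by simp)), mfderiv_extChartAt_self]
    rfl
  rw [← mfderiv_eq_fderiv, hm]
  ext v
  rw [coordForm_apply, extD_apply]
  rfl

/-- A form is smooth if its pullbacks through the inverse charts are. -/
theorem isSmoothForm_of_contDiffAt {k : ℕ} {η : DForm I M k}
    (h : ∀ (x₀ : M), ∀ y ∈ (extChartAt I x₀).target,
      ContDiffAt ℝ ∞ (coordForm (extChartAt I x₀).symm η) y) : IsSmoothForm η := fun x₀ ↦ by
  rw [localForm_eq_coordForm]
  exact fun y hy ↦ (h x₀ y hy).contDiffWithinAt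

theorem coordForm_chart_eventuallyEq {f : M → M'} {k : ℕ} (η : DForm I' M' k) {x₀ : M} {y : E}
    (hf : ContMDiffAt I I' ∞ f ((extChartAt I x₀).symm y)) (hy : y ∈ (extChartAt I x₀).target) :
    coordForm (extChartAt I x₀).symm (pullback (I := I) f η) =ᶠ[𝓝 y]
      coordForm (f ∘ (extChartAt I x₀).symm) η := by
  have h1 : ∀ᶠ z in 𝓝 y, z ∈ (extChartAt I x₀).target :=
    (isOpen_extChartAt_target x₀).mem_nhds hy
  have h2 := (contMDiffAt_extChartAt_symm hy).continuousAt.eventually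
      (ContMDiffAt.eventually_mdifferentiableAt hf)
  filter_upwards [h1, h2] with z hz hz'
  exact (coordForm_comp η hz' (mdifferentiableAt_extChartAt_symm hz)).symm

theorem IsSmoothForm.pullback [FiniteDimensional ℝ E] [FiniteDimensional ℝ E'] {k : ℕ}
    {η : DForm I' M' k} (hη : IsSmoothForm η) {f : M → M'} (hf : ContMDiff I I' ∞ f) :
    IsSmoothForm (pullback (I := I) f η) := by
  refine isSmoothForm_of_contDiffAt fun x₀ y hy ↦ ?_
  refine ContDiffAt.congr_of_eventuallyEq ?_ (coordForm_chart_eventuallyEq η hf.contMDiffAt hy)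
  exact hη.contDiffAt_coordForm (hf.contMDiffAt.comp y (contMDiffAt_extChartAt_symm hy))

theorem mfderiv_extChartAt_symm_self {x : M} :
    mfderiv 𝓘(ℝ, E) I (extChartAt I x).symm (extChartAt I x x) = ContinuousLinearMap.id ℝ E := by
  have : IsManifold I 1 M := IsManifold.of_le (n := ∞) (by simp)
  rw [← mfderivWithin_univ, ← I.range_eq_univ]
  exact mfderivWithin_range_extChartAt_symm

theorem coordForm_extChartAt_self {k : ℕ} (η : DForm I M k) (x : M) (v : Fin k → E) :
    coordForm (extChartAt I x).symm η (extChartAt I x x) v = η x v := by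
  rw [coordForm_apply, mfderiv_extChartAt_symm_self]
  have h0 : ∀ z, z = x → ∀ u : Fin k → E, η z u = η x u := by rintro z rfl u; rfl
  exact h0 _ (extChartAt_to_inv x) _

/-- A `k`-form is determined by its pullback under the inverse chart. -/
theorem form_eq_of_coordForm {k : ℕ} {η θ : DForm I M k} {x : M}
    (h : coordForm (extChartAt I x).symm η (extChartAt I x x) =
      coordForm (extChartAt I x).symm θ (extChartAt I x x)) : η x = θ x := by
  ext v
  exact (coordForm_extChartAt_self η x v).symm.trans
    ((congrArg (fun f ↦ f v) h).trans (coordForm_extChartAt_self θ x v))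

/-- The exterior derivative commutes with pullbacks. -/
theorem IsSmoothForm.extD_pullback_apply {k : ℕ} {η : DForm I' M' k} (hη : IsSmoothForm η)
    {f : M → M'} {x : M} (hf : ContMDiffAt I I' ∞ f x)
    (hs : IsSmoothForm (SymplecticInduction.pullback (I := I) f η)) :
    extD (SymplecticInduction.pullback (I := I) f η) x =
      SymplecticInduction.pullback (I := I) f (extD η) x := by
  apply form_eq_of_coordForm
  have hy := mem_extChartAt_target (I := I) x
  have hf' : ContMDiffAt I I' ∞ f ((extChartAt I x).symm (extChartAt I x x)) := by
    rwa [extChartAt_to_inv]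
  rw [hs.coordForm_extD (contMDiffAt_extChartAt_symm hy),
    (coordForm_chart_eventuallyEq η hf' hy).extDeriv_eq,
    (coordForm_chart_eventuallyEq (extD η) hf' hy).self_of_nhds,
    hη.coordForm_extD (hf'.comp _ (contMDiffAt_extChartAt_symm hy))]

theorem IsSmoothForm.extD_pullback [FiniteDimensional ℝ E] [FiniteDimensional ℝ E'] {k : ℕ}
    {η : DForm I' M' k} (hη : IsSmoothForm η) {f : M → M'} (hf : ContMDiff I I' ∞ f) :
    extD (SymplecticInduction.pullback (I := I) f η) =
      SymplecticInduction.pullback (I := I) f (extD η) :=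
  funext fun _ ↦ hη.extD_pullback_apply hf.contMDiffAt (hη.pullback hf)

end FormCalculus

/-! ### Smoothness of composition operators on spaces of continuous maps -/

section Superposition

universe u
variable {X : Type*} [TopologicalSpace X] [CompactSpace X]
  {E F : Type u} [NormedAddCommGroup E] [NormedSpace ℝ E] [NormedAddCommGroup F] [NormedSpace ℝ F]

/-- The superposition operator `γ ↦ f ∘ γ` on continuous maps. -/
def superposition (f : C(E, F)) (γ : C(X, E)) : C(X, F) := f.comp γ

theorem continuous_superposition (f : C(E, F)) :
    Continuous (superposition f : C(X, E) → C(X, F)) :=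
  ContinuousMap.continuous_postcomp f

variable (X E F) in
/-- Pointwise application of a continuous family of linear maps. -/
def pointwiseApply : C(X, E →L[ℝ] F) →L[ℝ] C(X, E) →L[ℝ] C(X, F) :=
  LinearMap.mkContinuous₂
    (LinearMap.mk₂ ℝ (fun (A : C(X, E →L[ℝ] F)) (h : C(X, E)) ↦
        (⟨fun t ↦ A t (h t), by fun_prop⟩ : C(X, F)))
      (fun A B h ↦ by ext t; simp) (fun c A h ↦ by ext t; simp)
      (fun A h k ↦ by ext t; simp) (fun c A h ↦ by ext t; simp)) 1 (fun A h ↦ by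
        rw [one_mul, ContinuousMap.norm_le _ (by positivity)]
        intro t
        calc ‖A t (h t)‖ ≤ ‖A t‖ * ‖h t‖ := (A t).le_opNorm _
          _ ≤ ‖A‖ * ‖h‖ := by gcongr <;> apply ContinuousMap.norm_coe_le_norm)

/-- The mean value inequality is applied at each point of `X`. Continuity of the superposition
operator of `f'` makes the estimate uniform over the compact space `X`. -/
theorem hasFDerivAt_superposition (f : C(E, F)) (f' : C(E, E →L[ℝ] F))
    (hf : ∀ x, HasFDerivAt f (f' x) x) (γ : C(X, E)) :
    HasFDerivAt (superposition f) (pointwiseApply X E F (superposition f' γ)) γ := by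
  rw [hasFDerivAt_iff_isLittleO_nhds_zero, Asymptotics.isLittleO_iff]
  intro c hc
  have hcont := Metric.continuous_iff.1 (continuous_superposition (X := X) f') γ c hc
  obtain ⟨δ, hδ, h⟩ := hcont
  filter_upwards [Metric.ball_mem_nhds (0 : C(X, E)) hδ] with η hη
  rw [mem_ball_zero_iff] at hη
  rw [ContinuousMap.norm_le _ (by positivity)]
  intro t
  -- A point `z` near `γ t` lies on the translate of `γ` by the constant `z - γ t`, which is
  -- uniformly close to `γ`.
  have hb : ∀ z ∈ Metric.ball (γ t) δ, ‖f' z - f' (γ t)‖ ≤ c := by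
    intro z hz
    have h2 : dist (γ + ContinuousMap.const X (z - γ t)) γ < δ := by
      rw [dist_eq_norm, add_sub_cancel_left]
      refine lt_of_le_of_lt ?_ (mem_ball_iff_norm.1 hz)
      exact (ContinuousMap.norm_le _ (norm_nonneg _)).2 fun _ ↦ le_rfl
    have h3 := (ContinuousMap.dist_lt_iff hc).1 (h _ h2) t
    rw [dist_eq_norm] at h3
    have h4 : (superposition f' (γ + ContinuousMap.const X (z - γ t))) t = f' z := by
      simp [superposition]
    rw [h4] at h3
    exact h3.le
  have hmv := Convex.norm_image_sub_le_of_norm_hasFDerivWithin_le' (f := f) (f' := f')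
    (φ := f' (γ t)) (s := Metric.ball (γ t) δ) (x := γ t) (y := γ t + η t)
    (fun z _ ↦ (hf z).hasFDerivWithinAt) hb (convex_ball _ _) (Metric.mem_ball_self hδ)
    (by
      rw [mem_ball_iff_norm, add_sub_cancel_left]
      exact (ContinuousMap.norm_coe_le_norm η t).trans_lt hη)
  rw [add_sub_cancel_left] at hmv
  refine hmv.trans ?_
  gcongr
  exact ContinuousMap.norm_coe_le_norm η t

/-- The derivative is again a superposition operator, that of `fderiv ℝ f`, followed by a continuous
linear map. The target changes at each induction step, hence the quantification over `F`. -/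
theorem contDiff_superposition_nat (k : ℕ) : ∀ {F : Type u} [NormedAddCommGroup F]
    [NormedSpace ℝ F] (f : C(E, F)), ContDiff ℝ k f →
    ContDiff ℝ k (superposition f : C(X, E) → C(X, F)) := by
  induction k with
  | zero =>
    intro F _ _ f _
    exact contDiff_zero.2 (continuous_superposition f)
  | succ k ih =>
    intro F _ _ f hf
    have hf' : ContDiff ℝ k (fderiv ℝ f) := hf.fderiv_right (by norm_cast)
    let f' : C(E, E →L[ℝ] F) := ⟨fderiv ℝ f, hf'.continuous⟩
    have hd : ∀ γ : C(X, E), HasFDerivAt (superposition f)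
        (pointwiseApply X E F (superposition f' γ)) γ :=
      hasFDerivAt_superposition f f' fun x ↦
        (hf.differentiable (by norm_cast) x).hasFDerivAt
    rw [Nat.cast_succ, contDiff_succ_iff_hasFDerivAt]
    exact ⟨fun γ ↦ pointwiseApply X E F (superposition f' γ),
      (ContinuousLinearMap.contDiff _).comp (ih f' hf'), hd⟩

theorem contDiff_superposition (f : C(E, F)) (hf : ContDiff ℝ ∞ f) :
    ContDiff ℝ ∞ (superposition f : C(X, E) → C(X, F)) :=
  contDiff_infty.2 fun k ↦ contDiff_superposition_nat k f (contDiff_infty.1 hf k)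

end Superposition

/-! ### Smooth dependence of solutions of differential equations -/

section LocalFlow

universe u
variable {E : Type u} [NormedAddCommGroup E] [NormedSpace ℝ E] [CompleteSpace E]

/-- Continuous curves on the interval `[-2, 2]`. -/
abbrev Curves (E : Type*) [TopologicalSpace E] : Type _ := C(Set.Icc (-2 : ℝ) 2, E)

/-- Extension of a curve on `[-2, 2]` to the real line. -/
def Curves.ext (γ : Curves E) (t : ℝ) : E :=
  γ (Set.projIcc (-2) 2 (by norm_num) t)

theorem Curves.continuous_ext (γ : Curves E) : Continuous γ.ext :=
  γ.continuous.comp continuous_projIcc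

theorem Curves.ext_of_mem (γ : Curves E) {t : ℝ} (ht : t ∈ Set.Icc (-2 : ℝ) 2) :
    γ.ext t = γ ⟨t, ht⟩ := by
  rw [Curves.ext, Set.projIcc_of_mem]

variable (E) in
/-- The primitive vanishing at `0`, as an operator on curves. -/
def primitive : Curves E →L[ℝ] Curves E :=
  LinearMap.mkContinuous
    { toFun := fun γ ↦ ⟨fun t ↦ ∫ s in (0 : ℝ)..t, γ.ext s,
        (intervalIntegral.continuous_primitive
          (fun a b ↦ γ.continuous_ext.intervalIntegrable a b) 0).comp continuous_subtype_val⟩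
      map_add' := fun γ η ↦ by
        ext t
        exact intervalIntegral.integral_add (γ.continuous_ext.intervalIntegrable _ _)
          (η.continuous_ext.intervalIntegrable _ _)
      map_smul' := fun c γ ↦ by
        ext t
        exact intervalIntegral.integral_smul c γ.ext } 2 (fun γ ↦ by
      rw [ContinuousMap.norm_le _ (by positivity)]
      intro t
      refine (intervalIntegral.norm_integral_le_of_norm_le_const (C := ‖γ‖)
        fun s _ ↦ γ.norm_coe_le_norm _).trans ?_
      rw [mul_comm]
      gcongr
      rw [sub_zero, abs_le]
      exact t.2)

/-- Smooth dependence of solutions on the initial point and on a scaling of the vector field: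
for a smooth vector field, the curve `c = c_{x, ε}` with `c' = ε f(c)` and `c(0) = x` exists on
`(-2, 2)` for `(x, ε)` near `(x₀, 0)`, and `c_{x, ε}(1)` depends smoothly on `(x, ε)`. -/
theorem exists_contDiffAt_flow (f : E → E) (hf : ContDiff ℝ ∞ f) (x₀ : E) {U : Set E}
    (hU : U ∈ 𝓝 x₀) :
    ∃ φ : E × ℝ → E, ContDiffAt ℝ ∞ φ (x₀, 0) ∧ ∀ᶠ p in 𝓝 (x₀, (0 : ℝ)), ∃ c : ℝ → E,
      c 0 = p.1 ∧ c 1 = φ p ∧ ∀ t ∈ Set.Ioo (-2 : ℝ) 2, c t ∈ U ∧ HasDerivAt c (p.2 • f (c t)) t := by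
  let fc : C(E, E) := ⟨f, hf.continuous⟩
  -- The zeros of `G` are the solutions of the integral equation `γ(t) = x + ε ∫₀ᵗ f(γ)`.
  let G : (E × ℝ) × Curves E → Curves E := fun q ↦
    q.2 - ContinuousMap.const _ q.1.1 - q.1.2 • primitive E (superposition fc q.2)
  let cst : E →L[ℝ] Curves E := ContinuousLinearMap.const ℝ _
  have hG : ContDiff ℝ ∞ G := by
    refine (contDiff_snd.sub (cst.contDiff.comp (contDiff_fst.comp contDiff_fst))).sub ?_
    exact (contDiff_snd.comp contDiff_fst).smul ((primitive E).contDiff.comp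
      ((contDiff_superposition fc hf).comp contDiff_snd))
  let u : (E × ℝ) × Curves E := ((x₀, 0), ContinuousMap.const _ x₀)
  have hGu : G u = 0 := by simp [G, u]
  -- For `ε = 0` the integral term vanishes, so the partial derivative in `γ` is the identity and
  -- the implicit function theorem produces the solution as a smooth function of `(x, ε)`.
  have hinv : fderiv ℝ G u ∘L .inr ℝ (E × ℝ) (Curves E) = ContinuousLinearMap.id ℝ _ := by
    have h1 : HasFDerivAt (fun γ ↦ G (u.1, γ)) (fderiv ℝ G u ∘L .inr ℝ (E × ℝ) (Curves E)) u.2 :=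
      HasFDerivAt.comp u.2 (g := G) (f := fun γ ↦ (u.1, γ))
        (hG.differentiable (by simp) u).hasFDerivAt (hasFDerivAt_prodMk_right u.1 u.2)
    have h2 : HasFDerivAt (fun γ ↦ G (u.1, γ)) (ContinuousLinearMap.id ℝ _) u.2 := by
      have : (fun γ ↦ G (u.1, γ)) = fun γ ↦ γ - ContinuousMap.const _ x₀ := by
        funext γ
        simp [G, u]
      rw [this]
      exact (hasFDerivAt_id _).sub_const _
    exact h1.unique h2
  have hinv' : (fderiv ℝ G u ∘L .inr ℝ (E × ℝ) (Curves E)).IsInvertible := by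
    rw [hinv]
    exact ⟨ContinuousLinearEquiv.refl ℝ _, rfl⟩
  have hGat : ContDiffAt ℝ ∞ G u := hG.contDiffAt
  let g := hGat.implicitFunction (by simp) hinv'
  have hg : ContDiffAt ℝ ∞ g u.1 := hGat.contDiffAt_implicitFunction (by simp) hinv'
  have hg0 : g u.1 = u.2 := hGat.implicitFunction_apply_self (by simp) hinv'
  have hgG : ∀ᶠ p in 𝓝 u.1, G (p, g p) = 0 := by
    rw [← hGu]
    exact hGat.eventually_apply_implicitFunction (by simp) hinv'
  obtain ⟨δ, hδ, hball⟩ := Metric.mem_nhds_iff.1 hU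
  have hclose : ∀ᶠ p in 𝓝 u.1, dist (g p) u.2 < δ := by
    have := hg.continuousAt
    rw [ContinuousAt, hg0] at this
    exact this.eventually (Metric.ball_mem_nhds _ hδ)
  have h1mem : (1 : ℝ) ∈ Set.Icc (-2 : ℝ) 2 := by constructor <;> norm_num
  have h0mem : (0 : ℝ) ∈ Set.Icc (-2 : ℝ) 2 := by constructor <;> norm_num
  -- Time `1` for the field `ε f` is time `ε` for `f`. The interval `[-2, 2]` keeps both `0` and `1`
  -- in its interior.
  refine ⟨fun p ↦ g p ⟨1, h1mem⟩, ?_, ?_⟩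
  · let ev : Curves E →L[ℝ] E := ContinuousMap.evalCLM ℝ ⟨1, h1mem⟩
    exact ev.contDiff.contDiffAt.comp _ hg
  · filter_upwards [hgG, hclose] with p hp hpc
    have hsol : ∀ t (ht : t ∈ Set.Icc (-2 : ℝ) 2), (g p).ext t =
        p.1 + p.2 • ∫ s in (0 : ℝ)..t, f ((g p).ext s) := by
      intro t ht
      have := congrArg (fun γ : Curves E ↦ γ ⟨t, ht⟩) hp
      have h3 : g p ⟨t, ht⟩ - p.1 - p.2 • (∫ s in (0 : ℝ)..t, f ((g p).ext s)) = 0 := this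
      rw [Curves.ext_of_mem _ ht]
      rw [sub_sub, sub_eq_zero] at h3
      exact h3
    refine ⟨(g p).ext, ?_, Curves.ext_of_mem _ h1mem, fun t ht ↦ ⟨?_, ?_⟩⟩
    · rw [hsol 0 h0mem]
      simp
    · apply hball
      rw [Curves.ext_of_mem _ (Set.Ioo_subset_Icc_self ht)]
      exact (ContinuousMap.dist_apply_le_dist (g := u.2) _).trans_lt hpc
    · have hc : Continuous fun s ↦ f ((g p).ext s) := hf.continuous.comp (g p).continuous_ext
      have hd : HasDerivAt (fun t ↦ p.1 + p.2 • ∫ s in (0 : ℝ)..t, f ((g p).ext s))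
          (p.2 • f ((g p).ext t)) t :=
        ((hc.integral_hasStrictDerivAt 0 t).hasDerivAt.const_smul p.2).const_add p.1
      refine hd.congr_of_eventuallyEq ?_
      filter_upwards [isOpen_Ioo.mem_nhds ht] with s hs
      exact hsol s (Set.Ioo_subset_Icc_self hs)

end LocalFlow

/-! ### Vector fields in parametrisations -/

section FieldCalculus

variable {F : Type*} [NormedAddCommGroup F] [NormedSpace ℝ F]
  {E : Type*} [NormedAddCommGroup E] [NormedSpace ℝ E]
  {H : Type*} [TopologicalSpace H] {I : ModelWithCorners ℝ E H}
  {M : Type*} [TopologicalSpace M] [ChartedSpace H M]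

/-- The expression of a vector field in a parametrisation. -/
def coordField (ψ : F → M) (X : VField I M) : F → F :=
  fun w ↦ VectorField.mpullback 𝓘(ℝ, F) I ψ X w

theorem mfderiv_coordField {ψ : F → M} (X : VField I M) {w : F}
    (h : (mfderiv 𝓘(ℝ, F) I ψ w).IsInvertible) :
    mfderiv 𝓘(ℝ, F) I ψ w (coordField (F := F) ψ X w) = X (ψ w) :=
  congrArg (fun f ↦ f (X (ψ w))) h.self_comp_inverse

theorem coordField_eq_iff {ψ : F → M} (X : VField I M) {w v : F}
    (h : (mfderiv 𝓘(ℝ, F) I ψ w).IsInvertible) :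
    coordField ψ X w = v ↔ X (ψ w) = mfderiv 𝓘(ℝ, F) I ψ w v := by
  constructor
  · rintro rfl
    exact (mfderiv_coordField X h).symm
  · intro hv
    change (mfderiv 𝓘(ℝ, F) I ψ w).inverse (X (ψ w)) = v
    rw [hv]
    exact congrArg (fun f ↦ f v) h.inverse_comp_self

variable [IsManifold I ∞ M] [I.Boundaryless] [CompleteSpace F] [CompleteSpace E]

theorem localField_eq_coordField (X : VField I M) (x₀ : M) :
    localField X x₀ = coordField (extChartAt I x₀).symm X := by
  funext y
  change VectorField.mpullbackWithin _ _ _ _ _ _ = _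
  rw [I.range_eq_univ, VectorField.mpullbackWithin_univ]
  rfl

theorem isInvertible_mfderiv_extChartAt_symm {x₀ : M} {y : E}
    (hy : y ∈ (extChartAt I x₀).target) :
    (mfderiv 𝓘(ℝ, E) I (extChartAt I x₀).symm y).IsInvertible := by
  have : IsManifold I 1 M := IsManifold.of_le (n := ∞) (by simp)
  rw [← mfderivWithin_univ, ← I.range_eq_univ]
  exact isInvertible_mfderivWithin_extChartAt_symm hy

theorem contDiffAt_coordField {X : VField I M} {ψ : F → M} {w : F}
    (hX : ContMDiffAt I I.tangent ∞ (fun x ↦ (⟨x, X x⟩ : TangentBundle I M)) (ψ w))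
    (hψ : ContMDiffAt 𝓘(ℝ, F) I ∞ ψ w) (h : (mfderiv 𝓘(ℝ, F) I ψ w).IsInvertible) :
    ContDiffAt ℝ ∞ (coordField ψ X) w :=
  contMDiffAt_vectorSpace_iff_contDiffAt.1
    (ContMDiffAt.mpullback_vectorField_preimage hX hψ h (by simp))

theorem coordField_extChartAt_self (X : VField I M) (x : M) :
    coordField (extChartAt I x).symm X (extChartAt I x x) = (X x : E) := by
  have h0 : ∀ z, z = x → (X z : E) = X x := by rintro z rfl; rfl
  refine (coordField_eq_iff (F := E) X
    (isInvertible_mfderiv_extChartAt_symm (mem_extChartAt_target x))).2 ?_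
  exact (h0 _ (extChartAt_to_inv x)).trans
    (congrArg (fun f : E →L[ℝ] E ↦ f (X x)) mfderiv_extChartAt_symm_self).symm

end FieldCalculus

/-! ### Smoothness of the flow of a complete vector field -/

section GlobalFlow

universe u
variable {E : Type u} [NormedAddCommGroup E] [NormedSpace ℝ E] [FiniteDimensional ℝ E]
  {H : Type*} [TopologicalSpace H] {I : ModelWithCorners ℝ E H} [I.Boundaryless]
  {M : Type*} [TopologicalSpace M] [ChartedSpace H M] [IsManifold I ∞ M]
  {X : VField I M}

/-- The flow of a complete vector field. -/
def flow (hX : IsCompleteField X) (x : M) : ℝ → M := (hX x).choose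

theorem flow_zero (hX : IsCompleteField X) (x : M) : flow hX x 0 = x := (hX x).choose_spec.1

theorem isMIntegralCurve_flow (hX : IsCompleteField X) (x : M) :
    IsMIntegralCurve (flow hX x) X := (hX x).choose_spec.2

variable [T2Space M]

theorem flow_add (hX : IsCompleteField X) (hs : IsSmoothField X) (x : M) (s t : ℝ) :
    flow hX x (s + t) = flow hX (flow hX x s) t := by
  have : IsManifold I 1 M := IsManifold.of_le (n := ∞) (by simp)
  have h1 := (isMIntegralCurve_flow hX x).comp_add s
  have h2 := isMIntegralCurve_Ioo_eq_of_contMDiff_boundaryless (t₀ := 0) (hs.of_le (by simp)) h1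
    (isMIntegralCurve_flow hX (flow hX x s)) (by simp [flow_zero])
  rw [add_comm]
  exact congrFun h2 t

/-- A bump function extends the chart expression of `X` to a smooth field on the whole model space,
where the flat theory applies. Curves with small parameters stay where the bump function equals `1`,
so uniqueness identifies them with the flow. -/
theorem contMDiffAt_flow_zero (hX : IsCompleteField X) (hs : IsSmoothField X) (x₀ : M) :
    ContMDiffAt (I.prod 𝓘(ℝ, ℝ)) I ∞ (fun p : M × ℝ ↦ flow hX p.1 p.2) (x₀, 0) := by
  have : IsManifold I 1 M := IsManifold.of_le (n := ∞) (by simp)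
  have : CompleteSpace E := FiniteDimensional.complete ℝ E
  set y₀ := extChartAt I x₀ x₀
  set T := (extChartAt I x₀).target
  have hT : T ∈ 𝓝 y₀ := (isOpen_extChartAt_target x₀).mem_nhds (mem_extChartAt_target x₀)
  obtain ⟨χ, -, hχ1, hχ2, hχ3, -⟩ : ∃ χ : E → ℝ, 0 ≤ χ ∧ (χ =ᶠ[𝓝 y₀] fun _ ↦ 1) ∧
      tsupport χ ⊆ T ∧ ContDiff ℝ ∞ χ ∧ True := by
    obtain ⟨r, hr, hrT⟩ := Metric.nhds_basis_closedBall.mem_iff.1 hT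
    let b : ContDiffBump y₀ := ⟨r / 2, r, by positivity, by linarith⟩
    exact ⟨b, fun x ↦ b.nonneg, b.eventuallyEq_one, by rw [b.tsupport_eq]; exact hrT,
      b.contDiff, trivial⟩
  set fh := coordField (extChartAt I x₀).symm X
  have hfh : ∀ y ∈ T, ContDiffAt ℝ ∞ fh y := fun y hy ↦
    contDiffAt_coordField (hs _) (contMDiffAt_extChartAt_symm hy)
      (isInvertible_mfderiv_extChartAt_symm hy)
  let f : E → E := fun y ↦ χ y • fh y
  have hf : ContDiff ℝ ∞ f := by
    rw [contDiff_iff_contDiffAt]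
    intro y
    by_cases hy : y ∈ tsupport χ
    · exact hχ3.contDiffAt.smul (hfh y (hχ2 hy))
    · have : f =ᶠ[𝓝 y] fun _ ↦ 0 := by
        filter_upwards [notMem_tsupport_iff_eventuallyEq.1 hy] with z hz
        simp [f, hz]
      exact contDiffAt_const.congr_of_eventuallyEq this
  obtain ⟨φ, hφ, hev⟩ := exists_contDiffAt_flow f hf y₀ (U := {y | χ y = 1} ∩ T)
    (Filter.inter_mem hχ1 hT)
  have key : ∀ᶠ p in 𝓝 (y₀, (0 : ℝ)),
      flow hX ((extChartAt I x₀).symm p.1) p.2 = (extChartAt I x₀).symm (φ p) := by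
    filter_upwards [hev] with p hp
    obtain ⟨c, hc0, hc1, hc⟩ := hp
    -- Both the curve `c` and the flow with time multiplied by `p.2` are integral curves of `p.2 •
    -- X` on `(-2, 2)` with the same initial point; they are compared at time `1`.
    have h1 : IsMIntegralCurveOn ((extChartAt I x₀).symm ∘ c) (p.2 • X) (Set.Ioo (-2) 2) := by
      intro t ht
      obtain ⟨⟨hct, hcT⟩, hd⟩ := hc t ht
      have hct' : χ (c t) = 1 := hct
      have h2 := (mdifferentiableAt_extChartAt_symm (I := I) hcT).hasMFDerivAt.comp t
        hd.hasFDerivAt.hasMFDerivAt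
      refine (h2.congr_mfderiv ?_).hasMFDerivWithinAt
      ext
      simp only [f, hct', one_smul]
      have h3 := mfderiv_coordField X (isInvertible_mfderiv_extChartAt_symm hcT)
      have h4 : mfderiv 𝓘(ℝ, E) I (extChartAt I x₀).symm (c t) (p.2 • fh (c t)) =
          p.2 • X ((extChartAt I x₀).symm (c t)) := by
        rw [← h3]
        exact (mfderiv 𝓘(ℝ, E) I (extChartAt I x₀).symm (c t)).map_smul p.2 (fh (c t))
      refine Eq.trans ?_ (h4.trans ?_)
      · change mfderiv 𝓘(ℝ, E) I (extChartAt I x₀).symm (c t) ((1 : ℝ) • (p.2 • fh (c t))) = _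
        rw [one_smul]
      · exact (one_smul ℝ (p.2 • X ((extChartAt I x₀).symm (c t)))).symm
    have h5 := ((isMIntegralCurve_flow hX ((extChartAt I x₀).symm p.1)).comp_mul
      p.2).isMIntegralCurveOn (Set.Ioo (-2) 2)
    have h6 : ContMDiff I I.tangent 1 (fun x ↦ (⟨x, (p.2 • X) x⟩ : TangentBundle I M)) :=
      (ContMDiff.const_smul_section hs).of_le (by simp)
    have h7 := isMIntegralCurveOn_Ioo_eqOn_of_contMDiff_boundaryless (t₀ := 0) (by norm_num) h6
      h5 h1 (by simp [flow_zero, hc0])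
    have h8 := h7 (x := 1) (by norm_num)
    simpa [hc1] using h8
  have hφ0 : φ (y₀, 0) ∈ T := by
    obtain ⟨c, hc0, hc1, hc⟩ := hev.self_of_nhds
    rw [← hc1]
    exact (hc 1 (by norm_num)).1.2
  have hcomp : ContMDiffAt (I.prod 𝓘(ℝ, ℝ)) I ∞
      (fun p : M × ℝ ↦ (extChartAt I x₀).symm (φ (extChartAt I x₀ p.1, p.2))) (x₀, 0) := by
    have h1 : ContMDiffAt (I.prod 𝓘(ℝ, ℝ)) (𝓘(ℝ, E).prod 𝓘(ℝ, ℝ)) ∞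
        (fun p : M × ℝ ↦ (extChartAt I x₀ p.1, p.2)) (x₀, 0) :=
      ((contMDiffAt_extChartAt (x := x₀)).comp (x₀, (0 : ℝ)) contMDiffAt_fst).prodMk
        contMDiffAt_snd
    rw [← modelWithCornersSelf_prod] at h1
    have h1 : ContMDiffAt (I.prod 𝓘(ℝ, ℝ)) 𝓘(ℝ, E × ℝ) ∞
        (fun p : M × ℝ ↦ (extChartAt I x₀ p.1, p.2)) (x₀, 0) := by
      rw [chartedSpaceSelf_prod] at h1
      exact h1
    exact ContMDiffAt.comp (x₀, (0 : ℝ)) (contMDiffAt_extChartAt_symm (x₀ := x₀) hφ0)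
      (hφ.contMDiffAt.comp (x₀, (0 : ℝ)) h1)
  refine hcomp.congr_of_eventuallyEq ?_
  have hc : ContinuousAt (fun p : M × ℝ ↦ (extChartAt I x₀ p.1, p.2)) (x₀, 0) :=
    ((continuousAt_extChartAt x₀).comp (x := (x₀, (0 : ℝ))) continuousAt_fst).prodMk
      continuousAt_snd
  have hsrc : ∀ᶠ p : M × ℝ in 𝓝 (x₀, 0), p.1 ∈ (extChartAt I x₀).source :=
    continuousAt_fst.eventually_mem ((isOpen_extChartAt_source x₀).mem_nhds
      (mem_extChartAt_source x₀))
  filter_upwards [hc.eventually key, hsrc] with p hp hp1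
  rw [← hp, (extChartAt I x₀).left_inv hp1]

/-- The flow of a complete smooth vector field is smooth. -/
theorem contMDiff_flow (hX : IsCompleteField X) (hs : IsSmoothField X) :
    ContMDiff (I.prod 𝓘(ℝ, ℝ)) I ∞ (fun p : M × ℝ ↦ flow hX p.1 p.2) := by
  have : IsManifold I 1 M := IsManifold.of_le (n := ∞) (by simp)
  set Fl : M × ℝ → M := fun p ↦ flow hX p.1 p.2
  -- Being `C^k` at a point propagates to a neighbourhood for finite `k` only.
  rw [contMDiff_infty]
  rintro k ⟨x₀, s⟩
  have hk : (k : WithTop ℕ∞) ≤ ∞ := by exact_mod_cast le_top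
  have : IsManifold I (k + 1) M := IsManifold.of_le (n := ∞) (by exact_mod_cast le_top)
  have : IsManifold I k M := IsManifold.of_le (n := ∞) hk
  -- This set of times contains `0`. The group law and smoothness near time `0` extend it by a step
  -- `δ` that is uniform near each point of `M`, so it is open and closed.
  let A : Set ℝ := {t | ContMDiffAt (I.prod 𝓘(ℝ, ℝ)) I k Fl (x₀, t)}
  have hstep : ∀ z : M, ∃ δ > 0, ∃ U ∈ 𝓝 z, ∀ t s' : ℝ, t ∈ A → Fl (x₀, t) ∈ U → |s' - t| < δ →
      s' ∈ A := by
    intro z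
    obtain ⟨V, hV, hVs⟩ : ∃ V ∈ 𝓝 (z, (0 : ℝ)), ∀ p ∈ V,
        ContMDiffAt (I.prod 𝓘(ℝ, ℝ)) I k Fl p := by
      have h := (contMDiffAt_iff_contMDiffAt_nhds (by simp)).1
        ((contMDiffAt_flow_zero hX hs z).of_le hk)
      exact ⟨_, h, fun p hp ↦ hp⟩
    obtain ⟨U, hU, W, hW, hUW⟩ := mem_nhds_prod_iff.1 hV
    obtain ⟨δ, hδ, hball⟩ := Metric.mem_nhds_iff.1 hW
    refine ⟨δ, hδ, U, hU, fun t s' ht htU hst ↦ ?_⟩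
    have h1 : ContMDiffAt (I.prod 𝓘(ℝ, ℝ)) I k Fl (Fl (x₀, t), s' - t) :=
      hVs _ (hUW ⟨htU, hball (by simpa using hst)⟩)
    have h2 : ContMDiffAt (I.prod 𝓘(ℝ, ℝ)) (I.prod 𝓘(ℝ, ℝ)) k
        (fun p : M × ℝ ↦ (Fl (p.1, t), p.2 - t)) (x₀, s') := by
      refine ContMDiffAt.prodMk ?_ (contMDiffAt_snd.sub contMDiffAt_const)
      exact ContMDiffAt.comp (x₀, s') (f := fun p : M × ℝ ↦ (p.1, t)) (g := Fl) ht
        (contMDiffAt_fst.prodMk contMDiffAt_const)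
    -- The group law writes the flow near time `s'` as a flow for a short time after the flow for
    -- the fixed time `t`.
    have h3 : Fl = Fl ∘ fun p : M × ℝ ↦ (Fl (p.1, t), p.2 - t) := by
      funext p
      change flow hX p.1 p.2 = flow hX (flow hX p.1 t) (p.2 - t)
      rw [← flow_add hX hs]
      congr 1
      ring
    change ContMDiffAt _ _ _ Fl _
    rw [h3]
    exact ContMDiffAt.comp (x₀, s') (g := Fl) h1 h2
  have hcont : Continuous fun t ↦ Fl (x₀, t) := (isMIntegralCurve_flow hX x₀).continuous
  have hopen : IsOpen A := by
    rw [Metric.isOpen_iff]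
    intro t ht
    obtain ⟨δ, hδ, U, hU, h⟩ := hstep (Fl (x₀, t))
    exact ⟨δ, hδ, fun s' hs' ↦ h t s' ht (mem_of_mem_nhds hU) hs'⟩
  have hclosed : IsClosed A := by
    refine isClosed_of_closure_subset fun t ht ↦ ?_
    obtain ⟨δ, hδ, U, hU, h⟩ := hstep (Fl (x₀, t))
    have hn : {t' | Fl (x₀, t') ∈ U} ∩ Metric.ball t δ ∈ 𝓝 t :=
      Filter.inter_mem (hcont.continuousAt.preimage_mem_nhds hU) (Metric.ball_mem_nhds t hδ)
    obtain ⟨t', ⟨ht'U, ht'⟩, ht'A⟩ := mem_closure_iff_nhds.1 ht _ hn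
    exact h t' t ht'A ht'U (by rw [abs_sub_comm]; exact ht')
  have huniv : A = Set.univ :=
    IsClopen.eq_univ ⟨hclosed, hopen⟩ ⟨0, (contMDiffAt_flow_zero hX hs x₀).of_le hk⟩
  have : s ∈ A := huniv ▸ Set.mem_univ s
  exact this

end GlobalFlow

/-! ### Forms of degree one and two as linear and bilinear maps -/

section LinBil

variable {F : Type*} [NormedAddCommGroup F] [NormedSpace ℝ F]

variable (F) in
/-- `1`-forms as linear forms. -/
def lin : (F [⋀^Fin 1]→L[ℝ] ℝ) →L[ℝ] F →L[ℝ] ℝ :=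
  ((ContinuousAlternatingMap.ofSubsingletonLIE (𝕜 := ℝ) (E := F) (F := ℝ)
    (0 : Fin 1)).symm.toContinuousLinearEquiv : (F [⋀^Fin 1]→L[ℝ] ℝ) →L[ℝ] F →L[ℝ] ℝ)

theorem lin_apply (a : F [⋀^Fin 1]→L[ℝ] ℝ) (v : F) : lin F a v = a ![v] := by
  change a (fun _ ↦ v) = _
  congr 1
  ext i
  fin_cases i
  rfl

variable (F) in
/-- `2`-forms as bilinear forms. -/
def bil : (F [⋀^Fin 2]→L[ℝ] ℝ) →L[ℝ] F →L[ℝ] F →L[ℝ] ℝ :=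
  (ContinuousLinearMap.compL ℝ F _ _ (lin F)).comp
    (ContinuousAlternatingMap.curryLeftLI (𝕜 := ℝ) (E := F) (F := ℝ)
      (n := 1)).toContinuousLinearMap

theorem bil_apply (b : F [⋀^Fin 2]→L[ℝ] ℝ) (u v : F) : bil F b u v = b ![u, v] :=
  lin_apply _ _

theorem bil_swap (b : F [⋀^Fin 2]→L[ℝ] ℝ) (u v : F) : bil F b v u = -bil F b u v := by
  rw [bil_apply, bil_apply]
  have := b.map_swap ![u, v] (i := 0) (j := 1) (by simp)
  refine Eq.trans ?_ this
  change b _ = b _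
  congr 1
  ext i
  fin_cases i <;> rfl

theorem hasFDerivAt_bil (b : F [⋀^Fin 2]→L[ℝ] ℝ) :
    HasFDerivAt (𝕜 := ℝ) (fun b : F [⋀^Fin 2]→L[ℝ] ℝ ↦ (bil F b : F →L[ℝ] F →L[ℝ] ℝ)) (bil F) b :=
  ContinuousLinearMap.hasFDerivAt (F := F →L[ℝ] F →L[ℝ] ℝ) (bil F)

theorem contDiff_bil {r : WithTop ℕ∞} :
    ContDiff ℝ r (fun b : F [⋀^Fin 2]→L[ℝ] ℝ ↦ (bil F b : F →L[ℝ] F →L[ℝ] ℝ)) :=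
  ContinuousLinearMap.contDiff (𝕜 := ℝ) (E := F [⋀^Fin 2]→L[ℝ] ℝ) (F := F →L[ℝ] F →L[ℝ] ℝ)
    (bil F)

theorem bil_self (b : F [⋀^Fin 2]→L[ℝ] ℝ) (u : F) : bil F b u u = 0 := by
  have := bil_swap b u u
  linarith

theorem fderiv_lin {G : Type*} [NormedAddCommGroup G] [NormedSpace ℝ G]
    {a : G → F [⋀^Fin 1]→L[ℝ] ℝ} {y : G} (ha : DifferentiableAt ℝ a y) (u : G) (v : F) :
    fderiv ℝ (fun z ↦ lin F (a z)) y u v = fderiv ℝ a y u ![v] := by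
  have h1 := ((lin F).hasFDerivAt.comp y ha.hasFDerivAt)
  rw [show (fun z ↦ lin F (a z)) = lin F ∘ a from rfl, h1.fderiv]
  exact lin_apply _ _

theorem fderiv_bil {G : Type*} [NormedAddCommGroup G] [NormedSpace ℝ G]
    {b : G → F [⋀^Fin 2]→L[ℝ] ℝ} {y : G} (hb : DifferentiableAt ℝ b y) (u : G) (v w : F) :
    fderiv ℝ (fun z ↦ bil F (b z)) y u v w = fderiv ℝ b y u ![v, w] := by
  have h1 : HasFDerivAt (fun z ↦ bil F (b z)) ((bil F).comp (fderiv ℝ b y)) y :=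
    HasFDerivAt.comp (𝕜 := ℝ) (E := G) (F := F [⋀^Fin 2]→L[ℝ] ℝ) (G := F →L[ℝ] F →L[ℝ] ℝ)
      (g := fun b ↦ bil F b) y (hasFDerivAt_bil (b y)) hb.hasFDerivAt
  rw [h1.fderiv]
  exact bil_apply _ _ _

theorem fderiv_bil_swap {G : Type*} [NormedAddCommGroup G] [NormedSpace ℝ G]
    {b : G → F [⋀^Fin 2]→L[ℝ] ℝ} {y : G} (hb : DifferentiableAt ℝ b y) (u : G) (v w : F) :
    fderiv ℝ (fun z ↦ bil F (b z)) y u w v = -fderiv ℝ (fun z ↦ bil F (b z)) y u v w := by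
  rw [fderiv_bil hb, fderiv_bil hb, ← bil_apply, ← bil_apply, bil_swap]

theorem bil_extDeriv {a : F → F [⋀^Fin 1]→L[ℝ] ℝ} {y : F} (ha : DifferentiableAt ℝ a y)
    (u v : F) :
    bil F (extDeriv a y) u v = fderiv ℝ (fun z ↦ lin F (a z)) y u v -
      fderiv ℝ (fun z ↦ lin F (a z)) y v u := by
  have h0 : Fin.removeNth (0 : Fin 2) ![u, v] = ![v] := by ext i; fin_cases i; rfl
  have h1 : Fin.removeNth (1 : Fin 2) ![u, v] = ![u] := by ext i; fin_cases i; rfl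
  rw [bil_apply, extDeriv_apply ha, fderiv_lin ha, fderiv_lin ha, Fin.sum_univ_two, h0, h1]
  simp only [fderiv_continuousAlternatingMap_apply_const_apply ha]
  simp
  ring

theorem extDeriv_two {b : F → F [⋀^Fin 2]→L[ℝ] ℝ} {y : F} (hb : DifferentiableAt ℝ b y)
    (u v w : F) :
    extDeriv b y ![u, v, w] = fderiv ℝ (fun z ↦ bil F (b z)) y u v w -
      fderiv ℝ (fun z ↦ bil F (b z)) y v u w + fderiv ℝ (fun z ↦ bil F (b z)) y w u v := by
  have h0 : Fin.removeNth (0 : Fin 3) ![u, v, w] = ![v, w] := by ext i; fin_cases i <;> rfl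
  have h1 : Fin.removeNth (1 : Fin 3) ![u, v, w] = ![u, w] := by ext i; fin_cases i <;> rfl
  have h2 : Fin.removeNth (2 : Fin 3) ![u, v, w] = ![u, v] := by ext i; fin_cases i <;> rfl
  rw [extDeriv_apply hb, fderiv_bil hb, fderiv_bil hb, fderiv_bil hb, Fin.sum_univ_three, h0, h1,
    h2]
  simp only [fderiv_continuousAlternatingMap_apply_const_apply hb]
  simp
  ring

theorem contDiffAt_lin {G : Type*} [NormedAddCommGroup G] [NormedSpace ℝ G]
    {a : G → F [⋀^Fin 1]→L[ℝ] ℝ} {y : G} {r : WithTop ℕ∞} (ha : ContDiffAt ℝ r a y) :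
    ContDiffAt ℝ r (fun z ↦ lin F (a z)) y :=
  (lin F).contDiff.contDiffAt.comp y ha

theorem contDiffAt_bil {G : Type*} [NormedAddCommGroup G] [NormedSpace ℝ G]
    {a : G → F [⋀^Fin 2]→L[ℝ] ℝ} {y : G} {r : WithTop ℕ∞} (ha : ContDiffAt ℝ r a y) :
    ContDiffAt ℝ r (fun z ↦ bil F (a z)) y :=
  ContDiffAt.comp (𝕜 := ℝ) (E := G) (F := F [⋀^Fin 2]→L[ℝ] ℝ) (G := F →L[ℝ] F →L[ℝ] ℝ)
    (g := fun b ↦ bil F b) y contDiff_bil.contDiffAt ha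

theorem one_form_ext {a a' : F [⋀^Fin 1]→L[ℝ] ℝ} (h : lin F a = lin F a') : a = a' :=
  (ContinuousAlternatingMap.ofSubsingletonLIE (𝕜 := ℝ) (E := F) (F := ℝ)
    (0 : Fin 1)).symm.injective h

theorem two_form_ext {b b' : F [⋀^Fin 2]→L[ℝ] ℝ} (h : ∀ u v, bil F b u v = bil F b' u v) :
    b = b' := by
  ext w
  have : w = ![w 0, w 1] := by ext i; fin_cases i <;> rfl
  rw [this, ← bil_apply, ← bil_apply, h]

end LinBil

/-! ### Cartan calculus for a conformal and a symplectic vector field -/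

section ConformalField

variable {E : Type*} [NormedAddCommGroup E] [NormedSpace ℝ E] [FiniteDimensional ℝ E]
  {H : Type*} [TopologicalSpace H] {I : ModelWithCorners ℝ E H} [I.Boundaryless]
  {M : Type*} [TopologicalSpace M] [ChartedSpace H M] [IsManifold I ∞ M]
  {F : Type*} [NormedAddCommGroup F] [NormedSpace ℝ F] [FiniteDimensional ℝ F]

theorem lin_coordForm_interior (ψ : F → M) (X : VField I M) (η : DForm I M 2) {w : F}
    (h : (mfderiv 𝓘(ℝ, F) I ψ w).IsInvertible) (v : F) :
    lin F (coordForm ψ (interior X η) w) v = bil F (coordForm ψ η w) (coordField ψ X w) v := by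
  rw [lin_apply, bil_apply, coordForm_apply, coordForm_apply]
  have h1 := mfderiv_coordField X h
  change η (ψ w) (Matrix.vecCons (X (ψ w)) _) = _
  rw [← h1]
  congr 1
  ext i
  fin_cases i <;> rfl

/-- The coordinate expressions enter as variables with defining equations, so that the later
computations take place in the model space instead of in tangent spaces. -/
theorem lieDeriv_two (X : VField I M) (η : DForm I M 2) (x : M) {b : E → E [⋀^Fin 2]→L[ℝ] ℝ}
    {Xc : E → E} {y : E} (hb : b = coordForm (extChartAt I x).symm η)
    (hX : Xc = coordField (extChartAt I x).symm X) (hy : y = extChartAt I x x) (u v : E) :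
    lieDeriv X η x ![u, v] = fderiv ℝ b y (Xc y) ![u, v] +
      (bil E (b y) (fderiv ℝ Xc y u) v + bil E (b y) u (fderiv ℝ Xc y v)) := by
  have : IsManifold I 1 M := IsManifold.of_le (n := ∞) (by simp)
  have : CompleteSpace E := FiniteDimensional.complete ℝ E
  have hw : (fun i ↦ mfderiv I 𝓘(ℝ, E) (extChartAt I x) x ((![u, v] : Fin 2 → E) i)) =
      (![u, v] : Fin 2 → E) := by
    rw [mfderiv_extChartAt_self]
    rfl
  have key : ∀ (b : E → E [⋀^Fin 2]→L[ℝ] ℝ) (X : E → E) (y : E) (w : Fin 2 → E), w = ![u, v] →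
      fderiv ℝ b y (X y) w + ∑ i, b y (Function.update w i (fderiv ℝ X y (w i))) =
      fderiv ℝ b y (X y) ![u, v] + (bil E (b y) (fderiv ℝ X y u) v +
        bil E (b y) u (fderiv ℝ X y v)) := by
    rintro b X y w rfl
    rw [Fin.sum_univ_two, bil_apply, bil_apply]
    congr 3 <;> ext i <;> fin_cases i <;> rfl
  subst hb hX hy
  rw [← localForm_eq_coordForm, ← localField_eq_coordField]
  refine Eq.trans ?_ (key (localForm η x) (localField X x) (extChartAt I x x) _ hw)
  rw [← fderivWithin_univ, ← fderivWithin_univ, ← I.range_eq_univ]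
  rfl

theorem mlieBracket_eq (X Y : VField I M) (x : M)
    {Xc Yc : E → E} {y : E} (hX : Xc = coordField (extChartAt I x).symm X)
    (hY : Yc = coordField (extChartAt I x).symm Y) (hy : y = extChartAt I x x) :
    VectorField.mlieBracket I X Y x = (fderiv ℝ Yc y (Xc y) - fderiv ℝ Xc y (Yc y) : E) := by
  have : IsManifold I 1 M := IsManifold.of_le (n := ∞) (by simp)
  have : CompleteSpace E := FiniteDimensional.complete ℝ E
  subst hX hY hy
  rw [← localField_eq_coordField, ← localField_eq_coordField]
  change (mfderiv I 𝓘(ℝ, E) (extChartAt I x) x).inverse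
    (VectorField.lieBracketWithin ℝ (E := E) (localField X x) (localField Y x)
      ((extChartAt I x).symm ⁻¹' Set.univ ∩ Set.range I) (extChartAt I x x)) = _
  rw [mfderiv_extChartAt_self,
    I.range_eq_univ, Set.preimage_univ, Set.univ_inter, VectorField.lieBracketWithin_univ]
  exact congrFun (congrArg DFunLike.coe (ContinuousLinearMap.inverse_id (R := ℝ) (M := E))) _

variable {μ : DForm I M 2} {S T : VField I M}

theorem contDiffAt_coordField_extChartAt {X : VField I M} (hX : IsSmoothField X) {x : M} {y : E}
    (hy : y ∈ (extChartAt I x).target) :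
    ContDiffAt ℝ ∞ (coordField (F := E) (extChartAt I x).symm X) y :=
  have : CompleteSpace E := FiniteDimensional.complete ℝ E
  contDiffAt_coordField (hX _) (contMDiffAt_extChartAt_symm hy)
    (isInvertible_mfderiv_extChartAt_symm hy)

theorem bil_coordForm_coordField (μ : DForm I M 2) (S T : VField I M) {ψ : F → M} {w : F}
    (h : (mfderiv 𝓘(ℝ, F) I ψ w).IsInvertible) :
    bil F (coordForm ψ μ w) (coordField ψ S w) (coordField ψ T w) =
      μ (ψ w) ![S (ψ w), T (ψ w)] := by
  rw [bil_apply, coordForm_apply]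
  congr 1
  ext i
  fin_cases i
  · exact mfderiv_coordField S h
  · exact mfderiv_coordField T h

theorem eventually_mem_extChartAt_target (I : ModelWithCorners ℝ E H) [I.Boundaryless] (x : M) :
    ∀ᶠ y in 𝓝 (extChartAt I x x), y ∈ (extChartAt I x).target :=
  (isOpen_extChartAt_target x).mem_nhds (mem_extChartAt_target x)

theorem pairing_chart_eventuallyEq (μ : DForm I M 2) (S T : VField I M) (x : M) :
    (fun y ↦ μ y ![S y, T y]) ∘ (extChartAt I x).symm =ᶠ[𝓝 (extChartAt I x x)]
    fun w ↦ bil E (coordForm (extChartAt I x).symm μ w)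
      (coordField (F := E) (extChartAt I x).symm S w)
      (coordField (F := E) (extChartAt I x).symm T w) := by
  have : CompleteSpace E := FiniteDimensional.complete ℝ E
  filter_upwards [eventually_mem_extChartAt_target I x] with w hw
  exact (bil_coordForm_coordField μ S T (isInvertible_mfderiv_extChartAt_symm hw)).symm

theorem IsSmoothForm.contMDiff_pairing (hμ : IsSmoothForm μ) (hS : IsSmoothField S)
    (hT : IsSmoothField T) : ContMDiff I 𝓘(ℝ, ℝ) ∞ (fun y ↦ μ y ![S y, T y]) := by
  intro x
  have h1 : ContDiffAt ℝ ∞ ((fun y ↦ μ y ![S y, T y]) ∘ (extChartAt I x).symm)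
      (extChartAt I x x) := by
    refine ContDiffAt.congr_of_eventuallyEq ?_ (pairing_chart_eventuallyEq μ S T x)
    exact ((contDiffAt_bil (hμ.contDiffAt_coordForm
      (contMDiffAt_extChartAt_symm (mem_extChartAt_target x)))).clm_apply
      (contDiffAt_coordField_extChartAt hS (mem_extChartAt_target x))).clm_apply (contDiffAt_coordField_extChartAt hT (mem_extChartAt_target x))
  have h2 := h1.contMDiffAt.comp x (contMDiffAt_extChartAt (I := I) (n := ∞) (x := x))
  refine h2.congr_of_eventuallyEq ?_
  filter_upwards [(isOpen_extChartAt_source (I := I) x).mem_nhds (mem_extChartAt_source x)]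
    with z hz
  have h3 : ∀ z', z' = z → μ z ![S z, T z] = μ z' ![S z', T z'] := by rintro z' rfl; rfl
  exact h3 _ ((extChartAt I x).left_inv hz)

theorem mfderiv_pairing (hμ : IsSmoothForm μ) (hS : IsSmoothField S)
    (hT : IsSmoothField T) (x : M) {b : E → E [⋀^Fin 2]→L[ℝ] ℝ}
    {Sc Tc : E → E} {y : E} (hb : b = coordForm (extChartAt I x).symm μ)
    (hSc : Sc = coordField (extChartAt I x).symm S)
    (hTc : Tc = coordField (extChartAt I x).symm T) (hy : y = extChartAt I x x) (v : E) :
    (mfderiv I 𝓘(ℝ, ℝ) (fun y ↦ μ y ![S y, T y]) x v : ℝ) =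
      fderiv ℝ (fun z ↦ bil E (b z)) y v (Sc y) (Tc y) +
        (bil E (b y) (fderiv ℝ Sc y v) (Tc y) + bil E (b y) (Sc y) (fderiv ℝ Tc y v)) := by
  have hbs := contDiffAt_bil (hμ.contDiffAt_coordForm
      (contMDiffAt_extChartAt_symm (mem_extChartAt_target (I := I) x)))
  have hSs := contDiffAt_coordField_extChartAt hS (mem_extChartAt_target x)
  have hTs := contDiffAt_coordField_extChartAt hT (mem_extChartAt_target x)
  rw [← hb, ← hy] at hbs
  rw [← hSc, ← hy] at hSs
  rw [← hTc, ← hy] at hTs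
  have h1 := ((hbs.differentiableAt (by simp)).hasFDerivAt.clm_apply
    (hSs.differentiableAt (by simp)).hasFDerivAt).clm_apply
    (hTs.differentiableAt (by simp)).hasFDerivAt
  have h2 : mfderiv I 𝓘(ℝ, ℝ) (fun y ↦ μ y ![S y, T y]) x =
      fderiv ℝ (fun z ↦ bil E (b z) (Sc z) (Tc z)) y := by
    rw [(hμ.contMDiff_pairing hS hT).mdifferentiableAt (by simp) |>.mfderiv, I.range_eq_univ,
      fderivWithin_univ]
    subst hb hSc hTc hy
    exact (pairing_chart_eventuallyEq μ S T x).fderiv_eq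
  rw [h2]
  refine (congrFun (congrArg DFunLike.coe h1.fderiv) v).trans ?_
  change bil E (b y) (Sc y) (fderiv ℝ Tc y v) + (bil E (b y) (fderiv ℝ Sc y v) (Tc y) +
    fderiv ℝ (fun z ↦ bil E (b z)) y v (Sc y) (Tc y)) = _
  ring

/-- For commuting fields `i(T) L_S μ = L_S i(T)μ`, and `i(T)μ` is closed because `L_T μ = 0` and `dμ
= 0`; Cartan's formula then gives `d(μ(S, T)) = -2 i(T)μ`. The hypotheses are these identities at
one point, and the conclusion is a linear combination of them. -/
theorem pairing_algebra {b : E → E [⋀^Fin 2]→L[ℝ] ℝ} {S T : E → E} {y v : E}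
    (hb : DifferentiableAt ℝ b y) (hc : extDeriv b y ![v, S y, T y] = 0)
    (hS : fderiv ℝ b y (S y) ![v, T y] + (bil E (b y) (fderiv ℝ S y v) (T y) +
      bil E (b y) v (fderiv ℝ S y (T y))) = 2 * b y ![v, T y])
    (hT : fderiv ℝ b y (T y) ![S y, v] + (bil E (b y) (fderiv ℝ T y (S y)) v +
      bil E (b y) (S y) (fderiv ℝ T y v)) = 0)
    (hST : fderiv ℝ T y (S y) - fderiv ℝ S y (T y) = 0) :
    fderiv ℝ (fun z ↦ bil E (b z)) y v (S y) (T y) +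
        (bil E (b y) (fderiv ℝ S y v) (T y) + bil E (b y) (S y) (fderiv ℝ T y v)) =
      2 * b y ![v, T y] := by
  rw [extDeriv_two hb] at hc
  rw [sub_eq_zero.1 hST, bil_swap] at hT
  rw [← fderiv_bil hb, ← bil_apply] at hS
  rw [← fderiv_bil hb] at hT
  rw [← bil_apply]
  have h1 := fderiv_bil_swap hb (T y) (S y) v
  linarith

/-- Cartan's formula `L_S μ = d i(S)μ + i(S) dμ` at one point, with `dμ = 0` and `L_S μ = 2μ`. -/
theorem interior_algebra {b : E → E [⋀^Fin 2]→L[ℝ] ℝ} {a : E → E [⋀^Fin 1]→L[ℝ] ℝ} {S : E → E}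
    {y u v : E} (hb : DifferentiableAt ℝ b y) (hSd : DifferentiableAt ℝ S y)
    (had : DifferentiableAt ℝ a y) (ha : (fun z ↦ lin E (a z)) =ᶠ[𝓝 y] fun z ↦ bil E (b z) (S z))
    (hc : extDeriv b y ![S y, u, v] = 0)
    (hS : fderiv ℝ b y (S y) ![u, v] + (bil E (b y) (fderiv ℝ S y u) v +
      bil E (b y) u (fderiv ℝ S y v)) = 2 * b y ![u, v]) :
    extDeriv a y ![u, v] = 2 * b y ![u, v] := by
  have hbd : DifferentiableAt ℝ (fun z ↦ bil E (b z)) y := by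
    have h1 : HasFDerivAt (fun z ↦ bil E (b z)) ((bil E).comp (fderiv ℝ b y)) y :=
      HasFDerivAt.comp (𝕜 := ℝ) (E := E) (F := E [⋀^Fin 2]→L[ℝ] ℝ) (G := E →L[ℝ] E →L[ℝ] ℝ)
        (g := fun b ↦ bil E b) y (hasFDerivAt_bil (b y)) hb.hasFDerivAt
    exact h1.differentiableAt
  have h1 : ∀ w w', fderiv ℝ (fun z ↦ lin E (a z)) y w w' =
      fderiv ℝ (fun z ↦ bil E (b z)) y w (S y) w' + bil E (b y) (fderiv ℝ S y w) w' := by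
    intro w w'
    rw [ha.fderiv_eq, (hbd.hasFDerivAt.clm_apply hSd.hasFDerivAt).fderiv]
    change bil E (b y) (fderiv ℝ S y w) w' + _ = _
    rw [add_comm]
    rfl
  rw [← bil_apply, bil_extDeriv had, h1, h1]
  rw [extDeriv_two hb] at hc
  rw [← fderiv_bil hb, ← bil_apply] at hS
  rw [← bil_apply]
  have h2 := bil_swap (b y) u (fderiv ℝ S y v)
  linarith

/-- The derivative of `μ(S, T)` for a conformal field `S` and a symplectic field `T` which
commute. -/
theorem mfderiv_pairing_eq (hμ : IsSmoothForm μ) (hc : extD μ = 0) (hS : IsSmoothField S)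
    (hT : IsSmoothField T) (hLS : ∀ x v, lieDeriv S μ x v = 2 * μ x v)
    (hLT : ∀ x v, lieDeriv T μ x v = 0) (hST : ∀ x, VectorField.mlieBracket I S T x = 0)
    (x : M) (v : TangentSpace I x) :
    (mfderiv I 𝓘(ℝ, ℝ) (fun y ↦ μ y ![S y, T y]) x v : ℝ) = 2 * μ x ![v, T x] := by
  have : CompleteSpace E := FiniteDimensional.complete ℝ E
  obtain ⟨b, hb⟩ : ∃ b, b = coordForm (extChartAt I x).symm μ := ⟨_, rfl⟩
  obtain ⟨Sc, hSc⟩ : ∃ b : E → E, b = coordField (extChartAt I x).symm S := ⟨_, rfl⟩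
  obtain ⟨Tc, hTc⟩ : ∃ b : E → E, b = coordField (extChartAt I x).symm T := ⟨_, rfl⟩
  obtain ⟨y, hy⟩ : ∃ y, y = extChartAt I x x := ⟨_, rfl⟩
  have hbs := (hμ.contDiffAt_coordForm
      (contMDiffAt_extChartAt_symm (mem_extChartAt_target (I := I) x)))
  rw [← hb, ← hy] at hbs
  have hbd := hbs.differentiableAt (by simp)
  have hbx : ∀ w : Fin 2 → E, μ x w = b y w := fun w ↦ by
    rw [hb, hy]; exact (coordForm_extChartAt_self μ x w).symm
  have hTx : (T x : E) = Tc y := by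
    rw [hTc, hy]; exact (coordField_extChartAt_self T x).symm
  have e5 : extDeriv b y ![v, Sc y, Tc y] = 0 := by
    have := extD_apply μ x ![v, Sc y, Tc y]
    rw [localForm_eq_coordForm, ← hb, ← hy, hc] at this
    exact this.symm
  refine (mfderiv_pairing hμ hS hT x hb hSc hTc hy v).trans
    ((pairing_algebra hbd e5 ?_ ?_ ?_).trans ?_)
  · exact (lieDeriv_two S μ x hb hSc hy v (Tc y)).symm.trans ((hLS x _).trans
      (congrArg (2 * ·) (hbx _)))
  · exact (lieDeriv_two T μ x hb hTc hy (Sc y) v).symm.trans (hLT x _)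
  · exact (mlieBracket_eq S T x hSc hTc hy).symm.trans (hST x)
  · exact congrArg (2 * ·) ((hbx _).symm.trans (congrArg (fun t : E ↦ μ x ![v, t]) hTx.symm))

theorem IsSmoothForm.interior (hμ : IsSmoothForm μ) (hS : IsSmoothField S) :
    IsSmoothForm (interior S μ) := by
  have : CompleteSpace E := FiniteDimensional.complete ℝ E
  refine isSmoothForm_of_contDiffAt fun x y hy ↦ contDiffAt_alternating_of_apply fun v ↦ ?_
  have hv : v = ![v 0] := by ext i; fin_cases i; rfl
  have h1 : (fun z ↦ coordForm (extChartAt I x).symm (SymplecticInduction.interior S μ) z v)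
      =ᶠ[𝓝 y] fun z ↦ bil E (coordForm (extChartAt I x).symm μ z)
        (coordField (F := E) (extChartAt I x).symm S z) (v 0) := by
    filter_upwards [(isOpen_extChartAt_target x).mem_nhds hy] with z hz
    rw [hv, ← lin_apply]
    exact lin_coordForm_interior _ S μ (isInvertible_mfderiv_extChartAt_symm hz) _
  refine ContDiffAt.congr_of_eventuallyEq ?_ h1
  exact ((contDiffAt_bil (hμ.contDiffAt_coordForm (contMDiffAt_extChartAt_symm hy))).clm_apply
    (contDiffAt_coordField (hS _) (contMDiffAt_extChartAt_symm hy)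
      (isInvertible_mfderiv_extChartAt_symm hy))).clm_apply contDiffAt_const

theorem IsSmoothForm.const_smul {k : ℕ} {η : DForm I M k} (hη : IsSmoothForm η) (c : ℝ) :
    IsSmoothForm (fun x ↦ c • η x) :=
  fun x ↦ (contDiffOn_const (c := c)).smul (hη x)

theorem extD_const_smul {k : ℕ} (η : DForm I M k) (c : ℝ) :
    extD (fun x ↦ c • η x) = fun x ↦ c • extD η x := by
  funext x
  ext v
  rw [extD_apply]
  have h1 : localForm (fun x ↦ c • η x) x = c • localForm η x := rfl
  rw [h1, extDeriv_smul]
  refine (congrArg (c * ·) (extD_apply η x v).symm).trans rfl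

/-- The exterior derivative of `i(S)μ` for a conformal field `S`. -/
theorem extD_interior (hμ : IsSmoothForm μ) (hc : extD μ = 0) (hS : IsSmoothField S)
    (hLS : ∀ x v, lieDeriv S μ x v = 2 * μ x v) :
    extD (fun x ↦ (1 / 2 : ℝ) • SymplecticInduction.interior S μ x) = μ := by
  have : CompleteSpace E := FiniteDimensional.complete ℝ E
  rw [extD_const_smul]
  funext x
  obtain ⟨b, hb⟩ : ∃ b, b = coordForm (extChartAt I x).symm μ := ⟨_, rfl⟩
  obtain ⟨a, ha⟩ : ∃ b, b = coordForm (extChartAt I x).symm (SymplecticInduction.interior S μ) :=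
    ⟨_, rfl⟩
  obtain ⟨Sc, hSc⟩ : ∃ b : E → E, b = coordField (extChartAt I x).symm S := ⟨_, rfl⟩
  obtain ⟨y, hy⟩ : ∃ y, y = extChartAt I x x := ⟨_, rfl⟩
  have hbs := (hμ.contDiffAt_coordForm
      (contMDiffAt_extChartAt_symm (mem_extChartAt_target (I := I) x)))
  have has := ((hμ.interior hS).contDiffAt_coordForm
      (contMDiffAt_extChartAt_symm (mem_extChartAt_target (I := I) x)))
  have hSs := contDiffAt_coordField_extChartAt hS (mem_extChartAt_target x)
  have hae : (fun z ↦ lin E (a z)) =ᶠ[𝓝 y] fun z ↦ bil E (b z) (Sc z) := by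
    rw [ha, hy, hb, hSc]
    filter_upwards [eventually_mem_extChartAt_target I x] with z hz
    ext v
    exact lin_coordForm_interior _ S μ (isInvertible_mfderiv_extChartAt_symm hz) _
  rw [← hb, ← hy] at hbs
  rw [← ha, ← hy] at has
  rw [← hSc, ← hy] at hSs
  have hbx : ∀ w : Fin 2 → E, μ x w = b y w := fun w ↦ by
    rw [hb, hy]; exact (coordForm_extChartAt_self μ x w).symm
  have key : ∀ u v : E, extDeriv a y ![u, v] = 2 * b y ![u, v] := by
    intro u v
    refine interior_algebra (hbs.differentiableAt (by simp)) (hSs.differentiableAt (by simp))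
      (has.differentiableAt (by simp)) hae ?_ ?_
    · have := extD_apply μ x ![Sc y, u, v]
      rw [localForm_eq_coordForm, ← hb, ← hy, hc] at this
      exact this.symm
    · exact (lieDeriv_two S μ x hb hSc hy u v).symm.trans ((hLS x _).trans
        (congrArg (2 * ·) (hbx _)))
  have key2 : extDeriv a y = (2 : ℝ) • b y := by
    ext w
    have hw : w = ![w 0, w 1] := by ext i; fin_cases i <;> rfl
    rw [hw]
    exact key _ _
  ext w
  have h3 := extD_apply (SymplecticInduction.interior S μ) x w
  rw [localForm_eq_coordForm, ← ha, ← hy, key2] at h3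
  refine (congrArg ((1 / 2 : ℝ) * ·) h3).trans ?_
  refine Eq.trans ?_ (hbx w).symm
  change (1 / 2 : ℝ) * (2 * b y w) = _
  ring

end ConformalField

/-! ### Straightening a function with nonzero differential -/

section SliceCharts

variable {E : Type*} [NormedAddCommGroup E] [NormedSpace ℝ E] [FiniteDimensional ℝ E]
  {V : Type*} [NormedAddCommGroup V] [NormedSpace ℝ V] [FiniteDimensional ℝ V]

/-- A vector `s` with `l s = 1` splits `E` as `ker l ⊕ ℝ s`, and `ker l` has the dimension of `V`.
-/
theorem exists_equiv_prod_of_ne_zero (hfin : Module.finrank ℝ E = Module.finrank ℝ V + 1)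
    {l : E →L[ℝ] ℝ} (hl : l ≠ 0) : ∃ T : E ≃L[ℝ] V × ℝ, ∀ v, (T v).2 = l v := by
  have hs : Function.Surjective (l : E →ₗ[ℝ] ℝ) :=
    LinearMap.surjective (fun h ↦ hl (by ext v; exact congrArg (fun f ↦ f v) h))
  obtain ⟨s, hs1⟩ := hs 1
  have hs1 : l s = 1 := hs1
  have h1 := LinearMap.finrank_range_add_finrank_ker (l : E →ₗ[ℝ] ℝ)
  rw [LinearMap.range_eq_top.2 hs, finrank_top, Module.finrank_self] at h1
  let iso := LinearEquiv.ofFinrankEq (R := ℝ) (LinearMap.ker (l : E →ₗ[ℝ] ℝ)) V (by omega)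
  let p : E →ₗ[ℝ] LinearMap.ker (l : E →ₗ[ℝ] ℝ) :=
    LinearMap.codRestrict _ (LinearMap.id - (l : E →ₗ[ℝ] ℝ).smulRight s) fun v ↦ by
      simp [hs1]
  let T₀ : E →ₗ[ℝ] V × ℝ := (iso.toLinearMap.comp p).prod l
  have hT₀ : ∀ v, T₀ v = (iso (p v), l v) := fun v ↦ rfl
  have hinj : Function.Injective T₀ := by
    rw [← LinearMap.ker_eq_bot, LinearMap.ker_eq_bot']
    intro v hv
    have h2 : l v = 0 := (congrArg Prod.snd (hT₀ v)).symm.trans (congrArg Prod.snd hv)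
    have h3 : iso (p v) = 0 := (congrArg Prod.fst (hT₀ v)).symm.trans (congrArg Prod.fst hv)
    have h4 : (p v : E) = 0 := by rw [iso.map_eq_zero_iff.1 h3]; rfl
    have h5 : (p v : E) = v - l v • s := rfl
    rw [h5, h2] at h4
    simpa using h4
  refine ⟨(LinearEquiv.ofInjectiveOfFinrankEq T₀ hinj (by simp [hfin])).toContinuousLinearEquiv,
    fun v ↦ congrArg Prod.snd (hT₀ v)⟩

/-- The second component of the linear equivalence is replaced by `g`. As `T` was chosen with second
component `dg` at `y₀`, the derivative there is still invertible and the inverse function theorem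
applies. -/
theorem exists_straightening (L : (V × ℝ) ≃L[ℝ] E) {g : E → ℝ} {O : Set E} (hO : IsOpen O)
    {y₀ : E} (hy₀ : y₀ ∈ O) (hg : ContDiffOn ℝ ∞ g O) (hg0 : fderiv ℝ g y₀ ≠ 0) :
    ∃ G : OpenPartialHomeomorph E E, y₀ ∈ G.source ∧ G ∈ contDiffGroupoid ∞ 𝓘(ℝ, E) ∧
      ∀ y ∈ G.source, (L.symm (G y)).2 = g y := by
  have : CompleteSpace E := FiniteDimensional.complete ℝ E
  obtain ⟨T, hT⟩ := exists_equiv_prod_of_ne_zero (V := V)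
    (by rw [← L.toLinearEquiv.finrank_eq]; simp) hg0
  let f : E → E := fun y ↦ L ((T y).1, g y)
  have hga : ∀ y ∈ O, ContDiffAt ℝ ∞ g y := fun y hy ↦ hg.contDiffAt (hO.mem_nhds hy)
  have hf : ∀ y ∈ O, ContDiffAt ℝ ∞ f y := fun y hy ↦
    L.contDiff.contDiffAt.comp y ((T.contDiff.fst.contDiffAt).prodMk (hga y hy))
  have hf' : HasFDerivAt f ((T.trans L : E ≃L[ℝ] E) : E →L[ℝ] E) y₀ := by
    have h1 := L.toContinuousLinearMap.hasFDerivAt.comp y₀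
      (((ContinuousLinearMap.fst ℝ V ℝ).comp T.toContinuousLinearMap).hasFDerivAt.prodMk
        ((hga y₀ hy₀).differentiableAt (by simp)).hasFDerivAt)
    refine h1.congr_fderiv ?_
    ext v
    simp [← hT]
  let G₀ := (hf y₀ hy₀).toOpenPartialHomeomorph f hf' (by simp)
  -- Restriction to the points where the derivative of `f` is invertible makes the inverse smooth on
  -- the whole target, as membership in the groupoid requires.
  let D : Set E := O ∩ fderiv ℝ f ⁻¹' Set.range ((↑) : (E ≃L[ℝ] E) → E →L[ℝ] E)
  have hD : IsOpen D := by
    refine ContinuousOn.isOpen_inter_preimage (fun y hy ↦ ?_) hO ContinuousLinearEquiv.isOpen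
    exact (((hf y hy).fderiv_right (m := 0) (by simp)).continuousAt).continuousWithinAt
  have hG : ∀ y ∈ (G₀.restrOpen D hD).source, y ∈ G₀.source ∧ y ∈ D := by
    intro y hy
    simpa using hy
  refine ⟨G₀.restrOpen D hD, ?_, ?_, ?_⟩
  · rw [OpenPartialHomeomorph.restrOpen_source]
    exact ⟨(hf y₀ hy₀).mem_toOpenPartialHomeomorph_source hf' (by simp), hy₀, _, hf'.fderiv.symm⟩
  · rw [contDiffGroupoid, mem_groupoid_of_pregroupoid]
    constructor
    · simp only [contDiffPregroupoid, modelWithCornersSelf_coe, modelWithCornersSelf_coe_symm,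
        Set.range_id, Set.inter_univ]
      exact fun y hy ↦ (hf y (hG y hy).2.1).contDiffWithinAt
    · simp only [contDiffPregroupoid, modelWithCornersSelf_coe, modelWithCornersSelf_coe_symm,
        Set.range_id, Set.inter_univ]
      intro z hz
      have h1 := (G₀.restrOpen D hD).map_target hz
      obtain ⟨h2, h3, A, hA⟩ := hG _ h1
      refine ((G₀.restrOpen D hD).contDiffAt_symm hz (f₀' := A) ?_ (hf _ h3)).contDiffWithinAt
      rw [hA]
      exact ((hf _ h3).differentiableAt (by simp)).hasFDerivAt
  · intro y hy
    change (L.symm (L ((T y).1, g y))).2 = g y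
    simp

end SliceCharts

/-! ### Regular level sets as embedded hypersurfaces -/

section LevelSet

variable {E : Type} [NormedAddCommGroup E] [NormedSpace ℝ E] [FiniteDimensional ℝ E]
  {V : Type*} [NormedAddCommGroup V] [NormedSpace ℝ V] [FiniteDimensional ℝ V]
  {P : Type*} [TopologicalSpace P] [ChartedSpace E P]

theorem trans_mem_maximalAtlas {H : Type*} [TopologicalSpace H] {M : Type*} [TopologicalSpace M]
    [ChartedSpace H M] {G : StructureGroupoid H} {e : OpenPartialHomeomorph M H}
    (he : e ∈ G.maximalAtlas M) {g : OpenPartialHomeomorph H H} (hg : g ∈ G) :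
    e ≫ₕ g ∈ G.maximalAtlas M := by
  rw [mem_maximalAtlas_iff] at he ⊢
  intro e' he'
  have h1 := G.trans (G.symm hg) (he e' he').1
  have h2 := G.trans (he e' he').2 hg
  rw [← OpenPartialHomeomorph.trans_assoc] at h1
  rw [OpenPartialHomeomorph.trans_assoc] at h2
  rw [OpenPartialHomeomorph.trans_symm_eq_symm_trans_symm]
  exact ⟨h1, h2⟩

/-- A chart of `P` in which the level set `g = 1` is a linear hyperplane. -/
structure IsSliceChart (L : (V × ℝ) ≃L[ℝ] E) (g : P → ℝ) (e : OpenPartialHomeomorph P E) :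
    Prop where
  mem_atlas : e ∈ IsManifold.maximalAtlas 𝓘(ℝ, E) ∞ P
  snd_eq : ∀ x ∈ e.source, (L.symm (e x)).2 = g x - 1

variable [IsManifold 𝓘(ℝ, E) ∞ P]

theorem exists_sliceChart (L : (V × ℝ) ≃L[ℝ] E) {g : P → ℝ} (hg : ContMDiff 𝓘(ℝ, E) 𝓘(ℝ, ℝ) ∞ g)
    {x : P} (hx : mfderiv 𝓘(ℝ, E) 𝓘(ℝ, ℝ) g x ≠ 0) :
    ∃ e, IsSliceChart L g e ∧ x ∈ e.source := by
  have h1 : ContDiffOn ℝ ∞ (fun y ↦ g ((chartAt E x).symm y) - 1) (chartAt E x).target := by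
    have h := (contMDiffOn_chart_symm (I := 𝓘(ℝ, E)) (n := ∞) (x := x))
    exact (contMDiffOn_iff_contDiffOn.1 (hg.comp_contMDiffOn h)).sub contDiffOn_const
  have h2 : fderiv ℝ (fun y ↦ g ((chartAt E x).symm y) - 1) (chartAt E x x) ≠ 0 := by
    rw [fderiv_sub_const]
    intro h
    apply hx
    rw [(hg.mdifferentiableAt (by simp)).mfderiv]
    rw [modelWithCornersSelf_coe, Set.range_id, fderivWithin_univ]
    exact h
  obtain ⟨G, hG1, hG2, hG3⟩ := exists_straightening L (chartAt E x).open_target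
    (mem_chart_target E x) h1 h2
  refine ⟨chartAt E x ≫ₕ G, ⟨trans_mem_maximalAtlas (IsManifold.chart_mem_maximalAtlas x) hG2,
    fun y hy ↦ ?_⟩, ?_⟩
  · simp only [OpenPartialHomeomorph.trans_source, Set.mem_inter_iff, Set.mem_preimage] at hy
    have := hG3 _ hy.2
    simpa [(chartAt E x).left_inv hy.1] using this
  · simpa using hG1

/-- The chart of the level set `g = 1` given by a slice chart. -/
def sliceChart (L : (V × ℝ) ≃L[ℝ] E) (g : P → ℝ) (e : OpenPartialHomeomorph P E)
    (he : IsSliceChart L g e) (x₀ : {x | g x = 1}) : OpenPartialHomeomorph {x | g x = 1} V where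
  toFun x := (L.symm (e x)).1
  -- The point `x₀` is only a default value off the target.
  invFun u := open Classical in if h : L (u, 0) ∈ e.target then ⟨e.symm (L (u, 0)), by
    have := he.snd_eq _ (e.map_target h)
    rw [e.right_inv h] at this
    simp only [ContinuousLinearEquiv.symm_apply_apply] at this
    exact (sub_eq_zero.1 this.symm)⟩ else x₀
  source := {x | (x : P) ∈ e.source}
  target := {u | L (u, 0) ∈ e.target}
  map_source' x hx := by
    have h1 : (L.symm (e x)).2 = 0 := by
      rw [he.snd_eq _ hx, sub_eq_zero]
      exact x.2
    have h2 : ((L.symm (e x)).1, (0 : ℝ)) = L.symm (e x) := by rw [← h1]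
    change L _ ∈ e.target
    rw [h2, L.apply_symm_apply]
    exact e.map_source hx
  map_target' u hu := by
    have hu : L (u, 0) ∈ e.target := hu
    simp only [hu, dif_pos]
    exact e.map_target hu
  left_inv' x hx := by
    have h1 : (L.symm (e x)).2 = 0 := by
      rw [he.snd_eq _ hx, sub_eq_zero]
      exact x.2
    have h2 : L ((L.symm (e x)).1, (0 : ℝ)) = e x := by
      rw [← L.apply_symm_apply (e x), ← h1]
      simp
    apply Subtype.ext
    simp only [h2, e.map_source hx, dif_pos, e.left_inv hx]
  right_inv' u hu := by
    have hu : L (u, 0) ∈ e.target := hu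
    simp only [hu, dif_pos, e.right_inv hu, L.symm_apply_apply]
  open_source := e.open_source.preimage continuous_subtype_val
  open_target := e.open_target.preimage (by fun_prop)
  continuousOn_toFun := by
    have h1 : ContinuousOn (fun x : {x | g x = 1} ↦ e x) {x | (x : P) ∈ e.source} :=
      e.continuousOn.comp continuous_subtype_val.continuousOn fun x hx ↦ hx
    exact (continuous_fst.comp L.symm.continuous).comp_continuousOn h1
  continuousOn_invFun := by
    rw [Topology.IsInducing.subtypeVal.continuousOn_iff]
    have h1 : ContinuousOn (fun u : V ↦ e.symm (L (u, 0))) {u | L (u, 0) ∈ e.target} :=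
      e.symm.continuousOn.comp (by fun_prop) fun x hx ↦ hx
    refine h1.congr fun u hu ↦ ?_
    have hu : L (u, 0) ∈ e.target := hu
    simp only [Function.comp_apply, hu, dif_pos]

variable {L : (V × ℝ) ≃L[ℝ] E} {g : P → ℝ} {e : OpenPartialHomeomorph P E}

theorem sliceChart_symm_apply (he : IsSliceChart L g e) (x₀ : {x | g x = 1}) {u : V}
    (hu : u ∈ (sliceChart L g e he x₀).target) :
    ((sliceChart L g e he x₀).symm u : P) = e.symm (L (u, 0)) := by
  have hu : L (u, 0) ∈ e.target := hu
  change (((sliceChart L g e he x₀).invFun u : {x | g x = 1}) : P) = _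
  simp only [sliceChart, hu, dif_pos]

theorem apply_sliceChart_symm (he : IsSliceChart L g e) (x₀ : {x | g x = 1}) {u : V}
    (hu : u ∈ (sliceChart L g e he x₀).target) :
    e ((sliceChart L g e he x₀).symm u) = L (u, 0) := by
  rw [sliceChart_symm_apply he x₀ hu]
  exact e.right_inv hu

/-- A regular level set is an embedded hypersurface. -/
theorem exists_chartedSpace_levelSet (L : (V × ℝ) ≃L[ℝ] E) {g : P → ℝ}
    (hg : ContMDiff 𝓘(ℝ, E) 𝓘(ℝ, ℝ) ∞ g)
    (hreg : ∀ x, g x = 1 → mfderiv 𝓘(ℝ, E) 𝓘(ℝ, ℝ) g x ≠ 0) :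
    ∃ _ : ChartedSpace V {x | g x = 1}, IsManifold 𝓘(ℝ, V) ∞ {x | g x = 1} ∧
      Manifold.IsSmoothEmbedding 𝓘(ℝ, V) 𝓘(ℝ, E) ∞ (Subtype.val : {x | g x = 1} → P) := by
  choose e he hxe using fun x : {x | g x = 1} ↦ exists_sliceChart L hg (hreg x x.2)
  let cs : ChartedSpace V {x | g x = 1} :=
    { atlas := Set.range fun x ↦ sliceChart L g (e x) (he x) x
      chartAt := fun x ↦ sliceChart L g (e x) (he x) x
      mem_chart_source := fun x ↦ hxe x
      chart_mem_atlas := fun x ↦ ⟨x, rfl⟩ }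
  have hm : IsManifold 𝓘(ℝ, V) ∞ {x | g x = 1} := by
    apply isManifold_of_contDiffOn
    rintro _ _ ⟨x, rfl⟩ ⟨y, rfl⟩
    simp only [modelWithCornersSelf_coe, modelWithCornersSelf_coe_symm, Set.range_id,
      Set.inter_univ, Function.comp_id, Function.id_comp, Set.preimage_id]
    have h1 := StructureGroupoid.compatible_of_mem_maximalAtlas (he x).mem_atlas (he y).mem_atlas
    have h2 := contMDiffOn_iff_contDiffOn.1 (contMDiffOn_of_mem_contDiffGroupoid h1)
    -- A transition map of the level set is the ambient one restricted to the hyperplane `V × 0` and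
    -- projected to `V`.
    have h3 : ContDiffOn ℝ ∞ (fun u : V ↦ (L.symm (((e x).symm ≫ₕ e y) (L (u, 0)))).1)
        {u | L (u, 0) ∈ ((e x).symm ≫ₕ e y).source} := by
      refine (contDiff_fst.comp L.symm.contDiff).comp_contDiffOn ?_
      exact h2.comp (L.contDiff.comp (contDiff_id.prodMk contDiff_const)).contDiffOn fun u hu ↦ hu
    refine (h3.mono ?_).congr ?_
    · intro u hu
      rw [OpenPartialHomeomorph.trans_source] at hu
      rw [Set.mem_ofPred_eq, OpenPartialHomeomorph.trans_source]
      refine ⟨hu.1, ?_⟩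
      have h4 := hu.2
      have h5 := sliceChart_symm_apply (he x) x hu.1
      change ((sliceChart L g (e x) (he x) x).symm u : P) ∈ (e y).source at h4
      rw [h5] at h4
      exact h4
    · intro u hu
      rw [OpenPartialHomeomorph.trans_source] at hu
      change (L.symm (e y ((sliceChart L g (e x) (he x) x).symm u : P))).1 = _
      rw [sliceChart_symm_apply (he x) x hu.1]
      rfl
  refine ⟨cs, hm, ⟨?_, Topology.IsEmbedding.subtypeVal⟩⟩
  refine ⟨ℝ, inferInstance, inferInstance, fun x ↦ ?_⟩
  -- In the slice charts the inclusion reads `u ↦ L (u, 0)`, the normal form of an immersion.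
  refine Manifold.IsImmersionAtOfComplement.mk_of_charts L (sliceChart L g (e x) (he x) x) (e x)
    (hxe x) (hxe x) (IsManifold.chart_mem_maximalAtlas (I := 𝓘(ℝ, V)) x) (he x).mem_atlas
    (fun y hy ↦ hy) fun u hu ↦ ?_
  have hu : u ∈ (sliceChart L g (e x) (he x) x).target := by simpa using hu
  exact apply_sliceChart_symm (he x) x hu

end LevelSet

/-! ### The manifold as a cone over the level set -/

section Cone

variable {E : Type*} [NormedAddCommGroup E] [NormedSpace ℝ E] [FiniteDimensional ℝ E]
  {H : Type*} [TopologicalSpace H] {I : ModelWithCorners ℝ E H} [I.Boundaryless]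
  {P : Type*} [TopologicalSpace P] [ChartedSpace H P] [IsManifold I ∞ P] [T2Space P]
  {V : Type*} [NormedAddCommGroup V] [NormedSpace ℝ V] [FiniteDimensional ℝ V]
  {H' : Type*} [TopologicalSpace H'] {J : ModelWithCorners ℝ V H'} [J.Boundaryless]
  {g : P → ℝ} [ChartedSpace H' {x | g x = 1}] [IsManifold J ∞ {x | g x = 1}]
  {S : VField I P}

theorem hasDerivAt_comp_flow (hS : IsCompleteField S) (hg : ContMDiff I 𝓘(ℝ, ℝ) ∞ g)
    (hgS : ∀ x, (mfderiv I 𝓘(ℝ, ℝ) g x (S x) : ℝ) = 2 * g x) (x : P) (s : ℝ) :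
    HasDerivAt (fun s ↦ g (flow hS x s)) (2 * g (flow hS x s)) s := by
  have h1 := isMIntegralCurve_flow hS x s
  have h2 := (hg.mdifferentiableAt (x := flow hS x s) (by simp)).hasMFDerivAt.comp s h1
  let A : ℝ →L[ℝ] ℝ := (mfderiv I 𝓘(ℝ, ℝ) g (flow hS x s)).comp
    (ContinuousLinearMap.smulRight (1 : ℝ →L[ℝ] ℝ) (S (flow hS x s)))
  have h3 : HasFDerivAt (fun s ↦ g (flow hS x s)) A s := hasMFDerivAt_iff_hasFDerivAt.1 h2
  have h4 : A 1 = 2 * g (flow hS x s) := by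
    refine Eq.trans ?_ (hgS _)
    change mfderiv I 𝓘(ℝ, ℝ) g (flow hS x s) ((1 : ℝ) • S (flow hS x s)) = _
    exact congrArg _ (one_smul ℝ (S (flow hS x s)))
  exact h3.hasDerivAt.congr_deriv h4

theorem eq_exp_mul_of_hasDerivAt {f : ℝ → ℝ} (hf : ∀ s, HasDerivAt f (2 * f s) s) (s : ℝ) :
    f s = Real.exp (2 * s) * f 0 := by
  have h1 : ∀ s, HasDerivAt (fun s ↦ Real.exp (-2 * s) * f s) 0 s := by
    intro s
    have h2 : HasDerivAt (fun s ↦ Real.exp (-2 * s)) (Real.exp (-2 * s) * (-2)) s := by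
      simpa using ((hasDerivAt_id s).const_mul (-2)).exp
    refine (h2.mul (hf s)).congr_deriv ?_
    ring
  have h2 := is_const_of_deriv_eq_zero (fun s ↦ (h1 s).differentiableAt) (fun s ↦ (h1 s).deriv) s 0
  simp only [mul_zero, Real.exp_zero, one_mul] at h2
  rw [← h2, ← mul_assoc, ← Real.exp_add]
  simp

theorem apply_flow (hS : IsCompleteField S) (hg : ContMDiff I 𝓘(ℝ, ℝ) ∞ g)
    (hgS : ∀ x, (mfderiv I 𝓘(ℝ, ℝ) g x (S x) : ℝ) = 2 * g x) (x : P) (s : ℝ) :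
    g (flow hS x s) = Real.exp (2 * s) * g x := by
  have := eq_exp_mul_of_hasDerivAt (hasDerivAt_comp_flow hS hg hgS x) s
  rwa [flow_zero] at this

/-- The retraction onto the level set along the flow of `S`. -/
def retraction (hS : IsCompleteField S) (hg : ContMDiff I 𝓘(ℝ, ℝ) ∞ g)
    (hgS : ∀ x, (mfderiv I 𝓘(ℝ, ℝ) g x (S x) : ℝ) = 2 * g x) (hpos : ∀ x, 0 < g x) (p : P) :
    {x | g x = 1} :=
  -- The flow for time `s` multiplies `g` by `exp (2 s)`, so this time brings `g p` to `1`.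
  ⟨flow hS p (-(1 / 2 * Real.log (g p))), by
    rw [Set.mem_ofPred_eq, apply_flow hS hg hgS, mul_neg, ← mul_assoc]
    norm_num
    rw [Real.exp_neg, Real.exp_log (hpos p), inv_mul_cancel₀ (hpos p).ne']⟩

/-- Smoothness into an embedded submanifold is tested after the inclusion, where the map is the flow
at a smooth time. -/
theorem contMDiff_retraction (hS : IsCompleteField S) (hs : IsSmoothField S)
    (hg : ContMDiff I 𝓘(ℝ, ℝ) ∞ g)
    (hgS : ∀ x, (mfderiv I 𝓘(ℝ, ℝ) g x (S x) : ℝ) = 2 * g x) (hpos : ∀ x, 0 < g x)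
    (hemb : Manifold.IsSmoothEmbedding J I ∞ (Subtype.val : {x | g x = 1} → P)) :
    ContMDiff I J ∞ (retraction hS hg hgS hpos) := by
  rw [ContMDiff.iff_comp_isImmersion hemb.isImmersion]
  have h1 : ContMDiff I I ∞ (fun p ↦ flow hS p (-(1 / 2 * Real.log (g p)))) := by
    have hlog : ContMDiff I 𝓘(ℝ, ℝ) ∞ fun p ↦ -(1 / 2 * Real.log (g p)) := by
      intro p
      have h2 : ContDiffAt ℝ ∞ (fun t : ℝ ↦ -(1 / 2 * Real.log t)) (g p) :=
        (contDiffAt_const.mul (Real.contDiffAt_log.2 (hpos p).ne')).neg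
      exact h2.contMDiffAt.comp p hg.contMDiffAt
    exact (contMDiff_flow hS hs).comp (contMDiff_id.prodMk hlog)
  exact ⟨hemb.isEmbedding.continuous_iff.2 h1.continuous, h1⟩

theorem retraction_val (hS : IsCompleteField S) (hg : ContMDiff I 𝓘(ℝ, ℝ) ∞ g)
    (hgS : ∀ x, (mfderiv I 𝓘(ℝ, ℝ) g x (S x) : ℝ) = 2 * g x) (hpos : ∀ x, 0 < g x)
    (x : {x | g x = 1}) : retraction hS hg hgS hpos x = x := by
  apply Subtype.ext
  have : g x = 1 := x.2
  simp [retraction, this, flow_zero]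

/-- The diffeomorphism given by the flow of `S`. -/
def coneDiffeo (hS : IsCompleteField S) (hs : IsSmoothField S)
    (hg : ContMDiff I 𝓘(ℝ, ℝ) ∞ g)
    (hgS : ∀ x, (mfderiv I 𝓘(ℝ, ℝ) g x (S x) : ℝ) = 2 * g x) (hpos : ∀ x, 0 < g x)
    (hemb : Manifold.IsSmoothEmbedding J I ∞ (Subtype.val : {x | g x = 1} → P)) :
    ({x | g x = 1} × ℝ) ≃ₘ^∞⟮J.prod 𝓘(ℝ, ℝ), I⟯ P where
  toFun p := flow hS (p.1 : P) p.2
  invFun p := (retraction hS hg hgS hpos p, 1 / 2 * Real.log (g p))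
  left_inv := by
    rintro ⟨x, s⟩
    have hx : g x = 1 := x.2
    have h1 : g (flow hS (x : P) s) = Real.exp (2 * s) := by rw [apply_flow hS hg hgS, hx, mul_one]
    have h2 : 1 / 2 * Real.log (g (flow hS (x : P) s)) = s := by rw [h1, Real.log_exp]; ring
    refine Prod.ext (Subtype.ext ?_) h2
    change flow hS (flow hS (x : P) s) (-(1 / 2 * Real.log (g (flow hS (x : P) s)))) = x
    rw [h2, ← flow_add hS hs, add_neg_cancel, flow_zero]
  right_inv p := by
    change flow hS (flow hS p (-(1 / 2 * Real.log (g p)))) (1 / 2 * Real.log (g p)) = p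
    rw [← flow_add hS hs, neg_add_cancel, flow_zero]
  contMDiff_toFun := (contMDiff_flow hS hs).comp
    ((hemb.isImmersion.contMDiff.comp contMDiff_fst).prodMk contMDiff_snd)
  contMDiff_invFun := by
    refine (contMDiff_retraction hS hs hg hgS hpos hemb).prodMk ?_
    intro p
    have h2 : ContDiffAt ℝ ∞ (fun t : ℝ ↦ 1 / 2 * Real.log t) (g p) :=
      contDiffAt_const.mul (Real.contDiffAt_log.2 (hpos p).ne')
    exact h2.contMDiffAt.comp p hg.contMDiffAt

end Cone

/-! ### Homogeneity in the coordinates of the cone -/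

section ConeCoordinates

variable {E : Type*} [NormedAddCommGroup E] [NormedSpace ℝ E] [FiniteDimensional ℝ E]
  {H : Type*} [TopologicalSpace H] {I : ModelWithCorners ℝ E H} [I.Boundaryless]
  {P : Type*} [TopologicalSpace P] [ChartedSpace H P] [IsManifold I ∞ P]
  {V : Type*} [NormedAddCommGroup V] [NormedSpace ℝ V] [FiniteDimensional ℝ V]
  {H' : Type*} [TopologicalSpace H'] {J : ModelWithCorners ℝ V H'} [J.Boundaryless]
  {N : Type*} [TopologicalSpace N] [ChartedSpace H' N] [IsManifold J ∞ N]
  {S : VField I P}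

variable (J) in
/-- The parametrisation of `P` given by the diffeomorphism `Φ : N × ℝ → P` and the preferred chart
of `N` at `j`. -/
def coneParam (Φ : N × ℝ → P) (j : N) : V × ℝ → P :=
  fun w ↦ Φ ((extChartAt J j).symm w.1, w.2)

variable (J) in
/-- The domain of the parametrisation `coneParam`. -/
def coneDomain (j : N) : Set (V × ℝ) := {w | w.1 ∈ (extChartAt J j).target}

theorem isOpen_coneDomain (j : N) : IsOpen (coneDomain J j) :=
  (isOpen_extChartAt_target j).preimage continuous_fst

theorem contMDiffAt_prodChart {j : N} {w : V × ℝ} (hw : w ∈ coneDomain J j) :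
    ContMDiffAt 𝓘(ℝ, V × ℝ) (J.prod 𝓘(ℝ, ℝ)) ∞
      (fun w : V × ℝ ↦ ((extChartAt J j).symm w.1, w.2)) w := by
  have h1 : ContMDiffAt 𝓘(ℝ, V × ℝ) J ∞ (fun w : V × ℝ ↦ (extChartAt J j).symm w.1) w :=
    (contMDiffAt_extChartAt_symm hw).comp w contDiff_fst.contDiffAt.contMDiffAt
  exact h1.prodMk contDiff_snd.contDiffAt.contMDiffAt

variable (Φ : (N × ℝ) ≃ₘ^∞⟮J.prod 𝓘(ℝ, ℝ), I⟯ P)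

theorem contMDiffAt_coneParam {j : N} {w : V × ℝ} (hw : w ∈ coneDomain J j) :
    ContMDiffAt 𝓘(ℝ, V × ℝ) I ∞ (coneParam J Φ j) w :=
  Φ.contMDiff.contMDiffAt.comp w (contMDiffAt_prodChart hw)

/-- The inverse of `coneParam`. -/
def coneChart (j : N) (p : P) : V × ℝ := (extChartAt J j (Φ.symm p).1, (Φ.symm p).2)

theorem coneParam_coneChart {j : N} {p : P} (hp : (Φ.symm p).1 ∈ (extChartAt J j).source) :
    coneParam J Φ j (coneChart Φ j p) = p := by
  simp only [coneParam, coneChart, (extChartAt J j).left_inv hp, Prod.mk.eta,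
    Diffeomorph.apply_symm_apply]

theorem coneChart_coneParam {j : N} {w : V × ℝ} (hw : w ∈ coneDomain J j) :
    coneChart Φ j (coneParam J Φ j w) = w := by
  simp only [coneParam, coneChart, Diffeomorph.symm_apply_apply]
  exact Prod.ext ((extChartAt J j).right_inv hw) rfl

theorem coneChart_mem {j : N} {p : P} (hp : (Φ.symm p).1 ∈ (extChartAt J j).source) :
    coneChart Φ j p ∈ coneDomain J j :=
  (extChartAt J j).map_source hp

theorem symm_coneParam_mem {j : N} {w : V × ℝ} (hw : w ∈ coneDomain J j) :
    (Φ.symm (coneParam J Φ j w)).1 ∈ (extChartAt J j).source := by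
  simp only [coneParam, Diffeomorph.symm_apply_apply]
  exact (extChartAt J j).map_target hw

theorem contMDiffAt_coneChart {j : N} {p : P} (hp : (Φ.symm p).1 ∈ (extChartAt J j).source) :
    ContMDiffAt I 𝓘(ℝ, V × ℝ) ∞ (coneChart Φ j) p := by
  have h0 := Φ.symm.contMDiff.contMDiffAt (x := p)
  have h1 : ContMDiffAt I 𝓘(ℝ, V) ∞ (fun p ↦ extChartAt J j (Φ.symm p).1) p :=
    (contMDiffAt_extChartAt_of_mem_source hp).comp p (contMDiffAt_fst.comp p h0)
  have h2 : ContMDiffAt I 𝓘(ℝ, ℝ) ∞ (fun p ↦ (Φ.symm p).2) p := contMDiffAt_snd.comp p h0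
  exact h1.prodMk_space h2

theorem isInvertible_mfderiv_coneParam {j : N} {w : V × ℝ} (hw : w ∈ coneDomain J j) :
    (mfderiv 𝓘(ℝ, V × ℝ) I (coneParam J Φ j) w).IsInvertible := by
  have h1 := (contMDiffAt_coneParam Φ hw).mdifferentiableAt (by simp)
  have h2 := (contMDiffAt_coneChart Φ (symm_coneParam_mem Φ hw)).mdifferentiableAt (by simp)
  have hev : coneChart Φ j ∘ coneParam J Φ j =ᶠ[𝓝 w] id := by
    filter_upwards [(isOpen_coneDomain (J := J) j).mem_nhds hw] with z hz
    exact coneChart_coneParam Φ hz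
  have e1 := mfderiv_comp w h2 h1
  rw [hev.mfderiv_eq, mfderiv_id] at e1
  have hsrc : ∀ᶠ p in 𝓝 (coneParam J Φ j w), (Φ.symm p).1 ∈ (extChartAt J j).source := by
    refine ContinuousAt.eventually_mem ?_
      ((isOpen_extChartAt_source j).mem_nhds (symm_coneParam_mem Φ hw))
    exact (continuous_fst.comp Φ.symm.continuous).continuousAt
  have hev' : coneParam J Φ j ∘ coneChart Φ j =ᶠ[𝓝 (coneParam J Φ j w)] id := by
    filter_upwards [hsrc] with z hz
    exact coneParam_coneChart Φ hz
  have h1' : MDifferentiableAt 𝓘(ℝ, V × ℝ) I (coneParam J Φ j)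
      (coneChart Φ j (coneParam J Φ j w)) := by rwa [coneChart_coneParam Φ hw]
  have e2 := mfderiv_comp (coneParam J Φ j w) h1' h2
  rw [hev'.mfderiv_eq, mfderiv_id] at e2
  rw [coneChart_coneParam Φ hw] at e2
  exact ContinuousLinearMap.IsInvertible.of_inverse e2.symm e1.symm

/-- If `Φ` follows the flow of `S`, then `S` is the coordinate field of the second factor. -/
theorem coordField_coneParam (hΦ : ∀ x, IsMIntegralCurve (fun s ↦ Φ (x, s)) S) {j : N}
    {w : V × ℝ} (hw : w ∈ coneDomain J j) : coordField (coneParam J Φ j) S w = (0, 1) := by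
  refine (coordField_eq_iff (F := V × ℝ) S (isInvertible_mfderiv_coneParam Φ hw)).2 ?_
  have h1 := (contMDiffAt_coneParam Φ hw).mdifferentiableAt (by simp)
  have h2 : HasFDerivAt (fun s : ℝ ↦ (w.1, s)) (ContinuousLinearMap.inr ℝ V ℝ) w.2 :=
    hasFDerivAt_prodMk_right w.1 w.2
  have h3 := HasMFDerivAt.comp (f := fun s : ℝ ↦ (w.1, s)) w.2 h1.hasMFDerivAt h2.hasMFDerivAt
  have h4 := hasMFDerivAt_unique (hΦ ((extChartAt J j).symm w.1) w.2) h3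
  have h5 := congrFun (congrArg DFunLike.coe h4) (1 : ℝ)
  have h6 : (1 : ℝ) • S (coneParam J Φ j w) = S (coneParam J Φ j w) := one_smul _ _
  exact h6.symm.trans h5

/-- The pullback of the primitive `½ i(S)μ` of `μ` is homogeneous of degree `2`. -/
theorem coordForm_coneParam_primitive {μ : DForm I P 2} (hμ : IsSmoothForm μ)
    (hs : IsSmoothField S)
    (hd : extD (fun x ↦ (1 / 2 : ℝ) • interior S μ x) = μ)
    (hΦ : ∀ x, IsMIntegralCurve (fun s ↦ Φ (x, s)) S) {ι : N → P} (hι : ContMDiff J I ∞ ι)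
    (hΦ0 : ∀ x, Φ (x, 0) = ι x) {j : N} {w : V × ℝ} (hw : w ∈ coneDomain J j) (u : V × ℝ) :
    lin _ (coordForm (coneParam J Φ j) (fun x ↦ (1 / 2 : ℝ) • interior S μ x) w) u =
      Real.exp (2 * w.2) * lin _ (coordForm (extChartAt J j).symm
        (pullback (I := J) ι (fun x ↦ (1 / 2 : ℝ) • interior S μ x)) w.1) u.1 := by
  set l : DForm I P 1 := fun x ↦ (1 / 2 : ℝ) • interior S μ x
  have hl : IsSmoothForm l := (hμ.interior hs).const_smul _
  set b := coordForm (coneParam J Φ j) l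
  -- In these coordinates `S` is the constant vector `(0, 1)`; in particular the primitive vanishes
  -- on it.
  have hlin : ∀ z ∈ coneDomain J j, ∀ v, lin _ (b z) v =
      1 / 2 * bil _ (coordForm (coneParam J Φ j) μ z) (0, 1) v := by
    intro z hz v
    have h1 := lin_coordForm_interior (coneParam J Φ j) S μ
      (isInvertible_mfderiv_coneParam Φ hz) v
    rw [coordField_coneParam Φ hΦ hz] at h1
    rw [← h1]
    rfl
  have hb : ∀ z ∈ coneDomain J j, ContDiffAt ℝ ∞ b z := fun z hz ↦
    hl.contDiffAt_coordForm (contMDiffAt_coneParam Φ hz)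
  -- Contracting `dλ = μ` with `∂_s` gives `∂_s (λ(v)) - ∂_v (λ(∂_s)) = μ(∂_s, v) = 2 λ(v)`, and
  -- `λ(∂_s)` vanishes identically. This is a linear equation along the lines `s ↦ (w.1, s)`.
  have hdb : ∀ z ∈ coneDomain J j, ∀ v, fderiv ℝ (fun z ↦ lin _ (b z)) z (0, 1) v =
      2 * lin _ (b z) v := by
    intro z hz v
    have h1 := hl.coordForm_extD (contMDiffAt_coneParam Φ hz)
    rw [hd] at h1
    rw [hlin z hz, h1, bil_extDeriv ((hb z hz).differentiableAt (by simp))]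
    have h2 : (fun z ↦ lin _ (b z) (0, 1)) =ᶠ[𝓝 z] fun _ ↦ 0 := by
      filter_upwards [(isOpen_coneDomain (J := J) j).mem_nhds hz] with z' hz'
      rw [hlin z' hz', bil_self, mul_zero]
    have h3 : fderiv ℝ (fun z ↦ lin _ (b z)) z v (0, 1) = 0 := by
      have h4 := ((contDiffAt_lin (hb z hz)).differentiableAt (by simp)).hasFDerivAt.clm_apply
        (hasFDerivAt_const ((0, 1) : V × ℝ) z)
      have h5 := h4.unique (((hasFDerivAt_const (0 : ℝ) z)).congr_of_eventuallyEq h2)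
      have h6 := congrFun (congrArg DFunLike.coe h5) v
      simpa using h6
    rw [h3]
    ring
  have hline : ∀ s, HasDerivAt (fun s : ℝ ↦ lin _ (b (w.1, s)) u) (2 * lin _ (b (w.1, s)) u) s := by
    intro s
    have hz : (w.1, s) ∈ coneDomain J j := hw
    rw [← hdb _ hz]
    have h4 := ((contDiffAt_lin (hb _ hz)).differentiableAt (by simp)).hasFDerivAt.clm_apply
        (hasFDerivAt_const u (w.1, s))
    have h5 := h4.comp_hasDerivAt s ((hasDerivAt_const s w.1).prodMk (hasDerivAt_id s))
    refine h5.congr_deriv ?_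
    simp
  have h7 := eq_exp_mul_of_hasDerivAt hline w.2
  change lin _ (b w) u = _ at h7
  rw [h7]
  congr 1
  have hw0 : (w.1, (0 : ℝ)) ∈ coneDomain J j := hw
  -- On the slice `s = 0` the component of `u` along `∂_s` is killed, and what remains is the
  -- restriction to the level set.
  have h8 : lin _ (b (w.1, 0)) u = lin _ (b (w.1, 0)) (u.1, 0) := by
    have h9 : u = (u.1, 0) + u.2 • (0, 1) := by ext <;> simp
    rw [h9, map_add, map_smul, hlin _ hw0 (0, 1), bil_self]
    simp
  rw [h8, ← coordForm_comp l (hι.mdifferentiableAt (by simp))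
    (mdifferentiableAt_extChartAt_symm (I := J) hw)]
  have h10 : ι ∘ (extChartAt J j).symm = coneParam J Φ j ∘ fun v ↦ (v, 0) := by
    funext v
    exact (hΦ0 _).symm
  rw [h10, coordForm_comp_right (f := fun v : V ↦ (v, (0 : ℝ))) (x := w.1) l ((contMDiffAt_coneParam Φ hw0).mdifferentiableAt (by simp))
    (by fun_prop), lin_apply, lin_apply]
  change b (w.1, 0) _ = b (w.1, 0) _
  refine congrArg (b (w.1, 0)) (funext fun i ↦ ?_)
  fin_cases i
  have : fderiv ℝ (fun v : V ↦ (v, (0 : ℝ))) w.1 = ContinuousLinearMap.inl ℝ V ℝ :=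
    (hasFDerivAt_prodMk_left w.1 (0 : ℝ)).fderiv
  change _ = fderiv ℝ (fun v : V ↦ (v, (0 : ℝ))) w.1 u.1
  rw [this]
  rfl

variable (J) in
theorem extChartAt_prod_symm (j : N) (s : ℝ) :
    ((extChartAt (J.prod 𝓘(ℝ, ℝ)) (j, s)).symm : V × ℝ → N × ℝ) =
      fun w ↦ ((extChartAt J j).symm w.1, w.2) := by
  rw [extChartAt_prod]
  rfl

/-- Both sides are exterior derivatives, so it suffices to compare the primitives, which
`coordForm_coneParam_primitive` does in coordinates. -/
theorem pullback_coneDiffeo {μ : DForm I P 2} (hμ : IsSmoothForm μ)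
    (hs : IsSmoothField S)
    (hd : extD (fun x ↦ (1 / 2 : ℝ) • interior S μ x) = μ)
    (hΦ : ∀ x, IsMIntegralCurve (fun s ↦ Φ (x, s)) S) {ι : N → P} (hι : ContMDiff J I ∞ ι)
    (hΦ0 : ∀ x, Φ (x, 0) = ι x) :
    pullback (I := J.prod 𝓘(ℝ, ℝ)) Φ μ =
      inducedForm (pullback (I := J) ι (fun x ↦ (1 / 2 : ℝ) • interior S μ x)) := by
  set l : DForm I P 1 := fun x ↦ (1 / 2 : ℝ) • interior S μ x
  have hl : IsSmoothForm l := (hμ.interior hs).const_smul _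
  have h1 := hl.extD_pullback Φ.contMDiff
  rw [hd] at h1
  rw [← h1, inducedForm]
  congr 1
  funext ⟨j, s⟩
  refine form_eq_of_coordForm (I := J.prod 𝓘(ℝ, ℝ)) (η := pullback (I := J.prod 𝓘(ℝ, ℝ)) Φ l)
    (θ := fun p : N × ℝ ↦ Real.exp (2 * p.2) •
      pullback (I := J.prod 𝓘(ℝ, ℝ)) (Prod.fst : N × ℝ → N) (pullback (I := J) ι l) p)
    (x := (j, s)) ?_
  have hw0 := mem_extChartAt_target (I := J.prod 𝓘(ℝ, ℝ)) (j, s)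
  set w := extChartAt (J.prod 𝓘(ℝ, ℝ)) (j, s) (j, s)
  have hw : w ∈ coneDomain J j := mem_extChartAt_target (I := J) j
  have hc := contMDiffAt_extChartAt_symm (I := J.prod 𝓘(ℝ, ℝ)) hw0
  refine one_form_ext (ContinuousLinearMap.ext fun u ↦ ?_)
  rw [← coordForm_comp l (Φ.contMDiff.mdifferentiableAt (by simp)) (hc.mdifferentiableAt (by simp))]
  have e1 := coordForm_coneParam_primitive Φ hμ hs hd hΦ hι hΦ0 hw u
  have e2 : (Φ ∘ (extChartAt (J.prod 𝓘(ℝ, ℝ)) (j, s)).symm : V × ℝ → P) = coneParam J Φ j := by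
    rw [extChartAt_prod_symm]
    rfl
  rw [e2, e1]
  set α := pullback (I := J) ι l
  have e3 : coordForm (extChartAt (J.prod 𝓘(ℝ, ℝ)) (j, s)).symm
      (fun p : N × ℝ ↦ Real.exp (2 * p.2) •
        pullback (I := J.prod 𝓘(ℝ, ℝ)) (Prod.fst : N × ℝ → N) α p) w =
      Real.exp (2 * w.2) • coordForm (Prod.fst ∘ (extChartAt (J.prod 𝓘(ℝ, ℝ)) (j, s)).symm) α w := by
    rw [coordForm_comp α mdifferentiableAt_fst (hc.mdifferentiableAt (by simp))]
    have h3 : ((extChartAt (J.prod 𝓘(ℝ, ℝ)) (j, s)).symm w).2 = w.2 := by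
      rw [extChartAt_prod_symm]
    rw [← h3]
    rfl
  have e4 : (Prod.fst ∘ (extChartAt (J.prod 𝓘(ℝ, ℝ)) (j, s)).symm : V × ℝ → N) =
      (extChartAt J j).symm ∘ Prod.fst := by
    rw [extChartAt_prod_symm]
    rfl
  rw [e3, e4, coordForm_comp_right α (mdifferentiableAt_extChartAt_symm (I := J) hw) (by fun_prop),
    map_smul, fderiv_fst, lin_apply]
  change _ = Real.exp (2 * w.2) * lin _ _ u
  rw [lin_apply]
  congr 1
  change _ = coordForm (extChartAt J j).symm α w.1 _
  congr 1
  ext i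
  fin_cases i
  rfl

end ConeCoordinates

/-! ### Linear algebra behind the contact condition -/

section ContactAlgebra

variable {W : Type*} [AddCommGroup W] [Module ℝ W]

/-- A nondegenerate alternating form on a space of dimension at least `2n` admits a symplectic
family of `2n` vectors. -/
theorem exists_symplectic_family [FiniteDimensional ℝ W] (b : W →ₗ[ℝ] W →ₗ[ℝ] ℝ)
    (hb : ∀ x, b x x = 0) (n : ℕ) : ∀ (K : Submodule ℝ W), 2 * n ≤ Module.finrank ℝ K →
      (∀ x ∈ K, (∀ y ∈ K, b x y = 0) → x = 0) →
      ∃ p q : Fin n → W, (∀ i, p i ∈ K) ∧ (∀ i, q i ∈ K) ∧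
        (∀ i j, b (p i) (p j) = 0) ∧ (∀ i j, b (q i) (q j) = 0) ∧
        ∀ i j, b (p i) (q j) = if i = j then 1 else 0 := by
  have hsw : ∀ x y, b y x = -b x y := by
    intro x y
    have h := hb (x + y)
    simp only [map_add, LinearMap.add_apply, hb] at h
    linarith
  induction n with
  | zero => exact fun K _ _ ↦ ⟨Fin.elim0, Fin.elim0, fun i ↦ i.elim0, fun i ↦ i.elim0,
      fun i ↦ i.elim0, fun i ↦ i.elim0, fun i ↦ i.elim0⟩
  | succ n ih =>
    intro K hK hnd
    have : Nontrivial K := Module.nontrivial_of_finrank_pos (R := ℝ) (by omega)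
    obtain ⟨⟨u, huK⟩, hu0⟩ := exists_ne (0 : K)
    have hu0 : u ≠ 0 := fun h ↦ hu0 (by simp [h])
    obtain ⟨v₀, hv₀K, hv₀⟩ : ∃ y ∈ K, b u y ≠ 0 := by
      by_contra! h
      exact hu0 (hnd u huK h)
    set v := (b u v₀)⁻¹ • v₀
    have hvK : v ∈ K := K.smul_mem _ hv₀K
    have huv : b u v = 1 := by simp [v, hv₀]
    have hvu : b v u = -1 := by rw [hsw u v, huv]
    let f : W →ₗ[ℝ] ℝ × ℝ := (b u).prod (b v)
    let f' := f.domRestrict K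
    -- The orthogonal of the hyperbolic pair `u, v` inside `K` loses at most two dimensions.
    let K' : Submodule ℝ W := K ⊓ LinearMap.ker f
    have hK' : 2 * n ≤ Module.finrank ℝ K' := by
      have h1 := LinearMap.finrank_range_add_finrank_ker f'
      have h2 : Module.finrank ℝ (LinearMap.range f') ≤ 2 := by
        refine (Submodule.finrank_le _).trans ?_
        simp
      have h3 : Module.finrank ℝ (LinearMap.ker f') ≤ Module.finrank ℝ K' := by
        let g : LinearMap.ker f' →ₗ[ℝ] K' := LinearMap.codRestrict K'
          (K.subtype.comp (LinearMap.ker f').subtype) fun x ↦ ⟨x.1.2, x.2⟩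
        refine LinearMap.finrank_le_finrank_of_injective (f := g) fun x y hxy ↦ ?_
        exact Subtype.ext (Subtype.ext (congrArg (fun z : K' ↦ (z : W)) hxy))
      omega
    have hmem : ∀ x, x ∈ K' ↔ x ∈ K ∧ b u x = 0 ∧ b v x = 0 := by
      intro x
      exact ⟨fun h ↦ ⟨h.1, congrArg Prod.fst (LinearMap.mem_ker.1 h.2),
        congrArg Prod.snd (LinearMap.mem_ker.1 h.2)⟩,
        fun h ↦ ⟨h.1, LinearMap.mem_ker.2 (Prod.ext h.2.1 h.2.2)⟩⟩
    obtain ⟨p, q, hp, hq, hpp, hqq, hpq⟩ := ih K' hK' (by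
      intro x hx h
      refine hnd x ((hmem x).1 hx).1 fun z hz ↦ ?_
      have hxu : b x u = 0 := by rw [hsw, ((hmem x).1 hx).2.1, neg_zero]
      have hxv : b x v = 0 := by rw [hsw, ((hmem x).1 hx).2.2, neg_zero]
      -- This is the projection of `z` to the orthogonal of the pair; an `x` in `K'` pairs with it
      -- as with `z`, so nondegeneracy passes to `K'`.
      have hz' : z - (b u z) • v + (b v z) • u ∈ K' := by
        refine (hmem _).2 ⟨K.add_mem (K.sub_mem hz (K.smul_mem _ hvK)) (K.smul_mem _ huK), ?_, ?_⟩
        · simp [huv, hb]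
        · simp [hvu, hb]
      have := h _ hz'
      simpa [hxu, hxv] using this)
    refine ⟨Fin.cons u p, Fin.cons v q, ?_, ?_, ?_, ?_, ?_⟩
    · intro i
      cases i using Fin.cases with
      | zero => exact huK
      | succ i => exact ((hmem _).1 (hp i)).1
    · intro i
      cases i using Fin.cases with
      | zero => exact hvK
      | succ i => exact ((hmem _).1 (hq i)).1
    · intro i j
      cases i using Fin.cases with
      | zero =>
        cases j using Fin.cases with
        | zero => exact hb u
        | succ j => exact ((hmem _).1 (hp j)).2.1
      | succ i =>
        cases j using Fin.cases with
        | zero =>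
          simp only [Fin.cons_succ, Fin.cons_zero]
          rw [hsw, ((hmem _).1 (hp i)).2.1, neg_zero]
        | succ j => exact hpp i j
    · intro i j
      cases i using Fin.cases with
      | zero =>
        cases j using Fin.cases with
        | zero => exact hb v
        | succ j => exact ((hmem _).1 (hq j)).2.2
      | succ i =>
        cases j using Fin.cases with
        | zero =>
          simp only [Fin.cons_succ, Fin.cons_zero]
          rw [hsw, ((hmem _).1 (hq i)).2.2, neg_zero]
        | succ j => exact hqq i j
    · intro i j
      cases i using Fin.cases with
      | zero =>
        cases j using Fin.cases with
        | zero => simpa using huv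
        | succ j =>
          simp only [Fin.cons_succ, Fin.cons_zero]
          rw [((hmem _).1 (hq j)).2.1, if_neg (Fin.succ_ne_zero j).symm]
      | succ i =>
        cases j using Fin.cases with
        | zero =>
          simp only [Fin.cons_succ, Fin.cons_zero]
          rw [hsw, ((hmem _).1 (hp i)).2.2, neg_zero, if_neg (Fin.succ_ne_zero i)]
        | succ j => simp [hpq i j]

/-- A permutation of `ι × Fin 2` preserving the fibres of the first projection has the sign of the
product of its restrictions to the fibres. -/
theorem sign_of_preserves_fst {ι : Type*} [Fintype ι] [DecidableEq ι]
    (σ : Equiv.Perm (ι × Fin 2)) (h : ∀ i, (σ (i, 0)).1 = (σ (i, 1)).1) :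
    ∃ κ : ι → Equiv.Perm (Fin 2), (∀ i c, (σ (i, c)).2 = κ i c) ∧
      Equiv.Perm.sign σ = ∏ i, Equiv.Perm.sign (κ i) := by
  have h' : ∀ i c, (σ (i, c)).1 = (σ (i, 0)).1 := by
    intro i c
    fin_cases c
    · rfl
    · exact (h i).symm
  let τ₀ : ι → ι := fun i ↦ (σ (i, 0)).1
  have hτ : Function.Bijective τ₀ := by
    refine Finite.surjective_iff_bijective.1 fun j ↦ ?_
    refine ⟨(σ.symm (j, 0)).1, ?_⟩
    have h1 := h' (σ.symm (j, 0)).1 (σ.symm (j, 0)).2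
    rw [Prod.mk.eta, Equiv.apply_symm_apply] at h1
    exact h1.symm
  have hκ : ∀ i, Function.Bijective fun c ↦ (σ (i, c)).2 := by
    intro i
    refine Finite.injective_iff_bijective.1 fun c d hcd ↦ ?_
    have h1 : σ (i, c) = σ (i, d) := Prod.ext ((h' i c).trans (h' i d).symm) hcd
    exact congrArg Prod.snd (σ.injective h1)
  let τ : Equiv.Perm ι := Equiv.ofBijective τ₀ hτ
  let κ : ι → Equiv.Perm (Fin 2) := fun i ↦ Equiv.ofBijective _ (hκ i)
  refine ⟨κ, fun i c ↦ rfl, ?_⟩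
  -- The permutation `τ` of the fibres acts on two copies of `ι` and contributes `sign τ ^ 2 = 1`;
  -- only the permutations `κ i` inside the fibres count.
  have hσ : σ = (Equiv.prodCongrLeft fun _ : Fin 2 ↦ τ) * Equiv.prodCongrRight κ := by
    ext ⟨i, c⟩ : 1
    exact Prod.ext (h' i c) rfl
  rw [hσ, Equiv.Perm.sign_mul, Equiv.Perm.sign_prodCongrLeft, Equiv.Perm.sign_prodCongrRight]
  simp

/-- A term vanishes unless `σ` fixes the distinguished index and maps pairs to pairs. Then each
factor `b` is the sign of the permutation of the corresponding pair, and the product of these signs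
is the sign of `σ`, so the term is a square times `a (w none)`. No cancellation can occur in the
sum. -/
theorem term_nonneg {ι : Type*} [Fintype ι] [DecidableEq ι] {a : W → ℝ} {b : W → W → ℝ}
    {w : Option (ι × Fin 2) → W} (ha0 : 0 < a (w none)) (ha : ∀ x, a (w (some x)) = 0)
    (hb : ∀ i j c d, b (w (some (i, c))) (w (some (j, d))) =
      if i = j then (if c = d then 0 else if c = 0 then 1 else -1) else 0)
    (σ : Equiv.Perm (Option (ι × Fin 2))) :
    0 ≤ ((Equiv.Perm.sign σ : ℤ) : ℝ) * (a (w (σ none)) *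
      ∏ i : ι, b (w (σ (some (i, 0)))) (w (σ (some (i, 1))))) := by
  by_cases hσ : σ none = none
  swap
  · obtain ⟨x, hx⟩ := Option.ne_none_iff_exists'.1 hσ
    rw [hx, ha]
    simp
  set σ' := Equiv.removeNone σ
  have hσ' : σ = Equiv.optionCongr σ' := by
    ext1 x
    cases x with
    | none => simpa using hσ
    | some x =>
      simp only [Equiv.optionCongr_apply, Option.map_some]
      refine (Equiv.removeNone_some σ ?_).symm
      rcases h : σ (some x) with _ | y
      · exact absurd (σ.injective (h.trans hσ.symm)) (by simp)
      · exact ⟨y, rfl⟩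
  have hs : ∀ x, σ (some x) = some (σ' x) := fun x ↦ by rw [hσ']; rfl
  simp only [hs, hσ]
  by_cases hall : ∀ i, (σ' (i, 0)).1 = (σ' (i, 1)).1
  swap
  · push Not at hall
    obtain ⟨i, hi⟩ := hall
    rw [Finset.prod_eq_zero (Finset.mem_univ i) (by
      have := hb (σ' (i, 0)).1 (σ' (i, 1)).1 (σ' (i, 0)).2 (σ' (i, 1)).2
      rw [if_neg hi] at this
      exact this)]
    simp
  obtain ⟨κ, hκ, hsign⟩ := sign_of_preserves_fst σ' hall
  have hterm : ∀ i, b (w (some (σ' (i, 0)))) (w (some (σ' (i, 1)))) =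
      ((Equiv.Perm.sign (κ i) : ℤ) : ℝ) := by
    intro i
    have h1 : b (w (some (σ' (i, 0)))) (w (some (σ' (i, 1)))) =
        if (σ' (i, 0)).1 = (σ' (i, 1)).1 then (if (σ' (i, 0)).2 = (σ' (i, 1)).2 then 0 else
          if (σ' (i, 0)).2 = 0 then 1 else -1) else 0 := hb _ _ _ _
    rw [if_pos (hall i), hκ, hκ] at h1
    refine h1.trans ?_
    generalize κ i = k
    revert k
    have : ∀ k : Equiv.Perm (Fin 2), (if k 0 = k 1 then 0 else if k 0 = 0 then 1 else -1 : ℤ) =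
        (Equiv.Perm.sign k : ℤ) := by decide
    intro k
    rw [← this k]
    push_cast
    rfl
  rw [Finset.prod_congr rfl fun i _ ↦ hterm i, hσ', Equiv.optionCongr_sign, hsign]
  push_cast
  rw [mul_left_comm, ← Finset.prod_mul_distrib]
  refine mul_nonneg ha0.le (Finset.prod_nonneg fun i _ ↦ ?_)
  exact mul_self_nonneg _

/-- The indexing of `0, …, 2n` by a point and `n` pairs. -/
def pairEquiv (n : ℕ) : Fin (2 * n + 1) ≃ Option (Fin n × Fin 2) :=
  (finSuccEquiv (2 * n)).trans
    (Equiv.optionCongr ((finCongr (mul_comm 2 n)).trans finProdFinEquiv.symm))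

theorem pairEquiv_zero (n : ℕ) : pairEquiv n 0 = none := by
  simp [pairEquiv]

theorem pairEquiv_symm_some (n : ℕ) (i : Fin n) (c : Fin 2) :
    (pairEquiv n).symm (some (i, c)) = ⟨2 * i + 1 + c, by omega⟩ := by
  rw [Equiv.symm_apply_eq]
  have h1 : (⟨2 * i + 1 + c, by omega⟩ : Fin (2 * n + 1)) = Fin.succ ⟨2 * i + c, by omega⟩ := by
    ext
    simp
    omega
  rw [h1]
  simp only [pairEquiv, Equiv.trans_apply, finSuccEquiv_succ, Equiv.optionCongr_apply,
    Option.map_some, Option.some.injEq]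
  rw [eq_comm, Equiv.symm_apply_eq]
  ext
  simp [finProdFinEquiv]
  omega

/-- Evaluated on `e` and the symplectic family, every term of the sum is nonnegative and the
identity contributes `a ![e] > 0`. -/
theorem wedgePow_ne_zero [TopologicalSpace W] {n : ℕ} {a : W [⋀^Fin 1]→L[ℝ] ℝ}
    {b : W [⋀^Fin 2]→L[ℝ] ℝ} {e : W} {p q : Fin n → W} (he : 0 < a ![e]) (hp : ∀ i, a ![p i] = 0)
    (hq : ∀ i, a ![q i] = 0) (hpp : ∀ i j, b ![p i, p j] = 0) (hqq : ∀ i j, b ![q i, q j] = 0)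
    (hpq : ∀ i j, b ![p i, q j] = if i = j then 1 else 0)
    (hqp : ∀ i j, b ![q i, p j] = if i = j then -1 else 0) :
    ∃ v, wedgePow n a b v ≠ 0 := by
  let w : Option (Fin n × Fin 2) → W := fun x ↦ x.elim e fun y ↦ if y.2 = 0 then p y.1 else q y.1
  have hb : ∀ i j c d, b ![w (some (i, c)), w (some (j, d))] =
      if i = j then (if c = d then 0 else if c = 0 then 1 else -1) else 0 := by
    intro i j c d
    fin_cases c <;> fin_cases d <;> simp [w, hpp, hqq, hpq, hqp]
  refine ⟨fun k ↦ w (pairEquiv n k), ?_⟩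
  unfold wedgePow
  refine mul_ne_zero (by positivity) (ne_of_gt ?_)
  obtain ⟨f, hf⟩ : ∃ f : Equiv.Perm (Option (Fin n × Fin 2)) → ℝ, ∀ τ, f τ =
      ((Equiv.Perm.sign τ : ℤ) : ℝ) *
        (a ![w (τ none)] * ∏ i : Fin n, b ![w (τ (some (i, 0))), w (τ (some (i, 1)))]) :=
    ⟨_, fun _ ↦ rfl⟩
  -- The sum is carried over to permutations of `Option (Fin n × Fin 2)`: `none` stands for the
  -- index `0` and `(i, c)` for `2 i + 1 + c`.
  have hterm : ∀ σ : Equiv.Perm (Fin (2 * n + 1)),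
      ((Equiv.Perm.sign σ : ℤ) : ℝ) * (a ![w (pairEquiv n (σ 0))] *
        ∏ i : Fin n, b ![w (pairEquiv n (σ ⟨2 * i + 1, by omega⟩)),
          w (pairEquiv n (σ ⟨2 * i + 2, by omega⟩))]) = f ((pairEquiv n).permCongr σ) := by
    intro σ
    rw [hf]
    simp only [Equiv.Perm.sign_permCongr, Equiv.permCongr_apply, pairEquiv_symm_some]
    have h0 : (pairEquiv n).symm none = 0 := by rw [← pairEquiv_zero, Equiv.symm_apply_apply]
    rw [h0]
    rfl
  rw [Finset.sum_congr rfl fun σ _ ↦ hterm σ, Equiv.sum_comp (pairEquiv n).permCongr f]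
  simp only [hf]
  refine Finset.sum_pos' (fun τ _ ↦ term_nonneg (a := fun x ↦ a ![x]) (b := fun x y ↦ b ![x, y])
    he (fun x ↦ ?_) hb τ) ⟨1, Finset.mem_univ _, ?_⟩
  · by_cases hx : x.2 = 0
    · simp [w, hx, hp]
    · simp [w, hx, hq]
  · simp only [Equiv.Perm.sign_one, Equiv.Perm.one_apply, hb]
    simpa [w] using he

end ContactAlgebra

/-! ### Descent of a closed two-form along a submersion -/

section Reduction

variable {V : Type*} [NormedAddCommGroup V] [NormedSpace ℝ V] [FiniteDimensional ℝ V]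
  {N : Type*} [TopologicalSpace N] [ChartedSpace V N] [IsManifold 𝓘(ℝ, V) ∞ N]
  {U : Type*} [NormedAddCommGroup U] [NormedSpace ℝ U] [FiniteDimensional ℝ U]
  {M : Type*} [TopologicalSpace M] [ChartedSpace U M] [IsManifold 𝓘(ℝ, U) ∞ M]
  {F : Type*} [NormedAddCommGroup F] [NormedSpace ℝ F]
  {β : DForm 𝓘(ℝ, V) N 2} {π : N → M}

/-- A closed form annihilated by the vertical vectors has zero Lie derivative along them, so its
coefficients are constant along segments of the fibre. -/
theorem basic_of_closed [FiniteDimensional ℝ F] {b : U × F → (U × F) [⋀^Fin 2]→L[ℝ] ℝ}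
    {T : Set (U × F)} (hT : IsOpen T) (hb : ∀ w ∈ T, ContDiffAt ℝ ∞ b w)
    (hc : ∀ w ∈ T, extDeriv b w = 0) (hk : ∀ w ∈ T, ∀ f v, bil _ (b w) (0, f) v = 0)
    {u : U} {f f₀ : F} (hseg : ∀ t ∈ Set.Icc (0 : ℝ) 1, (u, f₀ + t • (f - f₀)) ∈ T)
    (v v' : U × F) :
    bil _ (b (u, f)) v v' = bil _ (b (u, f₀)) (v.1, 0) (v'.1, 0) := by
  have hred : ∀ w ∈ T, ∀ v v', bil _ (b w) v v' = bil _ (b w) (v.1, 0) (v'.1, 0) := by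
    intro w hw v v'
    have e1 : v = (v.1, 0) + (0, v.2) := by ext <;> simp
    have e2 : v' = (v'.1, 0) + (0, v'.2) := by ext <;> simp
    have e3 : bil _ (b w) (v.1, 0) (0, v'.2) = 0 := by rw [bil_swap, hk w hw, neg_zero]
    calc bil _ (b w) v v' = bil _ (b w) ((v.1, 0) + (0, v.2)) ((v'.1, 0) + (0, v'.2)) := by
          rw [← e1, ← e2]
      _ = _ := by
          simp only [map_add, add_apply, hk w hw, e3, add_zero]
  -- In `db = 0` the two terms with `(0, g)` inserted in `b` vanish, which leaves the derivative of
  -- `b` in the vertical direction.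
  have hd : ∀ w ∈ T, ∀ g x y, fderiv ℝ (fun z ↦ bil _ (b z)) w (0, g) x y = 0 := by
    intro w hw g x y
    have h1 := extDeriv_two ((hb w hw).differentiableAt (by simp)) (0, g) x y
    have h2 : ∀ x y, fderiv ℝ (fun z ↦ bil _ (b z)) w x (0, g) y = 0 := by
      intro x y
      have hd1 := ((contDiffAt_bil (hb w hw)).differentiableAt (by simp)).hasFDerivAt.clm_apply
        (hasFDerivAt_const ((0, g) : U × F) w)
      have hd2 := hd1.clm_apply (hasFDerivAt_const y w)
      have hz : (fun z ↦ bil _ (b z) (0, g) y) =ᶠ[𝓝 w] fun _ ↦ 0 := by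
        filter_upwards [hT.mem_nhds hw] with z hz using hk z hz _ _
      have h5 := hd2.unique ((hasFDerivAt_const (0 : ℝ) w).congr_of_eventuallyEq hz)
      have h6 := congrFun (congrArg DFunLike.coe h5) x
      simpa using h6
    rw [hc w hw, h2, h2] at h1
    simpa using h1.symm
  have h0 : (u, f₀) ∈ T := by simpa using hseg 0 (by simp)
  have h1 : (u, f) ∈ T := by simpa using hseg 1 (by simp)
  rw [hred _ h1]
  have hconst : ∀ t ∈ Set.Icc (0 : ℝ) 1,
      HasDerivWithinAt (fun t : ℝ ↦ bil _ (b (u, f₀ + t • (f - f₀))) (v.1, 0) (v'.1, 0)) 0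
        (Set.Icc 0 1) t := by
    intro t ht
    have hd1 := ((contDiffAt_bil (hb _ (hseg t ht))).differentiableAt
      (by simp)).hasFDerivAt.clm_apply (hasFDerivAt_const ((v.1, 0) : U × F) _)
    have hd2 := hd1.clm_apply (hasFDerivAt_const ((v'.1, 0) : U × F) _)
    have hl : HasDerivAt (fun t : ℝ ↦ (u, f₀ + t • (f - f₀))) ((0 : U), (f - f₀)) t := by
      refine (hasDerivAt_const t u).prodMk ?_
      simpa using ((hasDerivAt_id t).smul_const (f - f₀)).const_add f₀
    refine ((hd2.comp_hasDerivAt t hl).congr_deriv ?_).hasDerivWithinAt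
    have := hd _ (hseg t ht) (f - f₀) (v.1, 0) (v'.1, 0)
    simpa using this
  have := (convex_Icc (0 : ℝ) 1).is_const_of_fderivWithin_eq_zero (𝕜 := ℝ)
    (fun t ht ↦ (hconst t ht).differentiableWithinAt) (fun t ht ↦ by
      have h := (hconst t ht).hasFDerivWithinAt.fderivWithin
        (uniqueDiffOn_Icc (by norm_num) t ht)
      rw [h]
      ext
      simp) (x := 1) (y := 0) (by simp) (by simp)
  simpa using this

/-- In the normal form `(u, f) ↦ u` of the submersion the section freezes `f` at its value at `x₀`.
By `basic_of_closed` the form does not depend on `f`, so it is the pullback of its restriction to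
this section. -/
theorem exists_local_section (hβ : IsSmoothForm β) (hc : extD β = 0) {x₀ : N}
    (hπ : Manifold.IsSubmersionAtOfComplement F 𝓘(ℝ, V) 𝓘(ℝ, U) ∞ π x₀)
    (hπs : ContMDiff 𝓘(ℝ, V) 𝓘(ℝ, U) ∞ π)
    (hk : ∀ x (u v : V), (mfderiv 𝓘(ℝ, V) 𝓘(ℝ, U) π x u : U) = 0 → bil V (β x) u v = 0) :
    ∃ s : M → N, s (π x₀) = x₀ ∧
      (∀ᶠ m in 𝓝 (π x₀), ContMDiffAt 𝓘(ℝ, U) 𝓘(ℝ, V) ∞ s m ∧ π (s m) = m) ∧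
      ∀ᶠ x in 𝓝 x₀, β x =
        pullback (I := 𝓘(ℝ, V)) π (pullback (I := 𝓘(ℝ, U)) s β) x := by
  set e : OpenPartialHomeomorph N V := hπ.domChart
  set d : OpenPartialHomeomorph M U := hπ.codChart
  set q := hπ.equiv
  have hFD : FiniteDimensional ℝ F := by
    refine FiniteDimensional.of_injective
      ((q.symm.toLinearEquiv.toLinearMap).comp (LinearMap.inr ℝ U F)) ?_
    exact q.symm.injective.comp LinearMap.inr_injective
  let T : Set (U × F) := {w | q.symm w ∈ e.target}
  have hT : IsOpen T := e.open_target.preimage q.symm.continuous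
  let ψ : U × F → N := fun w ↦ e.symm (q.symm w)
  let c : N → U × F := fun x ↦ q (e x)
  have hx₀ : x₀ ∈ e.source := hπ.mem_domChart_source
  have hψc : ∀ x ∈ e.source, ψ (c x) = x := fun x hx ↦ by simp [ψ, c, e.left_inv hx]
  have hcT : ∀ x ∈ e.source, c x ∈ T := fun x hx ↦ by simp [T, c, e.map_source hx]
  have hψs : ∀ w ∈ T, ψ w ∈ e.source := fun w hw ↦ e.map_target hw
  have hψ : ∀ w ∈ T, ContMDiffAt 𝓘(ℝ, U × F) 𝓘(ℝ, V) ∞ ψ w := fun w hw ↦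
    ((contMDiffOn_symm_of_mem_maximalAtlas hπ.domChart_mem_maximalAtlas).contMDiffAt
      (e.open_target.mem_nhds hw)).comp w q.symm.contDiff.contMDiff.contMDiffAt
  have hcs : ∀ x ∈ e.source, ContMDiffAt 𝓘(ℝ, V) 𝓘(ℝ, U × F) ∞ c x := fun x hx ↦
    q.contDiff.contMDiff.contMDiffAt.comp x
      (contMDiffAt_of_mem_maximalAtlas hπ.domChart_mem_maximalAtlas hx)
  have hdπ : ∀ w ∈ T, d (π (ψ w)) = w.1 := by
    intro w hw
    have h0 : q.symm w ∈ (hπ.domChart.extend 𝓘(ℝ, V)).target := by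
      rw [OpenPartialHomeomorph.extend_target]
      simpa [T] using hw
    have h1 := hπ.writtenInCharts h0
    have h2 : d (π (ψ w)) = (q (q.symm w)).1 := h1
    rwa [q.apply_symm_apply] at h2
  have hπψ : ∀ w ∈ T, π (ψ w) = d.symm w.1 := by
    intro w hw
    rw [← hdπ w hw, d.left_inv (hπ.source_subset_preimage_source (hψs w hw))]
  have hdt : ∀ w ∈ T, w.1 ∈ d.target := by
    intro w hw
    rw [← hdπ w hw]
    exact d.map_source (hπ.source_subset_preimage_source (hψs w hw))
  set w₀ := c x₀
  have hw₀ : w₀ ∈ T := hcT _ hx₀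
  -- Inside a ball the vertical segment from a point to the section stays in the domain.
  obtain ⟨r, hr, hball⟩ := Metric.isOpen_iff.1 hT w₀ hw₀
  let b := coordForm ψ β
  have hb : ∀ w ∈ T, ContDiffAt ℝ ∞ b w := fun w hw ↦ hβ.contDiffAt_coordForm (hψ w hw)
  have hbc : ∀ w ∈ T, extDeriv b w = 0 := by
    intro w hw
    rw [← hβ.coordForm_extD (hψ w hw), hc]
    rfl
  have hbk : ∀ w ∈ T, ∀ f v, bil _ (b w) (0, f) v = 0 := by
    intro w hw f v
    have h1 : mfderiv 𝓘(ℝ, U × F) 𝓘(ℝ, U) (π ∘ ψ) w =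
        mfderiv 𝓘(ℝ, U × F) 𝓘(ℝ, U) (d.symm ∘ Prod.fst) w := by
      refine Filter.EventuallyEq.mfderiv_eq ?_
      filter_upwards [hT.mem_nhds hw] with z hz using hπψ z hz
    have hds : ContMDiffAt 𝓘(ℝ, U) 𝓘(ℝ, U) ∞ d.symm w.1 :=
      (contMDiffOn_symm_of_mem_maximalAtlas hπ.codChart_mem_maximalAtlas).contMDiffAt
        (d.open_target.mem_nhds (hdt w hw))
    rw [mfderiv_comp w (hπs.mdifferentiableAt (by simp)) ((hψ w hw).mdifferentiableAt (by simp)),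
      mfderiv_comp w (hds.mdifferentiableAt (by simp))
        (differentiableAt_fst.mdifferentiableAt), mfderiv_eq_fderiv, fderiv_fst] at h1
    have h2 := congrFun (congrArg DFunLike.coe h1) ((0, f) : U × F)
    have h3 : (mfderiv 𝓘(ℝ, V) 𝓘(ℝ, U) π (ψ w)
        (mfderiv 𝓘(ℝ, U × F) 𝓘(ℝ, V) ψ w ((0, f) : U × F)) : U) = 0 :=
      h2.trans (map_zero (mfderiv 𝓘(ℝ, U) 𝓘(ℝ, U) d.symm w.1))
    have h4 := hk (ψ w) _ (mfderiv 𝓘(ℝ, U × F) 𝓘(ℝ, V) ψ w v) h3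
    rw [bil_apply]
    refine Eq.trans (congrArg (β (ψ w)) (funext fun i ↦ ?_)) ((bil_apply (F := V) _ _ _).symm.trans h4)
    fin_cases i <;> rfl
  let s : M → N := fun m ↦ ψ (d m, w₀.2)
  refine ⟨s, ?_, ?_, ?_⟩
  · have h1 : d (π x₀) = w₀.1 := by
      have := hdπ w₀ hw₀
      rwa [hψc _ hx₀] at this
    change ψ (d (π x₀), w₀.2) = x₀
    rw [h1]
    exact hψc _ hx₀
  · have h1 : d (π x₀) = w₀.1 := by
      have := hdπ w₀ hw₀
      rwa [hψc _ hx₀] at this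
    have hsrc : π x₀ ∈ d.source := hπ.mem_codChart_source
    have h2 : ∀ᶠ m in 𝓝 (π x₀), (d m, w₀.2) ∈ T := by
      have hcont : ContinuousAt (fun m ↦ (d m, w₀.2)) (π x₀) :=
        (d.continuousAt hsrc).prodMk continuousAt_const
      refine hcont.eventually_mem (hT.mem_nhds ?_)
      rw [h1]
      exact hw₀
    filter_upwards [h2, d.open_source.mem_nhds hsrc] with m hm hms
    refine ⟨?_, ?_⟩
    · have h3 : ContMDiffAt 𝓘(ℝ, U) 𝓘(ℝ, U × F) ∞ (fun m ↦ (d m, w₀.2)) m :=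
        (contMDiffAt_of_mem_maximalAtlas hπ.codChart_mem_maximalAtlas hms).prodMk_space
          contMDiffAt_const
      exact ContMDiffAt.comp (g := ψ) (f := fun m ↦ (d m, w₀.2)) m (hψ _ hm) h3
    · change π (ψ (d m, w₀.2)) = m
      rw [hπψ _ hm, d.left_inv hms]
  · have hcc : ContinuousAt c x₀ := (hcs x₀ hx₀).continuousAt
    filter_upwards [e.open_source.mem_nhds hx₀, hcc.eventually_mem (Metric.ball_mem_nhds _ hr)]
      with x hx hxb
    let P₀ : U × F → U × F := fun w ↦ (w.1, w₀.2)
    have hP₀ : ∀ w, HasFDerivAt P₀ ((ContinuousLinearMap.fst ℝ U F).prod 0) w := fun w ↦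
      (hasFDerivAt_fst).prodMk (hasFDerivAt_const _ _)
    have hxb' : dist (c x).1 w₀.1 < r ∧ dist (c x).2 w₀.2 < r := by
      rw [Metric.mem_ball, Prod.dist_eq] at hxb
      exact max_lt_iff.1 hxb
    have hseg : ∀ t ∈ Set.Icc (0 : ℝ) 1, ((c x).1, w₀.2 + t • ((c x).2 - w₀.2)) ∈ T := by
      intro t ht
      refine hball ?_
      rw [Metric.mem_ball, Prod.dist_eq]
      refine max_lt hxb'.1 ?_
      rw [dist_eq_norm, add_sub_cancel_left, norm_smul, Real.norm_of_nonneg ht.1]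
      have := hxb'.2
      rw [dist_eq_norm] at this
      nlinarith [ht.2, norm_nonneg ((c x).2 - w₀.2), ht.1]
    have hP₀T : P₀ (c x) ∈ T := by simpa [P₀] using hseg 0 (by simp)
    have key : coordForm ψ β (c x) = coordForm (ψ ∘ P₀) β (c x) := by
      rw [coordForm_comp_right β ((hψ _ hP₀T).mdifferentiableAt (by simp))
        (hP₀ _).differentiableAt, (hP₀ _).fderiv]
      refine two_form_ext fun v v' ↦ ?_
      have h1 := basic_of_closed hT hb hbc hbk hseg v v'
      refine h1.trans ?_
      rw [bil_apply, bil_apply]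
      change b (P₀ (c x)) _ = b (P₀ (c x)) _
      refine congrArg _ (funext fun i ↦ ?_)
      fin_cases i <;> rfl
    have hcx := hcs x hx
    have h1 : pullback (I := 𝓘(ℝ, V)) (ψ ∘ c) β x = β x := by
      have hev : ψ ∘ c =ᶠ[𝓝 x] id := by
        filter_upwards [e.open_source.mem_nhds hx] with z hz using hψc z hz
      rw [pullback_congr β hev]
      ext v
      rw [pullback_apply, mfderiv_id]
      rfl
    have h2 : pullback (I := 𝓘(ℝ, V)) (s ∘ π) β x =
        pullback (I := 𝓘(ℝ, V)) ((ψ ∘ P₀) ∘ c) β x := by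
      refine pullback_congr β ?_
      filter_upwards [e.open_source.mem_nhds hx] with z hz
      change ψ (d (π z), w₀.2) = ψ ((c z).1, w₀.2)
      rw [← hdπ _ (hcT z hz), hψc z hz]
    have hψP : MDifferentiableAt 𝓘(ℝ, U × F) 𝓘(ℝ, V) (ψ ∘ P₀) (c x) :=
      ((hψ _ hP₀T).mdifferentiableAt (by simp)).comp (c x)
        (hP₀ _).differentiableAt.mdifferentiableAt
    have hπx : (d (π x), w₀.2) ∈ T := by
      have := hdπ _ (hcT x hx)
      rw [hψc x hx] at this
      rw [this]
      exact hP₀T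
    have hsm : MDifferentiableAt 𝓘(ℝ, U) 𝓘(ℝ, V) s (π x) := by
      have h3 : ContMDiffAt 𝓘(ℝ, U) 𝓘(ℝ, U × F) ∞ (fun m ↦ (d m, w₀.2)) (π x) :=
        (contMDiffAt_of_mem_maximalAtlas hπ.codChart_mem_maximalAtlas
          (hπ.source_subset_preimage_source hx)).prodMk_space contMDiffAt_const
      exact (ContMDiffAt.comp (g := ψ) (f := fun m ↦ (d m, w₀.2)) (π x) (hψ _ hπx) h3).mdifferentiableAt (by simp)
    rw [← pullback_comp β hsm (hπs.mdifferentiableAt (by simp)), h2,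
      pullback_comp β hψP (hcx.mdifferentiableAt (by simp)), ← h1,
      pullback_comp β (by
        have : c x ∈ T := hcT x hx
        exact (hψ _ this).mdifferentiableAt (by simp)) (hcx.mdifferentiableAt (by simp))]
    ext v
    exact congrFun (congrArg DFunLike.coe key) _

/-- A closed form whose kernel is tangent to the connected fibres of a submersion descends to a
symplectic form. -/
theorem exists_reduced_form (hβ : IsSmoothForm β) (hc : extD β = 0)
    (hπ : Manifold.IsSubmersionOfComplement F 𝓘(ℝ, V) 𝓘(ℝ, U) ∞ π)
    (hπs : ContMDiff 𝓘(ℝ, V) 𝓘(ℝ, U) ∞ π) (hsurj : Function.Surjective π)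
    (hdπ : ∀ x, Function.Surjective (mfderiv 𝓘(ℝ, V) 𝓘(ℝ, U) π x))
    (hk : ∀ x (u v : V), (mfderiv 𝓘(ℝ, V) 𝓘(ℝ, U) π x u : U) = 0 → bil V (β x) u v = 0)
    (hk' : ∀ x (u : V), (∀ v, bil V (β x) u v = 0) →
      (mfderiv 𝓘(ℝ, V) 𝓘(ℝ, U) π x u : U) = 0)
    (hconn : ∀ x y, π x = π y → ∃ (γ : ℝ → N) (a b t : ℝ), 0 ∈ Set.Ioo a b ∧ t ∈ Set.Ioo a b ∧
      ContinuousOn γ (Set.Ioo a b) ∧ (∀ τ ∈ Set.Ioo a b, π (γ τ) = π x) ∧ γ 0 = x ∧ γ t = y) :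
    ∃ ζ : DForm 𝓘(ℝ, U) M 2, IsSymplecticForm ζ ∧ pullback (I := 𝓘(ℝ, V)) π ζ = β := by
  choose s hs0 hs1 hs2 using fun x ↦ exists_local_section hβ hc (hπ x) hπs hk
  -- The form on the base as seen from the point `x` of the fibre; surjectivity of the derivative of
  -- `π` makes it unique.
  let om : N → U [⋀^Fin 2]→L[ℝ] ℝ := fun x ↦ pullback (I := 𝓘(ℝ, U)) (s x) β (π x)
  have hom : ∀ x (v : Fin 2 → V), β x v = om x (fun i ↦ mfderiv 𝓘(ℝ, V) 𝓘(ℝ, U) π x (v i)) :=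
    fun x v ↦ congrFun (congrArg DFunLike.coe (hs2 x).self_of_nhds) v
  have huniq : ∀ x (θ θ' : U [⋀^Fin 2]→L[ℝ] ℝ),
      (∀ v : Fin 2 → V, θ (fun i ↦ mfderiv 𝓘(ℝ, V) 𝓘(ℝ, U) π x (v i)) =
        θ' (fun i ↦ mfderiv 𝓘(ℝ, V) 𝓘(ℝ, U) π x (v i))) → θ = θ' := by
    intro x θ θ' h
    ext v
    choose w hw using fun i ↦ hdπ x (v i)
    have h1 := h w
    rwa [show (fun i ↦ mfderiv 𝓘(ℝ, V) 𝓘(ℝ, U) π x (w i)) = v from funext hw] at h1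
  have hlocal : ∀ x₀, ∀ᶠ x in 𝓝 x₀, om x = pullback (I := 𝓘(ℝ, U)) (s x₀) β (π x) := by
    intro x₀
    filter_upwards [hs2 x₀] with x hx
    refine huniq x _ _ fun v ↦ ?_
    rw [← hom x v]
    exact congrFun (congrArg DFunLike.coe hx) v
  -- Along a curve in the fibre, `om` is locally constant by `hlocal`, hence constant; this is where
  -- connectedness of the fibres is needed.
  have hfib : ∀ x y, π x = π y → om x = om y := by
    intro x y hxy
    obtain ⟨γ, a, b, t, h0, ht, hγ, hπγ, hγ0, hγt⟩ := hconn x y hxy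
    have : PreconnectedSpace (Set.Ioo a b) := Subtype.preconnectedSpace isPreconnected_Ioo
    have hlc : IsLocallyConstant fun τ : Set.Ioo a b ↦ om (γ τ) := by
      rw [IsLocallyConstant.iff_eventually_eq]
      intro τ
      have hcont : ContinuousAt (fun τ : Set.Ioo a b ↦ γ τ) τ :=
        (continuousOn_iff_continuous_domRestrict.1 hγ).continuousAt
      filter_upwards [hcont.eventually (hlocal (γ τ))] with τ' hτ'
      rw [hτ', hπγ _ τ'.2, ← hπγ _ τ.2]
    have := hlc.apply_eq_of_preconnectedSpace ⟨0, h0⟩ ⟨t, ht⟩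
    simpa only [hγ0, hγt] using this
  choose r hr using hsurj
  let ζ : DForm 𝓘(ℝ, U) M 2 := fun m ↦ om (r m)
  -- The preimage `r m` is chosen without any continuity; `hfib` replaces it by the value of a
  -- smooth local section.
  have hζs : ∀ m₀, ∀ᶠ m in 𝓝 m₀, ζ m = pullback (I := 𝓘(ℝ, U)) (s (r m₀)) β m := by
    intro m₀
    have h1 := hs1 (r m₀)
    have h0 : s (r m₀) m₀ = r m₀ := by
      have := hs0 (r m₀)
      rwa [hr] at this
    rw [hr] at h1
    have hcont : ContinuousAt (s (r m₀)) m₀ := h1.self_of_nhds.1.continuousAt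
    have h2 : ∀ᶠ x in 𝓝 (s (r m₀) m₀), om x = pullback (I := 𝓘(ℝ, U)) (s (r m₀)) β (π x) := by
      rw [h0]
      exact hlocal (r m₀)
    filter_upwards [h1, hcont.eventually h2] with m hm hm'
    change om (r m) = _
    rw [hfib (r m) (s (r m₀) m) (by rw [hr, hm.2]), hm', hm.2]
  have hπζ : pullback (I := 𝓘(ℝ, V)) π ζ = β := by
    funext x
    ext v
    have h1 : om (r (π x)) = om x := hfib _ _ (hr _)
    exact (congrFun (congrArg DFunLike.coe h1) _).trans (hom x v).symm
  have hζsm : IsSmoothForm ζ := by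
    refine isSmoothForm_of_contDiffAt fun m₁ y hy ↦ ?_
    have hcs := contMDiffAt_extChartAt_symm (I := 𝓘(ℝ, U)) hy
    set m₀ := (extChartAt 𝓘(ℝ, U) m₁).symm y
    have h1 := hs1 (r m₀)
    rw [hr] at h1
    refine ContDiffAt.congr_of_eventuallyEq (f₁ := coordForm (extChartAt 𝓘(ℝ, U) m₁).symm ζ)
      (f := coordForm (s (r m₀) ∘ (extChartAt 𝓘(ℝ, U) m₁).symm) β) ?_ ?_
    · exact hβ.contDiffAt_coordForm (h1.self_of_nhds.1.comp y hcs)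
    · have hcont := hcs.continuousAt
      filter_upwards [hcont.eventually (hζs m₀), hcont.eventually h1,
        (isOpen_extChartAt_target m₁).mem_nhds hy] with z hz1 hz2 hz3
      rw [coordForm_comp β (hz2.1.mdifferentiableAt (by simp))
        (mdifferentiableAt_extChartAt_symm (I := 𝓘(ℝ, U)) hz3)]
      ext v
      exact congrFun (congrArg DFunLike.coe hz1) _
  refine ⟨ζ, ⟨hζsm, ?_, ?_⟩, hπζ⟩
  · have h1 := hζsm.extD_pullback hπs
    rw [hπζ, hc] at h1
    funext m
    obtain ⟨x, rfl⟩ : ∃ x, π x = m := ⟨r m, hr m⟩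
    ext v
    choose w hw using fun i ↦ hdπ x (v i)
    have h2 := congrFun (congrArg DFunLike.coe (congrFun h1 x)) w
    rw [pullback_apply, show (fun i ↦ mfderiv 𝓘(ℝ, V) 𝓘(ℝ, U) π x (w i)) = v from funext hw] at h2
    exact h2.symm
  · intro m v hv
    obtain ⟨x, rfl⟩ : ∃ x, π x = m := ⟨r m, hr m⟩
    obtain ⟨u, rfl⟩ := hdπ x v
    refine hk' x u fun u' ↦ ?_
    refine (bil_apply (F := V) (β x) u u').trans ?_
    rw [← hπζ]
    refine Eq.trans (congrArg (ζ (π x)) (funext fun i ↦ ?_)) (hv (mfderiv 𝓘(ℝ, V) 𝓘(ℝ, U) π x u'))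
    fin_cases i <;> rfl

end Reduction

/-! ### Traces and adjoints for a nondegenerate bilinear form -/

section TraceAlgebra

variable {W : Type*} [NormedAddCommGroup W] [NormedSpace ℝ W] [FiniteDimensional ℝ W]

/-- The trace of a continuous endomorphism. -/
def tr : (W →L[ℝ] W) →ₗ[ℝ] ℝ :=
  (LinearMap.trace ℝ W).comp (ContinuousLinearMap.coeLM ℝ)

theorem tr_apply (f : W →L[ℝ] W) : tr f = LinearMap.trace ℝ W (f : W →ₗ[ℝ] W) := rfl

theorem tr_smulRight (l : W →L[ℝ] ℝ) (v : W) : tr (l.smulRight v) = l v := by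
  rw [tr_apply]
  exact LinearMap.trace_smulRight (l : W →ₗ[ℝ] ℝ) v

theorem tr_comp_comm (f g : W →L[ℝ] W) : tr (f.comp g) = tr (g.comp f) :=
  LinearMap.trace_mul_comm ℝ (f : W →ₗ[ℝ] W) (g : W →ₗ[ℝ] W)

theorem tr_id : tr (ContinuousLinearMap.id ℝ W) = Module.finrank ℝ W :=
  LinearMap.trace_id ℝ W

variable {M : W →L[ℝ] W →L[ℝ] ℝ}

theorem isInvertible_of_nondegenerate (hM : ∀ u, (∀ v, M u v = 0) → u = 0) : M.IsInvertible := by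
  have hinj : Function.Injective (M : W →ₗ[ℝ] (W →L[ℝ] ℝ)) := by
    rw [← LinearMap.ker_eq_bot, LinearMap.ker_eq_bot']
    intro u hu
    exact hM u fun v ↦ congrArg (fun f : W →L[ℝ] ℝ ↦ f v) hu
  have hfin : Module.finrank ℝ W = Module.finrank ℝ (W →L[ℝ] ℝ) := by
    rw [← (LinearMap.toContinuousLinearMap (𝕜 := ℝ) (E := W) (F' := ℝ)).finrank_eq]
    exact (Subspace.dual_finrank_eq (K := ℝ) (V := W)).symm
  let Q : W ≃L[ℝ] (W →L[ℝ] ℝ) :=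
    (LinearEquiv.ofInjectiveOfFinrankEq (M : W →ₗ[ℝ] (W →L[ℝ] ℝ)) hinj hfin).toContinuousLinearEquiv
  exact ⟨Q, by ext; rfl⟩

theorem apply_inverse (hM : ∀ u, (∀ v, M u v = 0) → u = 0) (l : W →L[ℝ] ℝ) :
    M (M.inverse l) = l :=
  congrFun (congrArg DFunLike.coe (isInvertible_of_nondegenerate hM).self_comp_inverse) l

theorem eq_inverse (hM : ∀ u, (∀ v, M u v = 0) → u = 0) {u : W} {l : W →L[ℝ] ℝ}
    (h : ∀ v, M u v = l v) : u = M.inverse l := by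
  rw [show l = M u from ContinuousLinearMap.ext fun v ↦ (h v).symm]
  exact (congrFun (congrArg DFunLike.coe
    (isInvertible_of_nondegenerate hM).inverse_comp_self) u).symm

/-- The form `M` identifies the space with its dual and conjugates `f` to the transpose of `g`. -/
theorem tr_eq_of_adjoint (hM : ∀ u, (∀ v, M u v = 0) → u = 0) {f g : W →L[ℝ] W}
    (h : ∀ u v, M (f u) v = M u (g v)) : tr f = tr g := by
  obtain ⟨Q, hQ⟩ := isInvertible_of_nondegenerate hM
  let B : W ≃ₗ[ℝ] Module.Dual ℝ W :=
    Q.toLinearEquiv.trans (LinearMap.toContinuousLinearMap (𝕜 := ℝ) (E := W) (F' := ℝ)).symm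
  have hB : ∀ u v, B u v = M u v := fun u v ↦ by rw [← hQ]; rfl
  have h1 : B.conj (f : W →ₗ[ℝ] W) = Module.Dual.transpose (R := ℝ) (g : W →ₗ[ℝ] W) := by
    refine LinearMap.ext fun l ↦ LinearMap.ext fun v ↦ ?_
    obtain ⟨u, rfl⟩ := B.surjective l
    rw [LinearEquiv.conj_apply_apply, LinearEquiv.symm_apply_apply, hB]
    change M (f u) v = B u (g v)
    rw [hB, h]
  rw [tr_apply, tr_apply, ← LinearMap.trace_conj' (f : W →ₗ[ℝ] W) B, h1]
  exact LinearMap.trace_transpose' _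

theorem tr_eq_of_conj {K : W →L[ℝ] W} (hK : Function.Bijective K) {f g : W →L[ℝ] W}
    (h : ∀ u, K (f u) = g (K u)) : tr f = tr g := by
  let Q : W ≃ₗ[ℝ] W := LinearEquiv.ofBijective (K : W →ₗ[ℝ] W) hK
  have h1 : Q.conj (f : W →ₗ[ℝ] W) = (g : W →ₗ[ℝ] W) := by
    refine LinearMap.ext fun v ↦ ?_
    obtain ⟨u, rfl⟩ := Q.surjective v
    rw [LinearEquiv.conj_apply_apply, LinearEquiv.symm_apply_apply]
    exact h u
  rw [tr_apply, tr_apply, ← h1, LinearMap.trace_conj']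

end TraceAlgebra

/-! ### Local model: homogeneous symplectic forms and adapted connections -/

section ConeForms

variable {W : Type*} [NormedAddCommGroup W] [NormedSpace ℝ W] [FiniteDimensional ℝ W]

/-- A symplectic form on an open set, homogeneous of degree `2` under the translations along `e`. -/
structure ConeForm (O : Set W) (e : W) (M : W → W →L[ℝ] W →L[ℝ] ℝ) : Prop where
  isOpen : IsOpen O
  add_mem : ∀ w ∈ O, ∀ t : ℝ, w + t • e ∈ O
  smooth : ContDiffOn ℝ ∞ M O
  skew : ∀ w ∈ O, ∀ u v, M w u v = -M w v u
  nondegenerate : ∀ w ∈ O, ∀ u, (∀ v, M w u v = 0) → u = 0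
  closed : ∀ w ∈ O, ∀ x y z, fderiv ℝ M w x y z + fderiv ℝ M w y z x + fderiv ℝ M w z x y = 0
  homogeneous : ∀ w ∈ O, ∀ t : ℝ, M (w + t • e) = Real.exp (2 * t) • M w

/-- A torsion-free connection for which `M` is parallel, adapted to the field `e`. -/
structure ConeConn (O : Set W) (e : W) (M : W → W →L[ℝ] W →L[ℝ] ℝ)
    (Γ : W → W →L[ℝ] W →L[ℝ] W) : Prop where
  smooth : ContDiffOn ℝ ∞ Γ O
  symm : ∀ w ∈ O, ∀ u v, Γ w u v = Γ w v u
  unit : ∀ w ∈ O, ∀ v, Γ w e v = v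
  invariant : ∀ w ∈ O, ∀ t : ℝ, Γ (w + t • e) = Γ w
  parallel : ∀ w ∈ O, ∀ u v z, fderiv ℝ M w u v z = M w (Γ w u v) z + M w v (Γ w u z)

variable {O : Set W} {e : W} {M : W → W →L[ℝ] W →L[ℝ] ℝ} {Γ : W → W →L[ℝ] W →L[ℝ] W}

theorem fderiv_of_homogeneous {X : Type*} [NormedAddCommGroup X] [NormedSpace ℝ X] {f : W → X}
    {w : W} {a : ℝ} (hf : DifferentiableAt ℝ f w)
    (h : ∀ t : ℝ, f (w + t • e) = Real.exp (a * t) • f w) : fderiv ℝ f w e = a • f w := by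
  have hl : HasDerivAt (fun t : ℝ ↦ w + t • e) e 0 := by
    simpa using ((hasDerivAt_id (0 : ℝ)).smul_const e).const_add w
  have hf' : HasFDerivAt f (fderiv ℝ f w) (w + (0 : ℝ) • e) := by simpa using hf.hasFDerivAt
  have h1 := hf'.comp_hasDerivAt (0 : ℝ) hl
  have h2 : HasDerivAt (fun t : ℝ ↦ Real.exp (a * t) • f w) (a • f w) 0 := by
    have h3 : HasDerivAt (fun t : ℝ ↦ Real.exp (a * t)) a 0 := by
      simpa using ((hasDerivAt_id (0 : ℝ)).const_mul a).exp
    exact h3.smul_const (f w)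
  have h4 : f ∘ (fun t : ℝ ↦ w + t • e) = fun t ↦ Real.exp (a * t) • f w := funext h
  rw [h4] at h1
  exact h1.unique h2

theorem fderiv_of_invariant {X : Type*} [NormedAddCommGroup X] [NormedSpace ℝ X] {f : W → X}
    {w : W} (hf : DifferentiableAt ℝ f w) (h : ∀ t : ℝ, f (w + t • e) = f w) :
    fderiv ℝ f w e = 0 := by
  simpa using fderiv_of_homogeneous (a := 0) hf (by simpa using h)

theorem fderiv_add_smul {X : Type*} [NormedAddCommGroup X] [NormedSpace ℝ X] {f : W → X}
    (hO : IsOpen O) {t a : ℝ} (h : ∀ w ∈ O, f (w + t • e) = a • f w) {w : W} (hw : w ∈ O)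
    (hf : DifferentiableAt ℝ f w) : fderiv ℝ f (w + t • e) = a • fderiv ℝ f w := by
  rw [← fderiv_comp_add_right]
  have : (fun z ↦ f (z + t • e)) =ᶠ[𝓝 w] fun z ↦ a • f z := by
    filter_upwards [hO.mem_nhds hw] with z hz using h z hz
  rw [this.fderiv_eq, fderiv_fun_const_smul hf]

/-- The primitive `½ i(e) M`. -/
def prim (e : W) (M : W → W →L[ℝ] W →L[ℝ] ℝ) (w : W) : W →L[ℝ] ℝ := (1 / 2 : ℝ) • M w e

theorem prim_apply (w v : W) : prim e M w v = 1 / 2 * M w e v := rfl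

namespace ConeForm

variable (h : ConeForm O e M)
include h

theorem contDiffAt {w : W} (hw : w ∈ O) : ContDiffAt ℝ ∞ M w :=
  h.smooth.contDiffAt (h.isOpen.mem_nhds hw)

theorem differentiableAt {w : W} (hw : w ∈ O) : DifferentiableAt ℝ M w :=
  (h.contDiffAt hw).differentiableAt (by simp)

theorem self_eq_zero {w : W} (hw : w ∈ O) (u : W) : M w u u = 0 := by
  have := h.skew w hw u u
  linarith

theorem prim_self {w : W} (hw : w ∈ O) : prim e M w e = 0 := by
  rw [prim_apply, h.self_eq_zero hw, mul_zero]

theorem apply_e {w : W} (v : W) : M w e v = 2 * prim e M w v := by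
  rw [prim_apply]
  ring

theorem apply_right_e {w : W} (hw : w ∈ O) (v : W) : M w v e = -(2 * prim e M w v) := by
  rw [h.skew w hw, h.apply_e]

theorem prim_smooth : ContDiffOn ℝ ∞ (prim e M) O := by
  have h1 : ContDiffOn ℝ ∞ (fun w ↦ M w e) O := h.smooth.clm_apply contDiffOn_const
  exact h1.const_smul (1 / 2 : ℝ)

theorem prim_differentiableAt {w : W} (hw : w ∈ O) : DifferentiableAt ℝ (prim e M) w :=
  (h.prim_smooth.contDiffAt (h.isOpen.mem_nhds hw)).differentiableAt (by simp)

theorem fderiv_prim {w : W} (hw : w ∈ O) (u v : W) :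
    fderiv ℝ (prim e M) w u v = 1 / 2 * fderiv ℝ M w u e v := by
  have h1 := ((h.differentiableAt hw).hasFDerivAt.clm_apply
    (hasFDerivAt_const e w)).const_smul (1 / 2 : ℝ)
  have h2 : fderiv ℝ (prim e M) w = _ := h1.fderiv
  rw [h2]
  simp

theorem fderiv_skew {w : W} (hw : w ∈ O) (x u v : W) :
    fderiv ℝ M w x u v = -fderiv ℝ M w x v u := by
  have h1 : ∀ u v, HasFDerivAt (fun w ↦ M w u v) (((fderiv ℝ M w).flip u).flip v) w := by
    intro u v
    have := (((h.differentiableAt hw).hasFDerivAt.clm_apply (hasFDerivAt_const u w)).clm_apply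
      (hasFDerivAt_const v w))
    refine this.congr_fderiv ?_
    ext x
    simp
  have h2 : (fun w ↦ M w u v) =ᶠ[𝓝 w] fun w ↦ -M w v u := by
    filter_upwards [h.isOpen.mem_nhds hw] with z hz using h.skew z hz u v
  have h3 := ((h1 v u).neg.congr_of_eventuallyEq h2).unique (h1 u v)
  have h4 := congrFun (congrArg DFunLike.coe h3) x
  simpa using h4.symm

theorem fderiv_e {w : W} (hw : w ∈ O) : fderiv ℝ M w e = (2 : ℝ) • M w :=
  fderiv_of_homogeneous (X := W →L[ℝ] W →L[ℝ] ℝ) (f := M) (h.differentiableAt hw)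
    (h.homogeneous w hw)

/-- The local form of `dλ = μ`: closedness evaluated with `e` in one slot, where homogeneity turns
the derivative along `e` into a factor `2`. -/
theorem fderiv_prim_sub {w : W} (hw : w ∈ O) (u v : W) :
    fderiv ℝ (prim e M) w u v - fderiv ℝ (prim e M) w v u = M w u v := by
  have h1 := h.closed w hw u e v
  rw [h.fderiv_e hw, h.fderiv_skew hw v u e] at h1
  rw [h.fderiv_prim hw, h.fderiv_prim hw]
  have h2 := h.skew w hw u v
  simp at h1
  linarith

theorem prim_homogeneous {w : W} (hw : w ∈ O) (t : ℝ) :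
    prim e M (w + t • e) = Real.exp (2 * t) • prim e M w := by
  unfold prim
  rw [h.homogeneous w hw, smul_comm]
  rfl

theorem inverse_homogeneous {w : W} (hw : w ∈ O) (t : ℝ) (l : W →L[ℝ] ℝ) :
    (M (w + t • e)).inverse l = Real.exp (-(2 * t)) • (M w).inverse l := by
  symm
  refine eq_inverse (h.nondegenerate _ (h.add_mem w hw t)) fun v ↦ ?_
  rw [h.homogeneous w hw, map_smul]
  change Real.exp (-(2 * t)) * (Real.exp (2 * t) * M w ((M w).inverse l) v) = _
  rw [apply_inverse (h.nondegenerate w hw), ← mul_assoc, ← Real.exp_add]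
  simp

theorem inverse_smooth : ContDiffOn ℝ ∞ (fun w ↦ (M w).inverse) O := by
  intro w hw
  have : CompleteSpace W := FiniteDimensional.complete ℝ W
  obtain ⟨Q, hQ⟩ := isInvertible_of_nondegenerate (h.nondegenerate w hw)
  have h1 : ContDiffAt ℝ ∞ (ContinuousLinearMap.inverse (R := ℝ) (M := W) (M₂ := W →L[ℝ] ℝ))
      (M w) := by
    rw [← hQ]
    exact contDiffAt_map_inverse Q
  exact (h1.comp w (h.contDiffAt hw)).contDiffWithinAt

theorem prim_ne_zero {w : W} (hw : w ∈ O) (he : e ≠ 0) : ∃ v, prim e M w v ≠ 0 := by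
  by_contra! hv
  refine he (h.nondegenerate w hw e fun v ↦ ?_)
  rw [h.apply_e, hv, mul_zero]

end ConeForm

namespace ConeConn

variable (h : ConeForm O e M) (hΓ : ConeConn O e M Γ)
include h hΓ

/-- In invariant terms `∇λ = ½ M`, which follows from `λ = ½ M(e, ·)`, `∇M = 0` and `∇e = Id`. It
eliminates the derivatives of `λ` from all later computations. -/
theorem fderiv_prim {w : W} (hw : w ∈ O) (u v : W) :
    fderiv ℝ (prim e M) w u v = 1 / 2 * M w u v + prim e M w (Γ w u v) := by
  rw [h.fderiv_prim hw, hΓ.parallel w hw, hΓ.symm w hw u e, hΓ.unit w hw, prim_apply]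
  ring

theorem differentiableAt {w : W} (hw : w ∈ O) : DifferentiableAt ℝ Γ w :=
  (hΓ.smooth.contDiffAt (h.isOpen.mem_nhds hw)).differentiableAt (by simp)

theorem fderiv_e {w : W} (hw : w ∈ O) : fderiv ℝ Γ w e = 0 :=
  fderiv_of_invariant (X := W →L[ℝ] W →L[ℝ] W) (f := Γ) (hΓ.differentiableAt h hw)
    (hΓ.invariant w hw)

end ConeConn

end ConeForms

set_option maxSynthPendingDepth 3

/-! ### Bilinear maps on a finite-dimensional space -/

section Bilinear

variable {W : Type*} [NormedAddCommGroup W] [NormedSpace ℝ W] [FiniteDimensional ℝ W]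
  {X : Type*} [NormedAddCommGroup X] [NormedSpace ℝ X]

/-- A bilinear map on a finite-dimensional space, as a continuous bilinear map. -/
def mkBilin (f : W → W → X) (h1 : ∀ u u' v, f (u + u') v = f u v + f u' v)
    (h2 : ∀ (c : ℝ) u v, f (c • u) v = c • f u v) (h3 : ∀ u v v', f u (v + v') = f u v + f u v')
    (h4 : ∀ (c : ℝ) u v, f u (c • v) = c • f u v) : W →L[ℝ] W →L[ℝ] X :=
  LinearMap.toContinuousLinearMap
    ((LinearMap.toContinuousLinearMap (𝕜 := ℝ) (E := W) (F' := X)).toLinearMap.comp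
      (LinearMap.mk₂ ℝ f h1 h2 h3 h4))

theorem contDiffOn_of_apply₂ {Z : Type*} [NormedAddCommGroup Z] [NormedSpace ℝ Z] {O : Set Z}
    {B : Z → W →L[ℝ] W →L[ℝ] X} (h : ∀ u v, ContDiffOn ℝ ∞ (fun w ↦ B w u v) O) :
    ContDiffOn ℝ ∞ B O :=
  contDiffOn_clm_apply.2 fun u ↦ contDiffOn_clm_apply.2 fun v ↦ h u v

end Bilinear

/-! ### Local existence of adapted symplectic connections -/

section Existence

variable {W : Type*} [NormedAddCommGroup W] [NormedSpace ℝ W] [FiniteDimensional ℝ W]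
  {O : Set W} {e : W} {M : W → W →L[ℝ] W →L[ℝ] ℝ} {Γ : W → W →L[ℝ] W →L[ℝ] W}

namespace ConeForm

variable (h : ConeForm O e M)
include h

theorem fderiv_smooth : ContDiffOn ℝ ∞ (fderiv ℝ M) O :=
  h.smooth.fderiv_of_isOpen h.isOpen (by simp)

theorem fderiv_prim_smooth : ContDiffOn ℝ ∞ (fderiv ℝ (prim e M)) O :=
  h.prim_smooth.fderiv_of_isOpen h.isOpen (by simp)

theorem prim_inverse {w : W} (hw : w ∈ O) (l : W →L[ℝ] ℝ) :
    prim e M w ((M w).inverse l) = -(1 / 2 * l e) := by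
  rw [prim_apply, h.skew w hw, apply_inverse (h.nondegenerate w hw)]
  ring

/-- An intermediate connection, not yet symplectic, with `∇e = Id` and `∇λ = ½ M`. The last
condition prescribes only the `λ`-component of `Γ(u, v)`, and the vector `M⁻¹ l`, on which `λ` is
`-½`, is there to adjust it. -/
theorem exists_torsionFree (l : W →L[ℝ] ℝ) (hl : l e = 1) :
    ∃ Γ : W → W →L[ℝ] W →L[ℝ] W, ContDiffOn ℝ ∞ Γ O ∧ (∀ w ∈ O, ∀ u v, Γ w u v = Γ w v u) ∧
      (∀ w ∈ O, ∀ v, Γ w e v = v) ∧ (∀ w ∈ O, ∀ t : ℝ, Γ (w + t • e) = Γ w) ∧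
      ∀ w ∈ O, ∀ u v, prim e M w (Γ w u v) = fderiv ℝ (prim e M) w u v - 1 / 2 * M w u v := by
  -- The prescribed value of `λ(Γ(u, v))`, which is the symmetric part of the derivative of `λ`,
  -- minus what `l(u) v + l(v) u - l(u) l(v) e` already contributes.
  obtain ⟨s, hs⟩ : ∃ s : W → W → W → ℝ, ∀ w u v, s w u v = 1 / 2 * (fderiv ℝ (prim e M) w u v +
      fderiv ℝ (prim e M) w v u) - l u * prim e M w v - l v * prim e M w u :=
    ⟨_, fun _ _ _ ↦ rfl⟩
  obtain ⟨Γ, hΓ⟩ : ∃ Γ : W → W →L[ℝ] W →L[ℝ] W, ∀ w u v, Γ w u v =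
      l u • v + l v • u - (l u * l v) • e - (2 * s w u v) • (M w).inverse l := by
    refine ⟨fun w ↦ mkBilin (fun u v ↦ l u • v + l v • u - (l u * l v) • e -
      (2 * s w u v) • (M w).inverse l) ?_ ?_ ?_ ?_, fun w u v ↦ rfl⟩ <;>
    · intros
      simp only [hs, map_add, map_smul, add_apply,
        smul_apply, smul_eq_mul]
      module
  have hσ : ∀ w ∈ O, ∀ u v, 1 / 2 * (fderiv ℝ (prim e M) w u v + fderiv ℝ (prim e M) w v u) =
      fderiv ℝ (prim e M) w u v - 1 / 2 * M w u v := by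
    intro w hw u v
    linarith [h.fderiv_prim_sub hw u v]
  refine ⟨Γ, contDiffOn_of_apply₂ fun u v ↦ ?_, fun w hw u v ↦ ?_, fun w hw v ↦ ?_,
    fun w hw t ↦ ?_, fun w hw u v ↦ ?_⟩
  · simp only [hΓ, hs]
    have h1 : ∀ u, ContDiffOn ℝ ∞ (fun w ↦ prim e M w u) O := fun u ↦
      h.prim_smooth.clm_apply contDiffOn_const
    have h2 : ∀ u v, ContDiffOn ℝ ∞ (fun w ↦ fderiv ℝ (prim e M) w u v) O := fun u v ↦
      (h.fderiv_prim_smooth.clm_apply contDiffOn_const).clm_apply contDiffOn_const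
    have h3 : ContDiffOn ℝ ∞ (fun w ↦ (M w).inverse l) O :=
      h.inverse_smooth.clm_apply contDiffOn_const
    exact contDiffOn_const.sub ((contDiffOn_const.mul (((contDiffOn_const.mul
      ((h2 u v).add (h2 v u))).sub (contDiffOn_const.mul (h1 v))).sub
      (contDiffOn_const.mul (h1 u)))).smul h3)
  · simp only [hΓ, hs]
    module
  · have h1 : fderiv ℝ (prim e M) w e v = 2 * prim e M w v := by
      have := fderiv_of_homogeneous (h.prim_differentiableAt hw) (h.prim_homogeneous hw)
      rw [this]
      rfl
    have h2 : s w e v = 0 := by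
      rw [hs, hσ w hw, h1, hl, h.apply_e, h.prim_self hw]
      ring
    rw [hΓ, h2, hl]
    module
  · refine ContinuousLinearMap.ext fun u ↦ ContinuousLinearMap.ext fun v ↦ ?_
    have h1 : fderiv ℝ (prim e M) (w + t • e) = Real.exp (2 * t) • fderiv ℝ (prim e M) w :=
      fderiv_add_smul h.isOpen (fun w hw ↦ h.prim_homogeneous hw t) hw (h.prim_differentiableAt hw)
    have h2 : s (w + t • e) u v = Real.exp (2 * t) * s w u v := by
      rw [hs, hs, h1, h.prim_homogeneous hw]
      simp only [smul_apply, smul_eq_mul]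
      ring
    rw [hΓ, hΓ, h2, h.inverse_homogeneous hw, smul_smul]
    congr 2
    rw [show 2 * (Real.exp (2 * t) * s w u v) * Real.exp (-(2 * t)) =
      2 * s w u v * (Real.exp (2 * t) * Real.exp (-(2 * t))) by ring, ← Real.exp_add]
    simp
  · rw [hΓ]
    simp only [map_add, map_sub, map_smul, h.prim_inverse hw, h.prim_self hw, hl, smul_eq_mul, hs,
      hσ w hw]
    ring

/-- The classical symmetrisation: if `T` is the covariant derivative of `M` for a torsion-free
connection, then adding `⅓ M⁻¹(T(u, v) + T(v, u))` makes `M` parallel. This uses that `T` is skew in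
its last two arguments and has zero cyclic sum because `M` is closed. -/
theorem exists_coneConn (l : W →L[ℝ] ℝ) (hl : l e = 1) : ∃ Γ, ConeConn O e M Γ := by
  obtain ⟨G, hG, hGs, hGe, hGt, hGp⟩ := h.exists_torsionFree l hl
  obtain ⟨T, hT⟩ : ∃ T : W → W → W → W →L[ℝ] ℝ, ∀ w u v, T w u v =
      fderiv ℝ M w u v - M w (G w u v) - (M w v).comp (G w u) := ⟨_, fun _ _ _ ↦ rfl⟩
  have hT' : ∀ w u v z, T w u v z = fderiv ℝ M w u v z - M w (G w u v) z - M w v (G w u z) := by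
    intro w u v z
    rw [hT]
    rfl
  have hskew : ∀ w ∈ O, ∀ u v z, T w u v z = -T w u z v := by
    intro w hw u v z
    rw [hT', hT', h.fderiv_skew hw, h.skew w hw _ z, h.skew w hw v]
    ring
  have hcyc : ∀ w ∈ O, ∀ u v z, T w u v z + T w v z u + T w z u v = 0 := by
    intro w hw u v z
    have := h.closed w hw u v z
    simp only [hT']
    rw [hGs w hw v u, hGs w hw z u, hGs w hw z v, h.skew w hw v (G w u z), h.skew w hw z (G w u v),
      h.skew w hw u (G w v z)]
    linarith
  have hTe : ∀ w ∈ O, ∀ v, T w e v = 0 := by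
    intro w hw v
    refine ContinuousLinearMap.ext fun z ↦ ?_
    rw [hT', hGe w hw, hGe w hw, h.fderiv_e hw]
    change 2 * M w v z - _ - _ = (0 : ℝ)
    ring
  -- This is where `∇λ = ½ M` for the intermediate connection enters; it makes the correction vanish
  -- when an argument is `e`, so that `∇e = Id` survives.
  have hTe' : ∀ w ∈ O, ∀ u, T w u e = 0 := by
    intro w hw u
    refine ContinuousLinearMap.ext fun z ↦ ?_
    have h1 := hGp w hw u z
    rw [h.fderiv_prim hw] at h1
    rw [hT', hGs w hw u e, hGe w hw, h.apply_e (G w u z), h1]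
    change _ = (0 : ℝ)
    ring
  obtain ⟨Γ, hΓ⟩ : ∃ Γ : W → W →L[ℝ] W →L[ℝ] W, ∀ w u v, Γ w u v =
      G w u v + (1 / 3 : ℝ) • ((M w).inverse (T w u v) + (M w).inverse (T w v u)) := by
    refine ⟨fun w ↦ mkBilin (fun u v ↦ G w u v +
      (1 / 3 : ℝ) • ((M w).inverse (T w u v) + (M w).inverse (T w v u))) ?_ ?_ ?_ ?_,
      fun w u v ↦ rfl⟩ <;>
    · intros
      simp only [hT, map_add, map_sub, map_smul, add_apply,
        smul_apply, ContinuousLinearMap.comp_add, ContinuousLinearMap.add_comp,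
        ContinuousLinearMap.comp_smul, ContinuousLinearMap.smul_comp]
      module
  refine ⟨Γ, contDiffOn_of_apply₂ fun u v ↦ ?_, fun w hw u v ↦ ?_, fun w hw v ↦ ?_,
    fun w hw t ↦ ?_, fun w hw u v z ↦ ?_⟩
  · simp only [hΓ]
    have h1 : ∀ u v, ContDiffOn ℝ ∞ (fun w ↦ G w u v) O := fun u v ↦
      (hG.clm_apply contDiffOn_const).clm_apply contDiffOn_const
    have h2 : ∀ u v, ContDiffOn ℝ ∞ (fun w ↦ T w u v) O := by
      intro u v
      refine contDiffOn_clm_apply.2 fun z ↦ ?_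
      simp only [hT']
      exact (((h.fderiv_smooth.clm_apply contDiffOn_const).clm_apply contDiffOn_const).clm_apply
        contDiffOn_const |>.sub ((h.smooth.clm_apply (h1 u v)).clm_apply contDiffOn_const)).sub
        ((h.smooth.clm_apply contDiffOn_const).clm_apply (h1 u z))
    exact (h1 u v).add (((h.inverse_smooth.clm_apply (h2 u v)).add
      (h.inverse_smooth.clm_apply (h2 v u))).const_smul (1 / 3 : ℝ))
  · rw [hΓ, hΓ, hGs w hw, add_comm ((M w).inverse (T w u v))]
  · rw [hΓ, hTe w hw, hTe' w hw, hGe w hw]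
    simp
  · refine ContinuousLinearMap.ext fun u ↦ ContinuousLinearMap.ext fun v ↦ ?_
    have h1 : fderiv ℝ M (w + t • e) = Real.exp (2 * t) • fderiv ℝ M w :=
      fderiv_add_smul (X := W →L[ℝ] W →L[ℝ] ℝ) (f := M) h.isOpen
        (fun w hw ↦ h.homogeneous w hw t) hw (h.differentiableAt hw)
    have h2 : ∀ u v, (M (w + t • e)).inverse (T (w + t • e) u v) = (M w).inverse (T w u v) := by
      intro u v
      have : T (w + t • e) u v = Real.exp (2 * t) • T w u v := by
        refine ContinuousLinearMap.ext fun z ↦ ?_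
        simp only [hT', h1, h.homogeneous w hw, hGt w hw, smul_apply,
          smul_eq_mul]
        ring
      rw [this, h.inverse_homogeneous hw, map_smul, smul_smul, ← Real.exp_add]
      simp
    rw [hΓ, hΓ, hGt w hw, h2, h2]
  · have h1 : ∀ l z, M w ((M w).inverse l) z = l z := fun l z ↦ by
      rw [apply_inverse (h.nondegenerate w hw)]
    have h2 : ∀ l, M w v ((M w).inverse l) = -l v := fun l ↦ by
      rw [h.skew w hw, h1]
    rw [hΓ, hΓ]
    simp only [map_add, map_smul, add_apply, smul_apply,
      h1, h2, smul_eq_mul]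
    have h3 := hcyc w hw u v z
    have h4 := hskew w hw u z v
    have h5 := hskew w hw v u z
    have h6 := hT' w u v z
    linarith

end ConeForm

end Existence

/-! ### Curvature and Ricci tensor in coordinates -/

section Curvature

variable {W : Type*} [NormedAddCommGroup W] [NormedSpace ℝ W] [FiniteDimensional ℝ W]
  {O : Set W} {e : W} {M : W → W →L[ℝ] W →L[ℝ] ℝ} {Γ : W → W →L[ℝ] W →L[ℝ] W}

/-- The curvature endomorphism `R(u, v)` of a connection with Christoffel symbols `Γ`. -/
def curv (Γ : W → W →L[ℝ] W →L[ℝ] W) (w u v : W) : W →L[ℝ] W :=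
  fderiv ℝ Γ w u v - fderiv ℝ Γ w v u + (Γ w u).comp (Γ w v) - (Γ w v).comp (Γ w u)

theorem curv_apply (w u v z : W) : curv Γ w u v z =
    fderiv ℝ Γ w u v z - fderiv ℝ Γ w v u z + Γ w u (Γ w v z) - Γ w v (Γ w u z) := rfl

theorem curv_swap (w u v z : W) : curv Γ w u v z = -curv Γ w v u z := by
  rw [curv_apply, curv_apply]
  abel

/-- The endomorphism `u ↦ R(u, v) z`. -/
def ricEnd (Γ : W → W →L[ℝ] W →L[ℝ] W) (w v z : W) : W →L[ℝ] W :=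
  ((fderiv ℝ Γ w).flip v).flip z - (fderiv ℝ Γ w v).flip z + (Γ w).flip (Γ w v z) -
    (Γ w v).comp ((Γ w).flip z)

theorem ricEnd_apply (w u v z : W) : ricEnd Γ w v z u = curv Γ w u v z := rfl

/-- The Ricci tensor of a connection with Christoffel symbols `Γ`. -/
def ric (Γ : W → W →L[ℝ] W →L[ℝ] W) (w : W) : W →L[ℝ] W →L[ℝ] ℝ :=
  mkBilin (fun v z ↦ tr (ricEnd Γ w v z))
    (fun u v z ↦ by
      rw [← map_add]
      congr 1
      ext x
      simp only [ricEnd_apply, curv_apply, map_add, add_apply]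
      abel)
    (fun c u z ↦ by
      rw [← map_smul]
      congr 1
      ext x
      simp only [ricEnd_apply, curv_apply, map_smul, smul_apply]
      module)
    (fun u v z ↦ by
      rw [← map_add]
      congr 1
      ext x
      simp only [ricEnd_apply, curv_apply, map_add, add_apply])
    (fun c u z ↦ by
      rw [← map_smul]
      congr 1
      ext x
      simp only [ricEnd_apply, curv_apply, map_smul, smul_apply])

theorem ric_apply (w v z : W) : ric Γ w v z = tr (ricEnd Γ w v z) := rfl

theorem hasFDerivAt_apply₂ {X : Type*} [NormedAddCommGroup X] [NormedSpace ℝ X]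
    {B : W → W →L[ℝ] W →L[ℝ] X} {w : W} (hB : DifferentiableAt ℝ B w) (u v : W) :
    HasFDerivAt (fun w ↦ B w u v) (((fderiv ℝ B w).flip u).flip v) w := by
  have := (hB.hasFDerivAt.clm_apply (hasFDerivAt_const u w)).clm_apply (hasFDerivAt_const v w)
  refine this.congr_fderiv ?_
  ext x
  simp

theorem hasFDerivAt_apply₁ {X : Type*} [NormedAddCommGroup X] [NormedSpace ℝ X]
    {B : W → W →L[ℝ] X} {w : W} (hB : DifferentiableAt ℝ B w) (u : W) :
    HasFDerivAt (fun w ↦ B w u) ((fderiv ℝ B w).flip u) w := by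
  refine (hB.hasFDerivAt.clm_apply (hasFDerivAt_const u w)).congr_fderiv ?_
  ext x
  simp

namespace ConeConn

variable (h : ConeForm O e M) (hΓ : ConeConn O e M Γ)
include h hΓ

theorem fderiv_smooth : ContDiffOn ℝ ∞ (fderiv ℝ Γ) O :=
  hΓ.smooth.fderiv_of_isOpen h.isOpen (by simp)

theorem fderiv_symm {w : W} (hw : w ∈ O) (x u v : W) :
    fderiv ℝ Γ w x u v = fderiv ℝ Γ w x v u := by
  have h1 := hasFDerivAt_apply₂ (hΓ.differentiableAt h hw)
  have h2 : (fun w ↦ Γ w u v) =ᶠ[𝓝 w] fun w ↦ Γ w v u := by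
    filter_upwards [h.isOpen.mem_nhds hw] with z hz using hΓ.symm z hz u v
  exact congrFun (congrArg DFunLike.coe (((h1 v u).congr_of_eventuallyEq h2).unique (h1 u v)).symm) x

theorem fderiv_unit {w : W} (hw : w ∈ O) (x v : W) : fderiv ℝ Γ w x e v = 0 := by
  have h1 := hasFDerivAt_apply₂ (hΓ.differentiableAt h hw) e v
  have h2 : (fun w ↦ Γ w e v) =ᶠ[𝓝 w] fun _ ↦ v := by
    filter_upwards [h.isOpen.mem_nhds hw] with z hz using hΓ.unit z hz v
  exact congrFun (congrArg DFunLike.coe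
    (((hasFDerivAt_const v w).congr_of_eventuallyEq h2).unique h1).symm) x

/-- The symbols are constant along `e` and `Γ(e, ·)` is the constant identity, so both derivative
terms vanish and the two products cancel. -/
theorem curv_e {w : W} (hw : w ∈ O) (v z : W) : curv Γ w e v z = 0 := by
  rw [curv_apply, hΓ.fderiv_e h hw, hΓ.fderiv_unit h hw, hΓ.unit w hw, hΓ.unit w hw]
  simp

theorem bianchi {w : W} (hw : w ∈ O) (u v z : W) :
    curv Γ w u v z + curv Γ w v z u + curv Γ w z u v = 0 := by
  simp only [curv_apply]
  rw [hΓ.fderiv_symm h hw u v z, hΓ.fderiv_symm h hw v u z, hΓ.fderiv_symm h hw z u v,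
    hΓ.symm w hw v z, hΓ.symm w hw u z, hΓ.symm w hw u v]
  abel

/-- The equation `∇M = 0` is differentiated once more; symmetry of the second derivative of `M`
leaves the action of the curvature on `M`. -/
theorem curv_skew {w : W} (hw : w ∈ O) (x u v z : W) :
    M w (curv Γ w x u v) z + M w v (curv Γ w x u z) = 0 := by
  have hM := h.differentiableAt hw
  have hdM : DifferentiableAt ℝ (fderiv ℝ M) w :=
    (h.fderiv_smooth.contDiffAt (h.isOpen.mem_nhds hw)).differentiableAt (by simp)
  have hG := hΓ.differentiableAt h hw
  have hsymm : ∀ x u, fderiv ℝ (fderiv ℝ M) w x u = fderiv ℝ (fderiv ℝ M) w u x := fun x u ↦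
    ((h.contDiffAt hw).isSymmSndFDerivAt
      (by rw [minSmoothness_of_isRCLikeNormedField]; exact ENat.LEInfty.out)) x u
  have key : ∀ x u, fderiv ℝ (fderiv ℝ M) w x u v z =
      (fderiv ℝ M w x (Γ w u v) z + M w (fderiv ℝ Γ w x u v) z) +
        (fderiv ℝ M w x v (Γ w u z) + M w v (fderiv ℝ Γ w x u z)) := by
    intro x u
    have h1 : HasFDerivAt (fun w ↦ fderiv ℝ M w u v z)
        ((((fderiv ℝ (fderiv ℝ M) w).flip u).flip v).flip z) w := by
      refine (((hdM.hasFDerivAt.clm_apply (hasFDerivAt_const u w)).clm_apply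
        (hasFDerivAt_const v w)).clm_apply (hasFDerivAt_const z w)).congr_fderiv ?_
      ext x
      simp
    have h2 := ((hM.hasFDerivAt.clm_apply (hasFDerivAt_apply₂ hG u v)).clm_apply
      (hasFDerivAt_const z w)).add ((hM.hasFDerivAt.clm_apply (hasFDerivAt_const v w)).clm_apply
      (hasFDerivAt_apply₂ hG u z))
    have h3 : (fun w ↦ fderiv ℝ M w u v z) =ᶠ[𝓝 w]
        fun w ↦ M w (Γ w u v) z + M w v (Γ w u z) := by
      filter_upwards [h.isOpen.mem_nhds hw] with y hy using hΓ.parallel y hy u v z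
    have h4 := congrFun (congrArg DFunLike.coe (h1.unique (h2.congr_of_eventuallyEq h3))) x
    simpa [add_comm] using h4
  have h1 := key x u
  have h2 := key u x
  rw [hsymm x u] at h1
  simp only [hΓ.parallel w hw] at h1 h2
  simp only [curv_apply, map_add, map_sub, add_apply, sub_apply]
  linarith

/-- An infinitesimally symplectic endomorphism is minus its own adjoint, so it has trace zero. -/
theorem tr_curv {w : W} (hw : w ∈ O) (u v : W) : tr (curv Γ w u v) = 0 := by
  have h1 : tr (curv Γ w u v) = tr (-curv Γ w u v) :=
    tr_eq_of_adjoint (h.nondegenerate w hw) fun x y ↦ by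
      have := hΓ.curv_skew h hw u v x y
      rw [neg_apply, map_neg]
      linarith
  rw [map_neg] at h1
  linarith

/-- By the first Bianchi identity the skew part of the Ricci tensor is a trace of curvature
endomorphisms, which vanishes. -/
theorem ric_symm {w : W} (hw : w ∈ O) (v z : W) : ric Γ w v z = ric Γ w z v := by
  have h1 : ricEnd Γ w v z - ricEnd Γ w z v = -curv Γ w v z := by
    ext x
    have := hΓ.bianchi h hw x v z
    rw [sub_apply, neg_apply, ricEnd_apply, ricEnd_apply, curv_swap w x z v,
      eq_neg_iff_add_eq_zero]
    rw [← this]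
    abel
  have h2 := congrArg tr h1
  rw [map_sub, map_neg, hΓ.tr_curv h hw] at h2
  rw [ric_apply, ric_apply]
  linarith

theorem ric_e {w : W} (hw : w ∈ O) (z : W) : ric Γ w e z = 0 := by
  have : ricEnd Γ w e z = 0 := by
    ext x
    rw [ricEnd_apply, curv_swap, hΓ.curv_e h hw]
    simp
  rw [ric_apply, this, map_zero]

theorem ric_invariant {w : W} (hw : w ∈ O) (t : ℝ) : ric Γ (w + t • e) = ric Γ w := by
  have h1 : fderiv ℝ Γ (w + t • e) = fderiv ℝ Γ w := by
    have := fderiv_add_smul (X := W →L[ℝ] W →L[ℝ] W) (f := Γ) (t := t) (a := 1) h.isOpen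
      (fun w hw ↦ by rw [hΓ.invariant w hw, one_smul]) hw (hΓ.differentiableAt h hw)
    rwa [one_smul] at this
  refine ContinuousLinearMap.ext fun u ↦ ContinuousLinearMap.ext fun v ↦ ?_
  rw [ric_apply, ric_apply, ricEnd, ricEnd, h1, hΓ.invariant w hw]

theorem ric_smooth : ContDiffOn ℝ ∞ (ric Γ) O := by
  refine contDiffOn_of_apply₂ fun v z ↦ ?_
  have h1 : ContDiffOn ℝ ∞ (fun w ↦ ricEnd Γ w v z) O := by
    refine contDiffOn_clm_apply.2 fun u ↦ ?_
    have h1 : ∀ u v, ContDiffOn ℝ ∞ (fun w ↦ Γ w u v) O := fun u v ↦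
      (hΓ.smooth.clm_apply contDiffOn_const).clm_apply contDiffOn_const
    have h2 : ∀ x u v, ContDiffOn ℝ ∞ (fun w ↦ fderiv ℝ Γ w x u v) O := fun x u v ↦
      (((hΓ.fderiv_smooth h).clm_apply contDiffOn_const).clm_apply contDiffOn_const).clm_apply
        contDiffOn_const
    have h3 : ∀ u v z, ContDiffOn ℝ ∞ (fun w ↦ Γ w u (Γ w v z)) O := fun u v z ↦
      (hΓ.smooth.clm_apply contDiffOn_const).clm_apply (h1 v z)
    exact (((h2 u v z).sub (h2 v u z)).add (h3 u v z)).sub (h3 v u z)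
  exact (LinearMap.toContinuousLinearMap (tr (W := W))).contDiff.comp_contDiffOn h1

end ConeConn

end Curvature

/-! ### Effect of the correction tensor on the Ricci tensor -/

section Correction

variable {W : Type*} [NormedAddCommGroup W] [NormedSpace ℝ W] [FiniteDimensional ℝ W]
  {O : Set W} {e : W} {M : W → W →L[ℝ] W →L[ℝ] ℝ} {Γ : W → W →L[ℝ] W →L[ℝ] W}
  {τ : W → W →L[ℝ] W →L[ℝ] ℝ}

/-- The endomorphism `t` with `M(t u, v) = τ(u, v)`. -/
def raise (M τ : W → W →L[ℝ] W →L[ℝ] ℝ) (w : W) : W →L[ℝ] W := (M w).inverse.comp (τ w)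

theorem raise_apply (w u : W) : raise M τ w u = (M w).inverse (τ w u) := rfl

/-- The difference tensor `λ(u) t v + λ(v) t u + ½ τ(u, v) e` attached to `τ`. -/
def corr (e : W) (M τ : W → W →L[ℝ] W →L[ℝ] ℝ) (w : W) : W →L[ℝ] W →L[ℝ] W :=
  mkBilin (fun u v ↦ prim e M w u • raise M τ w v + prim e M w v • raise M τ w u +
      (1 / 2 * τ w u v) • e)
    (fun u u' v ↦ by simp only [map_add, add_apply]; module)
    (fun c u v ↦ by simp only [map_smul, smul_apply, smul_eq_mul]; module)
    (fun u v v' ↦ by simp only [map_add]; module)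
    (fun c u v ↦ by simp only [map_smul, smul_eq_mul]; module)

theorem corr_apply (w u v : W) : corr e M τ w u v =
    prim e M w u • raise M τ w v + prim e M w v • raise M τ w u + (1 / 2 * τ w u v) • e := rfl

/-- A symmetric horizontal tensor, invariant under translations along `e`. -/
structure Horizontal (O : Set W) (e : W) (τ : W → W →L[ℝ] W →L[ℝ] ℝ) : Prop where
  smooth : ContDiffOn ℝ ∞ τ O
  symm : ∀ w ∈ O, ∀ u v, τ w u v = τ w v u
  apply_e : ∀ w ∈ O, ∀ v, τ w e v = 0
  invariant : ∀ w ∈ O, ∀ t : ℝ, τ (w + t • e) = τ w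

namespace Horizontal

variable (h : ConeForm O e M) (hτ : Horizontal O e τ)
include h hτ

theorem differentiableAt {w : W} (hw : w ∈ O) : DifferentiableAt ℝ τ w :=
  (hτ.smooth.contDiffAt (h.isOpen.mem_nhds hw)).differentiableAt (by simp)

theorem fderiv_e {w : W} (hw : w ∈ O) : fderiv ℝ τ w e = 0 :=
  fderiv_of_invariant (X := W →L[ℝ] W →L[ℝ] ℝ) (f := τ) (hτ.differentiableAt h hw)
    (hτ.invariant w hw)

omit hτ in
theorem apply_raise {w : W} (hw : w ∈ O) (u v : W) : M w (raise M τ w u) v = τ w u v := by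
  rw [raise_apply, apply_inverse (h.nondegenerate w hw)]

omit hτ in
theorem apply_raise_right {w : W} (hw : w ∈ O) (u v : W) :
    M w v (raise M τ w u) = -τ w u v := by
  rw [h.skew w hw, apply_raise h hw]

theorem prim_raise {w : W} (hw : w ∈ O) (u : W) : prim e M w (raise M τ w u) = 0 := by
  rw [prim_apply, apply_raise_right h hw, hτ.symm w hw, hτ.apply_e w hw]
  simp

theorem raise_e {w : W} (hw : w ∈ O) : raise M τ w e = 0 := by
  have : τ w e = 0 := ContinuousLinearMap.ext fun v ↦ hτ.apply_e w hw v
  rw [raise_apply, this, map_zero]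

theorem apply_e_right {w : W} (hw : w ∈ O) (u : W) : τ w u e = 0 := by
  rw [hτ.symm w hw, hτ.apply_e w hw]

theorem raise_smooth : ContDiffOn ℝ ∞ (raise M τ) O := h.inverse_smooth.clm_comp hτ.smooth

theorem raise_differentiableAt {w : W} (hw : w ∈ O) : DifferentiableAt ℝ (raise M τ) w :=
  ((hτ.raise_smooth h).contDiffAt (h.isOpen.mem_nhds hw)).differentiableAt (by simp)

theorem corr_smooth : ContDiffOn ℝ ∞ (corr e M τ) O := by
  refine contDiffOn_of_apply₂ fun u v ↦ ?_
  have h1 : ∀ u, ContDiffOn ℝ ∞ (fun w ↦ prim e M w u) O := fun u ↦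
    h.prim_smooth.clm_apply contDiffOn_const
  have h2 : ∀ u, ContDiffOn ℝ ∞ (fun w ↦ raise M τ w u) O := fun u ↦
    (hτ.raise_smooth h).clm_apply contDiffOn_const
  have h3 : ContDiffOn ℝ ∞ (fun w ↦ τ w u v) O :=
    (hτ.smooth.clm_apply contDiffOn_const).clm_apply contDiffOn_const
  exact (((h1 u).smul (h2 v)).add ((h1 v).smul (h2 u))).add
    ((contDiffOn_const.mul h3).smul contDiffOn_const)

theorem corr_differentiableAt {w : W} (hw : w ∈ O) : DifferentiableAt ℝ (corr e M τ) w :=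
  ((hτ.corr_smooth h).contDiffAt (h.isOpen.mem_nhds hw)).differentiableAt (by simp)

theorem corr_symm {w : W} (hw : w ∈ O) (u v : W) : corr e M τ w u v = corr e M τ w v u := by
  rw [corr_apply, corr_apply, hτ.symm w hw u v]
  abel

theorem corr_e {w : W} (hw : w ∈ O) (v : W) : corr e M τ w e v = 0 := by
  rw [corr_apply, h.prim_self hw, hτ.raise_e h hw, hτ.apply_e w hw]
  simp

/-- Because `M(e, z) = 2 λ(z)`, the expression `M(corr(u, v), z)` equals `λ(u)τ(v, z) + λ(v)τ(u, z)
+ λ(z)τ(u, v)`. It is totally symmetric, which is exactly what keeps `M` parallel and the torsion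
zero; this fixes the factor `½` in front of `e`. The opposite scalings of `λ` and of `raise` give
invariance. -/
theorem add_corr (hΓ : ConeConn O e M Γ) : ConeConn O e M (fun w ↦ Γ w + corr e M τ w) := by
  refine ⟨hΓ.smooth.add (hτ.corr_smooth h), fun w hw u v ↦ ?_, fun w hw v ↦ ?_,
    fun w hw t ↦ ?_, fun w hw u v z ↦ ?_⟩
  · rw [add_apply, add_apply, add_apply, add_apply, hΓ.symm w hw, hτ.corr_symm h hw]
  · rw [add_apply, add_apply, hΓ.unit w hw, hτ.corr_e h hw, add_zero]
  · rw [hΓ.invariant w hw]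
    congr 1
    refine ContinuousLinearMap.ext fun u ↦ ContinuousLinearMap.ext fun v ↦ ?_
    have h1 : ∀ u v, prim e M (w + t • e) u • raise M τ (w + t • e) v =
        prim e M w u • raise M τ w v := by
      intro u v
      rw [raise_apply, raise_apply, hτ.invariant w hw, h.prim_homogeneous hw,
        h.inverse_homogeneous hw, smul_apply, smul_smul, smul_eq_mul]
      congr 1
      rw [show Real.exp (2 * t) * prim e M w u * Real.exp (-(2 * t)) =
        prim e M w u * (Real.exp (2 * t) * Real.exp (-(2 * t))) by ring, ← Real.exp_add]
      simp
    rw [corr_apply, corr_apply, h1, h1, hτ.invariant w hw]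
  · rw [hΓ.parallel w hw, add_apply, add_apply, add_apply, corr_apply, corr_apply]
    simp only [map_add, map_smul, add_apply, smul_apply, smul_eq_mul, apply_raise h hw,
      apply_raise_right h hw, h.apply_e, h.apply_right_e hw]
    rw [hτ.symm w hw v z, hτ.symm w hw u z, hτ.symm w hw u v]
    ring

/-- Symmetry of `τ` makes the endomorphism minus its own `M`-adjoint. -/
theorem tr_raise {w : W} (hw : w ∈ O) : tr (raise M τ w) = 0 := by
  have h1 : tr (raise M τ w) = tr (-raise M τ w) :=
    tr_eq_of_adjoint (h.nondegenerate w hw) fun x y ↦ by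
      rw [neg_apply, map_neg, apply_raise h hw, apply_raise_right h hw, hτ.symm w hw, neg_neg]
  rw [map_neg] at h1
  linarith

/-- Removes from the variation of the Ricci tensor all the terms in which the correction is traced
in its first argument. -/
theorem tr_corr {w : W} (hw : w ∈ O) (z : W) : tr ((corr e M τ w).flip z) = 0 := by
  have h1 : (corr e M τ w).flip z = (prim e M w).smulRight (raise M τ w z) +
      prim e M w z • raise M τ w + (1 / 2 : ℝ) • ((τ w).flip z).smulRight e := by
    ext x
    simp only [add_apply, smul_apply, ContinuousLinearMap.flip_apply,
      ContinuousLinearMap.smulRight_apply, corr_apply]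
    module
  rw [h1, map_add, map_add, map_smul, map_smul, tr_smulRight, tr_smulRight, hτ.prim_raise h hw,
    hτ.tr_raise h hw, ContinuousLinearMap.flip_apply, hτ.apply_e w hw]
  simp

theorem tr_fderiv_corr {w : W} (hw : w ∈ O) (v z : W) :
    tr ((fderiv ℝ (corr e M τ) w v).flip z) = 0 := by
  let L : (W →L[ℝ] W →L[ℝ] W) →L[ℝ] ℝ :=
    (LinearMap.toContinuousLinearMap (tr (W := W))).comp
      ((ContinuousLinearMap.apply ℝ (W →L[ℝ] W) z).comp
        (ContinuousLinearMap.flipₗᵢ ℝ W W W).toContinuousLinearEquiv.toContinuousLinearMap)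
  have h1 := L.hasFDerivAt.comp w (hτ.corr_differentiableAt h hw).hasFDerivAt
  have h2 : L ∘ corr e M τ =ᶠ[𝓝 w] fun _ ↦ (0 : ℝ) := by
    filter_upwards [h.isOpen.mem_nhds hw] with y hy using hτ.tr_corr h hy z
  have h3 := ((hasFDerivAt_const (0 : ℝ) w).congr_of_eventuallyEq h2).unique h1
  exact (congrFun (congrArg DFunLike.coe h3) v).symm

end Horizontal

/-- The divergence of the endomorphism field `t`. -/
def divEnd (Γ : W → W →L[ℝ] W →L[ℝ] W) (t : W → W →L[ℝ] W) (w z : W) : ℝ :=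
  tr ((fderiv ℝ t w).flip z + (Γ w).flip (t w z) - (t w).comp ((Γ w).flip z))

theorem ricEnd_add {A : W → W →L[ℝ] W →L[ℝ] W} {w : W} (hG : DifferentiableAt ℝ Γ w)
    (hA : DifferentiableAt ℝ A w) (v z : W) :
    ricEnd (fun w ↦ Γ w + A w) w v z = ricEnd Γ w v z +
      (((fderiv ℝ A w).flip v).flip z - (fderiv ℝ A w v).flip z + (A w).flip (Γ w v z) +
        (Γ w).flip (A w v z) + (A w).flip (A w v z) - (A w v).comp ((Γ w).flip z) -
        (Γ w v).comp ((A w).flip z) - (A w v).comp ((A w).flip z)) := by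
  have h1 : fderiv ℝ (fun w ↦ Γ w + A w) w = fderiv ℝ Γ w + fderiv ℝ A w :=
    fderiv_fun_add (F := W →L[ℝ] W →L[ℝ] W) hG hA
  ext u
  simp only [ricEnd_apply, curv_apply, h1, add_apply, sub_apply, map_add,
    ContinuousLinearMap.flip_apply, ContinuousLinearMap.comp_apply]
  abel

/-- In invariant form `Ric' = Ric + (d/2) τ + λ ⊗ δ + δ ⊗ λ - tr(t²) λ ⊗ λ`, where `t` is `raise M
τ` and `δ` its divergence. Every summand beyond `τ` contains a factor `λ`, and this makes the
stepwise elimination possible. -/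
theorem ric_add_corr (h : ConeForm O e M) (hτ : Horizontal O e τ) (hΓ : ConeConn O e M Γ)
    {w : W} (hw : w ∈ O) (v z : W) :
    ric (fun w ↦ Γ w + corr e M τ w) w v z = ric Γ w v z +
      (Module.finrank ℝ W / 2 : ℝ) * τ w v z + prim e M w v * divEnd Γ (raise M τ) w z +
      prim e M w z * divEnd Γ (raise M τ) w v -
      prim e M w v * prim e M w z * tr ((raise M τ w).comp (raise M τ w)) := by
  set l := prim e M w with hl
  set t := raise M τ w with ht
  set dt := fderiv ℝ (raise M τ) w with hdt
  have hlt : ∀ x, l (t x) = 0 := hτ.prim_raise h hw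
  have hle : l e = 0 := h.prim_self hw
  have hte : t e = 0 := hτ.raise_e h hw
  -- Each contribution is decomposed into rank-one endomorphisms, whose traces are evaluations, and
  -- a few terms belonging to `divEnd` or to `t²`. The derivative of `λ` is replaced by `½ M + λ ∘
  -- Γ`.
  have e1 : ((fderiv ℝ (corr e M τ) w).flip v).flip z =
      ((1 / 2 : ℝ) • (M w).flip v + l.comp ((Γ w).flip v)).smulRight (t z) + l v • dt.flip z +
      (((1 / 2 : ℝ) • (M w).flip z + l.comp ((Γ w).flip z)).smulRight (t v) + l z • dt.flip v) +
      ((1 / 2 : ℝ) • ((fderiv ℝ τ w).flip v).flip z).smulRight e := by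
    have a1 : ∀ u v, HasFDerivAt (fun w ↦ prim e M w u • raise M τ w v) _ w := fun u v ↦
      (hasFDerivAt_apply₁ (h.prim_differentiableAt hw) u).smul
        (hasFDerivAt_apply₁ (hτ.raise_differentiableAt h hw) v)
    have a2 : HasFDerivAt (fun w ↦ (1 / 2 * τ w v z) • e) _ w :=
      ((hasFDerivAt_apply₂ (hτ.differentiableAt h hw) v z).const_mul (1 / 2 : ℝ)).smul_const e
    have a3 := (hasFDerivAt_apply₂ (hτ.corr_differentiableAt h hw) v z).unique
      (((a1 v z).add (a1 z v)).add a2)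
    rw [a3]
    ext u
    simp only [add_apply, smul_apply, ContinuousLinearMap.flip_apply,
      ContinuousLinearMap.smulRight_apply, ContinuousLinearMap.comp_apply,
      hΓ.fderiv_prim h hw, ← hl, ← ht, ← hdt, smul_eq_mul]
    module
  have e2 : (Γ w).flip (corr e M τ w v z) = l v • (Γ w).flip (t z) + l z • (Γ w).flip (t v) +
      (1 / 2 * τ w v z) • ContinuousLinearMap.id ℝ W := by
    ext u
    simp only [corr_apply, map_add, map_smul, add_apply, smul_apply,
      ContinuousLinearMap.flip_apply, ContinuousLinearMap.id_apply, hΓ.symm w hw u e,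
      hΓ.unit w hw, ← hl, ← ht]
  have e3 : (corr e M τ w v).comp ((Γ w).flip z) = l v • t.comp ((Γ w).flip z) +
      (l.comp ((Γ w).flip z)).smulRight (t v) +
      ((1 / 2 : ℝ) • (τ w v).comp ((Γ w).flip z)).smulRight e := by
    ext u
    simp only [corr_apply, add_apply, smul_apply, ContinuousLinearMap.flip_apply,
      ContinuousLinearMap.smulRight_apply, ContinuousLinearMap.comp_apply, ← hl, ← ht,
      smul_eq_mul]
  have e4 : (Γ w v).comp ((corr e M τ w).flip z) = l.smulRight (Γ w v (t z)) +
      l z • (Γ w v).comp t + ((1 / 2 : ℝ) • (τ w).flip z).smulRight v := by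
    ext u
    simp only [corr_apply, add_apply, smul_apply, ContinuousLinearMap.flip_apply, map_add,
      map_smul, ContinuousLinearMap.smulRight_apply, ContinuousLinearMap.comp_apply, ← hl, ← ht,
      smul_eq_mul, hΓ.symm w hw v e, hΓ.unit w hw]
  have e5 : (corr e M τ w v).comp ((corr e M τ w).flip z) =
      l.smulRight (l v • t (t z) + (1 / 2 * τ w v (t z)) • e) + (l z * l v) • t.comp t +
      l z • ((1 / 2 : ℝ) • (τ w v).comp t).smulRight e := by
    ext u
    simp only [corr_apply, add_apply, smul_apply, ContinuousLinearMap.flip_apply, map_add,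
      map_smul, ContinuousLinearMap.smulRight_apply, ContinuousLinearMap.comp_apply, ← hl, ← ht,
      smul_eq_mul, hlt, hle, hte, hτ.apply_e_right h hw]
    module
  rw [ric_apply, ricEnd_add (hΓ.differentiableAt h hw) (hτ.corr_differentiableAt h hw), e1, e2,
    e3, e4, e5]
  simp only [map_add, map_sub, map_smul, tr_smulRight, hτ.tr_fderiv_corr h hw, hτ.tr_corr h hw,
    add_apply, smul_apply, ContinuousLinearMap.comp_apply, ContinuousLinearMap.flip_apply,
    hτ.fderiv_e h hw, hlt, hle, hte, hΓ.unit w hw, tr_id, divEnd, ← ht, ← hdt, smul_eq_mul,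
    ric_apply, map_zero, tr_comp_comm (Γ w v) t]
  have e6 : tr (t.comp ((Γ w).flip v)) = tr (t.comp (Γ w v)) := by
    congr 2
    ext u
    exact hΓ.symm w hw u v
  rw [e6, hΓ.symm w hw (t z) v, show (M w) (t z) v = τ w z v from
    Horizontal.apply_raise h hw z v, show (M w) (t v) z = τ w v z from
    Horizontal.apply_raise h hw v z, hτ.symm w hw z v]
  simp
  ring

end Correction

/-! ### Elimination of the Ricci tensor in three steps -/

section RicciFlat

variable {W : Type*} [NormedAddCommGroup W] [NormedSpace ℝ W] [FiniteDimensional ℝ W]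
  {O : Set W} {e : W} {M : W → W →L[ℝ] W →L[ℝ] ℝ} {Γ : W → W →L[ℝ] W →L[ℝ] W}
  {τ : W → W →L[ℝ] W →L[ℝ] ℝ}

/-- The connection corrected by the multiple `a` of its Ricci tensor. -/
def improve (e : W) (M : W → W →L[ℝ] W →L[ℝ] ℝ) (a : ℝ) (Γ : W → W →L[ℝ] W →L[ℝ] W) :
    W → W →L[ℝ] W →L[ℝ] W :=
  fun w ↦ Γ w + corr e M (fun w ↦ a • ric Γ w) w

namespace ConeConn

variable (h : ConeForm O e M) (hΓ : ConeConn O e M Γ)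
include h hΓ

theorem horizontal (a : ℝ) : Horizontal O e (fun w ↦ a • ric Γ w) where
  smooth := (hΓ.ric_smooth h).const_smul a
  symm w hw u v := by rw [smul_apply, smul_apply, smul_apply, smul_apply, hΓ.ric_symm h hw]
  apply_e w hw v := by rw [smul_apply, smul_apply, hΓ.ric_e h hw, smul_zero]
  invariant w hw t := by rw [hΓ.ric_invariant h hw]

theorem improve (a : ℝ) : ConeConn O e M (improve e M a Γ) :=
  (hΓ.horizontal h a).add_corr h hΓ

theorem ric_improve (a : ℝ) {w : W} (hw : w ∈ O) (v z : W) :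
    ric (SymplecticInduction.improve e M a Γ) w v z = (1 + Module.finrank ℝ W / 2 * a) * ric Γ w v z +
      prim e M w v * divEnd Γ (raise M fun w ↦ a • ric Γ w) w z +
      prim e M w z * divEnd Γ (raise M fun w ↦ a • ric Γ w) w v -
      prim e M w v * prim e M w z * tr ((raise M (fun w ↦ a • ric Γ w) w).comp
        (raise M (fun w ↦ a • ric Γ w) w)) := by
  have := ric_add_corr h (hΓ.horizontal h a) hΓ hw v z
  rw [show ric (SymplecticInduction.improve e M a Γ) w v z = _ from this]
  simp only [smul_apply, smul_eq_mul]
  ring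

end ConeConn

namespace Horizontal

variable (h : ConeForm O e M) (hτ : Horizontal O e τ) (he : e ≠ 0)
include h hτ he

/-- With `λ(z) ≠ 0` at `w`, hence nearby, every vector splits into a multiple of `z` and a vector of
`ker λ`. Expanding a symmetric form that vanishes on `ker λ` gives `ν = τ(z, ·)/λ(z) - τ(z, z) λ/(2
λ(z)²)`, which is differentiable as `z` is kept fixed. -/
theorem exists_factor (hker : ∀ w ∈ O, ∀ u v, prim e M w u = 0 → prim e M w v = 0 → τ w u v = 0)
    {w : W} (hw : w ∈ O) : ∃ ν : W → W →L[ℝ] ℝ, DifferentiableAt ℝ ν w ∧ ∀ᶠ y in 𝓝 w,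
      ∀ u v, τ y u v = prim e M y u * ν y v + ν y u * prim e M y v := by
  obtain ⟨z, hz⟩ := h.prim_ne_zero hw he
  have d1 : DifferentiableAt ℝ (fun y ↦ prim e M y z) w :=
    (hasFDerivAt_apply₁ (h.prim_differentiableAt hw) z).differentiableAt
  have d2 : DifferentiableAt ℝ (fun y ↦ τ y z) w :=
    (hasFDerivAt_apply₁ (hτ.differentiableAt h hw) z).differentiableAt
  have d3 : DifferentiableAt ℝ (fun y ↦ τ y z z) w :=
    (hasFDerivAt_apply₂ (hτ.differentiableAt h hw) z z).differentiableAt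
  refine ⟨fun y ↦ (prim e M y z)⁻¹ • τ y z -
    (1 / 2 * τ y z z * (prim e M y z)⁻¹ * (prim e M y z)⁻¹) • prim e M y, ?_, ?_⟩
  · have d4 := d1.inv hz
    exact (d4.smul d2).sub ((((d3.const_mul (1 / 2)).mul d4).mul d4).smul
      (h.prim_differentiableAt hw))
  · filter_upwards [h.isOpen.mem_nhds hw, d1.continuousAt.eventually_ne hz] with y hy hyz u v
    have h1 : ∀ u, prim e M y (u - (prim e M y u / prim e M y z) • z) = 0 := by
      intro u
      rw [map_sub, map_smul, smul_eq_mul]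
      field_simp
      ring
    have h2 := hker y hy _ _ (h1 u) (h1 v)
    simp only [map_sub, map_smul, sub_apply, smul_apply, smul_eq_mul] at h2 ⊢
    rw [hτ.symm y hy u z] at h2
    field_simp at h2 ⊢
    linarith

/-- Here `t = λ ⊗ N + ½ ν ⊗ e` with `N = M⁻¹ν`. On `ker λ` the trace collects `½` from the
derivative of `λ`, `-1` from that of `ν` along `e`, `d/2` from `Γ(·, e) = id` and `-½` from the last
term. -/
theorem divEnd_of_factor (hΓ : ConeConn O e M Γ) {w : W} (hw : w ∈ O) {ν : W → W →L[ℝ] ℝ}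
    (hν : DifferentiableAt ℝ ν w)
    (hf : ∀ᶠ y in 𝓝 w, ∀ u v, τ y u v = prim e M y u * ν y v + ν y u * prim e M y v) {y : W}
    (hy : prim e M w y = 0) :
    divEnd Γ (raise M τ) w y = (Module.finrank ℝ W / 2 - 1 : ℝ) * ν w y := by
  obtain ⟨z, hz⟩ := h.prim_ne_zero hw he
  have hle := h.prim_self hw
  have hνe : ν w e = 0 := by
    have := hf.self_of_nhds z e
    rw [hτ.apply_e_right h hw, hle, mul_zero, add_zero, eq_comm, mul_eq_zero] at this
    exact this.resolve_left hz
  have hdl : ∀ v, fderiv ℝ (prim e M) w e v = 2 * prim e M w v := by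
    intro v
    rw [hΓ.fderiv_prim h hw, hΓ.unit w hw, h.apply_e]
    ring
  have hd : ∀ u v, 2 * prim e M w u * ν w v + prim e M w u * fderiv ℝ ν w e v +
      fderiv ℝ ν w e u * prim e M w v + 2 * ν w u * prim e M w v = 0 := by
    intro u v
    have l := hasFDerivAt_apply₁ (h.prim_differentiableAt hw)
    have m := hasFDerivAt_apply₁ hν
    have h1 : HasFDerivAt (fun y ↦ τ y u v) _ w :=
      (((l u).mul (m v)).add ((m u).mul (l v))).congr_of_eventuallyEq
        (hf.mono fun y hy ↦ hy u v)
    have h2 := congrFun (congrArg DFunLike.coe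
      ((hasFDerivAt_apply₂ (hτ.differentiableAt h hw) u v).unique h1)) e
    simp only [ContinuousLinearMap.flip_apply, hτ.fderiv_e h hw, add_apply, smul_apply,
      smul_eq_mul, hdl] at h2
    simp only [zero_apply] at h2
    linarith
  -- The tensor `τ` is invariant along `e` while `λ` has degree `2`, so `ν` has degree `-2`.
  have hdν : ∀ v, fderiv ℝ ν w e v = -2 * ν w v := by
    have h1 : fderiv ℝ ν w e z = -2 * ν w z := by
      have h1 := hd z z
      have h2 : prim e M w z * (fderiv ℝ ν w e z + 2 * ν w z) = 0 := by linarith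
      have h3 := (mul_eq_zero.1 h2).resolve_left hz
      linarith
    intro v
    have h2 := hd z v
    rw [h1] at h2
    have h3 : prim e M w z * (fderiv ℝ ν w e v + 2 * ν w v) = 0 := by linarith
    have h4 := (mul_eq_zero.1 h3).resolve_left hz
    linarith
  obtain ⟨N, hN⟩ : ∃ N : W → W, ∀ y, N y = (M y).inverse (ν y) := ⟨_, fun _ ↦ rfl⟩
  have hNd : DifferentiableAt ℝ N w := by
    rw [show N = _ from funext hN]
    exact (((h.inverse_smooth).contDiffAt (h.isOpen.mem_nhds hw)).differentiableAt
      (by simp)).clm_apply hν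
  have hraise : ∀ᶠ y in 𝓝 w, ∀ u,
      raise M τ y u = prim e M y u • N y + (1 / 2 * ν y u) • e := by
    filter_upwards [h.isOpen.mem_nhds hw, hf] with y hy hfy u
    rw [raise_apply]
    refine (eq_inverse (h.nondegenerate y hy) fun v ↦ ?_).symm
    rw [map_add, map_smul, map_smul, add_apply, smul_apply, smul_apply, hN,
      apply_inverse (h.nondegenerate y hy), hfy, h.apply_e, smul_eq_mul, smul_eq_mul]
    ring
  have hdt : (fderiv ℝ (raise M τ) w).flip y = ((1 / 2 : ℝ) • (M w).flip y +
      (prim e M w).comp ((Γ w).flip y)).smulRight (N w) +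
      ((1 / 2 : ℝ) • (fderiv ℝ ν w).flip y).smulRight e := by
    have h1 : HasFDerivAt (fun w ↦ prim e M w y • N w + (1 / 2 * ν w y) • e) _ w :=
      ((hasFDerivAt_apply₁ (h.prim_differentiableAt hw) y).smul hNd.hasFDerivAt).add
        (((hasFDerivAt_apply₁ hν y).const_mul (1 / 2 : ℝ)).smul_const e)
    rw [(hasFDerivAt_apply₁ (hτ.raise_differentiableAt h hw) y).unique
      (h1.congr_of_eventuallyEq (hraise.mono fun w hw ↦ hw y))]
    ext u
    simp only [add_apply, smul_apply, ContinuousLinearMap.flip_apply,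
      ContinuousLinearMap.smulRight_apply, ContinuousLinearMap.comp_apply,
      hΓ.fderiv_prim h hw, smul_eq_mul, hy]
    module
  have hg : (Γ w).flip (raise M τ w y) = (1 / 2 * ν w y) • ContinuousLinearMap.id ℝ W := by
    ext u
    rw [hraise.self_of_nhds, hy, zero_smul, zero_add]
    simp only [ContinuousLinearMap.flip_apply, map_smul, smul_apply,
      ContinuousLinearMap.id_apply, hΓ.symm w hw u e, hΓ.unit w hw]
  have hr : (raise M τ w).comp ((Γ w).flip y) =
      ((prim e M w).comp ((Γ w).flip y)).smulRight (N w) +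
      ((1 / 2 : ℝ) • (ν w).comp ((Γ w).flip y)).smulRight e := by
    ext u
    simp only [ContinuousLinearMap.comp_apply, hraise.self_of_nhds, add_apply, smul_apply,
      ContinuousLinearMap.smulRight_apply, ContinuousLinearMap.flip_apply, smul_eq_mul]
  rw [divEnd, hdt, hg, hr]
  have hMN : M w (N w) y = ν w y := by rw [hN, apply_inverse (h.nondegenerate w hw)]
  simp only [map_add, map_sub, map_smul, tr_smulRight, tr_id, add_apply, smul_apply,
    ContinuousLinearMap.comp_apply, ContinuousLinearMap.flip_apply, hdν, hΓ.unit w hw,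
    smul_eq_mul, hMN]
  ring

/-- Now `t = c λ ⊗ e`, and invariance of `τ` forces `c` to have degree `-4`. The trace collects `-4
+ 1 + 1` from the derivative of `t`, `d` from `Γ(·, e) = id` and `-1` from the last term. -/
theorem divEnd_of_eq_smul (hΓ : ConeConn O e M Γ) {w : W} (hw : w ∈ O) {c : W → ℝ}
    (hc : DifferentiableAt ℝ c w)
    (hf : ∀ᶠ y in 𝓝 w, ∀ u v, τ y u v = 2 * c y * prim e M y u * prim e M y v) :
    (∀ u, raise M τ w u = (c w * prim e M w u) • e) ∧ ∀ y,
    divEnd Γ (raise M τ) w y = (Module.finrank ℝ W - 3 : ℝ) * c w * prim e M w y := by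
  obtain ⟨z, hz⟩ := h.prim_ne_zero hw he
  have hle := h.prim_self hw
  have hdc : fderiv ℝ c w e = -4 * c w := by
    have l := hasFDerivAt_apply₁ (h.prim_differentiableAt hw) z
    have h1 : HasFDerivAt (fun y ↦ τ y z z) _ w :=
      (((hc.hasFDerivAt.const_mul (2 : ℝ)).mul l).mul l).congr_of_eventuallyEq
        (hf.mono fun y hy ↦ hy z z)
    have h2 := congrFun (congrArg DFunLike.coe
      ((hasFDerivAt_apply₂ (hτ.differentiableAt h hw) z z).unique h1)) e
    simp only [ContinuousLinearMap.flip_apply, hτ.fderiv_e h hw, add_apply, smul_apply,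
      smul_eq_mul, hΓ.fderiv_prim h hw, hΓ.unit w hw, h.apply_e] at h2
    simp only [zero_apply, Pi.mul_apply] at h2
    have h3 : prim e M w z * (prim e M w z * (fderiv ℝ c w e + 4 * c w)) = 0 := by linarith
    have h4 := (mul_eq_zero.1 ((mul_eq_zero.1 h3).resolve_left hz)).resolve_left hz
    linarith
  have hraise : ∀ᶠ y in 𝓝 w, ∀ u, raise M τ y u = (c y * prim e M y u) • e := by
    filter_upwards [h.isOpen.mem_nhds hw, hf] with y hy hfy u
    rw [raise_apply]
    refine (eq_inverse (h.nondegenerate y hy) fun v ↦ ?_).symm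
    rw [map_smul, smul_apply, hfy, h.apply_e, smul_eq_mul]
    ring
  refine ⟨hraise.self_of_nhds, fun y ↦ ?_⟩
  have hdt : (fderiv ℝ (raise M τ) w).flip y = (prim e M w y • fderiv ℝ c w +
      c w • ((1 / 2 : ℝ) • (M w).flip y + (prim e M w).comp ((Γ w).flip y))).smulRight e := by
    have h1 : HasFDerivAt (fun w ↦ (c w * prim e M w y) • e) _ w :=
      (hc.hasFDerivAt.mul (hasFDerivAt_apply₁ (h.prim_differentiableAt hw) y)).smul_const e
    rw [(hasFDerivAt_apply₁ (hτ.raise_differentiableAt h hw) y).unique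
      (h1.congr_of_eventuallyEq (hraise.mono fun w hw ↦ hw y))]
    ext u
    simp only [add_apply, smul_apply, ContinuousLinearMap.flip_apply,
      ContinuousLinearMap.smulRight_apply, ContinuousLinearMap.comp_apply,
      hΓ.fderiv_prim h hw, smul_eq_mul]
    module
  have hg : (Γ w).flip (raise M τ w y) = (c w * prim e M w y) • ContinuousLinearMap.id ℝ W := by
    ext u
    rw [hraise.self_of_nhds]
    simp only [ContinuousLinearMap.flip_apply, map_smul, smul_apply,
      ContinuousLinearMap.id_apply, hΓ.symm w hw u e, hΓ.unit w hw]
  have hr : (raise M τ w).comp ((Γ w).flip y) =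
      (c w • (prim e M w).comp ((Γ w).flip y)).smulRight e := by
    ext u
    simp only [ContinuousLinearMap.comp_apply, hraise.self_of_nhds, smul_apply,
      ContinuousLinearMap.smulRight_apply, ContinuousLinearMap.flip_apply, smul_eq_mul]
  rw [divEnd, hdt, hg, hr]
  simp only [map_add, map_sub, map_smul, tr_smulRight, tr_id, add_apply, smul_apply,
    ContinuousLinearMap.comp_apply, ContinuousLinearMap.flip_apply, hdc, hΓ.unit w hw,
    smul_eq_mul, h.apply_e]
  ring

end Horizontal

namespace ConeConn

variable (h : ConeForm O e M) (hΓ : ConeConn O e M Γ)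
include h hΓ

/-- On `ker λ` all terms with a factor `λ` drop, and `a = -2/d` makes the coefficient `1 + (d/2) a`
of the old Ricci tensor vanish. -/
theorem ric_improve_ker {a : ℝ} (ha : a * Module.finrank ℝ W = -2) {w : W} (hw : w ∈ O) {u v : W}
    (hu : prim e M w u = 0) (hv : prim e M w v = 0) :
    ric (SymplecticInduction.improve e M a Γ) w u v = 0 := by
  rw [hΓ.ric_improve h a hw, hu, hv, show (1 + Module.finrank ℝ W / 2 * a : ℝ) = 0 by linarith]
  ring

/-- For `u` in `ker λ` one has `a Ric(u, v) = ν(u) λ(v)` and `δ(u) = (d/2 - 1) ν(u)`. The total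
coefficient of `ν(u) λ(v)` is `1/a + d/2 + d/2 - 1`, which is zero for `a = -1/(d - 1)`. -/
theorem ric_improve_left (he : e ≠ 0)
    (hker : ∀ w ∈ O, ∀ u v, prim e M w u = 0 → prim e M w v = 0 → ric Γ w u v = 0)
    {a : ℝ} (ha : a * (Module.finrank ℝ W - 1) = -1) {w : W} (hw : w ∈ O) {u : W}
    (hu : prim e M w u = 0) (v : W) : ric (SymplecticInduction.improve e M a Γ) w u v = 0 := by
  have hτ := hΓ.horizontal h a
  obtain ⟨ν, hν, hf⟩ := hτ.exists_factor h he (fun w hw u v hu hv ↦ by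
    rw [smul_apply, smul_apply, hker w hw u v hu hv, smul_zero]) hw
  rw [hΓ.ric_improve h a hw, hu, hτ.divEnd_of_factor h he hΓ hw hν hf hu]
  have h1 := hf.self_of_nhds u v
  rw [hu, zero_mul, zero_add, smul_apply, smul_apply, smul_eq_mul] at h1
  have ha0 : a ≠ 0 := by
    rintro rfl
    simp at ha
  refine mul_left_cancel₀ ha0 ?_
  linear_combination (1 + Module.finrank ℝ W / 2 * a) * h1 + ν w u * prim e M w v * ha

/-- Now `a Ric = 2c λ ⊗ λ`, so `t² = 0` because `λ(e) = 0`, and `δ = (d - 3) c λ`. The coefficient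
of `2c λ ⊗ λ` is `1/a + d/2 + d - 3`, which is zero for `a = -2/(3d - 6)`. -/
theorem ric_improve_eq_zero (he : e ≠ 0)
    (hker : ∀ w ∈ O, ∀ u v, prim e M w u = 0 → ric Γ w u v = 0)
    {a : ℝ} (ha : a * (3 * Module.finrank ℝ W - 6) = -2) {w : W} (hw : w ∈ O) (u v : W) :
    ric (SymplecticInduction.improve e M a Γ) w u v = 0 := by
  have hτ := hΓ.horizontal h a
  obtain ⟨z, hz⟩ := h.prim_ne_zero hw he
  have d1 : DifferentiableAt ℝ (fun y ↦ prim e M y z) w :=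
    (hasFDerivAt_apply₁ (h.prim_differentiableAt hw) z).differentiableAt
  have d2 : DifferentiableAt ℝ (fun y ↦ (a • ric Γ y) z z) w :=
    (hasFDerivAt_apply₂ (hτ.differentiableAt h hw) z z).differentiableAt
  obtain ⟨c, hc⟩ : ∃ c : W → ℝ, ∀ y, c y = 1 / 2 * (a • ric Γ y) z z * (prim e M y z)⁻¹ *
    (prim e M y z)⁻¹ := ⟨_, fun _ ↦ rfl⟩
  have hcd : DifferentiableAt ℝ c w := by
    rw [show c = _ from funext hc]
    exact ((d2.const_mul (1 / 2)).mul (d1.inv hz)).mul (d1.inv hz)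
  have hf : ∀ᶠ y in 𝓝 w, ∀ u v, (a • ric Γ y) u v =
      2 * c y * prim e M y u * prim e M y v := by
    filter_upwards [h.isOpen.mem_nhds hw, d1.continuousAt.eventually_ne hz] with y hy hyz u v
    have h1 : ∀ u, prim e M y (u - (prim e M y u / prim e M y z) • z) = 0 := by
      intro u
      rw [map_sub, map_smul, smul_eq_mul]
      field_simp
      ring
    have h2 := hker y hy _ v (h1 u)
    have h3 := hker y hy _ z (h1 v)
    simp only [map_sub, map_smul, sub_apply, smul_apply, smul_eq_mul] at h2 h3 ⊢
    rw [hΓ.ric_symm h hy v z] at h3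
    rw [hc, sub_eq_zero.1 h2, sub_eq_zero.1 h3]
    simp only [smul_apply, smul_eq_mul]
    field_simp
  obtain ⟨h1, h2⟩ := hτ.divEnd_of_eq_smul h he hΓ hw hcd hf
  have h3 : (raise M (fun w ↦ a • ric Γ w) w).comp (raise M (fun w ↦ a • ric Γ w) w) = 0 := by
    ext x
    rw [ContinuousLinearMap.comp_apply, h1, h1, map_smul, h.prim_self hw]
    simp
  rw [hΓ.ric_improve h a hw, h2, h2, h3, map_zero]
  have h4 := hf.self_of_nhds u v
  rw [smul_apply, smul_apply, smul_eq_mul] at h4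
  have ha0 : a ≠ 0 := by
    rintro rfl
    simp at ha
  refine mul_left_cancel₀ ha0 ?_
  linear_combination (1 + Module.finrank ℝ W / 2 * a) * h4 +
    c w * prim e M w u * prim e M w v * ha

/-- In dimension two the curvature is determined by `R(e, f)` for a basis `e, f`, and `R(e, ·) = 0`.
-/
theorem ric_eq_zero_of_finrank (he : e ≠ 0) (hd : Module.finrank ℝ W = 2) {w : W} (hw : w ∈ O)
    (v z : W) : ric Γ w v z = 0 := by
  have h1 : ∀ u v z, curv Γ w u v z = 0 := by
    intro u v z
    obtain ⟨f, hf⟩ : ∃ f : W, LinearIndependent ℝ ![e, f] :=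
      exists_linearIndependent_pair_of_one_lt_finrank (by omega) he
    have hs : ⊤ ≤ Submodule.span ℝ (Set.range ![e, f]) := by
      rw [hf.span_eq_top_of_card_eq_finrank (by simp [hd])]
    have hx : ∀ x : W, ∃ a b : ℝ, x = a • e + b • f := by
      intro x
      have := hs (Submodule.mem_top (x := x))
      rw [Matrix.range_cons, Matrix.range_cons, Matrix.range_empty, Set.union_empty,
        Set.singleton_union, Submodule.mem_span_pair] at this
      obtain ⟨a, b, hab⟩ := this
      exact ⟨a, b, hab.symm⟩
    have hc : curv Γ w e = 0 := funext fun v ↦ ContinuousLinearMap.ext fun z ↦ hΓ.curv_e h hw v z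
    obtain ⟨a, b, rfl⟩ := hx u
    obtain ⟨a', b', rfl⟩ := hx v
    have hff : curv Γ w f f z = 0 := by
      have h3 := curv_swap (Γ := Γ) w f f z
      have h4 : (2 : ℝ) • curv Γ w f f z = 0 := by
        rw [two_smul]
        nth_rewrite 1 [h3]
        exact neg_add_cancel _
      exact (smul_eq_zero.1 h4).resolve_left two_ne_zero
    have hef : curv Γ w e f z = 0 := hΓ.curv_e h hw f z
    have hfe : curv Γ w f e z = 0 := by rw [curv_swap, hef, neg_zero]
    have hee : curv Γ w e e z = 0 := hΓ.curv_e h hw e z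
    have h2 : curv Γ w (a • e + b • f) (a' • e + b' • f) z =
        (a * a') • curv Γ w e e z + (a * b') • curv Γ w e f z + (b * a') • curv Γ w f e z +
          (b * b') • curv Γ w f f z := by
      simp only [curv_apply, map_add, map_smul, add_apply, smul_apply]
      module
    rw [h2, hee, hef, hfe, hff]
    simp
  have : ricEnd Γ w v z = 0 := ContinuousLinearMap.ext fun u ↦ h1 u v z
  rw [ric_apply, this, map_zero]

end ConeConn

/-- The Ricci-flat connection obtained from a connection in three steps, in dimension `2 n + 2`. -/
def flatten (e : W) (M : W → W →L[ℝ] W →L[ℝ] ℝ) (n : ℕ) (Γ : W → W →L[ℝ] W →L[ℝ] W) :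
    W → W →L[ℝ] W →L[ℝ] W :=
  -- Read from the inside, the constants are `-2/d`, `-1/(d - 1)` and `-2/(3d - 6)` for `d = 2n +
  -- 2`. For `n = 0` the last one is `0` by the convention on division, which is harmless since
  -- dimension two is treated separately.
  improve e M (-(1 / (3 * n))) (improve e M (-(1 / (2 * n + 1))) (improve e M (-(1 / (n + 1))) Γ))

theorem ConeConn.flatten (h : ConeForm O e M) (hΓ : ConeConn O e M Γ) (n : ℕ) :
    ConeConn O e M (flatten e M n Γ) :=
  ((hΓ.improve h _).improve h _).improve h _

theorem ConeConn.ric_flatten (h : ConeForm O e M) (hΓ : ConeConn O e M Γ) (he : e ≠ 0) {n : ℕ}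
    (hn : Module.finrank ℝ W = 2 * n + 2) {w : W} (hw : w ∈ O) (u v : W) :
    ric (SymplecticInduction.flatten e M n Γ) w u v = 0 := by
  obtain rfl | hpos := Nat.eq_zero_or_pos n
  · exact (hΓ.flatten h 0).ric_eq_zero_of_finrank h he (by simpa using hn) hw u v
  have hn' : (Module.finrank ℝ W : ℝ) = 2 * n + 2 := by exact_mod_cast hn
  have h0 : (0 : ℝ) < n := by exact_mod_cast hpos
  refine ((hΓ.improve h _).improve h _).ric_improve_eq_zero h he (fun w hw u v hu ↦
    (hΓ.improve h _).ric_improve_left h he (fun w hw u v hu hv ↦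
      hΓ.ric_improve_ker h ?_ hw hu hv) ?_ hw hu v) ?_ hw u v
  all_goals
    rw [hn']
    field_simp
    try ring

end RicciFlat

/-! ### Behaviour under changes of coordinates -/

section Change

variable {W : Type*} [NormedAddCommGroup W] [NormedSpace ℝ W] [FiniteDimensional ℝ W]
  {O O' : Set W} {e : W} {M M' τ τ' : W → W →L[ℝ] W →L[ℝ] ℝ} {Γ Γ' : W → W →L[ℝ] W →L[ℝ] W}
  {κ f g : W → W} {w : W}

/-- `Γ` is at `w` the expression of `Γ'` after the change of coordinates `κ`. -/
def Related (κ : W → W) (w : W) (Γ Γ' : W → W →L[ℝ] W →L[ℝ] W) : Prop :=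
  ∀ u v, fderiv ℝ κ w (Γ w u v) =
    fderiv ℝ (fderiv ℝ κ) w u v + Γ' (κ w) (fderiv ℝ κ w u) (fderiv ℝ κ w v)

theorem differentiableAt_fderiv (hκ : ContDiffAt ℝ ∞ κ w) :
    DifferentiableAt ℝ (fderiv ℝ κ) w :=
  (hκ.fderiv_right (m := ∞) (by simp)).differentiableAt (by simp)

theorem second_fderiv_comp (hg : ContDiffAt ℝ ∞ g (f w)) (hf : ContDiffAt ℝ ∞ f w) (u v : W) :
    fderiv ℝ (fderiv ℝ (g ∘ f)) w u v =
      fderiv ℝ (fderiv ℝ g) (f w) (fderiv ℝ f w u) (fderiv ℝ f w v) +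
        fderiv ℝ g (f w) (fderiv ℝ (fderiv ℝ f) w u v) := by
  have h1 : (fun y ↦ fderiv ℝ (g ∘ f) y v) =ᶠ[𝓝 w]
      fun y ↦ fderiv ℝ g (f y) (fderiv ℝ f y v) := by
    filter_upwards [(hf.of_le (m := 1) (by simp)).eventually (by simp),
      hf.continuousAt.eventually ((hg.of_le (m := 1) (by simp)).eventually (by simp))] with y hy hgy
    rw [fderiv_comp y (hgy.differentiableAt (by simp)) (hy.differentiableAt (by simp))]
    rfl
  have h2 : HasFDerivAt (fun y ↦ fderiv ℝ g (f y) (fderiv ℝ f y v)) _ w :=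
    ((differentiableAt_fderiv hg).hasFDerivAt.comp w
      (hf.differentiableAt (by simp)).hasFDerivAt).clm_apply
      (hasFDerivAt_apply₁ (differentiableAt_fderiv hf) v)
  have h3 := (hasFDerivAt_apply₁ (differentiableAt_fderiv (hg.comp w hf)) v).unique
    (h2.congr_of_eventuallyEq h1)
  have h4 := congrFun (congrArg DFunLike.coe h3) u
  simp only [ContinuousLinearMap.flip_apply, add_apply, ContinuousLinearMap.comp_apply,
    Function.comp_apply] at h4
  rw [h4]
  abel

/-- Compatibility with a common third system of symbols gives compatibility with each other; this is
used on triple overlaps. -/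
theorem Related.cancel {A B C : W → W →L[ℝ] W →L[ℝ] W} (hg : ContDiffAt ℝ ∞ g (f w))
    (hf : ContDiffAt ℝ ∞ f w) (hinj : Function.Injective (fderiv ℝ g (f w)))
    (h1 : Related (g ∘ f) w A C) (h2 : Related g (f w) B C) : Related f w A B := by
  intro u v
  refine hinj ?_
  have h3 := h1 u v
  rw [second_fderiv_comp hg hf, fderiv_comp w (hg.differentiableAt (by simp))
    (hf.differentiableAt (by simp))] at h3
  simp only [ContinuousLinearMap.comp_apply, Function.comp_apply] at h3
  rw [h3, map_add, h2]
  abel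

theorem Related.congr {A B : W → W →L[ℝ] W →L[ℝ] W} (hfg : f =ᶠ[𝓝 w] g)
    (h1 : Related f w A B) : Related g w A B := by
  intro u v
  have h2 := h1 u v
  rwa [hfg.fderiv_eq, hfg.fderiv.fderiv_eq, hfg.eq_of_nhds] at h2

/-- The transformation law of the symbols is differentiated and antisymmetrised; the third
derivatives of `κ` cancel by symmetry, and the second ones cancel after the law is substituted once
more. -/
theorem curv_related (hκ : ContDiffAt ℝ ∞ κ w) (hΓ : DifferentiableAt ℝ Γ w)
    (hΓ' : DifferentiableAt ℝ Γ' (κ w)) (hrel : ∀ᶠ y in 𝓝 w, Related κ y Γ Γ') (u v z : W) :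
    fderiv ℝ κ w (curv Γ w u v z) =
      curv Γ' (κ w) (fderiv ℝ κ w u) (fderiv ℝ κ w v) (fderiv ℝ κ w z) := by
  set K := fderiv ℝ κ w with hK
  set Q := fderiv ℝ (fderiv ℝ κ) w with hQ
  have hκ1 : ContDiffAt ℝ ∞ (fderiv ℝ κ) w := hκ.fderiv_right (by simp)
  have hdκ := hκ.differentiableAt (by simp)
  have hd1 := differentiableAt_fderiv hκ
  have hd2 : DifferentiableAt ℝ (fderiv ℝ (fderiv ℝ κ)) w :=
    (hκ1.fderiv_right (m := ∞) (by simp)).differentiableAt (by simp)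
  have hsymm : ∀ x u, fderiv ℝ (fderiv ℝ (fderiv ℝ κ)) w x u =
      fderiv ℝ (fderiv ℝ (fderiv ℝ κ)) w u x := fun x u ↦
    (hκ1.isSymmSndFDerivAt (by rw [minSmoothness_of_isRCLikeNormedField]; exact ENat.LEInfty.out))
      x u
  have hQs : ∀ x u, Q x u = Q u x := fun x u ↦
    (hκ.isSymmSndFDerivAt (by rw [minSmoothness_of_isRCLikeNormedField]; exact ENat.LEInfty.out))
      x u
  have key : ∀ x u v, Q x (Γ w u v) + K (fderiv ℝ Γ w x u v) =
      fderiv ℝ (fderiv ℝ (fderiv ℝ κ)) w x u v + (fderiv ℝ Γ' (κ w) (K x) (K u) (K v) +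
        Γ' (κ w) (Q x u) (K v) + Γ' (κ w) (K u) (Q x v)) := by
    intro x u v
    have h1 : HasFDerivAt (fun y ↦ fderiv ℝ κ y (Γ y u v)) _ w :=
      hd1.hasFDerivAt.clm_apply (hasFDerivAt_apply₂ hΓ u v)
    have h2 : HasFDerivAt (fun y ↦ fderiv ℝ (fderiv ℝ κ) y u v +
        Γ' (κ y) (fderiv ℝ κ y u) (fderiv ℝ κ y v)) _ w :=
      (hasFDerivAt_apply₂ hd2 u v).add (((hΓ'.hasFDerivAt.comp w hdκ.hasFDerivAt).clm_apply
        (hasFDerivAt_apply₁ hd1 u)).clm_apply (hasFDerivAt_apply₁ hd1 v))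
    have h3 := congrFun (congrArg DFunLike.coe (h1.unique (h2.congr_of_eventuallyEq
      (hrel.mono fun y hy ↦ hy u v)))) x
    simp only [ContinuousLinearMap.flip_apply, add_apply, ContinuousLinearMap.comp_apply,
      Function.comp_apply, ← hK, ← hQ] at h3
    rw [add_comm, h3]
    abel
  have hr := hrel.self_of_nhds
  have h1 := key u v z
  have h2 := key v u z
  rw [hsymm u v, hQs u v, hQs u (Γ w v z)] at h1
  rw [hQs v (Γ w u z)] at h2
  have h3 : ∀ u v z, K (Γ w u (Γ w v z)) =
      Q u (Γ w v z) + Γ' (κ w) (K u) (Q v z + Γ' (κ w) (K v) (K z)) := by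
    intro u v z
    rw [hr u (Γ w v z), hr v z]
  simp only [curv_apply, map_add, map_sub, h3]
  rw [hQs u (Γ w v z), hQs v (Γ w u z)]
  rw [← eq_sub_iff_add_eq'] at h1 h2
  rw [h1, h2]
  abel

theorem ric_related (hκ : ContDiffAt ℝ ∞ κ w) (hK : Function.Bijective (fderiv ℝ κ w))
    (hΓ : DifferentiableAt ℝ Γ w) (hΓ' : DifferentiableAt ℝ Γ' (κ w))
    (hrel : ∀ᶠ y in 𝓝 w, Related κ y Γ Γ') (v z : W) :
    ric Γ w v z = ric Γ' (κ w) (fderiv ℝ κ w v) (fderiv ℝ κ w z) :=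
  tr_eq_of_conj hK fun u ↦ by
    rw [ricEnd_apply, ricEnd_apply, curv_related hκ hΓ hΓ' hrel]

theorem corr_related {K : W →L[ℝ] W} {w' : W} (hK : Function.Surjective K) (hKe : K e = e)
    (hM : ∀ u, (∀ v, M w u v = 0) → u = 0) (hM' : ∀ u, (∀ v, M' w' u v = 0) → u = 0)
    (hMM' : ∀ u v, M w u v = M' w' (K u) (K v)) (hττ' : ∀ u v, τ w u v = τ' w' (K u) (K v))
    (u v : W) : K (corr e M τ w u v) = corr e M' τ' w' (K u) (K v) := by
  have h1 : ∀ u, prim e M w u = prim e M' w' (K u) := by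
    intro u
    rw [prim_apply, prim_apply, hMM', hKe]
  have h2 : ∀ u, K (raise M τ w u) = raise M' τ' w' (K u) := by
    intro u
    refine eq_inverse hM' fun z ↦ ?_
    obtain ⟨v, rfl⟩ := hK z
    refine (hMM' _ _).symm.trans (Eq.trans ?_ (hττ' u v))
    rw [raise_apply, apply_inverse hM]
  rw [corr_apply, corr_apply, map_add, map_add, map_smul, map_smul, map_smul, h2, h2, hKe,
    ← h1, ← h1, hττ']

/-- The expression of a connection after the change of coordinates `κ`. -/
def transport (κ : W → W) (Γ' : W → W →L[ℝ] W →L[ℝ] W) (w : W) : W →L[ℝ] W →L[ℝ] W :=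
  mkBilin (fun u v ↦ (fderiv ℝ κ w).inverse (fderiv ℝ (fderiv ℝ κ) w u v +
      Γ' (κ w) (fderiv ℝ κ w u) (fderiv ℝ κ w v)))
    (fun u u' v ↦ by
      simp only [map_add, add_apply]
      abel)
    (fun c u v ↦ by simp only [map_smul, smul_apply, map_add, smul_add])
    (fun u v v' ↦ by
      simp only [map_add]
      abel)
    (fun c u v ↦ by simp only [map_smul, map_add, smul_add])

theorem transport_apply (u v : W) : transport κ Γ' w u v = (fderiv ℝ κ w).inverse
    (fderiv ℝ (fderiv ℝ κ) w u v + Γ' (κ w) (fderiv ℝ κ w u) (fderiv ℝ κ w v)) := rfl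

theorem isInvertible_of_bijective {K : W →L[ℝ] W} (hK : Function.Bijective K) :
    K.IsInvertible := by
  let Q : W ≃ₗ[ℝ] W := LinearEquiv.ofBijective (K : W →ₗ[ℝ] W) hK
  exact ⟨Q.toContinuousLinearEquiv, by ext; rfl⟩

theorem related_transport (hK : Function.Bijective (fderiv ℝ κ w)) :
    Related κ w (transport κ Γ' ) Γ' := by
  intro u v
  rw [transport_apply]
  exact congrFun (congrArg DFunLike.coe (isInvertible_of_bijective hK).self_comp_inverse) _

theorem ConeForm.mono (h : ConeForm O e M) (hO : IsOpen O') (hsub : O' ⊆ O)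
    (hadd : ∀ w ∈ O', ∀ t : ℝ, w + t • e ∈ O') : ConeForm O' e M where
  isOpen := hO
  add_mem := hadd
  smooth := h.smooth.mono hsub
  skew w hw := h.skew w (hsub hw)
  nondegenerate w hw := h.nondegenerate w (hsub hw)
  closed w hw := h.closed w (hsub hw)
  homogeneous w hw := h.homogeneous w (hsub hw)

/-- A change of coordinates between two cone forms. -/
structure ConeChange (O O' : Set W) (e : W) (M M' : W → W →L[ℝ] W →L[ℝ] ℝ) (κ : W → W) :
    Prop where
  mapsTo : ∀ w ∈ O, κ w ∈ O'
  smooth : ContDiffOn ℝ ∞ κ O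
  bijective : ∀ w ∈ O, Function.Bijective (fderiv ℝ κ w)
  add : ∀ w ∈ O, ∀ t : ℝ, κ (w + t • e) = κ w + t • e
  form : ∀ w ∈ O, ∀ u v, M w u v = M' (κ w) (fderiv ℝ κ w u) (fderiv ℝ κ w v)

namespace ConeChange

variable (hc : ConeChange O O' e M M' κ) (h : ConeForm O e M) (h' : ConeForm O' e M')
include hc h

theorem contDiffAt (hw : w ∈ O) : ContDiffAt ℝ ∞ κ w :=
  hc.smooth.contDiffAt (h.isOpen.mem_nhds hw)

theorem fderiv_add (hw : w ∈ O) (t : ℝ) : fderiv ℝ κ (w + t • e) = fderiv ℝ κ w := by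
  rw [← fderiv_comp_add_right]
  have : (fun z ↦ κ (z + t • e)) =ᶠ[𝓝 w] fun z ↦ κ z + t • e := by
    filter_upwards [h.isOpen.mem_nhds hw] with z hz using hc.add z hz t
  rw [this.fderiv_eq, fderiv_add_const]

theorem second_fderiv_add (hw : w ∈ O) (t : ℝ) :
    fderiv ℝ (fderiv ℝ κ) (w + t • e) = fderiv ℝ (fderiv ℝ κ) w := by
  have := fderiv_add_smul (X := W →L[ℝ] W) (f := fderiv ℝ κ) (t := t) (a := 1) h.isOpen
    (fun w hw ↦ by rw [hc.fderiv_add h hw, one_smul]) hw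
    (differentiableAt_fderiv (hc.contDiffAt h hw))
  rwa [one_smul] at this

theorem fderiv_e (hw : w ∈ O) : fderiv ℝ κ w e = e := by
  have hl : HasDerivAt (fun t : ℝ ↦ w + t • e) e 0 := by
    simpa using ((hasDerivAt_id (0 : ℝ)).smul_const e).const_add w
  have hf' : HasFDerivAt κ (fderiv ℝ κ w) (w + (0 : ℝ) • e) := by
    simpa using ((hc.contDiffAt h hw).differentiableAt (by simp)).hasFDerivAt
  have h1 := hf'.comp_hasDerivAt (0 : ℝ) hl
  have h2 : HasDerivAt (fun t : ℝ ↦ κ w + t • e) e 0 := by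
    simpa using ((hasDerivAt_id (0 : ℝ)).smul_const e).const_add (κ w)
  have h4 : κ ∘ (fun t : ℝ ↦ w + t • e) = fun t ↦ κ w + t • e := funext (hc.add w hw)
  rw [h4] at h1
  exact h1.unique h2

theorem second_fderiv_e (hw : w ∈ O) : fderiv ℝ (fderiv ℝ κ) w e = 0 :=
  fderiv_of_invariant (X := W →L[ℝ] W) (f := fderiv ℝ κ)
    (differentiableAt_fderiv (hc.contDiffAt h hw)) (hc.fderiv_add h hw)

theorem second_fderiv_symm (hw : w ∈ O) (u v : W) :
    fderiv ℝ (fderiv ℝ κ) w u v = fderiv ℝ (fderiv ℝ κ) w v u :=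
  ((hc.contDiffAt h hw).isSymmSndFDerivAt
    (by rw [minSmoothness_of_isRCLikeNormedField]; exact ENat.LEInfty.out)) u v

include h'

theorem fderiv_form (hw : w ∈ O) (x u v : W) : fderiv ℝ M w x u v =
    fderiv ℝ M' (κ w) (fderiv ℝ κ w x) (fderiv ℝ κ w u) (fderiv ℝ κ w v) +
      M' (κ w) (fderiv ℝ (fderiv ℝ κ) w x u) (fderiv ℝ κ w v) +
      M' (κ w) (fderiv ℝ κ w u) (fderiv ℝ (fderiv ℝ κ) w x v) := by
  have hκ := hc.contDiffAt h hw
  have hd1 := differentiableAt_fderiv hκ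
  have h2 : HasFDerivAt (fun y ↦ M' (κ y) (fderiv ℝ κ y u) (fderiv ℝ κ y v)) _ w :=
    (((h'.differentiableAt (hc.mapsTo w hw)).hasFDerivAt.comp w
      (hκ.differentiableAt (by simp)).hasFDerivAt).clm_apply
        (hasFDerivAt_apply₁ hd1 u)).clm_apply (hasFDerivAt_apply₁ hd1 v)
  have h1 : (fun y ↦ M y u v) =ᶠ[𝓝 w] fun y ↦ M' (κ y) (fderiv ℝ κ y u) (fderiv ℝ κ y v) := by
    filter_upwards [h.isOpen.mem_nhds hw] with y hy using hc.form y hy u v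
  have h3 := congrFun (congrArg DFunLike.coe
    ((hasFDerivAt_apply₂ (h.differentiableAt hw) u v).unique (h2.congr_of_eventuallyEq h1))) x
  simp only [ContinuousLinearMap.flip_apply, add_apply, ContinuousLinearMap.comp_apply,
    Function.comp_apply] at h3
  rw [h3]
  ring

theorem transport (hΓ : ConeConn O' e M' Γ') :
    ConeConn O e M (SymplecticInduction.transport κ Γ') := by
  have hrel : ∀ w ∈ O, Related κ w (SymplecticInduction.transport κ Γ') Γ' := fun w hw ↦
    related_transport (hc.bijective w hw)
  refine ⟨contDiffOn_of_apply₂ fun u v ↦ ?_, fun w hw u v ↦ ?_, fun w hw v ↦ ?_,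
    fun w hw t ↦ ?_, fun w hw u v z ↦ ?_⟩
  · simp only [transport_apply]
    have h1 : ContDiffOn ℝ ∞ (fderiv ℝ κ) O := hc.smooth.fderiv_of_isOpen h.isOpen (by simp)
    have h2 : ContDiffOn ℝ ∞ (fderiv ℝ (fderiv ℝ κ)) O :=
      h1.fderiv_of_isOpen h.isOpen (by simp)
    have h3 : ContDiffOn ℝ ∞ (fun w ↦ (fderiv ℝ κ w).inverse) O := by
      intro w hw
      have : CompleteSpace W := FiniteDimensional.complete ℝ W
      obtain ⟨Q, hQ⟩ := isInvertible_of_bijective (hc.bijective w hw)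
      have h4 : ContDiffAt ℝ ∞ (ContinuousLinearMap.inverse (R := ℝ) (M := W) (M₂ := W))
          (fderiv ℝ κ w) := by
        rw [← hQ]
        exact contDiffAt_map_inverse Q
      exact (h4.comp w (h1.contDiffAt (h.isOpen.mem_nhds hw))).contDiffWithinAt
    have h5 : ∀ u, ContDiffOn ℝ ∞ (fun w ↦ fderiv ℝ κ w u) O := fun u ↦
      h1.clm_apply contDiffOn_const
    have h6 : ContDiffOn ℝ ∞ (fun w ↦ Γ' (κ w)) O := hΓ.smooth.comp hc.smooth hc.mapsTo
    exact h3.clm_apply (((h2.clm_apply contDiffOn_const).clm_apply contDiffOn_const).add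
      ((h6.clm_apply (h5 u)).clm_apply (h5 v)))
  · rw [transport_apply, transport_apply, hc.second_fderiv_symm h hw,
      hΓ.symm _ (hc.mapsTo w hw)]
  · refine (hc.bijective w hw).1 ?_
    rw [hrel w hw, hc.second_fderiv_e h hw, hc.fderiv_e h hw, hΓ.unit _ (hc.mapsTo w hw)]
    simp
  · refine ContinuousLinearMap.ext fun u ↦ ContinuousLinearMap.ext fun v ↦ ?_
    rw [transport_apply, transport_apply, hc.fderiv_add h hw, hc.second_fderiv_add h hw,
      hc.add w hw, hΓ.invariant _ (hc.mapsTo w hw)]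
  · rw [hc.fderiv_form h h' hw, hΓ.parallel _ (hc.mapsTo w hw), hc.form w hw, hc.form w hw,
      hrel w hw, hrel w hw]
    simp only [map_add, add_apply]
    ring

/-- The correction is built from `M`, `e` and the Ricci tensor alone, all preserved by `κ`, so
corrected connections are related when the original ones are. -/
theorem improve (hΓ : ConeConn O e M Γ) (hΓ' : ConeConn O' e M' Γ')
    (hrel : ∀ w ∈ O, Related κ w Γ Γ') (a : ℝ) : ∀ w ∈ O,
    Related κ w (SymplecticInduction.improve e M a Γ) (SymplecticInduction.improve e M' a Γ') := by
  intro w hw u v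
  have h1 : ∀ u v, (a • ric Γ w) u v =
      (a • ric Γ' (κ w)) (fderiv ℝ κ w u) (fderiv ℝ κ w v) := by
    intro u v
    rw [smul_apply, smul_apply, smul_apply, smul_apply, ric_related (hc.contDiffAt h hw)
      (hc.bijective w hw) (hΓ.differentiableAt h hw)
      (hΓ'.differentiableAt h' (hc.mapsTo w hw))
      (Filter.eventually_of_mem (h.isOpen.mem_nhds hw) hrel)]
  have h2 := corr_related (e := e) (M := M) (M' := M') (τ := fun w ↦ a • ric Γ w)
    (τ' := fun w ↦ a • ric Γ' w)
    (hc.bijective w hw).2 (hc.fderiv_e h hw) (h.nondegenerate w hw)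
    (h'.nondegenerate _ (hc.mapsTo w hw)) (hc.form w hw) h1 u v
  simp only [SymplecticInduction.improve, add_apply, map_add, hrel w hw u v, h2]
  abel

theorem flatten (hΓ : ConeConn O e M Γ) (hΓ' : ConeConn O' e M' Γ')
    (hrel : ∀ w ∈ O, Related κ w Γ Γ') (n : ℕ) : ∀ w ∈ O,
    Related κ w (SymplecticInduction.flatten e M n Γ) (SymplecticInduction.flatten e M' n Γ') :=
  hc.improve h h' ((hΓ.improve h _).improve h _) ((hΓ'.improve h' _).improve h' _)
    (hc.improve h h' (hΓ.improve h _) (hΓ'.improve h' _) (hc.improve h h' hΓ hΓ' hrel _) _) _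

end ConeChange

end Change

/-! ### Gluing local connections -/

section Atlas

variable {ι : Type*} {W : Type*} [NormedAddCommGroup W] [NormedSpace ℝ W] [FiniteDimensional ℝ W]
  {e : W}

variable (ι W e) in
/-- A family of cone forms glued along changes of coordinates commuting with the translations
along `e`. -/
structure ConeAtlas where
  dom : ι → Set W
  form : ι → W → W →L[ℝ] W →L[ℝ] ℝ
  overlap : ι → ι → Set W
  change : ι → ι → W → W
  coneForm : ∀ j, ConeForm (dom j) e (form j)
  isOpen_overlap : ∀ i j, IsOpen (overlap i j)
  overlap_subset : ∀ i j, overlap i j ⊆ dom j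
  overlap_add : ∀ i j, ∀ w ∈ overlap i j, ∀ t : ℝ, w + t • e ∈ overlap i j
  change_self : ∀ j, ∀ w ∈ dom j, w ∈ overlap j j ∧ change j j w = w
  change_smooth : ∀ i j, ContDiffOn ℝ ∞ (change i j) (overlap i j)
  change_add : ∀ i j, ∀ w ∈ overlap i j, ∀ t : ℝ, change i j (w + t • e) = change i j w + t • e
  cocycle : ∀ i j k, ∀ w ∈ overlap i j, w ∈ overlap k j →
    change i j w ∈ overlap k i ∧ change k i (change i j w) = change k j w
  form_change : ∀ i j, ∀ w ∈ overlap i j, ∀ u v, form j w u v =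
    form i (change i j w) (fderiv ℝ (change i j) w u) (fderiv ℝ (change i j) w v)

namespace ConeAtlas

variable (A : ConeAtlas ι W e)

/-- A connection on the glued manifold. -/
structure IsConnection (Γ : ι → W → W →L[ℝ] W →L[ℝ] W) : Prop where
  conn : ∀ j, ConeConn (A.dom j) e (A.form j) (Γ j)
  related : ∀ i j, ∀ w ∈ A.overlap i j, Related (A.change i j) w (Γ j) (Γ i)

/-- A partition of unity on the glued manifold, invariant under the translations along `e`. -/
structure IsPartition (ρ : ι → ι → W → ℝ) : Prop where
  smooth : ∀ i j, ContDiffOn ℝ ∞ (ρ i j) (A.dom j)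
  add : ∀ i j, ∀ w ∈ A.dom j, ∀ t : ℝ, ρ i j (w + t • e) = ρ i j w
  locallyFinite : ∀ j, ∀ w ∈ A.dom j, ∃ s : Finset ι, (∀ i ∈ s, w ∈ A.overlap i j) ∧
    ∀ᶠ y in 𝓝 w, ∀ i, i ∉ s → ρ i j y = 0
  sum : ∀ j, ∀ w ∈ A.dom j, ∑ᶠ i, ρ i j w = 1
  change : ∀ i j k, ∀ w ∈ A.overlap k j, ρ i j w = ρ i k (A.change k j w)

theorem change_mem {i j : ι} {w : W} (hw : w ∈ A.overlap i j) : A.change i j w ∈ A.overlap j i :=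
  (A.cocycle i j j w hw (A.change_self j w (A.overlap_subset i j hw)).1).1

theorem change_change {i j : ι} {w : W} (hw : w ∈ A.overlap i j) :
    A.change j i (A.change i j w) = w := by
  have h1 := A.change_self j w (A.overlap_subset i j hw)
  rw [(A.cocycle i j j w hw h1.1).2, h1.2]

theorem contDiffAt_change {i j : ι} {w : W} (hw : w ∈ A.overlap i j) :
    ContDiffAt ℝ ∞ (A.change i j) w :=
  (A.change_smooth i j).contDiffAt ((A.isOpen_overlap i j).mem_nhds hw)

theorem fderiv_change_change {i j : ι} {w : W} (hw : w ∈ A.overlap i j) (u : W) :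
    fderiv ℝ (A.change j i) (A.change i j w) (fderiv ℝ (A.change i j) w u) = u := by
  have h1 := ((A.contDiffAt_change (A.change_mem hw)).differentiableAt (by simp)).hasFDerivAt.comp w
    ((A.contDiffAt_change hw).differentiableAt (by simp)).hasFDerivAt
  have h2 : A.change j i ∘ A.change i j =ᶠ[𝓝 w] id := by
    filter_upwards [(A.isOpen_overlap i j).mem_nhds hw] with y hy using A.change_change hy
  exact congrFun (congrArg DFunLike.coe
    (h1.unique ((hasFDerivAt_id w).congr_of_eventuallyEq h2))) u

theorem bijective_fderiv_change {i j : ι} {w : W} (hw : w ∈ A.overlap i j) :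
    Function.Bijective (fderiv ℝ (A.change i j) w) := by
  refine Function.bijective_iff_has_inverse.2 ⟨fderiv ℝ (A.change j i) (A.change i j w),
    A.fderiv_change_change hw, fun u ↦ ?_⟩
  have := A.fderiv_change_change (A.change_mem hw) u
  rwa [A.change_change hw] at this

theorem coneForm_overlap (i j : ι) : ConeForm (A.overlap i j) e (A.form j) :=
  (A.coneForm j).mono (A.isOpen_overlap i j) (A.overlap_subset i j) (A.overlap_add i j)

theorem coneChange (i j : ι) :
    ConeChange (A.overlap i j) (A.dom i) e (A.form j) (A.form i) (A.change i j) where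
  mapsTo _ hw := A.overlap_subset j i (A.change_mem hw)
  smooth := A.change_smooth i j
  bijective _ hw := A.bijective_fderiv_change hw
  add := A.change_add i j
  form := A.form_change i j

variable {A} in
theorem IsConnection.flatten {Γ : ι → W → W →L[ℝ] W →L[ℝ] W} (hΓ : A.IsConnection Γ) (n : ℕ) :
    A.IsConnection fun j ↦ SymplecticInduction.flatten e (A.form j) n (Γ j) where
  conn j := (hΓ.conn j).flatten (A.coneForm j) n
  related i j := by
    have hres : ConeConn (A.overlap i j) e (A.form j) (Γ j) := by
      have h := hΓ.conn j
      have hs := A.overlap_subset i j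
      exact ⟨h.smooth.mono hs, fun w hw ↦ h.symm w (hs hw), fun w hw ↦ h.unit w (hs hw),
        fun w hw ↦ h.invariant w (hs hw), fun w hw ↦ h.parallel w (hs hw)⟩
    exact (A.coneChange i j).flatten (A.coneForm_overlap i j) (A.coneForm i) hres (hΓ.conn i)
      (hΓ.related i j) n

/-- The conditions on the symbols, including the inhomogeneous transformation law, are affine, so
sums with weights adding up to one preserve them. The weights must be constant along `e` to keep
invariance. -/
theorem exists_isConnection {ρ : ι → ι → W → ℝ} (hρ : A.IsPartition ρ) (l : W →L[ℝ] ℝ)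
    (hl : l e = 1) : ∃ Γ, A.IsConnection Γ := by
  choose G hG using fun i ↦ (A.coneForm i).exists_coneConn l hl
  let T : ι → ι → W → W →L[ℝ] W →L[ℝ] W := fun i j ↦ transport (A.change i j) (G i)
  have hT : ∀ i j, ConeConn (A.overlap i j) e (A.form j) (T i j) := fun i j ↦
    (A.coneChange i j).transport (A.coneForm_overlap i j) (A.coneForm i) (hG i)
  -- The local connection number `i` is transported to the charts `j` and `k`; the cocycle relation
  -- makes the two expressions related on the triple overlap.
  have hTrel : ∀ i j k, ∀ w ∈ A.overlap i j, w ∈ A.overlap k j →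
      Related (A.change k j) w (T i j) (T i k) := by
    intro i j k w hw hk
    have hik : A.change k j w ∈ A.overlap i k := (A.cocycle k j i w hk hw).1
    have h1 : Related (A.change i j) w (T i j) (G i) :=
      related_transport (A.bijective_fderiv_change hw)
    have h2 : Related (A.change i k) (A.change k j w) (T i k) (G i) :=
      related_transport (A.bijective_fderiv_change hik)
    have h3 : A.change i j =ᶠ[𝓝 w] A.change i k ∘ A.change k j := by
      filter_upwards [(A.isOpen_overlap i j).mem_nhds hw, (A.isOpen_overlap k j).mem_nhds hk]
        with y hy hyk using (A.cocycle k j i y hyk hy).2.symm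
    exact (h1.congr h3).cancel (A.contDiffAt_change hik) (A.contDiffAt_change hk)
      (A.bijective_fderiv_change hik).1 h2
  obtain ⟨Γ, hΓ⟩ : ∃ Γ : ι → W → W →L[ℝ] W →L[ℝ] W, ∀ j w, Γ j w = ∑ᶠ i, ρ i j w • T i j w :=
    ⟨_, fun _ _ ↦ rfl⟩
  have hfin : ∀ j w (s : Finset ι), (∀ i, i ∉ s → ρ i j w = 0) →
      Γ j w = ∑ i ∈ s, ρ i j w • T i j w := by
    intro j w s hs
    rw [hΓ]
    refine finsum_eq_sum_of_support_subset _ fun i hi ↦ ?_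
    by_contra his
    exact hi (by simp only [hs i his, zero_smul])
  have hsum : ∀ j, ∀ w ∈ A.dom j, ∀ s : Finset ι, (∀ i, i ∉ s → ρ i j w = 0) →
      ∑ i ∈ s, ρ i j w = 1 := by
    intro j w hw s hs
    rw [← hρ.sum j w hw]
    refine (finsum_eq_sum_of_support_subset _ fun i hi ↦ ?_).symm
    by_contra his
    exact hi (hs i his)
  have happ : ∀ j w (s : Finset ι), (∀ i, i ∉ s → ρ i j w = 0) → ∀ u v,
      Γ j w u v = ∑ i ∈ s, ρ i j w • T i j w u v := by
    intro j w s hs u v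
    rw [hfin j w s hs]
    simp only [sum_apply, smul_apply]
  have hlin : ∀ j, ∀ w ∈ A.dom j, ∀ s : Finset ι, (∀ i, i ∉ s → ρ i j w = 0) →
      ∀ (x : W), ∑ i ∈ s, ρ i j w • x = x := by
    intro j w hw s hs x
    rw [← Finset.sum_smul, hsum j w hw s hs, one_smul]
  refine ⟨Γ, fun j ↦ ⟨fun w hw ↦ ?_, fun w hw u v ↦ ?_, fun w hw v ↦ ?_, fun w hw t ↦ ?_,
    fun w hw u v z ↦ ?_⟩, fun k j w hw u v ↦ ?_⟩
  · obtain ⟨s, hs, hs'⟩ := hρ.locallyFinite j w hw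
    have h1 : ContDiffAt ℝ ∞ (fun w ↦ ∑ i ∈ s, ρ i j w • T i j w) w :=
      ContDiffAt.sum fun i hi ↦
        ((hρ.smooth i j).contDiffAt ((A.coneForm j).isOpen.mem_nhds hw)).smul
          ((hT i j).smooth.contDiffAt ((A.isOpen_overlap i j).mem_nhds (hs i hi)))
    exact (h1.congr_of_eventuallyEq
      (hs'.mono fun y hy ↦ hfin j y s hy)).contDiffWithinAt
  · obtain ⟨s, hs, hs'⟩ := hρ.locallyFinite j w hw
    rw [happ j w s hs'.self_of_nhds, happ j w s hs'.self_of_nhds]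
    exact Finset.sum_congr rfl fun i hi ↦ by rw [(hT i j).symm w (hs i hi)]
  · obtain ⟨s, hs, hs'⟩ := hρ.locallyFinite j w hw
    rw [happ j w s hs'.self_of_nhds]
    refine (Finset.sum_congr rfl fun i hi ↦ ?_).trans (hlin j w hw s hs'.self_of_nhds v)
    rw [(hT i j).unit w (hs i hi)]
  · obtain ⟨s, hs, hs'⟩ := hρ.locallyFinite j w hw
    have h1 := hs'.self_of_nhds
    rw [hfin j w s h1, hfin j (w + t • e) s fun i hi ↦ by rw [hρ.add i j w hw, h1 i hi]]
    refine Finset.sum_congr rfl fun i hi ↦ ?_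
    rw [hρ.add i j w hw, (hT i j).invariant w (hs i hi)]
  · obtain ⟨s, hs, hs'⟩ := hρ.locallyFinite j w hw
    have h1 := hs'.self_of_nhds
    rw [happ j w s h1, happ j w s h1, map_sum, map_sum, sum_apply, ← Finset.sum_add_distrib]
    have h2 : fderiv ℝ (A.form j) w u v z = ∑ i ∈ s, ρ i j w * fderiv ℝ (A.form j) w u v z := by
      rw [← Finset.sum_mul, hsum j w hw s h1, one_mul]
    refine h2.trans (Finset.sum_congr rfl fun i hi ↦ ?_)
    rw [(hT i j).parallel w (hs i hi)]
    simp only [map_smul, smul_apply, smul_eq_mul]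
    ring
  · have hwj := A.overlap_subset k j hw
    obtain ⟨s, hs, hs'⟩ := hρ.locallyFinite j w hwj
    have h1 := hs'.self_of_nhds
    rw [happ j w s h1, happ k (A.change k j w) s fun i hi ↦ by rw [← hρ.change i j k w hw, h1 i hi],
      -- The inhomogeneous second derivative is spread over the weights, since they sum to one; then
      -- the law can be checked summand by summand.
      map_sum, ← hlin j w hwj s h1 (fderiv ℝ (fderiv ℝ (A.change k j)) w u v),
      ← Finset.sum_add_distrib]
    refine Finset.sum_congr rfl fun i hi ↦ ?_
    rw [map_smul, hTrel i j k w (hs i hi) hw, ← hρ.change i j k w hw, smul_add]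

theorem exists_ricciFlat {ρ : ι → ι → W → ℝ} (hρ : A.IsPartition ρ) (l : W →L[ℝ] ℝ)
    (hl : l e = 1) {n : ℕ} (hn : Module.finrank ℝ W = 2 * n + 2) :
    ∃ Γ, A.IsConnection Γ ∧ ∀ j, ∀ w ∈ A.dom j, ∀ u v, ric (Γ j) w u v = 0 := by
  obtain ⟨Γ, hΓ⟩ := A.exists_isConnection hρ l hl
  have he : e ≠ 0 := by
    rintro rfl
    simp at hl
  exact ⟨_, hΓ.flatten n, fun j w hw u v ↦
    (hΓ.conn j).ric_flatten (A.coneForm j) he hn hw u v⟩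

end ConeAtlas

end Atlas

/-! ### The cone atlas of the manifold -/

section ConeAtlas

variable {E : Type*} [NormedAddCommGroup E] [NormedSpace ℝ E] [FiniteDimensional ℝ E]
  {H : Type*} [TopologicalSpace H] {I : ModelWithCorners ℝ E H} [I.Boundaryless]
  {P : Type*} [TopologicalSpace P] [ChartedSpace H P] [IsManifold I ∞ P]
  {V : Type*} [NormedAddCommGroup V] [NormedSpace ℝ V] [FiniteDimensional ℝ V]
  {H' : Type*} [TopologicalSpace H'] {J : ModelWithCorners ℝ V H'} [J.Boundaryless]
  {N : Type*} [TopologicalSpace N] [ChartedSpace H' N] [IsManifold J ∞ N]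
  {S : VField I P}

variable (J) in
/-- The overlap of the domains of the parametrisations `coneParam` at `i` and `j`, in the
coordinates of the latter. -/
def coneOverlap (i j : N) : Set (V × ℝ) :=
  coneDomain J j ∩ {w | (extChartAt J j).symm w.1 ∈ (extChartAt J i).source}

theorem isOpen_coneOverlap (i j : N) : IsOpen (coneOverlap J i j) := by
  have h1 : IsOpen ((extChartAt J j).target ∩
      (extChartAt J j).symm ⁻¹' (extChartAt J i).source) :=
    (continuousOn_extChartAt_symm j).isOpen_inter_preimage (isOpen_extChartAt_target j)
      (isOpen_extChartAt_source i)
  exact h1.preimage continuous_fst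

variable (Φ : (N × ℝ) ≃ₘ^∞⟮J.prod 𝓘(ℝ, ℝ), I⟯ P)

theorem coneChart_coneParam_eq (i j : N) (w : V × ℝ) :
    (coneChart Φ i ∘ coneParam J Φ j) w =
      (extChartAt J i ((extChartAt J j).symm w.1), w.2) := by
  simp only [Function.comp_apply, coneParam, coneChart, Diffeomorph.symm_apply_apply]

theorem symm_coneParam (j : N) (w : V × ℝ) :
    Φ.symm (coneParam J Φ j w) = ((extChartAt J j).symm w.1, w.2) := by
  simp only [coneParam, Diffeomorph.symm_apply_apply]

theorem symm_coneParam_mem_of_overlap {i j : N} {w : V × ℝ} (hw : w ∈ coneOverlap J i j) :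
    (Φ.symm (coneParam J Φ j w)).1 ∈ (extChartAt J i).source := by
  rw [symm_coneParam]
  exact hw.2

theorem coneParam_change {i j : N} {w : V × ℝ} (hw : w ∈ coneOverlap J i j) :
    coneParam J Φ i ((coneChart Φ i ∘ coneParam J Φ j) w) = coneParam J Φ j w :=
  coneParam_coneChart Φ (symm_coneParam_mem_of_overlap Φ hw)

theorem change_mem_coneDomain {i j : N} {w : V × ℝ} (hw : w ∈ coneOverlap J i j) :
    (coneChart Φ i ∘ coneParam J Φ j) w ∈ coneDomain J i :=
  coneChart_mem Φ (symm_coneParam_mem_of_overlap Φ hw)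

theorem contDiffAt_coneChange {i j : N} {w : V × ℝ} (hw : w ∈ coneOverlap J i j) :
    ContDiffAt ℝ ∞ (coneChart Φ i ∘ coneParam J Φ j) w :=
  ((contMDiffAt_coneChart Φ (symm_coneParam_mem_of_overlap Φ hw)).comp w
    (contMDiffAt_coneParam Φ hw.1)).contDiffAt

theorem coordForm_change {k : ℕ} (η : DForm I P k) {i j : N} {w : V × ℝ}
    (hw : w ∈ coneOverlap J i j) : coordForm (coneParam J Φ j) η w =
      (coordForm (coneParam J Φ i) η ((coneChart Φ i ∘ coneParam J Φ j) w)).compContinuousLinearMap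
        (fderiv ℝ (coneChart Φ i ∘ coneParam J Φ j) w) := by
  have h1 := (contMDiffAt_coneParam Φ (change_mem_coneDomain Φ hw)).mdifferentiableAt (by simp)
  have h2 := (contDiffAt_coneChange Φ hw).differentiableAt (by simp)
  have h3 : coneParam J Φ j =ᶠ[𝓝 w] coneParam J Φ i ∘ (coneChart Φ i ∘ coneParam J Φ j) := by
    filter_upwards [(isOpen_coneOverlap i j).mem_nhds hw] with y hy
      using (coneParam_change Φ hy).symm
  rw [coordForm_congr η h3, coordForm_comp_right η h1 h2]

variable {μ : DForm I P 2}

/-- Nondegeneracy and closedness pass through the parametrisation. Homogeneity comes from the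
primitive: it scales by `exp (2 t)` under translation, and so does its exterior derivative. -/
theorem coneForm_coneParam (hμ : IsSymplecticForm μ) (hs : IsSmoothField S)
    (hd : extD (fun x ↦ (1 / 2 : ℝ) • interior S μ x) = μ)
    (hΦ : ∀ x, IsMIntegralCurve (fun s ↦ Φ (x, s)) S) {ι : N → P} (hι : ContMDiff J I ∞ ι)
    (hΦ0 : ∀ x, Φ (x, 0) = ι x) (j : N) :
    ConeForm (coneDomain J j) ((0, 1) : V × ℝ)
      (fun w ↦ bil (V × ℝ) (coordForm (coneParam J Φ j) μ w)) := by
  have hcd : ∀ w ∈ coneDomain J j, ContDiffAt ℝ ∞ (coordForm (coneParam J Φ j) μ) w :=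
    fun w hw ↦ hμ.smooth.contDiffAt_coordForm (contMDiffAt_coneParam Φ hw)
  have hadd : ∀ w ∈ coneDomain J j, ∀ t : ℝ, w + t • ((0, 1) : V × ℝ) ∈ coneDomain J j := by
    intro w hw t
    simpa [coneDomain] using hw
  refine ⟨isOpen_coneDomain (J := J) j, hadd, fun w hw ↦ (contDiffAt_bil (hcd w hw)).contDiffWithinAt,
    fun w hw u v ↦ bil_swap _ v u, fun w hw u hu ↦ ?_, fun w hw x y z ↦ ?_, fun w hw t ↦ ?_⟩
  · have hinv := isInvertible_mfderiv_coneParam Φ hw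
    have h1 : mfderiv 𝓘(ℝ, V × ℝ) I (coneParam J Φ j) w u = 0 := by
      refine hμ.nondegenerate _ _ fun v ↦ ?_
      obtain ⟨v', h2⟩ : ∃ v' : V × ℝ, mfderiv 𝓘(ℝ, V × ℝ) I (coneParam J Φ j) w v' = v :=
        ⟨(mfderiv 𝓘(ℝ, V × ℝ) I (coneParam J Φ j) w).inverse v,
          congrArg (fun f ↦ f v) hinv.self_comp_inverse⟩
      have h3 := hu v'
      rw [bil_apply, coordForm_apply] at h3
      refine Eq.trans ?_ h3
      congr 1
      ext i
      fin_cases i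
      · rfl
      · exact h2.symm
    have h4 : (mfderiv 𝓘(ℝ, V × ℝ) I (coneParam J Φ j) w).inverse
        (mfderiv 𝓘(ℝ, V × ℝ) I (coneParam J Φ j) w u) = u :=
      congrArg (fun f ↦ f u) hinv.inverse_comp_self
    rw [← h4, h1]
    exact map_zero _
  · have h1 := hμ.smooth.coordForm_extD (contMDiffAt_coneParam Φ hw)
    rw [hμ.closed] at h1
    have h2 := extDeriv_two ((hcd w hw).differentiableAt (by simp)) x y z
    rw [← h1] at h2
    have h3 : coordForm (coneParam J Φ j) (0 : DForm I P 3) w ![x, y, z] = 0 := rfl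
    rw [h3, fderiv_bil_swap ((hcd w hw).differentiableAt (by simp)) y z x] at h2
    linarith
  · set l : DForm I P 1 := fun x ↦ (1 / 2 : ℝ) • interior S μ x with hl
    have hls : IsSmoothForm l := (hμ.smooth.interior hs).const_smul _
    have hbd : ∀ w ∈ coneDomain J j, DifferentiableAt ℝ (coordForm (coneParam J Φ j) l) w :=
      fun w hw ↦ (hls.contDiffAt_coordForm (contMDiffAt_coneParam Φ hw)).differentiableAt (by simp)
    have hld : ∀ w ∈ coneDomain J j,
        DifferentiableAt ℝ (fun w ↦ lin (V × ℝ) (coordForm (coneParam J Φ j) l w)) w :=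
      fun w hw ↦ (contDiffAt_lin (hls.contDiffAt_coordForm
        (contMDiffAt_coneParam Φ hw))).differentiableAt (by simp)
    have h1 : ∀ w ∈ coneDomain J j, ∀ u v, bil (V × ℝ) (coordForm (coneParam J Φ j) μ w) u v =
        fderiv ℝ (fun w ↦ lin (V × ℝ) (coordForm (coneParam J Φ j) l w)) w u v -
          fderiv ℝ (fun w ↦ lin (V × ℝ) (coordForm (coneParam J Φ j) l w)) w v u := by
      intro w hw u v
      have h2 := hls.coordForm_extD (contMDiffAt_coneParam Φ hw)
      rw [hd] at h2
      rw [h2, bil_extDeriv (hbd w hw)]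
    have h3 := fderiv_add_smul (X := (V × ℝ) →L[ℝ] ℝ) (e := ((0, 1) : V × ℝ)) (t := t)
      (a := Real.exp (2 * t))
      (f := fun w ↦ lin (V × ℝ) (coordForm (coneParam J Φ j) l w)) (isOpen_coneDomain (J := J) j)
      (fun w hw ↦ ContinuousLinearMap.ext fun u ↦ by
        rw [smul_apply, coordForm_coneParam_primitive Φ hμ.smooth hs hd hΦ hι hΦ0 hw,
          coordForm_coneParam_primitive Φ hμ.smooth hs hd hΦ hι hΦ0 (hadd w hw t)]
        have h4 : w + t • ((0, 1) : V × ℝ) = (w.1, w.2 + t) := by ext <;> simp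
        rw [h4, smul_eq_mul, ← mul_assoc, ← Real.exp_add, mul_add, add_comm (2 * w.2)]) hw (hld w hw)
    refine ContinuousLinearMap.ext fun u ↦ ContinuousLinearMap.ext fun v ↦ ?_
    rw [h1 _ (hadd w hw t), h3, smul_apply, smul_apply, smul_apply, smul_apply, smul_apply,
      smul_apply, h1 w hw, smul_sub]

/-- The cone atlas of a symplectic manifold identified with `N × ℝ` by the flow of a homothety. -/
def coneAtlas (hμ : IsSymplecticForm μ) (hs : IsSmoothField S)
    (hd : extD (fun x ↦ (1 / 2 : ℝ) • interior S μ x) = μ)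
    (hΦ : ∀ x, IsMIntegralCurve (fun s ↦ Φ (x, s)) S) {ι : N → P} (hι : ContMDiff J I ∞ ι)
    (hΦ0 : ∀ x, Φ (x, 0) = ι x) : ConeAtlas N (V × ℝ) (0, 1) where
  dom := coneDomain J
  form j w := bil (V × ℝ) (coordForm (coneParam J Φ j) μ w)
  overlap := coneOverlap J
  change i j := coneChart Φ i ∘ coneParam J Φ j
  coneForm := coneForm_coneParam Φ hμ hs hd hΦ hι hΦ0
  isOpen_overlap := isOpen_coneOverlap
  overlap_subset _ _ := Set.inter_subset_left
  overlap_add i j w hw t := by simpa [coneOverlap, coneDomain] using hw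
  change_self j w hw := ⟨⟨hw, (extChartAt J j).map_target hw⟩, coneChart_coneParam Φ hw⟩
  change_smooth i j w hw := (contDiffAt_coneChange Φ hw).contDiffWithinAt
  change_add i j w hw t := by
    rw [coneChart_coneParam_eq, coneChart_coneParam_eq]
    simp
  cocycle i j k w hw hk := by
    have h1 : (extChartAt J i).symm (extChartAt J i ((extChartAt J j).symm w.1)) =
        (extChartAt J j).symm w.1 := (extChartAt J i).left_inv hw.2
    refine ⟨⟨change_mem_coneDomain Φ hw, ?_⟩, ?_⟩
    · rw [coneChart_coneParam_eq]
      change (extChartAt J i).symm (extChartAt J i ((extChartAt J j).symm w.1)) ∈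
        (extChartAt J k).source
      rw [h1]
      exact hk.2
    · rw [coneChart_coneParam_eq, coneChart_coneParam_eq, coneChart_coneParam_eq, h1]
  form_change i j w hw u v := by
    rw [coordForm_change Φ μ hw, bil_apply, bil_apply]
    change coordForm (coneParam J Φ i) μ _ _ = _
    refine congrArg _ (funext fun i ↦ ?_)
    fin_cases i <;> rfl

/-- A partition of unity of `N` subordinate to its charts is pulled back to the cone, so it does not
depend on the coordinate `s`. -/
theorem exists_isPartition [T2Space N] [SigmaCompactSpace N] (hμ : IsSymplecticForm μ)
    (hs : IsSmoothField S)
    (hd : extD (fun x ↦ (1 / 2 : ℝ) • interior S μ x) = μ)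
    (hΦ : ∀ x, IsMIntegralCurve (fun s ↦ Φ (x, s)) S) {ι : N → P} (hι : ContMDiff J I ∞ ι)
    (hΦ0 : ∀ x, Φ (x, 0) = ι x) : ∃ ρ, (coneAtlas Φ hμ hs hd hΦ hι hΦ0).IsPartition ρ := by
  obtain ⟨f, hf⟩ := SmoothPartitionOfUnity.exists_isSubordinate J isClosed_univ
    (fun i : N ↦ (extChartAt J i).source) (fun i ↦ isOpen_extChartAt_source i)
    (fun x _ ↦ Set.mem_iUnion.2 ⟨x, mem_extChartAt_source x⟩)
  refine ⟨fun i j w ↦ f i ((extChartAt J j).symm w.1), fun i j w hw ↦ ?_, fun i j w hw t ↦ ?_,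
    fun j w hw ↦ ?_, fun j w hw ↦ ?_, fun i j k w hw ↦ ?_⟩
  · have h1 : ContMDiffAt 𝓘(ℝ, V × ℝ) 𝓘(ℝ, ℝ) ∞ (fun w : V × ℝ ↦ f i ((extChartAt J j).symm w.1)) w :=
      (f i).contMDiff.contMDiffAt.comp w ((contMDiffAt_extChartAt_symm (I := J) hw).comp w
        contDiff_fst.contDiffAt.contMDiffAt)
    exact h1.contDiffAt.contDiffWithinAt
  · simp
  -- These are the indices whose closed support contains the point; subordination puts the point in
  -- each of the corresponding chart domains, and near it no other weight is nonzero.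
  · refine ⟨f.fintsupport ((extChartAt J j).symm w.1), fun i hi ↦ ⟨hw, ?_⟩, ?_⟩
    · exact hf i ((f.mem_fintsupport_iff _ i).1 hi)
    · have h1 : ContinuousAt (fun w : V × ℝ ↦ (extChartAt J j).symm w.1) w :=
        ((contMDiffAt_extChartAt_symm (I := J) hw).comp w
          contDiff_fst.contDiffAt.contMDiffAt).continuousAt
      filter_upwards [h1.eventually (f.eventually_finsupport_subset _)] with y hy i hi
      by_contra h2
      exact hi (hy ((f.mem_finsupport _).2 h2))
  · exact f.sum_eq_one (Set.mem_univ _)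
  · have h1 : (extChartAt J k).symm (extChartAt J k ((extChartAt J j).symm w.1)) =
        (extChartAt J j).symm w.1 := (extChartAt J k).left_inv hw.2
    change _ = f i ((extChartAt J k).symm ((coneChart Φ k ∘ coneParam J Φ j) w).1)
    rw [coneChart_coneParam_eq, h1]

end ConeAtlas

/-! ### Covariant derivatives from Christoffel symbols -/

section ParamAtlas

variable {ι : Type*} {W : Type*} [NormedAddCommGroup W] [NormedSpace ℝ W] [FiniteDimensional ℝ W]
  {E : Type*} [NormedAddCommGroup E] [NormedSpace ℝ E] [FiniteDimensional ℝ E]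
  {H : Type*} [TopologicalSpace H] {I : ModelWithCorners ℝ E H} [I.Boundaryless]
  {P : Type*} [TopologicalSpace P] [ChartedSpace H P] [IsManifold I ∞ P]

variable (ι W I P) in
/-- A family of smooth parametrisations of open subsets of a manifold, which cover it. -/
structure ParamAtlas where
  dom : ι → Set W
  src : ι → Set P
  param : ι → W → P
  chart : ι → P → W
  index : P → ι
  isOpen_dom : ∀ j, IsOpen (dom j)
  isOpen_src : ∀ j, IsOpen (src j)
  mem_src_index : ∀ p, p ∈ src (index p)
  contMDiffAt_param : ∀ j, ∀ w ∈ dom j, ContMDiffAt 𝓘(ℝ, W) I ∞ (param j) w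
  contMDiffAt_chart : ∀ j, ∀ p ∈ src j, ContMDiffAt I 𝓘(ℝ, W) ∞ (chart j) p
  chart_mem : ∀ j, ∀ p ∈ src j, chart j p ∈ dom j
  param_chart : ∀ j, ∀ p ∈ src j, param j (chart j p) = p
  chart_param : ∀ j, ∀ w ∈ dom j, chart j (param j w) = w
  isInvertible : ∀ j, ∀ w ∈ dom j, (mfderiv 𝓘(ℝ, W) I (param j) w).IsInvertible

namespace ParamAtlas

variable (a : ParamAtlas ι W I P)

/-- The derivative of a parametrisation, between model spaces. -/
def frame (j : ι) (w : W) : W →L[ℝ] E := mfderiv 𝓘(ℝ, W) I (a.param j) w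

/-- The expression of a vector field in a parametrisation. -/
def field (j : ι) (Y : VField I P) : W → W := coordField (F := W) (a.param j) Y

theorem field_apply (j : ι) (Y : VField I P) (w : W) :
    a.field j Y w = (a.frame j w).inverse (Y (a.param j w) : E) := rfl

variable {a} {i j : ι} {w : W}

theorem frame_inverse (hw : w ∈ a.dom j) (v : E) :
    a.frame j w ((a.frame j w).inverse v) = v :=
  congrArg (fun f : E →L[ℝ] E ↦ f v) (a.isInvertible j w hw).self_comp_inverse

theorem inverse_frame (hw : w ∈ a.dom j) (u : W) :
    (a.frame j w).inverse (a.frame j w u) = u :=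
  congrArg (fun f : W →L[ℝ] W ↦ f u) (a.isInvertible j w hw).inverse_comp_self

theorem frame_field (hw : w ∈ a.dom j) (Y : VField I P) :
    a.frame j w (a.field j Y w) = (Y (a.param j w) : E) :=
  frame_inverse hw _

theorem param_change (hi : a.param j w ∈ a.src i) :
    a.param i ((a.chart i ∘ a.param j) w) = a.param j w :=
  a.param_chart i _ hi

theorem change_mem (hi : a.param j w ∈ a.src i) : (a.chart i ∘ a.param j) w ∈ a.dom i :=
  a.chart_mem i _ hi

theorem contDiffAt_change (hw : w ∈ a.dom j) (hi : a.param j w ∈ a.src i) :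
    ContDiffAt ℝ ∞ (a.chart i ∘ a.param j) w :=
  ((a.contMDiffAt_chart i _ hi).comp w (a.contMDiffAt_param j w hw)).contDiffAt

theorem eventually_mem (hw : w ∈ a.dom j) (hi : a.param j w ∈ a.src i) :
    ∀ᶠ y in 𝓝 w, y ∈ a.dom j ∧ a.param j y ∈ a.src i := by
  filter_upwards [(a.isOpen_dom j).mem_nhds hw,
    (a.contMDiffAt_param j w hw).continuousAt.eventually_mem ((a.isOpen_src i).mem_nhds hi)]
    with y h1 h2 using ⟨h1, h2⟩

theorem frame_change (hw : w ∈ a.dom j) (hi : a.param j w ∈ a.src i) (u : W) :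
    a.frame i ((a.chart i ∘ a.param j) w) (fderiv ℝ (a.chart i ∘ a.param j) w u) =
      a.frame j w u := by
  have h1 := (a.contMDiffAt_param i _ (change_mem hi)).mdifferentiableAt (by simp)
  have h2 := (contDiffAt_change hw hi).differentiableAt (by simp)
  have h3 : a.param i ∘ (a.chart i ∘ a.param j) =ᶠ[𝓝 w] a.param j := by
    filter_upwards [eventually_mem hw hi] with y hy using param_change hy.2
  have h4 := mfderiv_comp w h1 h2.mdifferentiableAt
  rw [h3.mfderiv_eq, mfderiv_eq_fderiv] at h4
  exact (congrFun (congrArg DFunLike.coe h4) u).symm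

theorem apply_of_eq (Y : VField I P) {p q : P} (h : p = q) : (Y p : E) = Y q := by
  subst h
  rfl

theorem field_change (hw : w ∈ a.dom j) (hi : a.param j w ∈ a.src i) (Y : VField I P) :
    fderiv ℝ (a.chart i ∘ a.param j) w (a.field j Y w) =
      a.field i Y ((a.chart i ∘ a.param j) w) := by
  rw [← inverse_frame (change_mem hi) (fderiv ℝ (a.chart i ∘ a.param j) w (a.field j Y w)),
    frame_change hw hi, frame_field hw, field_apply, apply_of_eq Y (param_change hi)]

theorem differentiableAt_field (hw : w ∈ a.dom j) {Y : VField I P}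
    (hY : MDifferentiableAt I I.tangent (fun x ↦ (⟨x, Y x⟩ : TangentBundle I P)) (a.param j w)) :
    DifferentiableAt ℝ (a.field j Y) w := by
  have : CompleteSpace E := FiniteDimensional.complete ℝ E
  have : CompleteSpace W := FiniteDimensional.complete ℝ W
  have : IsManifold I 2 P := IsManifold.of_le (n := ∞) ENat.LEInfty.out
  have h1 := MDifferentiableAt.mpullback_vectorField hY (a.contMDiffAt_param j w hw)
    (a.isInvertible j w hw) ENat.LEInfty.out
  exact ((contMDiff_snd_tangentBundle_modelSpace W 𝓘(ℝ, W)).contMDiffAt.mdifferentiableAt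
    one_ne_zero |>.comp w h1).differentiableAt

theorem contDiffAt_field (hw : w ∈ a.dom j) {Y : VField I P}
    (hY : ContMDiffAt I I.tangent ∞ (fun x ↦ (⟨x, Y x⟩ : TangentBundle I P)) (a.param j w)) :
    ContDiffAt ℝ ∞ (a.field j Y) w :=
  have : CompleteSpace E := FiniteDimensional.complete ℝ E
  have : CompleteSpace W := FiniteDimensional.complete ℝ W
  contDiffAt_coordField hY (a.contMDiffAt_param j w hw) (a.isInvertible j w hw)

variable (a) in
/-- The covariant derivative with Christoffel symbols `Γ j` in the parametrisation `j`. -/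
def covDeriv (Γ : ι → W → W →L[ℝ] W →L[ℝ] W) (Y : VField I P) (p : P) :
    TangentSpace I p →L[ℝ] TangentSpace I p :=
  let j := a.index p
  let w := a.chart j p
  ((a.frame j w).comp ((fderiv ℝ (a.field j Y) w + (Γ j w).flip (a.field j Y w)).comp
    (a.frame j w).inverse) : E →L[ℝ] E)

theorem covDeriv_apply (Γ : ι → W → W →L[ℝ] W →L[ℝ] W) (Y : VField I P) (p : P) (v : E) :
    (covDeriv a Γ Y p v : E) = a.frame (a.index p) (a.chart (a.index p) p)
      (fderiv ℝ (a.field (a.index p) Y) (a.chart (a.index p) p)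
        ((a.frame (a.index p) (a.chart (a.index p) p)).inverse v) +
      Γ (a.index p) (a.chart (a.index p) p)
        ((a.frame (a.index p) (a.chart (a.index p) p)).inverse v)
        (a.field (a.index p) Y (a.chart (a.index p) p))) := rfl

variable {Γ : ι → W → W →L[ℝ] W →L[ℝ] W}

/-- The definition uses the parametrisation selected at each point; the transformation law shows
that any other one gives the same result. -/
theorem covDeriv_param
    (hΓ : ∀ i j, ∀ w ∈ a.dom j, a.param j w ∈ a.src i →
      Related (a.chart i ∘ a.param j) w (Γ j) (Γ i)) (hw : w ∈ a.dom j) {Y : VField I P}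
    (hY : MDifferentiableAt I I.tangent (fun x ↦ (⟨x, Y x⟩ : TangentBundle I P)) (a.param j w))
    (u : W) : (covDeriv a Γ Y (a.param j w) (a.frame j w u : E) : E) =
      a.frame j w (fderiv ℝ (a.field j Y) w u + Γ j w u (a.field j Y w)) := by
  rw [covDeriv_apply]
  obtain ⟨i, hi⟩ : ∃ i, i = a.index (a.param j w) := ⟨_, rfl⟩
  have hm : a.param j w ∈ a.src i := hi ▸ a.mem_src_index _
  rw [← hi]
  change a.frame i ((a.chart i ∘ a.param j) w) (fderiv ℝ (a.field i Y)
    ((a.chart i ∘ a.param j) w) ((a.frame i ((a.chart i ∘ a.param j) w)).inverse (a.frame j w u)) +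
    Γ i ((a.chart i ∘ a.param j) w) ((a.frame i ((a.chart i ∘ a.param j) w)).inverse
      (a.frame j w u)) (a.field i Y ((a.chart i ∘ a.param j) w))) = _
  have hκ := contDiffAt_change hw hm
  have hrel := hΓ i j w hw hm u (a.field j Y w)
  have hY' : DifferentiableAt ℝ (a.field i Y) ((a.chart i ∘ a.param j) w) :=
    differentiableAt_field (change_mem hm) (by rwa [param_change hm])
  -- The identity `field_change` is differentiated; the second derivative of the change of
  -- coordinates that appears is the inhomogeneous term of `Related`.
  have h1 : HasFDerivAt (fun y ↦ fderiv ℝ (a.chart i ∘ a.param j) y (a.field j Y y)) _ w :=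
    (differentiableAt_fderiv hκ).hasFDerivAt.clm_apply (differentiableAt_field hw hY).hasFDerivAt
  have h2 := hY'.hasFDerivAt.comp w (hκ.differentiableAt (by simp)).hasFDerivAt
  have h3 : (fun y ↦ fderiv ℝ (a.chart i ∘ a.param j) y (a.field j Y y)) =ᶠ[𝓝 w]
      a.field i Y ∘ (a.chart i ∘ a.param j) := by
    filter_upwards [eventually_mem hw hm] with y hy using field_change hy.1 hy.2 Y
  have h4 := congrFun (congrArg DFunLike.coe (h2.unique (h1.congr_of_eventuallyEq h3.symm))) u
  simp only [ContinuousLinearMap.flip_apply, add_apply, ContinuousLinearMap.comp_apply] at h4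
  rw [← frame_change hw hm u, inverse_frame (change_mem hm), h4, ← field_change hw hm,
    ← frame_change hw hm, map_add (fderiv ℝ (a.chart i ∘ a.param j) w), hrel]
  congr 1
  abel

theorem exists_param_eq (p : P) :
    ∃ j w, w ∈ a.dom j ∧ a.param j w = p ∧ j = a.index p :=
  ⟨_, a.chart _ p, a.chart_mem _ _ (a.mem_src_index p),
    a.param_chart _ _ (a.mem_src_index p), rfl⟩

theorem covDeriv_index (Γ : ι → W → W →L[ℝ] W →L[ℝ] W) (hw : w ∈ a.dom j)
    (hj : j = a.index (a.param j w)) (Y : VField I P) (v : E) :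
    (covDeriv a Γ Y (a.param j w) v : E) = a.frame j w
      (fderiv ℝ (a.field j Y) w ((a.frame j w).inverse v) +
        Γ j w ((a.frame j w).inverse v) (a.field j Y w)) := by
  rw [covDeriv_apply, ← hj, a.chart_param j w hw]

/-- Additivity and the Leibniz rule concern one point at a time, so the selected parametrisation
suffices and no compatibility is needed. -/
theorem isCovariantDerivativeOn_covDeriv :
    IsCovariantDerivativeOn E (covDeriv a Γ) (Set.univ : Set P) where
  add {Y Z p} hY hZ _ := by
    obtain ⟨j, w, hw, rfl, hj⟩ := a.exists_param_eq p
    refine ContinuousLinearMap.ext fun v ↦ ?_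
    obtain ⟨u, rfl⟩ : ∃ u, a.frame j w u = v := ⟨_, frame_inverse hw v⟩
    refine (covDeriv_index Γ hw hj _ (a.frame j w u)).trans (Eq.trans ?_
      (congrArg₂ (fun p q : E ↦ p + q) (covDeriv_index Γ hw hj Y (a.frame j w u))
        (covDeriv_index Γ hw hj Z (a.frame j w u))).symm)
    have h1 : a.field j (Y + Z) = fun y ↦ a.field j Y y + a.field j Z y :=
      funext fun y ↦ map_add (a.frame j y).inverse _ _
    rw [h1, fderiv_fun_add (differentiableAt_field hw hY) (differentiableAt_field hw hZ), add_apply,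
      map_add]
    simp only [map_add]
    abel
  leibniz {Y g p} hY hg _ := by
    obtain ⟨j, w, hw, rfl, hj⟩ := a.exists_param_eq p
    obtain ⟨d, hd⟩ : ∃ d : E →L[ℝ] ℝ, d = mfderiv I 𝓘(ℝ, ℝ) g (a.param j w) := ⟨_, rfl⟩
    obtain ⟨y, hy⟩ : ∃ y : E, y = Y (a.param j w) := ⟨_, rfl⟩
    refine ContinuousLinearMap.ext fun v ↦ ?_
    obtain ⟨u, rfl⟩ : ∃ u, a.frame j w u = v := ⟨_, frame_inverse hw v⟩
    refine (covDeriv_index Γ hw hj _ (a.frame j w u)).trans (Eq.trans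
      (b := g (a.param j w) • a.frame j w (fderiv ℝ (a.field j Y) w
        ((a.frame j w).inverse (a.frame j w u)) + Γ j w ((a.frame j w).inverse (a.frame j w u))
          (a.field j Y w)) + d (a.frame j w u) • y) ?_
      (congrArg₂ (fun p q : E ↦ p + q)
        (congrArg (fun p : E ↦ g (a.param j w) • p)
          (covDeriv_index Γ hw hj Y (a.frame j w u)).symm)
        (by rw [hd, hy]; rfl)))
    have h1 : a.field j (g • Y) = fun y ↦ g (a.param j y) • a.field j Y y :=
      funext fun y ↦ map_smul (a.frame j y).inverse _ _
    have h2 := hg.hasMFDerivAt.comp w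
      ((a.contMDiffAt_param j w hw).mdifferentiableAt (by simp)).hasMFDerivAt
    have h3 : HasFDerivAt (g ∘ a.param j) (d.comp (a.frame j w)) w := by
      rw [hd]
      exact h2.hasFDerivAt
    have h4 : HasFDerivAt (fun y ↦ g (a.param j y) • a.field j Y y) _ w :=
      h3.smul (differentiableAt_field hw hY).hasFDerivAt
    rw [h1, h4.fderiv, hy.trans (frame_field hw Y).symm, inverse_frame hw]
    simp only [add_apply, smul_apply, ContinuousLinearMap.smulRight_apply, map_smul, smul_add,
      map_add, Function.comp_apply, ContinuousLinearMap.comp_apply]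
    abel

end ParamAtlas

end ParamAtlas

/-! ### Smoothness and torsion of the glued connection -/

section GluedConnection

variable {ι : Type*} {W : Type*} [NormedAddCommGroup W] [NormedSpace ℝ W] [FiniteDimensional ℝ W]
  {E : Type*} [NormedAddCommGroup E] [NormedSpace ℝ E] [FiniteDimensional ℝ E]
  {H : Type*} [TopologicalSpace H] {I : ModelWithCorners ℝ E H} [I.Boundaryless]
  {P : Type*} [TopologicalSpace P] [ChartedSpace H P] [IsManifold I ∞ P]

namespace ParamAtlas

variable {a : ParamAtlas ι W I P} {i j : ι} {w : W} {Γ : ι → W → W →L[ℝ] W →L[ℝ] W}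

theorem mfderiv_extChartAt_frame {x p : P} (hp : p ∈ a.src i) (hx : p ∈ (extChartAt I x).source)
    (u : W) : (mfderiv I 𝓘(ℝ, E) (extChartAt I x) p (a.frame i (a.chart i p) u : E) : E) =
      fderiv ℝ (extChartAt I x ∘ a.param i) (a.chart i p) u := by
  have : IsManifold I 1 P := IsManifold.of_le (n := ∞) (by simp)
  have h1 := a.contMDiffAt_param i _ (a.chart_mem i p hp)
  have h2 : ContMDiffAt I 𝓘(ℝ, E) ∞ (extChartAt I x) (a.param i (a.chart i p)) := by
    rw [a.param_chart i p hp]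
    exact contMDiffAt_extChartAt' (by rwa [← extChartAt_source I])
  have h3 := mfderiv_comp _ (h2.mdifferentiableAt (by simp)) (h1.mdifferentiableAt (by simp))
  rw [mfderiv_eq_fderiv, a.param_chart i p hp] at h3
  exact (congrFun (congrArg DFunLike.coe h3) u).symm

theorem frame_fderiv_symm {x p : P} (hp : p ∈ a.src i) (hx : p ∈ (extChartAt I x).source) (v : E) :
    a.frame i (a.chart i p)
      (fderiv ℝ (a.chart i ∘ (extChartAt I x).symm) (extChartAt I x p) v) =
      (mfderivWithin 𝓘(ℝ, E) I (extChartAt I x).symm (Set.range I) (extChartAt I x p) v : E) := by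
  have h0 := (extChartAt I x).left_inv hx
  have ht := (extChartAt I x).map_source hx
  have h1 : ContMDiffAt 𝓘(ℝ, E) I ∞ (extChartAt I x).symm (extChartAt I x p) :=
    contMDiffAt_extChartAt_symm ht
  have h2 : ContMDiffAt 𝓘(ℝ, E) 𝓘(ℝ, W) ∞ (a.chart i ∘ (extChartAt I x).symm)
      (extChartAt I x p) := by
    refine ContMDiffAt.comp _ ?_ h1
    rw [h0]
    exact a.contMDiffAt_chart i p hp
  have hw : (a.chart i ∘ (extChartAt I x).symm) (extChartAt I x p) = a.chart i p :=
    congrArg (a.chart i) h0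
  have h3 : ContMDiffAt 𝓘(ℝ, W) I ∞ (a.param i)
      ((a.chart i ∘ (extChartAt I x).symm) (extChartAt I x p)) := by
    rw [hw]
    exact a.contMDiffAt_param i _ (a.chart_mem i p hp)
  have h4 := mfderiv_comp _ (h3.mdifferentiableAt (by simp)) (h2.mdifferentiableAt (by simp))
  have h5 : a.param i ∘ (a.chart i ∘ (extChartAt I x).symm) =ᶠ[𝓝 (extChartAt I x p)]
      (extChartAt I x).symm := by
    have : (extChartAt I x).symm (extChartAt I x p) ∈ a.src i := by rwa [h0]
    filter_upwards [h1.continuousAt.eventually_mem ((a.isOpen_src i).mem_nhds this)] with y hy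
    exact a.param_chart i _ hy
  rw [h5.mfderiv_eq, mfderiv_eq_fderiv, hw] at h4
  rw [I.range_eq_univ, mfderivWithin_univ]
  exact (congrFun (congrArg DFunLike.coe h4) v).symm

/-- By `covDeriv_param` one fixed parametrisation may be used near `x`, although the definition
selects one point by point. In the tangent trivialisation at `x` the operator is then a composition
of three smooth families of linear maps. -/
theorem contMDiff_covDeriv
    (hrel : ∀ i j, ∀ w ∈ a.dom j, a.param j w ∈ a.src i →
      Related (a.chart i ∘ a.param j) w (Γ j) (Γ i))
    (hΓ : ∀ j, ContDiffOn ℝ ∞ (Γ j) (a.dom j)) :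
    have : IsManifold I 1 P := IsManifold.of_le (n := ∞) (by simp)
    ContMDiffCovariantDerivativeOn E ∞ (covDeriv a Γ) (Set.univ : Set P) := by
  intro _
  refine ⟨fun {Y} hY ↦ ?_⟩
  rw [contMDiffOn_univ] at hY ⊢
  have hY' : ContMDiff I I.tangent ∞ (fun x ↦ (⟨x, Y x⟩ : TangentBundle I P)) := hY
  intro x
  obtain ⟨i, hi⟩ : ∃ i, x ∈ a.src i := ⟨_, a.mem_src_index x⟩
  rw [contMDiffAt_hom_bundle]
  refine ⟨contMDiffAt_id, ?_⟩
  have hχ := a.contMDiffAt_chart i x hi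
  have hw := a.chart_mem i x hi
  have hφ : ContMDiffAt I 𝓘(ℝ, E) ∞ (extChartAt I x) x := contMDiffAt_extChartAt
  have h1 : ContDiffAt ℝ ∞ (extChartAt I x ∘ a.param i) (a.chart i x) := by
    refine (ContMDiffAt.comp (I' := I) _ ?_ (a.contMDiffAt_param i _ hw)).contDiffAt
    rwa [a.param_chart i x hi]
  have h2 : ContDiffAt ℝ ∞ (a.chart i ∘ (extChartAt I x).symm) (extChartAt I x x) := by
    refine (ContMDiffAt.comp (I' := I) _ ?_
      (contMDiffAt_extChartAt_symm (mem_extChartAt_target x))).contDiffAt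
    rwa [extChartAt_to_inv]
  have h3 : ContDiffAt ℝ ∞ (a.field i Y) (a.chart i x) :=
    contDiffAt_field hw hY'.contMDiffAt
  have h4 : ContDiffAt ℝ ∞ (fun y ↦ fderiv ℝ (a.field i Y) y + (Γ i y).flip (a.field i Y y))
      (a.chart i x) := by
    refine (h3.fderiv_right (by simp)).add ?_
    have h5 : ContDiffAt ℝ ∞ (fun y ↦ (Γ i y).flip) (a.chart i x) :=
      (ContinuousLinearMap.flipₗᵢ ℝ W W W).contDiff.contDiffAt.comp _
        ((hΓ i).contDiffAt ((a.isOpen_dom i).mem_nhds hw))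
    exact h5.clm_apply h3
  have h5 : ContMDiffAt I 𝓘(ℝ, W →L[ℝ] E) ∞
      (fun p ↦ fderiv ℝ (extChartAt I x ∘ a.param i) (a.chart i p)) x :=
    (h1.fderiv_right (m := ∞) (by simp)).contMDiffAt.comp x hχ
  have h6 : ContMDiffAt I 𝓘(ℝ, W →L[ℝ] W) ∞ (fun p ↦ fderiv ℝ (a.field i Y) (a.chart i p) +
      (Γ i (a.chart i p)).flip (a.field i Y (a.chart i p))) x :=
    h4.contMDiffAt.comp x hχ
  have h7 : ContMDiffAt I 𝓘(ℝ, E →L[ℝ] W) ∞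
      (fun p ↦ fderiv ℝ (a.chart i ∘ (extChartAt I x).symm) (extChartAt I x p)) x :=
    (h2.fderiv_right (m := ∞) (by simp)).contMDiffAt.comp x hφ
  refine (h5.clm_comp (h6.clm_comp h7)).congr_of_eventuallyEq ?_
  filter_upwards [(a.isOpen_src i).mem_nhds hi, (isOpen_extChartAt_source (I := I) x).mem_nhds
    (mem_extChartAt_source x)] with p hp hx
  have hx' : p ∈ (chartAt H x).source := by rwa [← extChartAt_source I]
  refine (inTangentCoordinates_eq_mfderiv_comp (I := I) (I' := I) (f := fun p : P ↦ p)
    (g := fun p : P ↦ p) (ϕ := fun p ↦ covDeriv a Γ Y p) (x₀ := x) (x := p) hx' hx').trans ?_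
  refine ContinuousLinearMap.ext fun v ↦ ?_
  have e1 := frame_fderiv_symm hp hx v
  obtain ⟨u, hu⟩ : ∃ u, u = fderiv ℝ (a.chart i ∘ (extChartAt I x).symm) (extChartAt I x p) v :=
    ⟨_, rfl⟩
  have hYp : MDifferentiableAt I I.tangent (fun x ↦ (⟨x, Y x⟩ : TangentBundle I P))
      (a.param i (a.chart i p)) := hY'.contMDiffAt.mdifferentiableAt (by simp)
  have e2 := covDeriv_param hrel (a.chart_mem i p hp) hYp u
  rw [← hu] at e1
  have e3 : (covDeriv a Γ Y p (a.frame i (a.chart i p) u : E) : E) =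
      a.frame i (a.chart i p) (fderiv ℝ (a.field i Y) (a.chart i p) u +
        Γ i (a.chart i p) u (a.field i Y (a.chart i p))) := by
    rw [← e2]
    rw [a.param_chart i p hp]
  refine (congrArg (fun z : E ↦ (mfderiv I 𝓘(ℝ, E) (extChartAt I x) p
    (covDeriv a Γ Y p z : E) : E)) e1.symm).trans ?_
  refine (congrArg (fun z : E ↦ (mfderiv I 𝓘(ℝ, E) (extChartAt I x) p z : E)) e3).trans ?_
  rw [mfderiv_extChartAt_frame hp hx, hu]
  rfl

variable (a Γ) in
/-- The linear connection with Christoffel symbols `Γ j` in the parametrisation `j`. -/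
def connection : LinearConnection I P where
  toFun := covDeriv a Γ
  isCovariantDerivativeOnUniv := isCovariantDerivativeOn_covDeriv

theorem field_connection
    (hrel : ∀ i j, ∀ w ∈ a.dom j, a.param j w ∈ a.src i →
      Related (a.chart i ∘ a.param j) w (Γ j) (Γ i)) (hw : w ∈ a.dom j) (X : VField I P)
    {Y : VField I P}
    (hY : MDifferentiableAt I I.tangent (fun x ↦ (⟨x, Y x⟩ : TangentBundle I P)) (a.param j w)) :
    a.field j (fun p ↦ connection a Γ Y p (X p)) w =
      fderiv ℝ (a.field j Y) w (a.field j X w) + Γ j w (a.field j X w) (a.field j Y w) := by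
  have h := covDeriv_param hrel hw hY (a.field j X w)
  rw [frame_field hw] at h
  rw [← inverse_frame hw (fderiv ℝ (a.field j Y) w (a.field j X w) +
    Γ j w (a.field j X w) (a.field j Y w)), ← h]
  rfl

theorem field_mlieBracket (hw : w ∈ a.dom j) {X Y : VField I P}
    (hX : MDifferentiableAt I I.tangent (fun x ↦ (⟨x, X x⟩ : TangentBundle I P)) (a.param j w))
    (hY : MDifferentiableAt I I.tangent (fun x ↦ (⟨x, Y x⟩ : TangentBundle I P)) (a.param j w)) :
    a.field j (VectorField.mlieBracket I X Y) w =
      fderiv ℝ (a.field j Y) w (a.field j X w) - fderiv ℝ (a.field j X) w (a.field j Y w) := by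
  have : CompleteSpace E := FiniteDimensional.complete ℝ E
  have : CompleteSpace W := FiniteDimensional.complete ℝ W
  have : IsManifold I (minSmoothness ℝ 3) P := by
    rw [minSmoothness_of_isRCLikeNormedField]
    exact IsManifold.of_le (n := ∞) ENat.LEInfty.out
  have h := VectorField.mpullback_mlieBracket (I := 𝓘(ℝ, W)) (I' := I) (n := ∞) hX hY
    (a.contMDiffAt_param j w hw)
    (by rw [minSmoothness_of_isRCLikeNormedField]; exact ENat.LEInfty.out)
  refine h.trans ?_
  rw [← VectorField.mlieBracketWithin_univ, VectorField.mlieBracketWithin_eq_lieBracketWithin]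
  exact congrFun (VectorField.lieBracketWithin_univ (𝕜 := ℝ) (V := a.field j X)
    (W := a.field j Y)) w

theorem eq_of_field_eq (hw : w ∈ a.dom j) {X Y : VField I P} (h : a.field j X w = a.field j Y w) :
    (X (a.param j w) : E) = Y (a.param j w) := by
  rw [← frame_field hw X, ← frame_field hw Y, h]

theorem field_sub (X Y : VField I P) :
    a.field j (fun p ↦ X p - Y p) w = a.field j X w - a.field j Y w :=
  map_sub (a.frame j w).inverse _ _

theorem torsion_connection
    (hrel : ∀ i j, ∀ w ∈ a.dom j, a.param j w ∈ a.src i →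
      Related (a.chart i ∘ a.param j) w (Γ j) (Γ i))
    (hsymm : ∀ j, ∀ w ∈ a.dom j, ∀ u v, Γ j w u v = Γ j w v u) :
    (connection a Γ).torsion = 0 := by
  rw [CovariantDerivative.torsion_eq_zero_iff]
  intro X Y p hX hY
  obtain ⟨j, w, hw, rfl, -⟩ := a.exists_param_eq p
  refine eq_of_field_eq (X := fun p ↦ connection a Γ Y p (X p) - connection a Γ X p (Y p)) hw ?_
  refine (field_sub (a := a) (j := j) (w := w) (fun p ↦ connection a Γ Y p (X p))
    (fun p ↦ connection a Γ X p (Y p))).trans ?_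
  rw [field_connection hrel hw X hY, field_connection hrel hw Y hX, field_mlieBracket hw hX hY,
    hsymm j w hw]
  abel

end ParamAtlas

end GluedConnection

/-! ### Parallelism, curvature and Ricci tensor of the glued connection -/

section GluedCurvature

variable {ι : Type*} {W : Type*} [NormedAddCommGroup W] [NormedSpace ℝ W] [FiniteDimensional ℝ W]
  {E : Type*} [NormedAddCommGroup E] [NormedSpace ℝ E] [FiniteDimensional ℝ E]
  {H : Type*} [TopologicalSpace H] {I : ModelWithCorners ℝ E H} [I.Boundaryless]
  {P : Type*} [TopologicalSpace P] [ChartedSpace H P] [IsManifold I ∞ P]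

namespace ParamAtlas

variable {a : ParamAtlas ι W I P} {i j : ι} {w : W} {Γ : ι → W → W →L[ℝ] W →L[ℝ] W}
  {μ : DForm I P 2}

theorem parallel_connection
    (hrel : ∀ i j, ∀ w ∈ a.dom j, a.param j w ∈ a.src i →
      Related (a.chart i ∘ a.param j) w (Γ j) (Γ i)) (hμ : IsSmoothForm μ)
    (hpar : ∀ j, ∀ w ∈ a.dom j, ∀ u v z,
      fderiv ℝ (fun w ↦ bil W (coordForm (a.param j) μ w)) w u v z =
        bil W (coordForm (a.param j) μ w) (Γ j w u v) z +
          bil W (coordForm (a.param j) μ w) v (Γ j w u z))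
    {Y Z : VField I P} (hY : IsSmoothField Y) (hZ : IsSmoothField Z) (p : P)
    (v : TangentSpace I p) :
    (mfderiv I 𝓘(ℝ, ℝ) (fun y ↦ μ y ![Y y, Z y]) p v : ℝ) =
      μ p ![connection a Γ Y p v, Z p] + μ p ![Y p, connection a Γ Z p v] := by
  -- The product rule for `μ(Y, Z)`, isolated as an identity between maps of the model space.
  have alg : ∀ (B : W →L[ℝ] W →L[ℝ] ℝ) (dB : W →L[ℝ] W →L[ℝ] W →L[ℝ] ℝ) (dY dZ : W →L[ℝ] W)
      (G : W →L[ℝ] W →L[ℝ] W) (y z u : W),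
      (∀ v z, dB u v z = B (G u v) z + B v (G u z)) →
      ((B y).comp dZ + (B.comp dY + dB.flip y).flip z) u =
        B (dY u + G u y) z + B y (dZ u + G u z) := fun B dB dY dZ G y z u h ↦ by
    simp only [add_apply, ContinuousLinearMap.flip_apply, ContinuousLinearMap.comp_apply, h,
      map_add]
    ring
  obtain ⟨j, w, hw, rfl, -⟩ := a.exists_param_eq p
  obtain ⟨u, rfl⟩ : ∃ u, a.frame j w u = v := ⟨_, frame_inverse hw v⟩
  have hψ := a.contMDiffAt_param j w hw
  have hYw : MDifferentiableAt I I.tangent (fun x ↦ (⟨x, Y x⟩ : TangentBundle I P))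
    (a.param j w) := (ContMDiff.contMDiffAt hY).mdifferentiableAt (by simp)
  have hZw : MDifferentiableAt I I.tangent (fun x ↦ (⟨x, Z x⟩ : TangentBundle I P))
    (a.param j w) := (ContMDiff.contMDiffAt hZ).mdifferentiableAt (by simp)
  obtain ⟨d, hd⟩ : ∃ d : E →L[ℝ] ℝ,
      d = mfderiv I 𝓘(ℝ, ℝ) (fun y ↦ μ y ![Y y, Z y]) (a.param j w) := ⟨_, rfl⟩
  have h1 : HasFDerivAt ((fun y ↦ μ y ![Y y, Z y]) ∘ a.param j) (d.comp (a.frame j w)) w := by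
    rw [hd]
    exact ((hμ.contMDiff_pairing hY hZ).contMDiffAt.mdifferentiableAt (by simp)).hasMFDerivAt.comp w
      (hψ.mdifferentiableAt (by simp)).hasMFDerivAt |>.hasFDerivAt
  have hb : DifferentiableAt ℝ (fun w ↦ bil W (coordForm (a.param j) μ w)) w :=
    (contDiffAt_bil (hμ.contDiffAt_coordForm hψ)).differentiableAt (by simp)
  have h2 := (hb.hasFDerivAt.clm_apply (differentiableAt_field hw hYw).hasFDerivAt).clm_apply
    (differentiableAt_field hw hZw).hasFDerivAt
  have h3 : (fun y ↦ μ y ![Y y, Z y]) ∘ a.param j =ᶠ[𝓝 w]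
      fun w ↦ bil W (coordForm (a.param j) μ w) (a.field j Y w) (a.field j Z w) := by
    filter_upwards [(a.isOpen_dom j).mem_nhds hw] with y hy
      using (bil_coordForm_coordField μ Y Z (a.isInvertible j y hy)).symm
  have h4 := congrFun (congrArg DFunLike.coe ((h1.congr_of_eventuallyEq h3.symm).unique h2)) u
  refine Eq.trans (Eq.trans (b := d (a.frame j w u)) (by rw [hd]; rfl) h4) ?_
  have pair : ∀ x z : W, bil W (coordForm (a.param j) μ w) x z =
      μ (a.param j w) ![a.frame j w x, a.frame j w z] := fun x z ↦ by
    rw [bil_apply, coordForm_apply]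
    refine congrArg _ (funext fun i ↦ ?_)
    fin_cases i <;> rfl
  have e1 := covDeriv_param hrel hw hYw u
  have e2 := covDeriv_param hrel hw hZw u
  refine Eq.trans ?_ (congrArg₂ (fun x z : E ↦ μ (a.param j w) ![x, (Z (a.param j w) : E)] +
    μ (a.param j w) ![(Y (a.param j w) : E), z]) e1 e2).symm
  rw [← frame_field hw Z, ← frame_field hw Y]
  refine Eq.trans ?_ (congrArg₂ (fun x y : ℝ ↦ x + y)
    (pair (fderiv ℝ (a.field j Y) w u + Γ j w u (a.field j Y w)) (a.field j Z w))
    (pair (a.field j Y w) (fderiv ℝ (a.field j Z) w u + Γ j w u (a.field j Z w))))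
  exact alg _ _ _ _ _ _ _ _ (hpar j w hw u)

variable (a Γ) in
/-- The curvature tensor of the connection with Christoffel symbols `Γ j`. -/
def curvTensor (p : P) : TangentSpace I p →ₗ[ℝ] TangentSpace I p →ₗ[ℝ]
    TangentSpace I p →ₗ[ℝ] TangentSpace I p :=
  let j := a.index p
  let w := a.chart j p
  let A : E →L[ℝ] W := (a.frame j w).inverse
  (LinearMap.mk₂ ℝ (fun u v : E ↦ ((a.frame j w).comp ((curv (Γ j) w (A u) (A v)).comp A) :
      E →ₗ[ℝ] E))
    (fun u v z ↦ by ext x; simp [curv_apply]; abel)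
    (fun c u v ↦ by ext x; simp [curv_apply, smul_sub, smul_add])
    (fun u v z ↦ by ext x; simp [curv_apply]; abel)
    (fun c u v ↦ by ext x; simp [curv_apply, smul_sub, smul_add]) :
    E →ₗ[ℝ] E →ₗ[ℝ] E →ₗ[ℝ] E)

theorem curvTensor_apply (hw : w ∈ a.dom j) (hj : j = a.index (a.param j w)) (u v z : E) :
    (curvTensor a Γ (a.param j w) u v z : E) = a.frame j w (curv (Γ j) w
      ((a.frame j w).inverse u) ((a.frame j w).inverse v) ((a.frame j w).inverse z)) := by
  have h : (curvTensor a Γ (a.param j w) u v z : E) =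
      a.frame (a.index (a.param j w)) (a.chart (a.index (a.param j w)) (a.param j w))
      (curv (Γ (a.index (a.param j w))) (a.chart (a.index (a.param j w)) (a.param j w))
      ((a.frame (a.index (a.param j w)) (a.chart (a.index (a.param j w)) (a.param j w))).inverse u)
      ((a.frame (a.index (a.param j w)) (a.chart (a.index (a.param j w)) (a.param j w))).inverse v)
      ((a.frame (a.index (a.param j w)) (a.chart (a.index (a.param j w))
        (a.param j w))).inverse z)) := rfl
  rw [h, ← hj, a.chart_param j w hw]

theorem isSmoothField_connection
    (hrel : ∀ i j, ∀ w ∈ a.dom j, a.param j w ∈ a.src i →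
      Related (a.chart i ∘ a.param j) w (Γ j) (Γ i))
    (hΓ : ∀ j, ContDiffOn ℝ ∞ (Γ j) (a.dom j)) {X Y : VField I P} (hX : IsSmoothField X)
    (hY : IsSmoothField Y) : IsSmoothField (fun p ↦ connection a Γ Y p (X p)) := by
  have : IsManifold I 1 P := IsManifold.of_le (n := ∞) (by simp)
  have h1 := contMDiffOn_univ.1 ((contMDiff_covDeriv hrel hΓ).contMDiff
    (σ := Y) (contMDiffOn_univ.2 hY))
  intro p
  exact ContMDiffAt.clm_bundle_apply (h1 p) (hX p)

theorem isCurvatureTensor_curvTensor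
    (hrel : ∀ i j, ∀ w ∈ a.dom j, a.param j w ∈ a.src i →
      Related (a.chart i ∘ a.param j) w (Γ j) (Γ i))
    (hΓ : ∀ j, ContDiffOn ℝ ∞ (Γ j) (a.dom j)) :
    IsCurvatureTensor (connection a Γ) (curvTensor a Γ) := by
  intro X Y Z hX hY hZ p
  obtain ⟨j, w, hw, rfl, hj⟩ := a.exists_param_eq p
  have hd : ∀ {Y : VField I P}, IsSmoothField Y → ∀ p, MDifferentiableAt I I.tangent
      (fun x ↦ (⟨x, Y x⟩ : TangentBundle I P)) p :=
    fun h p ↦ (ContMDiff.contMDiffAt h).mdifferentiableAt (by simp)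
  have hf : ∀ {Y : VField I P}, IsSmoothField Y → ContDiffAt ℝ ∞ (a.field j Y) w :=
    fun h ↦ contDiffAt_field hw (ContMDiff.contMDiffAt h)
  have hG : DifferentiableAt ℝ (Γ j) w :=
    ((hΓ j).contDiffAt ((a.isOpen_dom j).mem_nhds hw)).differentiableAt (by simp)
  -- The second covariant derivative in coordinates. On exchanging `X` and `Y`, the second
  -- derivatives of `Z` cancel by symmetry and the derivatives of `X` and `Y` combine into the
  -- bracket term; what is left is `curv`.
  have key : ∀ {X Y : VField I P}, IsSmoothField X → IsSmoothField Y →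
      a.field j (fun p ↦ connection a Γ (fun q ↦ connection a Γ Z q (Y q)) p (X p)) w =
        fderiv ℝ (fderiv ℝ (a.field j Z)) w (a.field j X w) (a.field j Y w) +
        fderiv ℝ (a.field j Z) w (fderiv ℝ (a.field j Y) w (a.field j X w)) +
        fderiv ℝ (Γ j) w (a.field j X w) (a.field j Y w) (a.field j Z w) +
        Γ j w (fderiv ℝ (a.field j Y) w (a.field j X w)) (a.field j Z w) +
        Γ j w (a.field j Y w) (fderiv ℝ (a.field j Z) w (a.field j X w)) +
        Γ j w (a.field j X w) (fderiv ℝ (a.field j Z) w (a.field j Y w)) +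
        Γ j w (a.field j X w) (Γ j w (a.field j Y w) (a.field j Z w)) := by
    intro X Y hX hY
    rw [field_connection hrel hw X (hd (isSmoothField_connection hrel hΓ hY hZ) _),
      field_connection hrel hw Y (hd hZ _)]
    have h1 : a.field j (fun q ↦ connection a Γ Z q (Y q)) =ᶠ[𝓝 w] fun w ↦
        fderiv ℝ (a.field j Z) w (a.field j Y w) + Γ j w (a.field j Y w) (a.field j Z w) := by
      filter_upwards [(a.isOpen_dom j).mem_nhds hw] with y hy
        using field_connection hrel hy Y (hd hZ _)
    have hY' := ((hf hY).differentiableAt (by simp)).hasFDerivAt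
    have hZ' := ((hf hZ).differentiableAt (by simp)).hasFDerivAt
    have h2 := ((differentiableAt_fderiv (hf hZ)).hasFDerivAt.clm_apply hY').add
      ((hG.hasFDerivAt.clm_apply hY').clm_apply hZ')
    rw [(h2.congr_of_eventuallyEq h1).fderiv]
    simp only [add_apply, ContinuousLinearMap.flip_apply, ContinuousLinearMap.comp_apply, map_add]
    abel
  have hs : fderiv ℝ (fderiv ℝ (a.field j Z)) w (a.field j X w) (a.field j Y w) =
      fderiv ℝ (fderiv ℝ (a.field j Z)) w (a.field j Y w) (a.field j X w) :=
    ((hf hZ).isSymmSndFDerivAt (by simp; exact ENat.LEInfty.out)).eq _ _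
  have hc : a.field j (curvature (connection a Γ) X Y Z) w =
      curv (Γ j) w (a.field j X w) (a.field j Y w) (a.field j Z w) := by
    have h1 : a.field j (curvature (connection a Γ) X Y Z) w =
        a.field j (fun p ↦ connection a Γ (fun q ↦ connection a Γ Z q (Y q)) p (X p)) w -
        a.field j (fun p ↦ connection a Γ (fun q ↦ connection a Γ Z q (X q)) p (Y p)) w -
        a.field j (fun p ↦ connection a Γ Z p (VectorField.mlieBracket I X Y p)) w := by
      refine (map_sub (a.frame j w).inverse _ _).trans ?_
      exact congrArg (· - _) (map_sub (a.frame j w).inverse _ _)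
    rw [h1, key hX hY, key hY hX, field_connection hrel hw (VectorField.mlieBracket I X Y)
      (hd hZ _), field_mlieBracket hw (hd hX _) (hd hY _), hs, curv_apply]
    simp only [map_sub, sub_apply]
    abel
  refine (curvTensor_apply hw hj _ _ _).trans ?_
  rw [← frame_field hw (curvature (connection a Γ) X Y Z), hc]
  rfl

theorem trace_eq_ric (hw : w ∈ a.dom j) (v z : W) (T : E →ₗ[ℝ] E)
    (hT : ∀ u, T u = a.frame j w (curv (Γ j) w ((a.frame j w).inverse u) v z)) :
    LinearMap.trace ℝ E T = ric (Γ j) w v z := by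
  obtain ⟨L, hL⟩ : ∃ L : W ≃L[ℝ] E, (L : W →L[ℝ] E) = a.frame j w := a.isInvertible j w hw
  have h : T = L.toLinearEquiv.conj (ricEnd (Γ j) w v z : W →ₗ[ℝ] W) := by
    refine LinearMap.ext fun u ↦ ?_
    rw [hT, ← hL, ContinuousLinearMap.inverse_equiv]
    rfl
  rw [h, LinearMap.trace_conj', ric_apply, tr_apply]

theorem trace_curvTensor (p : P) (v z : E) (T : E →ₗ[ℝ] E)
    (hT : ∀ u, T u = (curvTensor a Γ p u v z : E)) :
    ∃ j, ∃ w ∈ a.dom j, ∃ v' z' : W, LinearMap.trace ℝ E T = ric (Γ j) w v' z' := by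
  obtain ⟨j, w, hw, rfl, hj⟩ := a.exists_param_eq p
  refine ⟨j, w, hw, (a.frame j w).inverse v, (a.frame j w).inverse z,
    trace_eq_ric hw _ _ T fun u ↦ ?_⟩
  rw [hT]
  exact curvTensor_apply hw hj u v z

theorem isRicciFlat_connection
    (hrel : ∀ i j, ∀ w ∈ a.dom j, a.param j w ∈ a.src i →
      Related (a.chart i ∘ a.param j) w (Γ j) (Γ i))
    (hΓ : ∀ j, ContDiffOn ℝ ∞ (Γ j) (a.dom j))
    (hric : ∀ j, ∀ w ∈ a.dom j, ∀ u v, ric (Γ j) w u v = 0) :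
    IsRicciFlat (connection a Γ) := by
  have hR := isCurvatureTensor_curvTensor hrel hΓ
  have hT := fun p v z ↦ trace_curvTensor (a := a) (Γ := Γ) p v z
  generalize curvTensor a Γ = R at hR hT
  refine ⟨R, hR, fun p u z ↦ ?_⟩
  obtain ⟨j, w, hw, v', z', h⟩ := hT p u z (((R p).flip u).flip z) (fun _ ↦ rfl)
  exact h.trans (hric j w hw v' z')

theorem isSymplecticConnection_connection
    (hrel : ∀ i j, ∀ w ∈ a.dom j, a.param j w ∈ a.src i →
      Related (a.chart i ∘ a.param j) w (Γ j) (Γ i))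
    (hΓ : ∀ j, ContDiffOn ℝ ∞ (Γ j) (a.dom j))
    (hsymm : ∀ j, ∀ w ∈ a.dom j, ∀ u v, Γ j w u v = Γ j w v u) (hμ : IsSmoothForm μ)
    (hpar : ∀ j, ∀ w ∈ a.dom j, ∀ u v z,
      fderiv ℝ (fun w ↦ bil W (coordForm (a.param j) μ w)) w u v z =
        bil W (coordForm (a.param j) μ w) (Γ j w u v) z +
          bil W (coordForm (a.param j) μ w) v (Γ j w u z)) :
    IsSymplecticConnection μ (connection a Γ) where
  smooth := ⟨contMDiff_covDeriv hrel hΓ⟩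
  torsionFree := torsion_connection hrel hsymm
  parallel _ _ hY hZ := parallel_connection hrel hμ hpar hY hZ

end ParamAtlas

end GluedCurvature

/-! ### The Ricci-flat connection on the cone -/

section ConeConnection

variable {E : Type*} [NormedAddCommGroup E] [NormedSpace ℝ E] [FiniteDimensional ℝ E]
  {H : Type*} [TopologicalSpace H] {I : ModelWithCorners ℝ E H} [I.Boundaryless]
  {P : Type*} [TopologicalSpace P] [ChartedSpace H P] [IsManifold I ∞ P]
  {V : Type*} [NormedAddCommGroup V] [NormedSpace ℝ V] [FiniteDimensional ℝ V]
  {H' : Type*} [TopologicalSpace H'] {J : ModelWithCorners ℝ V H'} [J.Boundaryless]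
  {N : Type*} [TopologicalSpace N] [ChartedSpace H' N] [IsManifold J ∞ N]
  {μ : DForm I P 2} {S : VField I P}

/-- The parametrisations of `P` given by the diffeomorphism `Φ : N × ℝ → P` and the charts
of `N`. -/
def coneParamAtlas (Φ : (N × ℝ) ≃ₘ^∞⟮J.prod 𝓘(ℝ, ℝ), I⟯ P) : ParamAtlas N (V × ℝ) I P where
  dom := coneDomain J
  src j := {p | (Φ.symm p).1 ∈ (extChartAt J j).source}
  param := coneParam J Φ
  chart := coneChart Φ
  index p := (Φ.symm p).1
  isOpen_dom j := isOpen_coneDomain j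
  isOpen_src j := (isOpen_extChartAt_source j).preimage
    (continuous_fst.comp Φ.symm.continuous)
  mem_src_index _ := mem_extChartAt_source _
  contMDiffAt_param _ _ hw := contMDiffAt_coneParam Φ hw
  contMDiffAt_chart _ _ hp := contMDiffAt_coneChart Φ hp
  chart_mem _ _ hp := coneChart_mem Φ hp
  param_chart _ _ hp := coneParam_coneChart Φ hp
  chart_param _ _ hw := coneChart_coneParam Φ hw
  isInvertible _ _ hw := isInvertible_mfderiv_coneParam Φ hw

/-- The projection to `ℝ` is the linear form with value `1` on `e` that local existence asks for.
The symbols produced on `coneAtlas` are then read in `coneParamAtlas`, which has the same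
parametrisations. -/
theorem exists_ricciFlat_connection [T2Space N] [SigmaCompactSpace N]
    (Φ : (N × ℝ) ≃ₘ^∞⟮J.prod 𝓘(ℝ, ℝ), I⟯ P) (hμ : IsSymplecticForm μ) (hs : IsSmoothField S)
    (hd : extD (fun x ↦ (1 / 2 : ℝ) • interior S μ x) = μ)
    (hΦ : ∀ x, IsMIntegralCurve (fun s ↦ Φ (x, s)) S) {ι : N → P} (hι : ContMDiff J I ∞ ι)
    (hΦ0 : ∀ x, Φ (x, 0) = ι x) {n : ℕ} (hn : Module.finrank ℝ V = 2 * n + 1) :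
    ∃ D : LinearConnection I P, IsSymplecticConnection μ D ∧ IsRicciFlat D := by
  obtain ⟨ρ, hρ⟩ := exists_isPartition Φ hμ hs hd hΦ hι hΦ0
  obtain ⟨Γ, hΓ, hric⟩ := (coneAtlas Φ hμ hs hd hΦ hι hΦ0).exists_ricciFlat hρ
    (ContinuousLinearMap.snd ℝ V ℝ) rfl (n := n)
    (by rw [Module.finrank_prod, hn, Module.finrank_self])
  have hrel : ∀ i j, ∀ w ∈ (coneParamAtlas Φ).dom j, (coneParamAtlas Φ).param j w ∈
      (coneParamAtlas Φ).src i → Related ((coneParamAtlas Φ).chart i ∘ (coneParamAtlas Φ).param j)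
        w (Γ j) (Γ i) := fun i j w hw hi ↦ by
    refine hΓ.related i j w ⟨hw, ?_⟩
    have h : (Φ.symm (coneParam J Φ j w)).1 ∈ (extChartAt J i).source := hi
    rwa [symm_coneParam] at h
  have hsm : ∀ j, ContDiffOn ℝ ∞ (Γ j) ((coneParamAtlas Φ).dom j) := fun j ↦ (hΓ.conn j).smooth
  exact ⟨(coneParamAtlas Φ).connection Γ,
    ParamAtlas.isSymplecticConnection_connection hrel hsm (fun j ↦ (hΓ.conn j).symm) hμ.smooth
      (fun j ↦ (hΓ.conn j).parallel), ParamAtlas.isRicciFlat_connection hrel hsm hric⟩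

end ConeConnection

/-! ### Linear algebra of a hyperplane in a symplectic space -/

section HypersurfaceAlgebra

variable {E : Type*} [NormedAddCommGroup E] [NormedSpace ℝ E] [FiniteDimensional ℝ E]
  {V : Type*} [NormedAddCommGroup V] [NormedSpace ℝ V] [FiniteDimensional ℝ V]
  {m : E →L[ℝ] E →L[ℝ] ℝ} {A : V →L[ℝ] E} {R : E →L[ℝ] V} {s t : E} {e : V}

/-- The range of the injective map `A` lies in the hyperplane `m(·, t) = 0` and has the same
dimension. -/
theorem exists_apply_eq_of_finrank (hfin : Module.finrank ℝ E = Module.finrank ℝ V + 1)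
    (hR : ∀ u, R (A u) = u) (hA : ∀ u, m (A u) t = 0) (hst : m s t = 1) {v : E} (hv : m v t = 0) :
    ∃ u, A u = v := by
  have h1 : LinearMap.range (A : V →ₗ[ℝ] E) ≤ LinearMap.ker (m.flip t : E →ₗ[ℝ] ℝ) := by
    rintro _ ⟨u, rfl⟩
    exact hA u
  have h2 := LinearMap.finrank_range_of_inj (f := (A : V →ₗ[ℝ] E))
    (Function.LeftInverse.injective (g := R) hR)
  have h3 := LinearMap.finrank_range_add_finrank_ker (m.flip t : E →ₗ[ℝ] ℝ)
  have h4 : LinearMap.range (m.flip t : E →ₗ[ℝ] ℝ) = ⊤ :=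
    LinearMap.range_eq_top.2 fun c ↦ ⟨c • s, by simp [hst]⟩
  rw [h4, finrank_top, Module.finrank_self] at h3
  have h5 := Submodule.eq_of_le_of_finrank_eq h1 (by omega)
  have h6 : v ∈ LinearMap.range (A : V →ₗ[ℝ] E) := h5 ▸ hv
  exact h6

/-- The vector `A u - m(s, A u) t` is orthogonal to the hyperplane and to `s`, which together span
`E`, so it is zero. -/
theorem eq_smul_of_degenerate (hfin : Module.finrank ℝ E = Module.finrank ℝ V + 1)
    (hR : ∀ u, R (A u) = u) (hA : ∀ u, m (A u) t = 0) (hst : m s t = 1)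
    (hsk : ∀ u v, m u v = -m v u) (hnd : ∀ u, (∀ v, m u v = 0) → u = 0) (he : A e = t) {u : V}
    (hu : ∀ v, m (A u) (A v) = 0) : u = m s (A u) • e := by
  have h1 : A u - m s (A u) • t = 0 := by
    refine hnd _ fun v ↦ ?_
    obtain ⟨w, hw⟩ := exists_apply_eq_of_finrank hfin hR hA hst (v := v - m v t • s)
      (by simp [hst])
    have h2 : v = A w + m v t • s := by rw [hw]; abel
    have h3 : m t (A w) = 0 := by rw [hsk, hA, neg_zero]
    have h4 : m t s = -1 := by rw [hsk, hst]
    rw [h2]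
    simp only [map_sub, map_add, map_smul, sub_apply, smul_apply, smul_eq_mul, hu, h3, h4,
      hsk (A u) s]
    ring
  have h2 := congrArg R (sub_eq_zero.1 h1)
  rwa [hR, map_smul, ← he, hR] at h2

/-- The kernel of `a` is a complement of the line `ℝ e`, the kernel of `b`. So `b` is nondegenerate
on it, and its dimension `2n` leaves room for a symplectic family. -/
theorem exists_wedgePow_ne_zero {n : ℕ} (hfin : Module.finrank ℝ V = 2 * n + 1)
    (a : V [⋀^Fin 1]→L[ℝ] ℝ) (b : V [⋀^Fin 2]→L[ℝ] ℝ) (ha : 0 < a ![e])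
    (hb : ∀ v, b ![e, v] = 0) (hker : ∀ u, (∀ v, b ![u, v] = 0) → ∃ c : ℝ, u = c • e) :
    ∃ v, wedgePow n a b v ≠ 0 := by
  obtain ⟨B, hB⟩ : ∃ B : V →ₗ[ℝ] V →ₗ[ℝ] ℝ, ∀ u v, B u v = b ![u, v] :=
    ⟨LinearMap.mk₂ ℝ (fun u v ↦ bil V b u v) (by simp) (by simp) (by simp) (by simp),
      fun u v ↦ bil_apply b u v⟩
  have hsk : ∀ u v, B u v = -B v u := fun u v ↦ by
    rw [hB, hB, ← bil_apply, ← bil_apply, bil_swap]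
  have hal : ∀ u, a ![u] = lin V a u := fun u ↦ (lin_apply a u).symm
  simp only [hal] at ha
  have h1 : LinearMap.range (lin V a : V →ₗ[ℝ] ℝ) = ⊤ :=
    LinearMap.range_eq_top.2 fun c ↦ ⟨(c / lin V a e) • e, by simp [ha.ne']⟩
  have h2 := LinearMap.finrank_range_add_finrank_ker (lin V a : V →ₗ[ℝ] ℝ)
  rw [h1, finrank_top, Module.finrank_self] at h2
  obtain ⟨p, q, hp, hq, hpp, hqq, hpq⟩ := exists_symplectic_family B
    (fun x ↦ by linarith [hsk x x]) n (LinearMap.ker (lin V a : V →ₗ[ℝ] ℝ)) (by omega) (by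
      intro x hx hxy
      have hx' : lin V a x = 0 := hx
      obtain ⟨c, rfl⟩ := hker x fun v ↦ by
        have h3 := hxy (v - (lin V a v / lin V a e) • e) (by
          change lin V a _ = 0
          rw [map_sub, map_smul, smul_eq_mul, div_mul_cancel₀ _ ha.ne', sub_self])
        rw [map_sub, map_smul, hsk x e, hB e, hb] at h3
        rw [← hB]
        simpa using h3
      rw [map_smul, smul_eq_mul] at hx'
      rw [(mul_eq_zero.1 hx').resolve_right ha.ne', zero_smul])
  simp only [hB] at hpp hqq hpq
  refine wedgePow_ne_zero (e := e) (by rwa [hal]) (fun i ↦ (hal _).trans (hp i))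
    (fun i ↦ (hal _).trans (hq i)) hpp hqq hpq fun i j ↦ ?_
  rw [← hB, hsk, hB, hpq]
  by_cases h : i = j <;> simp [h, eq_comm]

end HypersurfaceAlgebra

/-! ### Curves and tangent vectors of the level set -/

section Hypersurface

variable {E : Type*} [NormedAddCommGroup E] [NormedSpace ℝ E] [FiniteDimensional ℝ E]
  {H : Type*} [TopologicalSpace H] {I : ModelWithCorners ℝ E H} [I.Boundaryless]
  {P : Type*} [TopologicalSpace P] [ChartedSpace H P] [IsManifold I ∞ P]
  {V : Type*} [NormedAddCommGroup V] [NormedSpace ℝ V] [FiniteDimensional ℝ V]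
  {H' : Type*} [TopologicalSpace H'] {J : ModelWithCorners ℝ V H'} [J.Boundaryless]
  {g : P → ℝ} [ChartedSpace H' {x | g x = 1}] [IsManifold J ∞ {x | g x = 1}]
  {T : VField I P}

theorem hasDerivAt_comp_integralCurve (hg : ContMDiff I 𝓘(ℝ, ℝ) ∞ g) {γ : ℝ → P} {t : ℝ}
    (hγ : HasMFDerivAt 𝓘(ℝ, ℝ) I γ t ((1 : ℝ →L[ℝ] ℝ).smulRight (T (γ t)))) :
    HasDerivAt (g ∘ γ) (mfderiv I 𝓘(ℝ, ℝ) g (γ t) (T (γ t)) : ℝ) t := by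
  have h2 := (hg.mdifferentiableAt (x := γ t) (by simp)).hasMFDerivAt.comp t hγ
  let A : ℝ →L[ℝ] ℝ := (mfderiv I 𝓘(ℝ, ℝ) g (γ t)).comp
    (ContinuousLinearMap.smulRight (1 : ℝ →L[ℝ] ℝ) (T (γ t)))
  have h3 : HasFDerivAt (g ∘ γ) A t := h2.hasFDerivAt
  have h4 := h3.hasDerivAt
  have h5 : A 1 = (mfderiv I 𝓘(ℝ, ℝ) g (γ t) (T (γ t)) : ℝ) :=
    congrArg (fun v : E ↦ (mfderiv I 𝓘(ℝ, ℝ) g (γ t) v : ℝ)) (one_smul ℝ (T (γ t) : E))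
  rwa [h5] at h4

theorem apply_eq_of_isMIntegralCurveOn (hg : ContMDiff I 𝓘(ℝ, ℝ) ∞ g)
    (hgT : ∀ x, (mfderiv I 𝓘(ℝ, ℝ) g x (T x) : ℝ) = 0) {γ : ℝ → P} {a b t t' : ℝ}
    (hγ : IsMIntegralCurveOn γ T (Set.Ioo a b)) (ht : t ∈ Set.Ioo a b) (ht' : t' ∈ Set.Ioo a b) :
    g (γ t) = g (γ t') := by
  have h1 : ∀ τ ∈ Set.Ioo a b, HasDerivAt (g ∘ γ) 0 τ := fun τ hτ ↦ by
    have := hasDerivAt_comp_integralCurve hg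
      ((hγ τ hτ).hasMFDerivAt (isOpen_Ioo.mem_nhds hτ))
    rwa [hgT] at this
  exact isOpen_Ioo.is_const_of_deriv_eq_zero isPreconnected_Ioo
    (fun τ hτ ↦ (h1 τ hτ).differentiableAt.differentiableWithinAt)
    (fun τ hτ ↦ (h1 τ hτ).deriv) ht ht'

/-- An integral curve of `T` starting on the level set stays there since `g` is constant along it.
Composition with the retraction `r` turns it into a map into the level set for all real parameters.
-/
theorem exists_curve_of_sameOrbit {r : P → {x | g x = 1}} (hr : Continuous r)
    (hr0 : ∀ x : {x | g x = 1}, r x = x) (hg : ContMDiff I 𝓘(ℝ, ℝ) ∞ g)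
    (hgT : ∀ x, (mfderiv I 𝓘(ℝ, ℝ) g x (T x) : ℝ) = 0) {x y : {x | g x = 1}}
    (h : SameOrbit T (x : P) (y : P)) :
    ∃ (γ : ℝ → {x | g x = 1}) (a b t : ℝ), 0 ∈ Set.Ioo a b ∧ t ∈ Set.Ioo a b ∧
      ContinuousOn γ (Set.Ioo a b) ∧ (∀ τ ∈ Set.Ioo a b, SameOrbit T (x : P) (γ τ : P)) ∧
      γ 0 = x ∧ γ t = y := by
  obtain ⟨γ, a, b, t, h0, ht, hγ, hx, hy⟩ := h
  refine ⟨fun τ ↦ r (γ τ), a, b, t, h0, ht, hr.comp_continuousOn hγ.continuousOn, fun τ hτ ↦ ?_,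
    (congrArg r hx).trans (hr0 x), (congrArg r hy).trans (hr0 y)⟩
  have h1 : g (γ τ) = 1 := by
    rw [apply_eq_of_isMIntegralCurveOn hg hgT hγ hτ h0, hx]
    exact x.2
  have h2 : ((r (γ τ) : {x | g x = 1}) : P) = γ τ := congrArg Subtype.val (hr0 ⟨γ τ, h1⟩)
  exact ⟨γ, a, b, τ, h0, hτ, hγ, hx, h2.symm⟩

theorem mfderiv_retraction_val {r : P → {x | g x = 1}} (hr : ContMDiff I J ∞ r)
    (hr0 : ∀ x : {x | g x = 1}, r x = x)
    (hι : ContMDiff J I ∞ (Subtype.val : {x | g x = 1} → P)) (x : {x | g x = 1}) (u : V) :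
    (mfderiv I J r x (mfderiv J I (Subtype.val : {x | g x = 1} → P) x u : E) : V) = u := by
  have h1 := mfderiv_comp x (hr.mdifferentiableAt (x := (x : P)) (by simp))
    (hι.mdifferentiableAt (x := x) (by simp))
  have h2 : r ∘ (Subtype.val : {x | g x = 1} → P) = id := funext hr0
  rw [h2, mfderiv_id] at h1
  exact (congrFun (congrArg DFunLike.coe h1) u).symm

theorem mfderiv_apply_mfderiv_val (hg : ContMDiff I 𝓘(ℝ, ℝ) ∞ g)
    (hι : ContMDiff J I ∞ (Subtype.val : {x | g x = 1} → P)) (x : {x | g x = 1}) (u : V) :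
    (mfderiv I 𝓘(ℝ, ℝ) g x (mfderiv J I (Subtype.val : {x | g x = 1} → P) x u : E) : ℝ) = 0 := by
  have h1 := mfderiv_comp x (hg.mdifferentiableAt (x := (x : P)) (by simp))
    (hι.mdifferentiableAt (x := x) (by simp))
  have h2 : g ∘ (Subtype.val : {x | g x = 1} → P) = fun _ ↦ 1 := funext fun x ↦ x.2
  rw [h2, mfderiv_const] at h1
  exact (congrFun (congrArg DFunLike.coe h1) u).symm

variable {U : Type*} [NormedAddCommGroup U] [NormedSpace ℝ U]
  {H'' : Type*} [TopologicalSpace H''] {K : ModelWithCorners ℝ U H''}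
  {M : Type*} [TopologicalSpace M] [ChartedSpace H'' M]

/-- Differentiates `π` along a local integral curve of `T`, on which it is constant. The vector
`dr(T)` is `T` regarded as a tangent vector of the level set. -/
theorem mfderiv_eq_zero_of_sameOrbit {r : P → {x | g x = 1}} (hr : ContMDiff I J ∞ r)
    (hr0 : ∀ x : {x | g x = 1}, r x = x) (hg : ContMDiff I 𝓘(ℝ, ℝ) ∞ g)
    (hgT : ∀ x, (mfderiv I 𝓘(ℝ, ℝ) g x (T x) : ℝ) = 0) (hT : IsSmoothField T)
    {π : {x | g x = 1} → M} (hπ : ContMDiff J K ∞ π)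
    (horb : ∀ x y : {x | g x = 1}, SameOrbit T (x : P) (y : P) → π x = π y) (x : {x | g x = 1}) :
    (mfderiv J K π x (mfderiv I J r x (T x) : V) : U) = 0 := by
  have : IsManifold I 1 P := IsManifold.of_le (n := ∞) (by simp)
  have : CompleteSpace E := FiniteDimensional.complete ℝ E
  obtain ⟨γ, hγ0, hγ⟩ := exists_isMIntegralCurveAt_of_contMDiffAt_boundaryless (t₀ := 0)
    (I := I) (v := T) (x₀ := (x : P)) ((hT.contMDiffAt (x := (x : P))).of_le (by simp))
  have hγ' := hγ.hasMFDerivAt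
  obtain ⟨ε, hε, hball⟩ := isMIntegralCurveAt_iff'.1 hγ
  have h0 : (0 : ℝ) ∈ Set.Ioo (-ε) ε := ⟨by linarith, hε⟩
  have hIoo : IsMIntegralCurveOn γ T (Set.Ioo (-ε) ε) := by
    rwa [Real.ball_eq_Ioo, zero_sub, zero_add] at hball
  have hc : π ∘ r ∘ γ =ᶠ[𝓝 0] fun _ ↦ π x := by
    filter_upwards [isOpen_Ioo.mem_nhds h0] with τ hτ
    have h1 : g (γ τ) = 1 := by
      rw [apply_eq_of_isMIntegralCurveOn hg hgT hIoo hτ h0, hγ0]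
      exact x.2
    have h2 : r (γ τ) = ⟨γ τ, h1⟩ := hr0 ⟨γ τ, h1⟩
    exact (horb x (r (γ τ)) ⟨γ, -ε, ε, τ, h0, hτ, hIoo, hγ0, by rw [h2]⟩).symm
  have h3 := (hr.mdifferentiableAt (x := γ 0) (by simp)).hasMFDerivAt.comp 0 hγ'
  have h4 := (hπ.mdifferentiableAt (x := r (γ 0)) (by simp)).hasMFDerivAt.comp 0 h3
  have h5 := h4.congr_of_eventuallyEq (hc.symm : (fun _ ↦ π x) =ᶠ[𝓝 0] π ∘ r ∘ γ)
  have h6 := hasMFDerivAt_unique h5 (hasMFDerivAt_const (π x) (0 : ℝ))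
  have h7 : (mfderiv J K π (r (γ 0)) (mfderiv I J r (γ 0) ((1 : ℝ) • T (γ 0) : E) : V) : U) = 0 :=
    congrFun (congrArg DFunLike.coe h6) (1 : ℝ)
  rw [one_smul, hγ0] at h7
  rwa [hr0] at h7

end Hypersurface

/-! ### The reduced symplectic form -/

section Reduction

variable {E : Type*} [NormedAddCommGroup E] [NormedSpace ℝ E] [FiniteDimensional ℝ E]
  {P : Type*} [TopologicalSpace P] [ChartedSpace E P] [IsManifold 𝓘(ℝ, E) ∞ P]
  {V : Type*} [NormedAddCommGroup V] [NormedSpace ℝ V] [FiniteDimensional ℝ V]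
  {g : P → ℝ} [ChartedSpace V {x | g x = 1}] [IsManifold 𝓘(ℝ, V) ∞ {x | g x = 1}]
  {U : Type*} [NormedAddCommGroup U] [NormedSpace ℝ U] [FiniteDimensional ℝ U]
  {M : Type*} [TopologicalSpace M] [ChartedSpace U M] [IsManifold 𝓘(ℝ, U) ∞ M]
  {μ : DForm 𝓘(ℝ, E) P 2} {S T : VField 𝓘(ℝ, E) P}

/-- The tangent spaces of the level set `{g = 1}` and the restrictions of `μ` to them: `T` is
tangent to the level set, and spans the kernel of the restriction of `μ`. -/
theorem levelSet_kernel (hμ : IsSymplecticForm μ) (hg : ContMDiff 𝓘(ℝ, E) 𝓘(ℝ, ℝ) ∞ g)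
    (hgST : ∀ x, μ x ![S x, T x] = g x)
    (hdg : ∀ x (v : TangentSpace 𝓘(ℝ, E) x),
      (mfderiv 𝓘(ℝ, E) 𝓘(ℝ, ℝ) g x v : ℝ) = 2 * μ x ![v, T x])
    (hfin : Module.finrank ℝ E = Module.finrank ℝ V + 1)
    (hι : ContMDiff 𝓘(ℝ, V) 𝓘(ℝ, E) ∞ (Subtype.val : {x | g x = 1} → P))
    {r : P → {x | g x = 1}} (hr : ContMDiff 𝓘(ℝ, E) 𝓘(ℝ, V) ∞ r)
    (hr0 : ∀ x : {x | g x = 1}, r x = x) (x : {x | g x = 1}) {e : V}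
    (he : e = mfderiv 𝓘(ℝ, E) 𝓘(ℝ, V) r x (T x)) {β : V [⋀^Fin 2]→L[ℝ] ℝ}
    (hβ : β = pullback (I := 𝓘(ℝ, V)) (Subtype.val : {x | g x = 1} → P) μ x)
    {a : V [⋀^Fin 1]→L[ℝ] ℝ}
    (ha : a = pullback (I := 𝓘(ℝ, V)) (Subtype.val : {x | g x = 1} → P)
      (fun x ↦ (1 / 2 : ℝ) • interior S μ x) x) :
    a ![e] = 1 / 2 ∧ (∀ v, β ![e, v] = 0) ∧ ∀ u, (∀ v, β ![u, v] = 0) → ∃ c : ℝ, u = c • e := by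
  obtain ⟨A, hA⟩ : ∃ A : V →L[ℝ] E,
    A = mfderiv 𝓘(ℝ, V) 𝓘(ℝ, E) (Subtype.val : {x | g x = 1} → P) x := ⟨_, rfl⟩
  obtain ⟨R, hR⟩ : ∃ R : E →L[ℝ] V, R = mfderiv 𝓘(ℝ, E) 𝓘(ℝ, V) r x := ⟨_, rfl⟩
  obtain ⟨b, hb⟩ : ∃ b : E [⋀^Fin 2]→L[ℝ] ℝ, b = μ x := ⟨_, rfl⟩
  obtain ⟨s, hs⟩ : ∃ s : E, s = S x := ⟨_, rfl⟩
  obtain ⟨t, ht⟩ : ∃ t : E, t = T x := ⟨_, rfl⟩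
  have hRA : ∀ u, R (A u) = u := fun u ↦ by
    rw [hR, hA]
    exact mfderiv_retraction_val hr hr0 hι x u
  obtain ⟨d, hd⟩ : ∃ d : E →L[ℝ] ℝ, d = mfderiv 𝓘(ℝ, E) 𝓘(ℝ, ℝ) g x := ⟨_, rfl⟩
  have hdg' : ∀ v : E, d v = 2 * bil E b v t := fun v ↦ by
    rw [bil_apply, hb, ht, hd]
    exact hdg x v
  have hdA : ∀ u, d (A u) = 0 := fun u ↦ by
    rw [hd, hA]
    exact mfderiv_apply_mfderiv_val hg hι x u
  have hAt : ∀ u, bil E b (A u) t = 0 := fun u ↦ by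
    linarith [hdg' (A u), hdA u]
  have hst : bil E b s t = 1 := by
    rw [bil_apply, hb, hs, ht]
    exact (hgST x).trans x.2
  have htt : bil E b t t = 0 := bil_self b t
  have hsk : ∀ u v, bil E b u v = -bil E b v u := fun u v ↦ bil_swap b v u
  have hnd : ∀ u, (∀ v, bil E b u v = 0) → u = 0 := fun u hu ↦
    hμ.nondegenerate x u fun v ↦
      (congrArg (fun b : E [⋀^Fin 2]→L[ℝ] ℝ ↦ b ![u, (v : E)]) hb).symm.trans
        ((bil_apply b u v).symm.trans (hu v))
  have he' : e = R t := by
    rw [he, hR, ht]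
    rfl
  -- As `m(t, t) = 0`, the vector `t` lies in the hyperplane, hence is tangent to the level set, and
  -- `R` returns its preimage.
  have hAe : A e = t := by
    obtain ⟨u, hu⟩ := exists_apply_eq_of_finrank hfin hRA hAt hst htt
    rw [he', ← hu, hRA]
  have hβ' : ∀ u v, β ![u, v] = bil E b (A u) (A v) := fun u v ↦ by
    rw [bil_apply, hβ, hb, hA]
    refine congrArg (μ x) (funext fun i ↦ ?_)
    fin_cases i <;> rfl
  refine ⟨?_, fun v ↦ ?_, fun u hu ↦ ?_⟩
  · have h1 : a ![e] = 1 / 2 * bil E b s (A e) := by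
      rw [bil_apply, ha, hb, hs, hA]
      refine congrArg (fun z ↦ (1 / 2 : ℝ) * μ x z) (funext fun i ↦ ?_)
      fin_cases i <;> rfl
    rw [h1, hAe, hst, mul_one]
  · rw [hβ', hAe, hsk, hAt, neg_zero]
  · exact ⟨_, eq_smul_of_degenerate hfin hRA hAt hst hsk hnd hAe fun v ↦ by rw [← hβ', hu]⟩

/-- A submersion has local sections, whose derivatives are right inverses of its own. They are taken
from `exists_local_section` applied to the zero form, for which the hypotheses on the form are
trivial. -/
theorem surjective_mfderiv_of_isSubmersion {N : Type*} [TopologicalSpace N] [ChartedSpace V N]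
    [IsManifold 𝓘(ℝ, V) ∞ N] {β : DForm 𝓘(ℝ, V) N 2} (hβ : IsSmoothForm β) {π : N → M}
    (hπ : Manifold.IsSubmersion 𝓘(ℝ, V) 𝓘(ℝ, U) ∞ π) (x : N) :
    Function.Surjective (mfderiv 𝓘(ℝ, V) 𝓘(ℝ, U) π x) := by
  have h0 : (fun x ↦ (0 : ℝ) • β x) = fun _ ↦ 0 := funext fun x ↦ zero_smul ℝ (β x)
  obtain ⟨s, hs0, hs, -⟩ := exists_local_section (hβ.const_smul 0)
    ((extD_const_smul β 0).trans (funext fun x ↦ zero_smul ℝ (extD β x)))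
    (hπ.isSubmersionOfComplement_complement x) hπ.contMDiff fun x u v _ ↦
      (bil_apply (F := V) ((0 : ℝ) • β x) u v).trans (zero_mul _)
  intro v
  have h1 := hs.self_of_nhds
  have h2 : π ∘ s =ᶠ[𝓝 (π x)] id := hs.mono fun m hm ↦ hm.2
  have h3 := mfderiv_comp (π x) (hπ.contMDiff.mdifferentiableAt (x := s (π x)) (by simp))
    (h1.1.mdifferentiableAt (by simp))
  rw [h2.mfderiv_eq, mfderiv_id, hs0] at h3
  exact ⟨mfderiv 𝓘(ℝ, U) 𝓘(ℝ, V) s (π x) v, (congrFun (congrArg DFunLike.coe h3) v).symm⟩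

/-- Both kernels are the line `ℝ e`: that of `D` is one-dimensional by the dimension count and
contains `e`, which is nonzero because `a` does not vanish on it. -/
theorem kernel_iff {D : V →L[ℝ] U} (hD : Function.Surjective D)
    (hfin : Module.finrank ℝ V = Module.finrank ℝ U + 1) {β : V [⋀^Fin 2]→L[ℝ] ℝ}
    {a : V [⋀^Fin 1]→L[ℝ] ℝ} {e : V} (ha : a ![e] = 1 / 2) (hβ : ∀ v, β ![e, v] = 0)
    (hker : ∀ u, (∀ v, β ![u, v] = 0) → ∃ c : ℝ, u = c • e) (hDe : D e = 0) :
    (∀ u v, D u = 0 → bil V β u v = 0) ∧ ∀ u, (∀ v, bil V β u v = 0) → D u = 0 := by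
  refine ⟨fun u v hu ↦ ?_, fun u hu ↦ ?_⟩
  · have he0 : e ≠ 0 := by
      rintro h0
      rw [h0, ← lin_apply, map_zero] at ha
      norm_num at ha
    have h1 := LinearMap.finrank_range_add_finrank_ker (D : V →ₗ[ℝ] U)
    rw [LinearMap.range_eq_top.2 hD, finrank_top] at h1
    have h2 : Module.finrank ℝ (LinearMap.ker (D : V →ₗ[ℝ] U)) = 1 := by omega
    obtain ⟨c, hc⟩ := (finrank_eq_one_iff_of_nonzero' (⟨e, hDe⟩ : LinearMap.ker (D : V →ₗ[ℝ] U))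
      (fun h ↦ he0 (congrArg Subtype.val h))).1 h2 ⟨u, hu⟩
    have hc' : c • e = u := congrArg Subtype.val hc
    rw [← hc', map_smul, smul_apply, bil_apply, hβ, smul_zero]
  · obtain ⟨c, rfl⟩ := hker u fun v ↦ (bil_apply _ _ _).symm.trans (hu v)
    rw [map_smul, hDe, smul_zero]

theorem exists_reduced_form_levelSet (hμ : IsSymplecticForm μ)
    (hg : ContMDiff 𝓘(ℝ, E) 𝓘(ℝ, ℝ) ∞ g) (hT : IsSmoothField T)
    (hgST : ∀ x, μ x ![S x, T x] = g x)
    (hdg : ∀ x (v : TangentSpace 𝓘(ℝ, E) x),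
      (mfderiv 𝓘(ℝ, E) 𝓘(ℝ, ℝ) g x v : ℝ) = 2 * μ x ![v, T x])
    (hfin : Module.finrank ℝ E = Module.finrank ℝ V + 1)
    (hfin' : Module.finrank ℝ V = Module.finrank ℝ U + 1)
    (hι : ContMDiff 𝓘(ℝ, V) 𝓘(ℝ, E) ∞ (Subtype.val : {x | g x = 1} → P))
    {r : P → {x | g x = 1}} (hr : ContMDiff 𝓘(ℝ, E) 𝓘(ℝ, V) ∞ r)
    (hr0 : ∀ x : {x | g x = 1}, r x = x) {π : {x | g x = 1} → M} (hsurj : Function.Surjective π)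
    (hπ : Manifold.IsSubmersion 𝓘(ℝ, V) 𝓘(ℝ, U) ∞ π)
    (horb : ∀ x y : {x | g x = 1}, π x = π y ↔ SameOrbit T (x : P) (y : P)) :
    ∃ ζ : DForm 𝓘(ℝ, U) M 2, IsSymplecticForm ζ ∧ pullback (I := 𝓘(ℝ, V)) π ζ =
      pullback (I := 𝓘(ℝ, V)) (Subtype.val : {x | g x = 1} → P) μ := by
  have hgT : ∀ x, (mfderiv 𝓘(ℝ, E) 𝓘(ℝ, ℝ) g x (T x) : ℝ) = 0 := fun x ↦ by
    have h1 : ∀ (b : E [⋀^Fin 2]→L[ℝ] ℝ) (t : E), b ![t, t] = 0 := fun b t ↦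
      (bil_apply b t t).symm.trans (bil_self b t)
    exact (hdg x (T x)).trans ((congrArg (fun z : ℝ ↦ 2 * z) (h1 (μ x) (T x))).trans (mul_zero 2))
  have hβ := hμ.smooth.pullback hι
  have hc := (hμ.smooth.extD_pullback hι).trans (by rw [hμ.closed])
  have hds := surjective_mfderiv_of_isSubmersion hβ hπ
  have hker := fun x ↦ levelSet_kernel (V := V) hμ hg hgST hdg hfin hι hr hr0 x rfl rfl rfl
  have hde := mfderiv_eq_zero_of_sameOrbit hr hr0 hg hgT hT hπ.contMDiff
    (fun x y h ↦ (horb x y).2 h)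
  refine exists_reduced_form hβ hc hπ.isSubmersionOfComplement_complement hπ.contMDiff hsurj hds
    (fun x u v hu ↦ ?_) (fun x u hu ↦ ?_) (fun x y hxy ↦ ?_)
  · exact (kernel_iff (V := V) (U := U) (D := mfderiv 𝓘(ℝ, V) 𝓘(ℝ, U) π x) (hds x) hfin' (hker x).1 (hker x).2.1
      (hker x).2.2 (hde x)).1 u v hu
  · exact (kernel_iff (V := V) (U := U) (D := mfderiv 𝓘(ℝ, V) 𝓘(ℝ, U) π x) (hds x) hfin' (hker x).1 (hker x).2.1
      (hker x).2.2 (hde x)).2 u hu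
  · obtain ⟨γ, a, b, t, h0, ht, hγ, ho, hx, hy⟩ :=
      exists_curve_of_sameOrbit hr.continuous hr0 hg hgT ((horb x y).1 hxy)
    exact ⟨γ, a, b, t, h0, ht, hγ, fun τ hτ ↦ ((horb x (γ τ)).2 (ho τ hτ)).symm, hx, hy⟩

end Reduction

/-! ### Assembly of the theorem -/

theorem nonempty_prod_equiv {V E : Type*} [NormedAddCommGroup V] [NormedSpace ℝ V]
    [FiniteDimensional ℝ V] [NormedAddCommGroup E] [NormedSpace ℝ E] [FiniteDimensional ℝ E]
    (h : Module.finrank ℝ E = Module.finrank ℝ V + 1) : Nonempty ((V × ℝ) ≃L[ℝ] E) :=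
  ⟨ContinuousLinearEquiv.ofFinrankEq (by simp [h])⟩

section Cone

variable {E : Type*} [NormedAddCommGroup E] [NormedSpace ℝ E] [FiniteDimensional ℝ E]
  {H : Type*} [TopologicalSpace H] {I : ModelWithCorners ℝ E H} [I.Boundaryless]
  {P : Type*} [TopologicalSpace P] [ChartedSpace H P] [IsManifold I ∞ P] [T2Space P]
  {V : Type*} [NormedAddCommGroup V] [NormedSpace ℝ V] [FiniteDimensional ℝ V]
  {H' : Type*} [TopologicalSpace H'] {J : ModelWithCorners ℝ V H'} [J.Boundaryless]
  {g : P → ℝ} [ChartedSpace H' {x | g x = 1}] [IsManifold J ∞ {x | g x = 1}]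
  {S : VField I P}

theorem exists_coneDiffeo (hS : IsCompleteField S) (hs : IsSmoothField S)
    (hg : ContMDiff I 𝓘(ℝ, ℝ) ∞ g)
    (hgS : ∀ x, (mfderiv I 𝓘(ℝ, ℝ) g x (S x) : ℝ) = 2 * g x) (hpos : ∀ x, 0 < g x)
    (hemb : Manifold.IsSmoothEmbedding J I ∞ (Subtype.val : {x | g x = 1} → P)) :
    ∃ Φ : ({x | g x = 1} × ℝ) ≃ₘ^∞⟮J.prod 𝓘(ℝ, ℝ), I⟯ P,
      (∀ x, IsMIntegralCurve (fun s ↦ Φ (x, s)) S) ∧ ∀ x, Φ (x, 0) = x :=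
  ⟨coneDiffeo hS hs hg hgS hpos hemb, fun x ↦ isMIntegralCurve_flow hS x,
    fun x ↦ flow_zero hS x⟩

end Cone

/-- The pairing of the two fields enters as a function `g` known only through `hgST` and `hdg`, so
that the level set is the type treated in the preceding parts. -/
theorem exists_contactQuadruple_levelSet {n : ℕ}
    {P : Type*} [TopologicalSpace P] [T2Space P] [SecondCountableTopology P]
    [ChartedSpace (EuclideanSpace ℝ (Fin (2 * n + 2))) P] [IsManifold (𝓡 (2 * n + 2)) ∞ P]
    {μ : DForm (𝓡 (2 * n + 2)) P 2} (hμ : IsSymplecticForm μ)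
    {S T : VField (𝓡 (2 * n + 2)) P} (hS : IsSmoothField S) (hT : IsSmoothField T)
    (hSc : IsCompleteField S) (hd : extD (fun x ↦ (1 / 2 : ℝ) • interior S μ x) = μ) {g : P → ℝ}
    (hg : ContMDiff (𝓡 (2 * n + 2)) 𝓘(ℝ, ℝ) ∞ g) (hgST : ∀ x, μ x ![S x, T x] = g x)
    (hdg : ∀ x (v : TangentSpace (𝓡 (2 * n + 2)) x),
      (mfderiv (𝓡 (2 * n + 2)) 𝓘(ℝ, ℝ) g x v : ℝ) = 2 * μ x ![v, T x]) (hpos : ∀ x, 0 < g x)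
    [ChartedSpace (EuclideanSpace ℝ (Fin (2 * n + 1))) {x | g x = 1}]
    [IsManifold (𝓡 (2 * n + 1)) ∞ {x | g x = 1}]
    (hemb : Manifold.IsSmoothEmbedding (𝓡 (2 * n + 1)) (𝓡 (2 * n + 2)) ∞
      (Subtype.val : {x | g x = 1} → P))
    {M : Type*} [TopologicalSpace M] [ChartedSpace (EuclideanSpace ℝ (Fin (2 * n))) M]
    [IsManifold (𝓡 (2 * n)) ∞ M] {π : {x | g x = 1} → M} (hsurj : Function.Surjective π)
    (hπ : Manifold.IsSubmersion (𝓡 (2 * n + 1)) (𝓡 (2 * n)) ∞ π)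
    (horb : ∀ x y : {x | g x = 1}, π x = π y ↔ SameOrbit T (x : P) (y : P)) :
    (∃ ωM : DForm (𝓡 (2 * n)) M 2, IsSymplecticForm ωM ∧
      pullback π ωM = (pullback (Subtype.val : {x | g x = 1} → P) μ :
        DForm (𝓡 (2 * n + 1)) {x | g x = 1} 2) ∧
      IsContactQuadruple ωM (pullback (Subtype.val : {x | g x = 1} → P)
        (fun x ↦ (1 / 2 : ℝ) • interior S μ x)) π ∧
      IsInducedFrom μ (pullback (Subtype.val : {x | g x = 1} → P)
        (fun x ↦ (1 / 2 : ℝ) • interior S μ x) : DForm (𝓡 (2 * n + 1)) {x | g x = 1} 1)) ∧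
    ∃ D : LinearConnection (𝓡 (2 * n + 2)) P, IsSymplecticConnection μ D ∧ IsRicciFlat D := by
  have hι := hemb.isImmersion.contMDiff
  have hgS : ∀ x, (mfderiv (𝓡 (2 * n + 2)) 𝓘(ℝ, ℝ) g x (S x) : ℝ) = 2 * g x := fun x ↦
    (hdg x (S x)).trans (by rw [hgST])
  have hr := contMDiff_retraction hSc hS hg hgS hpos hemb
  have hr0 := retraction_val hSc hg hgS hpos
  have hfin : Module.finrank ℝ (EuclideanSpace ℝ (Fin (2 * n + 2))) =
      Module.finrank ℝ (EuclideanSpace ℝ (Fin (2 * n + 1))) + 1 := by simp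
  have hfin' : Module.finrank ℝ (EuclideanSpace ℝ (Fin (2 * n + 1))) =
      Module.finrank ℝ (EuclideanSpace ℝ (Fin (2 * n))) + 1 := by simp
  have hl : IsSmoothForm (fun x ↦ (1 / 2 : ℝ) • interior S μ x) :=
    (hμ.smooth.interior hS).const_smul _
  have hext : extD (pullback (I := 𝓡 (2 * n + 1)) (Subtype.val : {x | g x = 1} → P)
      (fun x ↦ (1 / 2 : ℝ) • interior S μ x)) =
      pullback (I := 𝓡 (2 * n + 1)) (Subtype.val : {x | g x = 1} → P) μ := by
    rw [hl.extD_pullback hι, hd]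
  obtain ⟨Φ, hΦ, hΦ0⟩ := exists_coneDiffeo hSc hS hg hgS hpos hemb
  obtain ⟨ζ, hζ, hζπ⟩ := exists_reduced_form_levelSet hμ hg hT hgST hdg hfin hfin' hι hr hr0 hsurj
    hπ horb
  -- Required by the partition of unity: the level set is second countable as a subspace of `P` and
  -- locally compact as a manifold.
  have : SigmaCompactSpace {x | g x = 1} :=
    have := ChartedSpace.locallyCompactSpace (EuclideanSpace ℝ (Fin (2 * n + 1))) {x | g x = 1}
    inferInstance
  have hnv : ∀ x, ∃ v : Fin (2 * n + 1) → TangentSpace (𝓡 (2 * n + 1)) x,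
      wedgePow n (pullback (I := 𝓡 (2 * n + 1)) (Subtype.val : {x | g x = 1} → P)
        (fun x ↦ (1 / 2 : ℝ) • interior S μ x) x) (extD (pullback (I := 𝓡 (2 * n + 1))
        (Subtype.val : {x | g x = 1} → P) (fun x ↦ (1 / 2 : ℝ) • interior S μ x)) x) v ≠ 0 := by
    intro x
    obtain ⟨h1, h2, h3⟩ := levelSet_kernel (V := EuclideanSpace ℝ (Fin (2 * n + 1))) hμ hg hgST hdg
      hfin hι hr hr0 x rfl rfl rfl
    rw [hext]
    exact exists_wedgePow_ne_zero (V := EuclideanSpace ℝ (Fin (2 * n + 1))) (by simp) _ _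
      (by rw [h1]; norm_num) h2 h3
  have hR := exists_ricciFlat_connection Φ hμ hS hd hΦ hι hΦ0 (n := n) (by simp)
  have hI := pullback_coneDiffeo Φ hμ.smooth hS hd hΦ hι hΦ0
  exact ⟨⟨ζ, hζ, hζπ, ⟨hζ, ⟨hl.pullback hι, hnv⟩, hπ, hext.trans hζπ.symm⟩, ⟨Φ, hI⟩⟩, hR⟩

end SymplecticInduction

end

open SymplecticInduction in
theorem theorem5p3 (n : ℕ)
    {P : Type*} [TopologicalSpace P] [T2Space P] [SecondCountableTopology P]
    [ChartedSpace (EuclideanSpace ℝ (Fin (2 * n + 2))) P] [IsManifold (𝓡 (2 * n + 2)) ∞ P]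
    (μ : DForm (𝓡 (2 * n + 2)) P 2) (hμ : IsSymplecticForm μ)
    (S E : VField (𝓡 (2 * n + 2)) P) (hS : IsSmoothField S) (hE : IsSmoothField E)
    (hS_complete : IsCompleteField S)
    (hS_conformal : ∀ x v, lieDeriv S μ x v = 2 * μ x v)
    (hE_symplectic : ∀ x v, lieDeriv E μ x v = 0)
    (hSE_commute : ∀ x, VectorField.mlieBracket (𝓡 (2 * n + 2)) S E x = 0)
    (hSE_pos : ∀ x, 0 < μ x ![S x, E x]) :
    -- the constraint set is an embedded hypersurface of `P`
    (∃ _ : ChartedSpace (EuclideanSpace ℝ (Fin (2 * n + 1))) (constraintSet μ S E),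
      IsManifold (𝓡 (2 * n + 1)) ∞ (constraintSet μ S E) ∧
      Manifold.IsSmoothEmbedding (𝓡 (2 * n + 1)) (𝓡 (2 * n + 2)) ∞
        (Subtype.val : constraintSet μ S E → P)) ∧
    -- for its structure of embedded submanifold, and for every manifold structure `M` on its
    -- quotient by the flow of `E` for which the projection `π` is a surjective submersion:
    ∀ [ChartedSpace (EuclideanSpace ℝ (Fin (2 * n + 1))) (constraintSet μ S E)]
      [IsManifold (𝓡 (2 * n + 1)) ∞ (constraintSet μ S E)],
      Manifold.IsSmoothEmbedding (𝓡 (2 * n + 1)) (𝓡 (2 * n + 2)) ∞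
        (Subtype.val : constraintSet μ S E → P) →
      ∀ {M : Type*} [TopologicalSpace M] [T2Space M] [SecondCountableTopology M]
        [ChartedSpace (EuclideanSpace ℝ (Fin (2 * n))) M] [IsManifold (𝓡 (2 * n)) ∞ M]
        (π : constraintSet μ S E → M),
        Function.Surjective π →
        Manifold.IsSubmersion (𝓡 (2 * n + 1)) (𝓡 (2 * n)) ∞ π →
        (∀ x y, π x = π y ↔ SameOrbit E (x : P) (y : P)) →
        (∃ ωM : DForm (𝓡 (2 * n)) M 2,
          IsSymplecticForm ωM ∧
          pullback π ωM
            = (pullback (Subtype.val : constraintSet μ S E → P) μ :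
                DForm (𝓡 (2 * n + 1)) (constraintSet μ S E) 2) ∧
          IsContactQuadruple ωM
            (pullback (Subtype.val : constraintSet μ S E → P)
              (fun x ↦ (1 / 2 : ℝ) • interior S μ x)) π ∧
          IsInducedFrom μ
            (pullback (Subtype.val : constraintSet μ S E → P)
              (fun x ↦ (1 / 2 : ℝ) • interior S μ x) :
                DForm (𝓡 (2 * n + 1)) (constraintSet μ S E) 1)) ∧
        (∃ D : LinearConnection (𝓡 (2 * n + 2)) P, IsSymplecticConnection μ D ∧ IsRicciFlat D) := by
  have hg := hμ.smooth.contMDiff_pairing hS hE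
  have hdg := mfderiv_pairing_eq hμ.smooth hμ.closed hS hE hS_conformal hE_symplectic hSE_commute
  refine ⟨?_, fun {cs} {im} hemb {M} _ _ _ _ _ π hsurj hπ horb ↦ ?_⟩
  · obtain ⟨L⟩ := nonempty_prod_equiv (V := EuclideanSpace ℝ (Fin (2 * n + 1)))
      (E := EuclideanSpace ℝ (Fin (2 * n + 2))) (by simp)
    refine exists_chartedSpace_levelSet
      (V := EuclideanSpace ℝ (Fin (2 * n + 1))) L hg fun x hx h0 ↦ ?_
    -- The differential of the pairing takes the value `2 μ(S, E) > 0` on `S`, so it vanishes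
    -- nowhere.
    have h1 := (hdg x (S x)).symm.trans (congrFun (congrArg DFunLike.coe h0) (S x))
    have h2 : 2 * μ x ![S x, E x] = 0 := h1
    linarith [hSE_pos x]
  -- `constraintSet` unfolds to this level set; the given manifold structure is carried over
  -- unchanged.
  · let _ : ChartedSpace (EuclideanSpace ℝ (Fin (2 * n + 1))) {x | μ x ![S x, E x] = 1} := cs
    have : IsManifold (𝓡 (2 * n + 1)) ∞ {x | μ x ![S x, E x] = 1} := im
    exact exists_contactQuadruple_levelSet hμ hS hE hS_complete
      (extD_interior hμ.smooth hμ.closed hS hS_conformal) hg (fun _ ↦ rfl) hdg hSE_pos hemb hsurj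
      hπ horb
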